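/- **Setting.** Let $\mathbb{T}_3=[0,2\pi]^3$, $\nu>0$, and let $\mathcal D^\infty$ be the space of smooth, $2\pi$-periodic, divergence-free, mean-zero vector fields $\varphi:\mathbb R^3\to\mathbb R^3$. Let $H$ and $V$ be the closures of $\mathcal D^\infty$ in $L^2(\mathbb T_3)$ and $H^1(\mathbb T_3)$, with $|u|_V=|\nabla u|_{L^2}$, let $A$ be the Stokes operator ($A\varphi=-\Delta\varphi$ on $\mathcal D^\infty$), $D(A)$ its domain with the graph norm, and $D(A)'$ the dual of $D(A)$. Put $\langle w,B(u,v)\rangle=\int_{\mathbb T_3}\sum_{i,j}u_i\,\partial_iv_j\,w_j\,dx$. Let $\Omega=C([0,\infty);D(A)')$ with its Borel $\sigma$-field $\mathscr B$, canonical process $\xi_t(\omega)=\omega(t)$ and filtration $\mathscr B_t=\sigma(\xi_s:0\le s\le t)$. For $\varphi\in\mathcal D^\infty$ let $$M_t^\varphi=\langle\xi_t-\xi_0,\varphi\rangle+\nu\int_0^t\langle\xi_s,A\varphi\rangle\,ds-\int_0^t\langle B(\xi_s,\varphi),\xi_s\rangle\,ds .$$ On the paths in $L^2(0,t;H)$ let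 $W(t)$ be the distribution with $\langle W(t),\varphi\rangle=M^\varphi_t$, and let $z(t)=W(t)-\nu\int_0^tA e^{-\nu A(t-s)}W(s)\,ds$, where the integral is taken against each eigenfunction of $A$; on the other paths let $z(t)=0$. For $x\in H$ put $z_x(t)=z(t)+e^{-\nu At}x$ and $v_x=\xi-z_x$, and write $v=v_0$ (so $z=z_0$). Norms $|\cdot|_H$, $|\cdot|_V$ of distributions outside $H$, $V$ are $+\infty$. Define, with values in $[-\infty,+\infty]$, $$\mathscr E_t(v_x,z_x)=\tfrac12|v_x(t)|_H^2+\nu\int_0^t|v_x(r)|_V^2\,dr-\int_0^t\langle z_x(r),B(v_x(r)+z_x(r),v_x(r))\rangle\,dr,$$ understood as $+\infty$ if the last integral does not exist as a Lebesgue integral (that is, unless for a.e. $r\le t$ one has $z_x(r)\in H$, $v_x(r)\in V$ and the integrand in $x$ is integrable, and the resulting function of $r$ is integrable on $[0,t]$). **Proposition.** For every $x\in H$ the map $(t,\omega)\mapsto\mathscr E_t(v_x(\omega),z_x(\omega))$, $(t,\omega)\in[0,\infty)\times\Omega$, is progressively measurable with respect to $(\mathscr B_t)_{t\ge0}$, and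 1. for all $0\le s\le t$ the set $E_{s,t}(x)=\{\mathscr E_t(v_x,z_x)\le\mathscr E_s(v_x,z_x)\}$ is $\mathscr B_t$-measurable; 2. for all $t>0$ the set $E_t(x)=\{\mathscr E_t(v_x,z_x)\le\mathscr E_s(v_x,z_x)\text{ for a.e. }s\le t\text{ (including }s=0)\}$ is $\mathscr B_t$-measurable; 3. the set $E(x)=\mathcal R\cap\{\mathscr E_t(v_x,z_x)\le\mathscr E_s(v_x,z_x)\text{ for a.e. }s\ge0\text{ (including }s=0)\text{ and all }t\ge s\}$ is $\mathscr B$-measurable, where $$\mathcal R=\{z\in L^8_{\rm loc}([0,\infty);L^4(\mathbb T_3)),\ v\in L^\infty_{\rm loc}([0,\infty);H)\cap L^2_{\rm loc}([0,\infty);V)\}.$$ Moreover, let $\mathcal Q$ be a bounded symmetric positive (semidefinite) operator on $H$ with finite trace, let $\mu_0$ be a probability on $H$, and let $P$ be a probability on $(\Omega,\mathscr B)$ such that * (e1) $P$ is a weak martingale solution starting at $\mu_0$: $P[\xi\in L^2_{\rm loc}([0,\infty);H)]=1$; for each $\varphi\in\mathcal D^\infty$ the process $M^\varphi$ is square integrable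 and is, under $P$, a continuous $(\mathscr B_t)$-martingale with quadratic variation $t\,|\mathcal Q^{1/2}\varphi|_H^2$; and the law of $\xi_0$ under $P$ is $\mu_0$; * (e2) $P[v\in L^\infty_{\rm loc}([0,\infty);H)\cap L^2_{\rm loc}([0,\infty);V)]=1$. Then the property * (e3) there is a Lebesgue-null set $T_P\subset(0,\infty)$ such that $P[\mathscr E_t(v,z)\le\mathscr E_s(v,z)]=1$ for all $s\in[0,\infty)\setminus T_P$ and all $t\ge s$ is equivalent to each of the following: * (e3a) there is $x\in H$ such that for each $t>0$ there is a Lebesgue-null set $T\subset(0,t]$ with $P[E_{s,t}(x)]=1$ for all $s\in[0,t]\setminus T$; * (e3b) there is $x\in H$ such that $P[E_t(x)]=1$ for each $t>0$; * (e3c) there is $x\in H$ such that $P[E(x)]=1$. -/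

import Mathlib

open MeasureTheory ProbabilityTheory
open scoped NNReal ENNReal RealInnerProductSpace

noncomputable section

namespace NavierStokes

/-! ## Fields on the three-dimensional torus -/

/-- The space variable. Functions on the torus are `2π`-periodic functions of it. -/
abbrev Space : Type := Fin 3 → ℝ

/-- The values of a vector field, with the Euclidean norm. -/
abbrev Vec : Type := EuclideanSpace ℝ (Fin 3)

/-- The values of a gradient, with the Hilbert-Schmidt norm; the entry `(i, j)` stands for
`∂ᵢ uⱼ`. -/
abbrev Grad : Type := EuclideanSpace ℝ (Fin 3 × Fin 3)

/-- The periodicity cell `[0, 2π]³`. -/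
def cell : Set Space := Set.Icc (fun _ => 0) (fun _ => 2 * Real.pi)

/-- Lebesgue measure on the periodicity cell. -/
def cellMeasure : Measure Space := volume.restrict cell

/-- The partial derivative `∂ᵢ φ`. -/
def pderiv (i : Fin 3) (φ : Space → Vec) (x : Space) : Vec :=
  fderiv ℝ φ x (Pi.single i 1)

lemma isCompact_cell : IsCompact cell := isCompact_Icc

instance : IsFiniteMeasure cellMeasure :=
  ⟨by rw [cellMeasure, Measure.restrict_apply_univ]; exact isCompact_cell.measure_lt_top⟩

lemma integrable_of_continuous {E : Type*} [NormedAddCommGroup E] {f : Space → E}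
    (hf : Continuous f) : Integrable f cellMeasure :=
  hf.continuousOn.integrableOn_compact isCompact_cell

lemma memLp_of_continuous {E : Type*} [NormedAddCommGroup E]
    [SecondCountableTopologyEither Space E] {f : Space → E}
    (hf : Continuous f) : MemLp f 2 cellMeasure := by
  obtain ⟨C, hC⟩ := isCompact_cell.exists_bound_of_continuousOn hf.continuousOn
  refine MemLp.of_bound hf.aestronglyMeasurable C ?_
  exact (ae_restrict_mem measurableSet_Icc).mono fun x hx => hC x hx

/-- Smooth `2π`-periodic divergence-free vector fields with mean zero. -/
def testField : Submodule ℝ (Space → Vec) where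
  carrier := {φ | ContDiff ℝ (⊤ : ℕ∞) φ ∧ (∀ x i, φ (x + Pi.single i (2 * Real.pi)) = φ x) ∧
    (∀ x, ∑ i, pderiv i φ x i = 0) ∧ ∫ x, φ x ∂cellMeasure = 0}
  add_mem' := by
    rintro φ ψ ⟨h1, h2, h3, h4⟩ ⟨k1, k2, k3, k4⟩
    refine ⟨h1.add k1, fun x i => by simp [h2, k2], fun x => ?_, ?_⟩
    · have : ∀ i, pderiv i (φ + ψ) x = pderiv i φ x + pderiv i ψ x := fun i => by
        unfold pderiv
        rw [fderiv_add (h1.differentiable (by simp) x) (k1.differentiable (by simp) x)]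
        rfl
      simp [this, Finset.sum_add_distrib, h3, k3]
    · simp only [Pi.add_apply]
      rw [integral_add (integrable_of_continuous h1.continuous)
        (integrable_of_continuous k1.continuous), h4, k4, add_zero]
  zero_mem' := by
    refine ⟨contDiff_const, fun x i => rfl, fun x => ?_, by simp⟩
    simp [pderiv]
  smul_mem' := by
    rintro c φ ⟨h1, h2, h3, h4⟩
    refine ⟨contDiff_const.smul h1, fun x i => by simp [h2], fun x => ?_, ?_⟩
    · have : ∀ i, pderiv i (c • φ) x = c • pderiv i φ x := fun i => by
        unfold pderiv
        rw [fderiv_const_smul (h1.differentiable (by simp) x)]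
        rfl
      simp [this, ← Finset.mul_sum, h3]
    · simp only [Pi.smul_apply]
      rw [integral_smul, h4, smul_zero]

lemma contDiff_pderiv {φ : Space → Vec} (h : ContDiff ℝ (⊤ : ℕ∞) φ) (i : Fin 3) :
    ContDiff ℝ (⊤ : ℕ∞) (pderiv i φ) :=
  (h.fderiv_right (m := (⊤ : ℕ∞)) (by simp)).clm_apply contDiff_const

lemma pderiv_periodic {φ : Space → Vec}
    (h : ∀ x i, φ (x + Pi.single i (2 * Real.pi)) = φ x) (j : Fin 3) (x : Space) (i : Fin 3) :
    pderiv j φ (x + Pi.single i (2 * Real.pi)) = pderiv j φ x := by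
  unfold pderiv
  rw [← fderiv_comp_add_right]
  simp only [h]

lemma pderiv_comm {φ : Space → Vec} (h : ContDiff ℝ (⊤ : ℕ∞) φ) (i j : Fin 3) (x : Space) :
    pderiv i (pderiv j φ) x = pderiv j (pderiv i φ) x := by
  have hs : IsSymmSndFDerivAt ℝ φ x :=
    h.contDiffAt.isSymmSndFDerivAt (by
      rw [minSmoothness_of_isRCLikeNormedField]
      exact WithTop.coe_le_coe.2 (le_top : (2 : ℕ∞) ≤ ⊤))
  have hd : DifferentiableAt ℝ (fderiv ℝ φ) x :=
    (h.fderiv_right (m := (⊤ : ℕ∞)) (by simp)).differentiable (by simp) x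
  have key : ∀ a b : Fin 3, pderiv a (pderiv b φ) x
      = fderiv ℝ (fderiv ℝ φ) x (Pi.single a 1) (Pi.single b 1) := by
    intro a b
    unfold pderiv
    rw [fderiv_clm_apply hd (differentiableAt_const _)]
    simp
  rw [key, key]
  exact hs _ _

lemma integral_pderiv {φ : Space → Vec} (h : ContDiff ℝ (⊤ : ℕ∞) φ)
    (hp : ∀ x i, φ (x + Pi.single i (2 * Real.pi)) = φ x) (j : Fin 3) :
    ∫ x, pderiv j φ x ∂cellMeasure = 0 := by
  have hle : (fun _ : Fin 3 => (0 : ℝ)) ≤ fun _ => 2 * Real.pi :=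
    fun _ => by positivity
  have key := integral_divergence_of_hasFDerivAt_off_countable'
    (fun _ : Fin 3 => (0 : ℝ)) (fun _ => 2 * Real.pi) hle
    (fun i => if i = j then φ else 0)
    (fun i => if i = j then fderiv ℝ φ else 0) ∅ Set.countable_empty
    (fun i => by
      by_cases hi : i = j
      · simpa [hi] using h.continuous.continuousOn
      · simpa [hi] using (continuous_zero : Continuous (0 : Space → Vec)).continuousOn)
    (fun x _ i => by
      by_cases hi : i = j
      · simpa [hi] using (h.differentiable (by simp) x).hasFDerivAt
      · simp only [hi, if_false]; exact hasFDerivAt_const (0 : Vec) x)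
    (by
      refine ContinuousOn.integrableOn_compact isCompact_Icc (Continuous.continuousOn ?_)
      refine continuous_finsetSum _ fun i _ => ?_
      by_cases hi : i = j
      · simp only [hi, if_true]; exact (contDiff_pderiv h j).continuous
      · simpa [hi] using continuous_const)
  have hL : ∀ x : Space, (∑ i : Fin 3, (if i = j then fderiv ℝ φ else 0) x (Pi.single i 1))
      = pderiv j φ x := by
    intro x
    rw [Finset.sum_eq_single j]
    · simp [pderiv]
    · intro b _ hb; simp [hb]
    · simp
  simp only [hL] at key
  rw [cellMeasure, cell, key]
  refine Finset.sum_eq_zero fun i _ => ?_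
  by_cases hi : i = j
  · rw [sub_eq_zero]
    refine integral_congr_ae (Filter.Eventually.of_forall fun y => ?_)
    simp only [hi, if_true]
    have : Fin.insertNth (α := fun _ => ℝ) j (2 * Real.pi) y
        = Fin.insertNth (α := fun _ => ℝ) j 0 y + Pi.single j (2 * Real.pi) := by
      funext k
      rcases Fin.eq_self_or_eq_succAbove j k with rfl | ⟨l, rfl⟩
      · simp
      · simp [Pi.single_eq_of_ne]
    rw [this, hp]
  · simp [hi]

lemma pderiv_mem {φ : Space → Vec} (hφ : φ ∈ testField) (j : Fin 3) :
    pderiv j φ ∈ testField := by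
  obtain ⟨h1, h2, h3, -⟩ := hφ
  refine ⟨contDiff_pderiv h1 j, pderiv_periodic h2 j, fun x => ?_, integral_pderiv h1 h2 j⟩
  have hz : (fun y => ∑ i, pderiv i φ y i) = fun _ => (0 : ℝ) := funext h3
  have hd : ∀ i, DifferentiableAt ℝ (pderiv i φ) x := fun i =>
    (contDiff_pderiv h1 i).differentiable (by simp) x
  have hc : ∀ i, HasFDerivAt (fun y => pderiv i φ y i)
      ((EuclideanSpace.proj i : Vec →L[ℝ] ℝ) ∘L fderiv ℝ (pderiv i φ) x) x := fun i =>
    (EuclideanSpace.proj i : Vec →L[ℝ] ℝ).hasFDerivAt.comp x (hd i).hasFDerivAt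
  have hs := HasFDerivAt.fun_sum (u := Finset.univ) fun i _ => hc i
  rw [hz] at hs
  have h0 := hs.unique (hasFDerivAt_const (0 : ℝ) x)
  have := congrArg (fun L : Space →L[ℝ] ℝ => L (Pi.single j 1)) h0
  simp only [pderiv_comm h1 _ j]
  simpa [pderiv] using this

/-- The partial derivative as an operator on test fields. -/
def testPderiv (j : Fin 3) : testField →ₗ[ℝ] testField where
  toFun φ := ⟨pderiv j φ, pderiv_mem φ.2 j⟩
  map_add' φ ψ := by
    ext1; funext x
    change fderiv ℝ ((φ : Space → Vec) + (ψ : Space → Vec)) x _ = _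
    rw [fderiv_add (φ.2.1.differentiable (by simp) x) (ψ.2.1.differentiable (by simp) x)]
    rfl
  map_smul' c φ := by
    ext1; funext x
    change fderiv ℝ (c • (φ : Space → Vec)) x _ = _
    rw [fderiv_const_smul (φ.2.1.differentiable (by simp) x)]
    rfl

/-- The Stokes operator on test fields. On periodic divergence-free fields the Leray projection
commutes with the Laplacian, so that `A φ = -Δ φ`. -/
def stokes : testField →ₗ[ℝ] testField :=
  -∑ j, testPderiv j ∘ₗ testPderiv j

/-- The gradient of a test field. -/
def grad (φ : testField) (x : Space) : Grad :=
  WithLp.toLp 2 fun p => pderiv p.1 φ x p.2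

lemma continuous_grad (φ : testField) : Continuous (grad φ) := by
  refine (PiLp.continuous_toLp 2 _).comp (continuous_pi fun p => ?_)
  exact (EuclideanSpace.proj p.2 : Vec →L[ℝ] ℝ).continuous.comp
    (contDiff_pderiv φ.2.1 p.1).continuous

/-! ## The spaces `H`, `V` and `D(A)'` -/

/-- `L²(𝕋³; ℝ³)`. -/
abbrev L2Vec : Type := Lp Vec 2 cellMeasure

/-- `L²` for gradients. -/
abbrev L2Grad : Type := Lp Grad 2 cellMeasure

/-- A test field as an element of `L²`. -/
def testToL2 : testField →ₗ[ℝ] L2Vec where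
  toFun φ := (memLp_of_continuous φ.2.1.continuous).toLp φ
  map_add' _ _ := rfl
  map_smul' _ _ := rfl

/-- The gradient of a test field as an element of `L²`. -/
def testGradToL2 : testField →ₗ[ℝ] L2Grad where
  toFun φ := (memLp_of_continuous (continuous_grad φ)).toLp (grad φ)
  map_add' φ ψ := by
    rw [← MemLp.toLp_add]
    congr 1
    funext x
    ext p
    exact congrArg (fun χ : testField => (χ : Space → Vec) x p.2) (map_add (testPderiv p.1) φ ψ)
  map_smul' c φ := by
    rw [RingHom.id_apply, ← MemLp.toLp_const_smul]
    congr 1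
    funext x
    ext p
    exact congrArg (fun χ : testField => (χ : Space → Vec) x p.2)
      (map_smul (testPderiv p.1) c φ)

/-- The space `H`: the closure of the test fields in `L²`. -/
def HSub : Submodule ℝ L2Vec := (LinearMap.range testToL2).topologicalClosure

/-- The Hilbert space `H`, with the inner product and norm of `L²`. -/
abbrev H : Type := HSub

instance : CompleteSpace H :=
  (Submodule.isClosed_topologicalClosure _).completeSpace_coe

instance : MeasurableSpace H := borel H

instance : BorelSpace H := ⟨rfl⟩

/-- A test field as an element of `H`. -/
def testToH : testField →ₗ[ℝ] H :=
  testToL2.codRestrict HSub fun φ => Submodule.le_topologicalClosure _ ⟨φ, rfl⟩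

/-- The space `V`: the closure of the test fields in `H¹`. An element is recorded as the pair of
the field and its (weak) gradient, and `H¹` carries the topology of `L² × L²` on such pairs. -/
def V : Submodule ℝ (L2Vec × L2Grad) :=
  (LinearMap.range (testToL2.prod testGradToL2)).topologicalClosure

/-- The space `D^∞` with the graph norm of the Stokes operator. It is dense in the domain
`D(A)`, so that both have the same dual. -/
def DomA : Type := testField

instance : AddCommGroup DomA := inferInstanceAs (AddCommGroup testField)

instance : Module ℝ DomA := inferInstanceAs (Module ℝ testField)

/-- The map `φ ↦ (φ, A φ)` onto the graph of the Stokes operator. -/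
def graphMap : DomA →ₗ[ℝ] L2Vec × L2Vec := testToL2.prod (testToL2 ∘ₗ stokes)

instance : SeminormedAddCommGroup DomA := SeminormedAddCommGroup.induced DomA _ graphMap

instance : NormedSpace ℝ DomA := NormedSpace.induced ℝ DomA _ graphMap

/-- The dual space `D(A)'`, with the dual norm. -/
abbrev DomADual : Type := StrongDual ℝ DomA

instance : MeasurableSpace DomADual := borel DomADual

instance : BorelSpace DomADual := ⟨rfl⟩

/-- The pairing `⟨u, φ⟩` of `u ∈ D(A)'` with a test field. -/
def pair (u : DomADual) (φ : testField) : ℝ := u φ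

/-- The inclusion of test fields, with the graph norm, in `H`. -/
def domAToH : DomA →L[ℝ] H :=
  LinearMap.mkContinuous (E := DomA) testToH 1 fun φ => by
    rw [one_mul]
    exact norm_fst_le (graphMap φ)

/-- The embedding `H ⊂ D(A)'`, `⟨h, φ⟩ = ⟨h, φ⟩_H`. -/
def embed (h : H) : DomADual := innerSL ℝ h ∘L domAToH

open Classical in
/-- The element of `H` that corresponds to `u ∈ D(A)'` if there is one; `0` otherwise. -/
def hPart (u : DomADual) : H := if hu : ∃ h, embed h = u then hu.choose else 0

/-- The norm `|u|_H` of `u ∈ D(A)'`; it is `∞` if `u ∉ H`. -/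
def dualHNorm (u : DomADual) : ℝ≥0∞ := ⨅ (h : H) (_ : embed h = u), ‖h‖ₑ

/-! ## The path space -/

/-- Lebesgue measure on the half-line `[0, ∞)` of times. -/
def timeMeasure : Measure ℝ≥0 := (volume : Measure ℝ).comap (fun t : ℝ≥0 => (t : ℝ))

/-- The path space `Ω = C([0, ∞); D(A)')`. -/
abbrev PathSpace : Type := C(ℝ≥0, DomADual)

instance : MeasurableSpace PathSpace := borel PathSpace

instance : BorelSpace PathSpace := ⟨rfl⟩

/-- The filtration `𝓑_t = σ(ξ_s : s ≤ t)` of the canonical process `ξ_s(ω) = ω(s)`. -/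
def canonicalFiltration : Filtration ℝ≥0 (inferInstance : MeasurableSpace PathSpace) where
  seq t := ⨆ s ≤ t, MeasurableSpace.comap (fun ω : PathSpace => ω s) inferInstance
  mono' _ _ h := iSup₂_le fun s hs =>
    le_iSup₂_of_le (f := fun s (_ : s ≤ _) =>
      MeasurableSpace.comap (fun ω : PathSpace => ω s) inferInstance) s (hs.trans h) le_rfl
  le' _ := iSup₂_le fun s _ =>
    (ContinuousEvalConst.continuous_eval_const s).measurable.comap_le

/-! ## Weak martingale solutions -/

/-- `⟨B(u, φ), u⟩ = ∫ ∑ uᵢ (∂ᵢ φⱼ) uⱼ dx` for `u ∈ H` and a test field `φ`. -/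
def convection (u : H) (φ : testField) : ℝ :=
  ∫ x, ∑ i, ∑ j, (u : L2Vec) x i * grad φ x (i, j) * (u : L2Vec) x j ∂cellMeasure

/-- The process `M^φ_t = ⟨ξ_t - ξ_0, φ⟩ + ν ∫₀ᵗ ⟨ξ_s, A φ⟩ ds - ∫₀ᵗ ⟨B(ξ_s, φ), ξ_s⟩ ds`. -/
def mart (ν : ℝ) (φ : testField) (t : ℝ≥0) (ω : PathSpace) : ℝ :=
  pair (ω t - ω 0) φ + ν * ∫ s in Set.Iic t, pair (ω s) (stokes φ) ∂timeMeasure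
    - ∫ s in Set.Iic t, convection (hPart (ω s)) φ ∂timeMeasure

/-- The path `ω` is in `L²(0, t; H)`. -/
def InL2H (ω : PathSpace) (t : ℝ≥0) : Prop :=
  ∫⁻ s in Set.Iic t, dualHNorm (ω s) ^ 2 ∂timeMeasure < ⊤

/-- A bounded symmetric positive operator `Q` on `H` has finite trace. -/
def HasFiniteTrace (Q : H →L[ℝ] H) : Prop :=
  ∃ e : HilbertBasis ℕ ℝ H, Summable fun n => ⟪Q (e n), e n⟫

/-- `P` is a weak martingale solution, starting at `μ₀`, of the Navier-Stokes equations with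
viscosity `ν` and noise covariance `Q`. That the quadratic variation of the continuous martingale
`M^φ` is `t |Q^{1/2} φ|²` is expressed by saying that `(M^φ_t)² - t |Q^{1/2} φ|²` is a martingale;
here `|Q^{1/2} φ|² = ⟨Q φ, φ⟩`. -/
structure IsWeakMartingaleSolution (ν : ℝ) (Q : H →L[ℝ] H) (μ₀ : Measure H)
    (P : Measure PathSpace) : Prop where
  square_integrable_paths : ∀ᵐ ω ∂P, ∀ t, InL2H ω t
  memLp : ∀ φ t, MemLp (mart ν φ t) 2 P
  continuous : ∀ φ, ∀ᵐ ω ∂P, Continuous fun t => mart ν φ t ω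
  martingale : ∀ φ, Martingale (mart ν φ) canonicalFiltration P
  quadratic_variation : ∀ φ, Martingale
    (fun t ω => mart ν φ t ω ^ 2 - (t : ℝ) * ⟪Q (testToH φ), testToH φ⟫) canonicalFiltration P
  initial : P.map (fun ω => ω 0) = μ₀.map embed

/-! ## The Ornstein-Uhlenbeck process and its complement -/

/-- An eigenfunction of the Stokes operator with its eigenvalue. The eigenfunctions span a dense
subspace of each of the spaces above. -/
structure StokesEigen where
  field : testField
  eigenvalue : ℝ
  eq : stokes field = eigenvalue • field

/-- A (possibly very irregular) distribution on the torus, divergence-free and with mean zero,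
given by its pairings with the eigenfunctions of the Stokes operator. -/
abbrev Distr : Type := StokesEigen → ℝ

/-- The distribution `T` is the `L²` field `f`. -/
def Represents (T : Distr) (f : L2Vec) : Prop := ∀ e, T e = ⟪f, testToL2 e.field⟫

/-- `|T|_H`, which is `∞` if `T ∉ H`. -/
def normH (T : Distr) : ℝ≥0∞ := ⨅ (h : H) (_ : Represents T h), ‖h‖ₑ

/-- `|T|_V = |∇T|_{L²}`, which is `∞` if `T ∉ V`. -/
def normV (T : Distr) : ℝ≥0∞ := ⨅ (p : V) (_ : Represents T p.1.1), ‖p.1.2‖ₑ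

/-- `|T|_{L⁴}`, which is `∞` if `T` is not an element of `H` that belongs to `L⁴`. -/
def normL4 (T : Distr) : ℝ≥0∞ :=
  ⨅ (h : H) (_ : Represents T h), eLpNorm (h : L2Vec) 4 cellMeasure

open Classical in
/-- The Ornstein-Uhlenbeck process `z(t) = W(t) - ν ∫₀ᵗ A e^{-νA(t-s)} W(s) ds` starting at `0`.
The process `W` is determined by `⟨W(t), φ⟩ = M^φ_t`, and `e^{-νA(t-s)}` multiplies an eigenfunction
of `A` with eigenvalue `λ` by `e^{-νλ(t-s)}`. Paths outside `L²(0, t; H)`, on which `M^φ` is not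
defined, are assigned the value `0`. -/
def ou (ν : ℝ) (t : ℝ≥0) (ω : PathSpace) : Distr := fun e =>
  if InL2H ω t then
    mart ν e.field t ω - ν * ∫ s in Set.Iic t,
      e.eigenvalue * Real.exp (-(ν * e.eigenvalue * ((t : ℝ) - s))) * mart ν e.field s ω ∂timeMeasure
  else 0

/-- The process `z_x(t) = z(t) + e^{-νAt} x`. -/
def zProc (ν : ℝ) (x : H) (ω : PathSpace) (t : ℝ≥0) : Distr := fun e =>
  ou ν t ω e + Real.exp (-(ν * e.eigenvalue * t)) * ⟪x, testToH e.field⟫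

/-- The process `v_x = ξ - z_x`. -/
def vProc (ν : ℝ) (x : H) (ω : PathSpace) (t : ℝ≥0) : Distr := fun e =>
  pair (ω t) e.field - zProc ν x ω t e

/-! ## The energy -/

/-- The integrand of `⟨z, B(v + z, v)⟩ = ∫ ∑ (v + z)ᵢ (∂ᵢ vⱼ) zⱼ dx`, for `v ∈ V` (given with its
gradient) and `z ∈ H`. -/
def trilinearIntegrand (z : H) (v : V) (x : Space) : ℝ :=
  ∑ i, ∑ j, (v.1.1 x i + (z : L2Vec) x i) * v.1.2 x (i, j) * (z : L2Vec) x j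

/-- `⟨z, B(v + z, v)⟩` is well defined, with value `c`. -/
def HasTrilinear (z v : Distr) (c : ℝ) : Prop :=
  ∃ (h : H) (p : V), Represents z h ∧ Represents v p.1.1 ∧
    Integrable (trilinearIntegrand h p) cellMeasure ∧
    ∫ x, trilinearIntegrand h p x ∂cellMeasure = c

open Classical in
/-- The value `⟨z, B(v + z, v)⟩` (and `0` if it is not well defined). -/
def trilinear (z v : Distr) : ℝ := if hc : ∃ c, HasTrilinear z v c then hc.choose else 0

/-- `∫₀ᵗ ⟨z_r, B(v_r + z_r, v_r)⟩ dr` exists as a Lebesgue integral. -/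
def TrilinearIntegrable (v z : ℝ≥0 → Distr) (t : ℝ≥0) : Prop :=
  (∀ᵐ r ∂(timeMeasure.restrict (Set.Iic t)), ∃ c, HasTrilinear (z r) (v r) c) ∧
    IntegrableOn (fun r => trilinear (z r) (v r)) (Set.Iic t) timeMeasure

open Classical in
/-- The energy `𝓔_t(v, z) = ½ |v_t|²_H + ν ∫₀ᵗ |v_r|²_V dr - ∫₀ᵗ ⟨z_r, B(v_r + z_r, v_r)⟩ dr`, with
values in the extended reals; it is `+∞` if the last integral does not exist. -/
def energy (ν : ℝ) (v z : ℝ≥0 → Distr) (t : ℝ≥0) : EReal :=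
  if TrilinearIntegrable v z t then
    ((2⁻¹ * normH (v t) ^ 2
        + ENNReal.ofReal ν * ∫⁻ r in Set.Iic t, normV (v r) ^ 2 ∂timeMeasure : ℝ≥0∞) : EReal)
      - ((∫ r in Set.Iic t, trilinear (z r) (v r) ∂timeMeasure : ℝ) : EReal)
  else ⊤

/-- `𝓔_t(v_x, z_x)`. -/
def energyAt (ν : ℝ) (x : H) (t : ℝ≥0) (ω : PathSpace) : EReal :=
  energy ν (vProc ν x ω) (zProc ν x ω) t

/-- `E_{s,t}(x) = {𝓔_t(v_x, z_x) ≤ 𝓔_s(v_x, z_x)}`. -/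
def energySetBetween (ν : ℝ) (x : H) (s t : ℝ≥0) : Set PathSpace :=
  {ω | energyAt ν x t ω ≤ energyAt ν x s ω}

/-- `E_t(x) = {𝓔_t(v_x, z_x) ≤ 𝓔_s(v_x, z_x) for a.e. s ≤ t, including 0}`. -/
def energySetUpTo (ν : ℝ) (x : H) (t : ℝ≥0) : Set PathSpace :=
  {ω | energyAt ν x t ω ≤ energyAt ν x 0 ω ∧
    ∀ᵐ s ∂timeMeasure, s ≤ t → energyAt ν x t ω ≤ energyAt ν x s ω}

/-- `v ∈ L^∞_loc([0, ∞); H) ∩ L²_loc([0, ∞); V)`. -/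
def IsEnergyClass (v : ℝ≥0 → Distr) : Prop :=
  ∀ T : ℝ≥0, essSup (fun t => normH (v t)) (timeMeasure.restrict (Set.Iic T)) < ⊤ ∧
    ∫⁻ t in Set.Iic T, normV (v t) ^ 2 ∂timeMeasure < ⊤

/-- The set `𝓡 = {z ∈ L⁸_loc([0, ∞); L⁴), v ∈ L^∞_loc([0, ∞); H) ∩ L²_loc([0, ∞); V)}`, where
`z = z_0` and `v = v_0` are the processes for `x = 0`. -/
def regularSet (ν : ℝ) : Set PathSpace :=
  {ω | (∀ T : ℝ≥0, ∫⁻ t in Set.Iic T, normL4 (zProc ν 0 ω t) ^ 8 ∂timeMeasure < ⊤) ∧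
    IsEnergyClass (vProc ν 0 ω)}

/-- `E(x) = 𝓡 ∩ {𝓔_t(v_x, z_x) ≤ 𝓔_s(v_x, z_x) for a.e. s ≥ 0, including 0, and all t ≥ s}`. -/
def energySet (ν : ℝ) (x : H) : Set PathSpace :=
  regularSet ν ∩ {ω | (∀ t, energyAt ν x t ω ≤ energyAt ν x 0 ω) ∧
    ∀ᵐ s ∂timeMeasure, ∀ t, s ≤ t → energyAt ν x t ω ≤ energyAt ν x s ω}

/-- Almost surely `v ∈ L^∞_loc([0, ∞); H) ∩ L²_loc([0, ∞); V)`. -/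
def HasEnergyClassPaths (ν : ℝ) (P : Measure PathSpace) : Prop :=
  ∀ᵐ ω ∂P, IsEnergyClass (vProc ν 0 ω)

/-- The energy inequality between all times `s` outside a null set of positive times and all
`t ≥ s`, almost surely for each pair of times. -/
def EnergyProperty (ν : ℝ) (P : Measure PathSpace) : Prop :=
  ∃ T : Set ℝ≥0, 0 ∉ T ∧ timeMeasure T = 0 ∧
    ∀ s ∉ T, ∀ t, s ≤ t → P {ω | energyAt ν 0 t ω ≤ energyAt ν 0 s ω} = 1

/-- The variant of the energy property with `E_{s,t}(x)`. -/
def EnergyPropertyA (ν : ℝ) (P : Measure PathSpace) : Prop :=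
  ∃ x : H, ∀ t : ℝ≥0, 0 < t → ∃ T ⊆ Set.Ioc 0 t, timeMeasure T = 0 ∧
    ∀ s ≤ t, s ∉ T → P (energySetBetween ν x s t) = 1

/-- The variant of the energy property with `E_t(x)`. -/
def EnergyPropertyB (ν : ℝ) (P : Measure PathSpace) : Prop :=
  ∃ x : H, ∀ t : ℝ≥0, 0 < t → P (energySetUpTo ν x t) = 1

/-- The variant of the energy property with `E(x)`. -/
def EnergyPropertyC (ν : ℝ) (P : Measure PathSpace) : Prop :=
  ∃ x : H, P (energySet ν x) = 1

end NavierStokes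

end

/-!
The measurability assertions and the equivalences rest on a description of all objects by their
coefficients in an orthonormal basis of `H` of eigenfunctions of the Stokes operator.

*Coordinates.* The fields `(cos (k · x) + sin (k · x)) a`, with `k` a nonzero lattice vector and
`a ⟂ k`, form after normalization the basis `hBasis` of `H`, and their gradients are orthogonal and
total among the gradients of elements of `V` (`gradBasis`). The processes `ξ`, `z_x` and `v_x` are
determined by their pairings with these modes (`IsSpectral`), and the norms of `H` and `V` are
weighted `ℓ²` norms of the coefficients (`normH_sq`, `normV_sq`).

*Measurability.* The coefficients depend jointly measurably on time and path, and so does every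
norm. The trilinear term is a measurable function of `(z, v) ∈ H × V`, being a limit of truncated
integrals that are continuous in `(z, v)` (`measurable_triple`). The energy at time `t` depends only
on the path stopped at `t`, which turns joint measurability into progressive measurability. For the
set with a quantifier over all later times, the energy is lower semicontinuous from the right
(`energy_le_of_frequently`), so that a countable dense set of times suffices.

*Regular paths have full measure.* With `κ = νλ`, the coefficient of `z` at time `T` is the
stochastic integral `∫₀ᵀ e^{-κ(T-s)} dM_s`, written pathwise by parts. Since `M` is a continuous
martingale with deterministic variance `ct`, Riemann sums of the integral satisfy Lindeberg's
condition: the sum of the second moments of the large increments tends to zero, because it is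
bounded by the probability that a large increment occurs and by the tail of the final variable
(`HasConstantVariance.sum_integral_large_le`). Hence the coefficient is Gaussian with variance at most `c / (2κ)`
(`IsLinearVariation.exists_map_eq_gaussianReal`). Finite trace of `Q` sums these variances in any
basis, and so `z ∈ L⁸_loc([0, ∞); V)` almost surely; `V ⊂ L⁴` gives `ae_mem_regularSet`.

*Independence of `x`.* On regular paths the difference of the energies of `(v, z)` and `(v_x, z_x)`
is constant in time as long as both are finite (`inner_add_integral_eq`). With `y = e^{-νAt} x` and
`u = v + z`, the difference of the kinetic terms is `⟨v, y⟩ - |y|² / 2`, whose derivative follows from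
the equation for the coefficients of `v`; after cancellations by the skew-symmetry
`⟨q, B(u, p)⟩ = -⟨p, B(u, q)⟩` (`triple_skew`), it is compensated by the other terms. The
computation is made at positive times, where `y` is smooth, and extended to time `0` by weak
continuity of `v`.

*The equivalences.* Fubini's theorem exchanges "almost every time" and "almost surely". For the
passage from the inequality at fixed final times to all final times, the exceptional sets of a
countable dense set of final times are collected, and semicontinuity does the rest.
-/

noncomputable section

namespace NavierStokes

/-! ### The Hartley modes -/

/-- The phase `k · x` of a lattice vector `k`. -/
def phase (k : Fin 3 → ℤ) : Space →L[ℝ] ℝ :=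
  ∑ i, (k i : ℝ) • ContinuousLinearMap.proj (R := ℝ) (φ := fun _ : Fin 3 => ℝ) i

lemma phase_apply (k : Fin 3 → ℤ) (x : Space) : phase k x = ∑ i, (k i : ℝ) * x i := by
  simp [phase]

lemma phase_single (k : Fin 3 → ℤ) (i : Fin 3) (c : ℝ) :
    phase k (Pi.single i c) = k i * c := by
  rw [phase_apply, Finset.sum_eq_single i] <;> simp +contextual

lemma phase_neg (k : Fin 3 → ℤ) (x : Space) : phase (-k) x = -phase k x := by
  simp [phase_apply]

lemma phase_add (k l : Fin 3 → ℤ) (x : Space) : phase (k + l) x = phase k x + phase l x := by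
  simp [phase_apply, Fin.sum_univ_three]; ring

lemma phase_sub (k l : Fin 3 → ℤ) (x : Space) : phase (k - l) x = phase k x - phase l x := by
  simp [phase_apply, Fin.sum_univ_three]; ring

lemma phase_add_single (k : Fin 3 → ℤ) (x : Space) (i : Fin 3) :
    phase k (x + Pi.single i (2 * Real.pi)) = phase k x + k i * (2 * Real.pi) := by
  rw [map_add, phase_single]

/-- The real Fourier mode `cos (k · x) + sin (k · x)`. These modes, for `k` in the whole lattice,
are orthogonal, and each partial derivative maps the mode of `k` to a multiple of that of `-k`. -/
def hartley (k : Fin 3 → ℤ) (x : Space) : ℝ := Real.cos (phase k x) + Real.sin (phase k x)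

lemma contDiff_hartley (k : Fin 3 → ℤ) : ContDiff ℝ (⊤ : ℕ∞) (hartley k) :=
  (Real.contDiff_cos.comp (phase k).contDiff).add (Real.contDiff_sin.comp (phase k).contDiff)

lemma hartley_periodic (k : Fin 3 → ℤ) (x : Space) (i : Fin 3) :
    hartley k (x + Pi.single i (2 * Real.pi)) = hartley k x := by
  simp only [hartley, phase_add_single, Real.cos_add_int_mul_two_pi, Real.sin_add_int_mul_two_pi]

lemma fderiv_hartley (k : Fin 3 → ℤ) (x : Space) :
    HasFDerivAt (hartley k) (hartley (-k) x • phase k) x := by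
  have h : HasFDerivAt (phase k : Space → ℝ) (phase k) x := (phase k).hasFDerivAt
  refine HasFDerivAt.congr_fderiv (f := hartley k) (h.cos.add h.sin) ?_
  rw [← add_smul]
  congr 1
  simp [hartley, phase_neg, add_comm]

lemma integral_fderiv_scalar {g : Space → ℝ} (hg : ContDiff ℝ (⊤ : ℕ∞) g)
    (hp : ∀ x i, g (x + Pi.single i (2 * Real.pi)) = g x) (i : Fin 3) :
    ∫ x, fderiv ℝ g x (Pi.single i 1) ∂cellMeasure = 0 := by
  set a : Vec := EuclideanSpace.single 0 1
  have h := integral_pderiv (φ := fun x => g x • a) (hg.smul contDiff_const)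
    (fun x j => by simp only [hp]) i
  have h2 : ∀ x, pderiv i (fun x => g x • a) x = fderiv ℝ g x (Pi.single i 1) • a := by
    intro x
    unfold pderiv
    rw [fderiv_fun_smul (hg.differentiable (by simp) x) (differentiableAt_const _)]
    simp
  simp only [h2, integral_smul_const] at h
  have := congrArg (fun v : Vec => v 0) h
  simpa [a] using this

lemma integral_cos_phase {m : Fin 3 → ℤ} (hm : m ≠ 0) :
    ∫ x, Real.cos (phase m x) ∂cellMeasure = 0 := by
  obtain ⟨i, hi⟩ := Function.ne_iff.1 hm
  have h := integral_fderiv_scalar (g := fun x => Real.sin (phase m x))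
    (Real.contDiff_sin.comp (phase m).contDiff)
    (fun x j => by simp only [phase_add_single, Real.sin_add_int_mul_two_pi]) i
  have h2 : ∀ x, fderiv ℝ (fun x => Real.sin (phase m x)) x (Pi.single i 1)
      = Real.cos (phase m x) * m i := by
    intro x
    rw [((phase m).hasFDerivAt (x := x)).sin.fderiv]
    simp [phase_single]
  simp only [h2, integral_mul_const] at h
  have hi' : (m i : ℝ) ≠ 0 := by exact_mod_cast hi
  simpa [hi'] using h

lemma integral_sin_phase (m : Fin 3 → ℤ) : ∫ x, Real.sin (phase m x) ∂cellMeasure = 0 := by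
  by_cases hm : m = 0
  · simp [hm, phase_apply]
  obtain ⟨i, hi⟩ := Function.ne_iff.1 hm
  have h := integral_fderiv_scalar (g := fun x => Real.cos (phase m x))
    (Real.contDiff_cos.comp (phase m).contDiff)
    (fun x j => by simp only [phase_add_single, Real.cos_add_int_mul_two_pi]) i
  have h2 : ∀ x, fderiv ℝ (fun x => Real.cos (phase m x)) x (Pi.single i 1)
      = -Real.sin (phase m x) * m i := by
    intro x
    rw [((phase m).hasFDerivAt (x := x)).cos.fderiv]
    simp [phase_single]
  simp only [h2, integral_mul_const, integral_neg] at h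
  have hi' : (m i : ℝ) ≠ 0 := by exact_mod_cast hi
  simpa [hi'] using h

lemma hartley_mul (k l : Fin 3 → ℤ) (x : Space) :
    hartley k x * hartley l x = Real.cos (phase (k - l) x) + Real.sin (phase (k + l) x) := by
  simp only [hartley, phase_sub, phase_add, Real.cos_sub, Real.sin_add]
  ring

/-- The volume `(2π)³` of the periodicity cell. -/
def cellVolume : ℝ := (2 * Real.pi) ^ 3

lemma cellVolume_pos : 0 < cellVolume := by unfold cellVolume; positivity

lemma cellMeasure_univ : cellMeasure.real Set.univ = cellVolume := by
  rw [cellMeasure, measureReal_restrict_apply_univ, cell, measureReal_def, Real.volume_Icc_pi]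
  simp [cellVolume, Real.pi_pos.le]

lemma integral_hartley_mul (k l : Fin 3 → ℤ) :
    ∫ x, hartley k x * hartley l x ∂cellMeasure = if k = l then cellVolume else 0 := by
  simp only [hartley_mul]
  rw [integral_add (integrable_of_continuous (by fun_prop))
    (integrable_of_continuous (by fun_prop)), integral_sin_phase, add_zero]
  split_ifs with h
  · simp [h, phase_apply, cellMeasure_univ]
  · exact integral_cos_phase (sub_ne_zero.2 h)

/-! ### Solenoidal modes -/

/-- The lattice vector `k` as a vector of `ℝ³`. -/
def waveVec (k : Fin 3 → ℤ) : Vec := WithLp.toLp 2 fun i => (k i : ℝ)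

lemma waveVec_ne_zero {k : Fin 3 → ℤ} (hk : k ≠ 0) : waveVec k ≠ 0 := by
  intro h
  apply hk
  funext i
  have := congrArg (fun v : Vec => v i) h
  simpa [waveVec] using this

lemma inner_waveVec (k : Fin 3 → ℤ) (a : Vec) : ⟪waveVec k, a⟫ = ∑ i, (k i : ℝ) * a i := by
  simp [waveVec, PiLp.inner_apply, mul_comm]

lemma pderiv_hartley_smul (k : Fin 3 → ℤ) (a : Vec) (i : Fin 3) :
    pderiv i (fun x => hartley k x • a) = fun x => (k i : ℝ) • hartley (-k) x • a := by
  funext x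
  unfold pderiv
  rw [((fderiv_hartley k x).smul_const a).fderiv]
  simp [phase_single, smul_smul, mul_comm]

lemma hartley_smul_mem {k : Fin 3 → ℤ} (hk : k ≠ 0) {a : Vec} (ha : ⟪waveVec k, a⟫ = 0) :
    (fun x => hartley k x • a) ∈ testField := by
  refine ⟨(contDiff_hartley k).smul contDiff_const, fun x i => by simp only [hartley_periodic],
    fun x => ?_, ?_⟩
  · simp only [pderiv_hartley_smul, PiLp.smul_apply, smul_eq_mul]
    rw [inner_waveVec] at ha
    calc ∑ i, (k i : ℝ) * (hartley (-k) x * a i)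
        = hartley (-k) x * ∑ i, (k i : ℝ) * a i := by
          rw [Finset.mul_sum]; exact Finset.sum_congr rfl fun i _ => by ring
      _ = 0 := by rw [ha, mul_zero]
  · rw [integral_smul_const]
    have h := integral_hartley_mul k 0
    have h0 : ∀ x, hartley 0 x = 1 := fun x => by simp [hartley, phase_apply]
    simp only [h0, mul_one, if_neg hk] at h
    rw [h, zero_smul]

/-- The solenoidal field `a (cos (k · x) + sin (k · x))` with `a ⟂ k`. -/
def solMode (k : Fin 3 → ℤ) (hk : k ≠ 0) (a : (ℝ ∙ waveVec k)ᗮ) : testField :=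
  ⟨fun x => hartley k x • (a : Vec), hartley_smul_mem hk
    (Submodule.mem_orthogonal_singleton_iff_inner_right.1 a.2)⟩

lemma pderiv_smul_testField (j : Fin 3) (c : ℝ) {φ : Space → Vec}
    (h : Differentiable ℝ φ) : pderiv j (fun x => c • φ x) = fun x => c • pderiv j φ x := by
  funext x
  unfold pderiv
  rw [fderiv_fun_const_smul (h x)]
  rfl

lemma stokes_apply (φ : testField) (x : Space) :
    (stokes φ : Space → Vec) x = -∑ j, pderiv j (pderiv j φ) x := by
  simp [stokes, LinearMap.neg_apply, LinearMap.sum_apply, testPderiv]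

lemma stokes_solMode (k : Fin 3 → ℤ) (hk : k ≠ 0) (a : (ℝ ∙ waveVec k)ᗮ) :
    stokes (solMode k hk a) = ‖waveVec k‖ ^ 2 • solMode k hk a := by
  ext1
  funext x
  rw [stokes_apply]
  have h1 : ∀ j, pderiv j (pderiv j (solMode k hk a : Space → Vec)) x
      = -((k j : ℝ) ^ 2 • hartley k x • (a : Vec)) := by
    intro j
    rw [show (solMode k hk a : Space → Vec) = fun x => hartley k x • (a : Vec) from rfl,
      pderiv_hartley_smul, pderiv_smul_testField j (k j) (φ := fun x => hartley (-k) x • (a : Vec))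
        (((contDiff_hartley (-k)).smul contDiff_const).differentiable (by simp)),
      pderiv_hartley_smul]
    simp [smul_smul]
    ring_nf
  simp only [h1, Finset.sum_neg_distrib, neg_neg, ← Finset.sum_smul]
  rw [EuclideanSpace.norm_sq_eq]
  simp only [waveVec, Real.norm_eq_abs, sq_abs]
  rfl

lemma coeFn_testToL2 (φ : testField) : testToL2 φ =ᵐ[cellMeasure] (φ : Space → Vec) :=
  (memLp_of_continuous φ.2.1.continuous).coeFn_toLp

lemma inner_testToL2 (φ ψ : testField) :
    ⟪testToL2 φ, testToL2 ψ⟫ = ∫ x, ⟪(φ : Space → Vec) x, (ψ : Space → Vec) x⟫ ∂cellMeasure := by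
  rw [L2.inner_def]
  refine integral_congr_ae ?_
  filter_upwards [coeFn_testToL2 φ, coeFn_testToL2 ψ] with x h1 h2
  rw [h1, h2]

lemma inner_solMode (k l : Fin 3 → ℤ) (hk : k ≠ 0) (hl : l ≠ 0) (a : (ℝ ∙ waveVec k)ᗮ)
    (b : (ℝ ∙ waveVec l)ᗮ) :
    ⟪testToL2 (solMode k hk a), testToL2 (solMode l hl b)⟫
      = if k = l then cellVolume * ⟪(a : Vec), (b : Vec)⟫ else 0 := by
  rw [inner_testToL2]
  simp only [solMode, inner_smul_left, inner_smul_right, RCLike.conj_to_real]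
  calc _ = ∫ x, hartley k x * hartley l x * ⟪(a : Vec), (b : Vec)⟫ ∂cellMeasure := by
          refine integral_congr_ae (Filter.Eventually.of_forall fun x => ?_)
          simp only; ring
    _ = _ := by
          rw [integral_mul_const, integral_hartley_mul]
          split_ifs <;> simp

instance : Fact (Module.finrank ℝ Vec = 2 + 1) := ⟨by simp⟩

/-- The index set of the eigenbasis: a nonzero lattice vector and one of two polarizations. -/
abbrev Mode : Type := {k : Fin 3 → ℤ // k ≠ 0} × Fin 2

/-- The eigenvalue `|k|²` of a mode. -/
def lam (n : Mode) : ℝ := ‖waveVec n.1.1‖ ^ 2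

lemma one_le_lam (n : Mode) : 1 ≤ lam n := by
  obtain ⟨i, hi⟩ := Function.ne_iff.1 n.1.2
  rw [lam, EuclideanSpace.norm_sq_eq]
  have h1 : (1 : ℝ) ≤ ‖waveVec n.1.1 i‖ ^ 2 := by
    have : (1 : ℤ) ≤ (n.1.1 i) ^ 2 := by
      have : n.1.1 i ≠ 0 := hi
      have := sq_pos_of_ne_zero (R := ℤ) this
      lia
    simp only [waveVec, Real.norm_eq_abs, sq_abs]
    exact_mod_cast this
  exact h1.trans (Finset.single_le_sum (f := fun i => ‖waveVec n.1.1 i‖ ^ 2)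
    (fun j _ => by positivity) (Finset.mem_univ i))

lemma lam_pos (n : Mode) : 0 < lam n := zero_lt_one.trans_le (one_le_lam n)

/-- The normalized eigenfunctions of the Stokes operator. -/
def modeField (n : Mode) : testField :=
  (Real.sqrt cellVolume)⁻¹ • solMode n.1.1 n.1.2
    (OrthonormalBasis.fromOrthogonalSpanSingleton (𝕜 := ℝ) 2 (waveVec_ne_zero n.1.2) n.2)

lemma stokes_modeField (n : Mode) : stokes (modeField n) = lam n • modeField n := by
  rw [modeField, map_smul, stokes_solMode, smul_comm, lam]

/-- A mode as an eigenfunction with its eigenvalue. -/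
def modeEigen (n : Mode) : StokesEigen := ⟨modeField n, lam n, stokes_modeField n⟩

lemma inner_testToH (φ ψ : testField) : ⟪testToH φ, testToH ψ⟫ = ⟪testToL2 φ, testToL2 ψ⟫ := rfl

lemma orthonormal_mode : Orthonormal ℝ fun n => testToH (modeField n) := by
  classical
  rw [orthonormal_iff_ite]
  rintro ⟨⟨k, hk⟩, i⟩ ⟨⟨l, hl⟩, j⟩
  rw [inner_testToH, modeField, modeField, map_smul, map_smul, inner_smul_left, inner_smul_right,
    inner_solMode]
  simp only [RCLike.conj_to_real]
  by_cases h : k = l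
  · subst h
    have := orthonormal_iff_ite.1 (OrthonormalBasis.fromOrthogonalSpanSingleton (𝕜 := ℝ) 2
      (waveVec_ne_zero hk)).orthonormal i j
    rw [Submodule.coe_inner] at this
    rw [if_pos rfl, this]
    have hs : Real.sqrt cellVolume * Real.sqrt cellVolume = cellVolume :=
      Real.mul_self_sqrt cellVolume_pos.le
    have hp : Real.sqrt cellVolume ≠ 0 := (Real.sqrt_pos.2 cellVolume_pos).ne'
    by_cases hij : i = j
    · simp only [hij, if_true, mul_one]
      nth_rewrite 3 [← hs]
      field_simp
    · simp [hij]
  · simp [h]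

/-! ### Completeness of the modes -/

section Torus

local instance : MeasureSpace UnitAddCircle := ⟨AddCircle.haarAddCircle⟩

local instance : Measure.IsAddHaarMeasure (volume : Measure UnitAddCircle) :=
  inferInstanceAs (Measure.IsAddHaarMeasure AddCircle.haarAddCircle)

local instance : IsProbabilityMeasure (volume : Measure UnitAddCircle) :=
  inferInstanceAs (IsProbabilityMeasure AddCircle.haarAddCircle)

/-- The identification of the unit torus with the periodicity cell. -/
def torusToCell (x : UnitAddTorus (Fin 3)) : Space :=
  fun i => 2 * Real.pi * (AddCircle.measurableEquivIoc 1 0 (x i) : ℝ)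

lemma measurable_torusToCell : Measurable torusToCell :=
  measurable_pi_lambda _ fun i => (measurable_subtype_coe.comp
    ((AddCircle.measurableEquivIoc 1 0).measurable.comp (measurable_pi_apply i))).const_mul _

lemma torusToCell_coe {y : Space} (hy : ∀ i, y i ∈ Set.Ioc (0 : ℝ) (0 + 1)) :
    torusToCell (fun i => (y i : UnitAddCircle)) = (2 * Real.pi) • y := by
  funext i
  simp only [torusToCell, Pi.smul_apply, smul_eq_mul]
  congr 1
  exact congrArg Subtype.val ((AddCircle.equivIoc 1 (0 : ℝ)).apply_symm_apply ⟨y i, hy i⟩)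

lemma map_torusToCell :
    (volume : Measure (UnitAddTorus (Fin 3))).map torusToCell
      = ENNReal.ofReal cellVolume⁻¹ • cellMeasure := by
  ext A hA
  rw [Measure.map_apply measurable_torusToCell hA, ← lintegral_indicator_one
    (measurable_torusToCell hA), UnitAddTorus.lintegral_preimage _ 0]
  set Q : Set Space := {x | ∀ i, x i ∈ Set.Ioc ((0 : Space) i) ((0 : Space) i + 1)} with hQ
  have hQm : MeasurableSet Q := by
    have : Q = Set.univ.pi fun i => Set.Ioc ((0 : Space) i) ((0 : Space) i + 1) := by
      ext; simp [Q]
    rw [this]; exact MeasurableSet.univ_pi fun i => measurableSet_Ioc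
  have hpos : (0 : ℝ) < 2 * Real.pi := by positivity
  have h1 : ∫⁻ y in Q, (torusToCell ⁻¹' A).indicator 1 (fun i => (y i : UnitAddCircle))
      = ∫⁻ y in Q, ((fun y : Space => (2 * Real.pi) • y) ⁻¹' A).indicator 1 y := by
    refine setLIntegral_congr_fun hQm fun y hy => ?_
    have := torusToCell_coe (y := y) hy
    by_cases hmem : (2 * Real.pi) • y ∈ A
    · rw [Set.indicator_of_mem (s := torusToCell ⁻¹' A) (by rwa [Set.mem_preimage, this]),
        Set.indicator_of_mem (by exact hmem)]
      rfl
    · rw [Set.indicator_of_notMem (s := torusToCell ⁻¹' A) (by rwa [Set.mem_preimage, this]),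
        Set.indicator_of_notMem (by exact hmem)]
  have hAm : MeasurableSet ((fun y : Space => (2 * Real.pi) • y) ⁻¹' A) :=
    (measurable_const_smul (2 * Real.pi)) hA
  rw [h1, lintegral_indicator_one hAm, Measure.restrict_apply hAm]
  set C : Set Space := Set.univ.pi fun _ => Set.Ioc (0 : ℝ) (2 * Real.pi) with hC
  have h2 : (fun y : Space => (2 * Real.pi) • y) ⁻¹' A ∩ Q
      = (fun y : Space => (2 * Real.pi) • y) ⁻¹' (A ∩ C) := by
    ext y
    simp only [Set.mem_inter_iff, Set.mem_preimage, hQ, hC, Set.mem_ofPred_eq, Set.mem_pi,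
      Set.mem_univ, true_imp_iff, Set.mem_Ioc, Pi.smul_apply, smul_eq_mul, Pi.zero_apply, zero_add]
    refine and_congr_right fun _ => forall_congr' fun i => ?_
    constructor
    · rintro ⟨h, h'⟩; exact ⟨by positivity, by nlinarith⟩
    · rintro ⟨h, h'⟩
      exact ⟨pos_of_mul_pos_right h hpos.le, le_of_mul_le_mul_left (by linarith) hpos⟩
  rw [h2, Measure.addHaar_preimage_smul _ hpos.ne', Measure.smul_apply, smul_eq_mul, cellMeasure,
    Measure.restrict_apply hA]
  congr 1
  · simp only [Module.finrank_fintype_fun_eq_card, Fintype.card_fin]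
    rw [abs_of_pos (by positivity), cellVolume]
  · refine measure_congr (Filter.EventuallyEq.inter (Filter.EventuallyEq.refl _ _) ?_)
    exact Measure.univ_pi_Ioc_ae_eq_Icc (μ := fun _ : Fin 3 => (volume : Measure ℝ))

lemma mFourier_eq (n : Fin 3 → ℤ) (x : UnitAddTorus (Fin 3)) :
    UnitAddTorus.mFourier n x = Complex.exp (Complex.I * phase n (torusToCell x)) := by
  have h : ∀ i, fourier (n i) (x i) =
    Complex.exp (Complex.I * ((n i : ℝ) * torusToCell x i : ℝ)) := by
    intro i
    have hx : x i = ((AddCircle.measurableEquivIoc 1 0 (x i) : ℝ) : UnitAddCircle) :=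
      ((AddCircle.equivIoc 1 (0 : ℝ)).symm_apply_apply (x i)).symm
    conv_lhs => rw [hx]
    rw [fourier_coe_apply]
    congr 1
    simp [torusToCell]
    ring
  change ∏ i, fourier (n i) (x i) = _
  simp only [h]
  rw [← Complex.exp_sum, phase_apply, ← Finset.mul_sum]
  push_cast
  rfl

/-- A square integrable function on the cell that is orthogonal to all the modes vanishes. -/
lemma ae_eq_zero_of_integral_hartley {f : Space → ℝ} (hf : MemLp f 2 cellMeasure)
    (h : ∀ k, ∫ x, f x * hartley k x ∂cellMeasure = 0) : f =ᵐ[cellMeasure] 0 := by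
  have hc : ENNReal.ofReal cellVolume⁻¹ ≠ 0 := by
    simpa using cellVolume_pos
  have hint : ∀ k, Integrable (fun x => f x * hartley k x) cellMeasure := fun k =>
    (hf.integrable_mul (memLp_of_continuous (contDiff_hartley k).continuous))
  have hmap : (volume : Measure (UnitAddTorus (Fin 3))).map torusToCell
      = ENNReal.ofReal cellVolume⁻¹ • cellMeasure := map_torusToCell
  have hfm : MemLp f 2 ((volume : Measure (UnitAddTorus (Fin 3))).map torusToCell) := by
    rw [hmap]; exact hf.smul_measure ENNReal.ofReal_ne_top
  have hF : MemLp (fun x => (f (torusToCell x) : ℂ)) 2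
      (volume : Measure (UnitAddTorus (Fin 3))) :=
    ((memLp_map_measure_iff hfm.1 measurable_torusToCell.aemeasurable).1 hfm).ofReal
  have hcos : ∀ n, ∫ x, Real.cos (phase n x) * f x ∂cellMeasure = 0 := by
    intro n
    have := integral_add (hint n) (hint (-n))
    rw [h, h] at this
    have h2 : ∀ x, f x * hartley n x + f x * hartley (-n) x = 2 * (Real.cos (phase n x) * f x) := by
      intro x; simp only [hartley, phase_neg, Real.cos_neg, Real.sin_neg]; ring
    simp only [h2, integral_const_mul] at this
    linarith
  have hsin : ∀ n, ∫ x, Real.sin (phase n x) * f x ∂cellMeasure = 0 := by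
    intro n
    have := integral_sub (hint n) (hint (-n))
    rw [h, h] at this
    have h2 : ∀ x, f x * hartley n x - f x * hartley (-n) x = 2 * (Real.sin (phase n x) * f x) := by
      intro x; simp only [hartley, phase_neg, Real.cos_neg, Real.sin_neg]; ring
    simp only [h2, integral_const_mul] at this
    linarith
  have hfi : Integrable f cellMeasure := hf.integrable (by norm_num)
  have hcoef : ∀ n, UnitAddTorus.mFourierCoeff (fun x => (f (torusToCell x) : ℂ)) n = 0 := by
    intro n
    have h1 : UnitAddTorus.mFourierCoeff (fun x => (f (torusToCell x) : ℂ)) n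
        = ∫ x, (fun y : Space => Complex.exp (Complex.I * phase (-n) y) * (f y : ℂ)) (torusToCell x)
          ∂(volume : Measure (UnitAddTorus (Fin 3))) := by
      refine integral_congr_ae (Filter.Eventually.of_forall fun x => ?_)
      simp only [mFourier_eq, smul_eq_mul]
    have hcs : ∀ y, Complex.exp (Complex.I * phase (-n) y) * (f y : ℂ)
        = ((Real.cos (phase (-n) y) * f y : ℝ) : ℂ)
          + ((Real.sin (phase (-n) y) * f y : ℝ) : ℂ) * Complex.I := by
      intro y
      rw [mul_comm Complex.I, Complex.exp_mul_I]
      push_cast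
      ring
    have hcont : Continuous fun y : Space => Complex.exp (Complex.I * phase (-n) y) := by fun_prop
    have hI : ∀ g : Space → ℝ, Continuous g → (∀ x, |g x| ≤ 1) →
        Integrable (fun x => g x * f x) cellMeasure := fun g hg hb =>
      hfi.bdd_mul (c := 1) hg.aestronglyMeasurable (Filter.Eventually.of_forall hb)
    have h2 := integral_map (μ := (volume : Measure (UnitAddTorus (Fin 3))))
      measurable_torusToCell.aemeasurable
      (f := fun y : Space => Complex.exp (Complex.I * phase (-n) y) * (f y : ℂ))
      (hcont.aestronglyMeasurable.mul (Complex.continuous_ofReal.comp_aestronglyMeasurable hfm.1))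
    rw [h1, ← h2, hmap, integral_smul_measure]
    simp only [hcs]
    rw [integral_add, integral_mul_const, integral_complex_ofReal, integral_complex_ofReal,
      hcos, hsin]
    · simp
    · exact (hI _ (by fun_prop) fun x => Real.abs_cos_le_one _).ofReal
    · exact (hI _ (by fun_prop) fun x => Real.abs_sin_le_one _).ofReal.mul_const _
  have hz : hF.toLp _ = 0 := by
    rw [← UnitAddTorus.mFourierBasis.repr.map_eq_zero_iff]
    ext n
    rw [UnitAddTorus.mFourierBasis_repr]
    refine Eq.trans ?_ (hcoef n)
    refine integral_congr_ae ?_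
    filter_upwards [hF.coeFn_toLp] with x hx
    rw [hx]
  have h0 : ∀ᵐ x ∂(volume : Measure (UnitAddTorus (Fin 3))), f (torusToCell x) = 0 := by
    have := hF.coeFn_toLp
    rw [hz] at this
    filter_upwards [this, Lp.coeFn_zero ℂ 2 (volume : Measure (UnitAddTorus (Fin 3)))] with x hx h0
    rw [h0, Pi.zero_apply] at hx
    exact_mod_cast hx.symm
  have hmap' : Measure.map torusToCell (volume : Measure (UnitAddTorus (Fin 3)))
      {x | ¬ hf.1.mk f x = 0} = 0 := by
    have hms : MeasurableSet {x | ¬ hf.1.mk f x = 0} :=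
      (hf.1.stronglyMeasurable_mk.measurable (measurableSet_singleton 0)).compl
    rw [Measure.map_apply measurable_torusToCell hms]
    have hmk : f =ᵐ[(volume : Measure (UnitAddTorus (Fin 3))).map torusToCell] hf.1.mk f := by
      rw [hmap]
      exact Measure.ae_smul_measure hf.1.ae_eq_mk _
    have h3 := ae_of_ae_map measurable_torusToCell.aemeasurable hmk
    change ∀ᵐ x ∂(volume : Measure (UnitAddTorus (Fin 3))), hf.1.mk f (torusToCell x) = 0
    filter_upwards [h0, h3] with x h4 h5
    rw [← h5, h4]
  rw [hmap, Measure.smul_apply, smul_eq_mul, mul_eq_zero] at hmap'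
  have h6 : ∀ᵐ x ∂cellMeasure, hf.1.mk f x = 0 := hmap'.resolve_left hc
  filter_upwards [h6, hf.1.ae_eq_mk] with x h7 h8
  rw [h8, h7]; rfl

end Torus

/-! ### The eigenbasis of `H` -/

lemma coe_testToH (φ : testField) : ((testToH φ : H) : L2Vec) = testToL2 φ := rfl

lemma inner_eq_zero_of_mem_HSub {Ψ : L2Vec} (h : ∀ φ, ⟪testToL2 φ, Ψ⟫ = 0) {u : L2Vec}
    (hu : u ∈ HSub) : ⟪u, Ψ⟫ = 0 := by
  have hc : IsClosed {u : L2Vec | ⟪u, Ψ⟫ = 0} :=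
    isClosed_eq (by fun_prop) continuous_const
  refine closure_minimal (s := (LinearMap.range testToL2 : Set L2Vec)) ?_ hc hu
  rintro _ ⟨φ, rfl⟩
  exact h φ

lemma inner_toLp_of_continuous (u : L2Vec) {ψ : Space → Vec} (hψ : Continuous ψ) :
    ⟪u, (memLp_of_continuous hψ).toLp ψ⟫ = ∫ x, ⟪u x, ψ x⟫ ∂cellMeasure := by
  rw [L2.inner_def]
  refine integral_congr_ae ?_
  filter_upwards [(memLp_of_continuous hψ).coeFn_toLp] with x h1
  rw [h1]

/-- The gradient of a scalar function as a vector field. -/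
def gradient (g : Space → ℝ) (x : Space) : Vec :=
  WithLp.toLp 2 fun i => fderiv ℝ g x (Pi.single i 1)

lemma continuous_gradient {g : Space → ℝ} (hg : ContDiff ℝ (⊤ : ℕ∞) g) :
    Continuous (gradient g) :=
  (PiLp.continuous_toLp 2 _).comp (continuous_pi fun _ =>
    (hg.continuous_fderiv (by simp)).clm_apply continuous_const)

/-- Elements of `H` are weakly divergence free. -/
lemma integral_inner_gradient {u : L2Vec} (hu : u ∈ HSub) {g : Space → ℝ}
    (hg : ContDiff ℝ (⊤ : ℕ∞) g) (hp : ∀ x i, g (x + Pi.single i (2 * Real.pi)) = g x) :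
    ∫ x, ⟪u x, gradient g x⟫ ∂cellMeasure = 0 := by
  rw [← inner_toLp_of_continuous u (continuous_gradient hg)]
  refine inner_eq_zero_of_mem_HSub (fun φ => ?_) hu
  rw [inner_toLp_of_continuous _ (continuous_gradient hg)]
  have h1 : ∀ i, ∫ x, pderiv i (fun x => g x • (φ : Space → Vec) x) x ∂cellMeasure = 0 :=
    integral_pderiv (hg.smul φ.2.1) (fun x j => by simp only [hp, φ.2.2.1])
  have h2 : ∀ i x, pderiv i (fun x => g x • (φ : Space → Vec) x) x
      = g x • pderiv i φ x + fderiv ℝ g x (Pi.single i 1) • (φ : Space → Vec) x := by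
    intro i x
    unfold pderiv
    rw [fderiv_fun_smul (hg.differentiable (by simp) x) (φ.2.1.differentiable (by simp) x)]
    simp
  have hcont : ∀ i, Continuous (pderiv i (fun x => g x • (φ : Space → Vec) x)) := fun i =>
    (contDiff_pderiv (hg.smul φ.2.1) i).continuous
  have h3 : ∀ i, ∫ x, (pderiv i (fun x => g x • (φ : Space → Vec) x) x) i ∂cellMeasure = 0 := by
    intro i
    have := (EuclideanSpace.proj i : Vec →L[ℝ] ℝ).integral_comp_comm
      (integrable_of_continuous (hcont i))
    rw [h1 i, map_zero] at this
    exact this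
  calc ∫ x, ⟪testToL2 φ x, gradient g x⟫ ∂cellMeasure
      = ∫ x, ∑ i, (pderiv i (fun x => g x • (φ : Space → Vec) x) x) i ∂cellMeasure := by
        refine integral_congr_ae ?_
        filter_upwards [coeFn_testToL2 φ] with x hx
        rw [hx]
        simp only [h2, PiLp.add_apply, PiLp.smul_apply, smul_eq_mul, Finset.sum_add_distrib,
          ← Finset.mul_sum, φ.2.2.2.1 x, mul_zero, zero_add, PiLp.inner_apply, gradient]
        rfl
    _ = 0 := by
        have h4 : ∀ i, Integrable
            (fun x => (pderiv i (fun x => g x • (φ : Space → Vec) x) x) i) cellMeasure :=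
          fun i => integrable_of_continuous
            ((EuclideanSpace.proj i : Vec →L[ℝ] ℝ).continuous.comp (hcont i))
        rw [integral_finsetSum _ fun i _ => h4 i]
        exact Finset.sum_eq_zero fun i _ => h3 i

/-- An element of `H` that is orthogonal to all the modes vanishes. The components along the wave
vector of the Fourier coefficients vanish because the field is divergence free. -/
lemma eq_zero_of_inner_mode {u : H} (h : ∀ n, ⟪u, testToH (modeField n)⟫ = 0) : u = 0 := by
  have hu := u.2
  have hsol : ∀ (k : Fin 3 → ℤ) (hk : k ≠ 0) (a : (ℝ ∙ waveVec k)ᗮ),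
      ⟪(u : L2Vec), testToL2 (solMode k hk a)⟫ = 0 := by
    intro k hk a
    set b := OrthonormalBasis.fromOrthogonalSpanSingleton (𝕜 := ℝ) 2 (waveVec_ne_zero hk)
    have h1 : ∀ j, ⟪(u : L2Vec), testToL2 (solMode k hk (b j))⟫ = 0 := by
      intro j
      have := h (⟨k, hk⟩, j)
      rw [Submodule.coe_inner, coe_testToH, modeField, map_smul, inner_smul_right] at this
      exact (mul_eq_zero.1 this).resolve_left
        (inv_ne_zero (Real.sqrt_pos.2 cellVolume_pos).ne')
    have h2 : solMode k hk a = ∑ j, b.repr a j • solMode k hk (b j) := by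
      ext1
      funext x
      have h3 : (a : Vec) = ∑ j, b.repr a j • ((b j : (ℝ ∙ waveVec k)ᗮ) : Vec) := by
        conv_lhs => rw [← b.sum_repr a]
        simp
      simp only [Submodule.coe_sum, Finset.sum_apply, Submodule.coe_smul, Pi.smul_apply, solMode]
      conv_lhs => rw [h3, Finset.smul_sum]
      exact Finset.sum_congr rfl fun j _ => smul_comm _ _ _
    rw [h2, map_sum, inner_sum]
    refine Finset.sum_eq_zero fun j _ => ?_
    rw [map_smul, inner_smul_right, h1, mul_zero]
  have hint : ∀ k (w : Vec), Integrable (fun x => ⟪(u : L2Vec) x, hartley k x • w⟫) cellMeasure :=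
    fun k w => by
      have := L2.integrable_inner (𝕜 := ℝ) (u : L2Vec) ((memLp_of_continuous
        (((contDiff_hartley k).continuous).smul (continuous_const (y := w)))).toLp _)
      refine this.congr ?_
      filter_upwards [(memLp_of_continuous
        (((contDiff_hartley k).continuous).smul (continuous_const (y := w)))).coeFn_toLp] with x hx
      rw [hx]; rfl
  have hall : ∀ k (w : Vec), ∫ x, ⟪(u : L2Vec) x, hartley k x • w⟫ ∂cellMeasure = 0 := by
    intro k w
    by_cases hk : k = 0
    · subst hk
      have h0 : ∀ x, hartley 0 x = 1 := fun x => by simp [hartley, phase_apply]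
      simp only [h0, one_smul]
      rw [← inner_toLp_of_continuous (u : L2Vec) (continuous_const (y := w))]
      refine inner_eq_zero_of_mem_HSub (fun φ => ?_) hu
      rw [inner_toLp_of_continuous _ (continuous_const (y := w))]
      have h1 : ∫ x, ⟪testToL2 φ x, w⟫ ∂cellMeasure
          = ∫ x, ⟪w, (φ : Space → Vec) x⟫ ∂cellMeasure := by
        refine integral_congr_ae ?_
        filter_upwards [coeFn_testToL2 φ] with x hx
        rw [hx, real_inner_comm]
      rw [h1, integral_inner (integrable_of_continuous φ.2.1.continuous), φ.2.2.2.2,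
        inner_zero_right]
    · set K := (ℝ ∙ waveVec k)
      have hw : w = (K.starProjection w) + (Kᗮ.starProjection w) := by
        rw [Submodule.starProjection_orthogonal]; simp
      obtain ⟨c, hc⟩ := Submodule.mem_span_singleton.1 (K.starProjection_apply_mem w)
      have h1 : ∫ x, ⟪(u : L2Vec) x, hartley k x • waveVec k⟫ ∂cellMeasure = 0 := by
        have := integral_inner_gradient hu (contDiff_hartley (-k)) (hartley_periodic (-k))
        have h2 : ∀ x, gradient (hartley (-k)) x = -(hartley k x • waveVec k) := by
          intro x
          ext i
          simp [gradient, (fderiv_hartley (-k) x).fderiv, phase_single, waveVec]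
        simp only [h2, inner_neg_right, integral_neg, neg_eq_zero] at this
        exact this
      have h2 : ∫ x, ⟪(u : L2Vec) x, hartley k x • Kᗮ.starProjection w⟫ ∂cellMeasure = 0 := by
        rw [← hsol k hk ⟨_, Kᗮ.starProjection_apply_mem w⟩, L2.inner_def]
        refine integral_congr_ae ?_
        filter_upwards [coeFn_testToL2 (solMode k hk ⟨_, Kᗮ.starProjection_apply_mem w⟩)] with x hx
        rw [hx]; rfl
      have h3 : ∀ x, ⟪(u : L2Vec) x, hartley k x • w⟫
          = c * ⟪(u : L2Vec) x, hartley k x • waveVec k⟫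
            + ⟪(u : L2Vec) x, hartley k x • Kᗮ.starProjection w⟫ := by
        intro x
        conv_lhs => rw [hw, ← hc]
        simp only [smul_add, inner_add_right, inner_smul_right]
        ring
      simp only [h3]
      rw [integral_add ((hint _ _).const_mul _) (hint _ _), integral_const_mul, h1, h2]
      simp
  have hcomp : ∀ i, (fun x => (u : L2Vec) x i) =ᵐ[cellMeasure] 0 := by
    intro i
    refine ae_eq_zero_of_integral_hartley ?_ fun k => ?_
    · exact (EuclideanSpace.proj i : Vec →L[ℝ] ℝ).comp_memLp' (Lp.memLp (u : L2Vec))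
    · rw [← hall k (EuclideanSpace.single i 1)]
      refine integral_congr_ae (Filter.Eventually.of_forall fun x => ?_)
      simp [inner_smul_right, EuclideanSpace.inner_single_right, mul_comm]
  ext1
  rw [ZeroMemClass.coe_zero, Lp.ext_iff]
  filter_upwards [ae_all_iff.2 hcomp, Lp.coeFn_zero Vec 2 cellMeasure] with x hx h0
  ext i
  rw [hx i, h0]
  rfl

/-- The eigenfunctions of the Stokes operator as a Hilbert basis of `H`. -/
def hBasis : HilbertBasis Mode ℝ H :=
  HilbertBasis.mkOfOrthogonalEqBot orthonormal_mode (by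
    rw [Submodule.eq_bot_iff]
    intro u hu
    refine eq_zero_of_inner_mode fun n => ?_
    rw [real_inner_comm]
    exact hu _ (Submodule.subset_span ⟨n, rfl⟩))

lemma hBasis_apply (n : Mode) : hBasis n = testToH (modeField n) := by
  rw [hBasis, HilbertBasis.coe_mkOfOrthogonalEqBot]

/-- The coefficient of an element of `H` with respect to a mode. -/
def coef (h : H) (n : Mode) : ℝ := ⟪h, testToH (modeField n)⟫

lemma hasSum_coef_mul (h g : H) : HasSum (fun n => coef h n * coef g n) ⟪h, g⟫ := by
  have := hBasis.hasSum_inner_mul_inner h g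
  simp only [hBasis_apply] at this
  simpa only [coef, real_inner_comm] using this

lemma hasSum_coef_sq (h : H) : HasSum (fun n => coef h n ^ 2) (‖h‖ ^ 2) := by
  simpa only [← pow_two, real_inner_self_eq_norm_sq] using hasSum_coef_mul h h

lemma hasSum_coef_smul (h : H) : HasSum (fun n => coef h n • testToH (modeField n)) h := by
  have := hBasis.hasSum_repr h
  simpa only [hBasis.repr_apply_apply, hBasis_apply, real_inner_comm, coef] using this

lemma ext_coef {h g : H} (e : ∀ n, coef h n = coef g n) : h = g :=
  (hasSum_coef_smul h).unique (by simpa only [e] using hasSum_coef_smul g)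

lemma continuous_coef (n : Mode) : Continuous fun h => coef h n := by
  unfold coef; fun_prop

lemma coef_smul (c : ℝ) (h : H) (n : Mode) : coef (c • h) n = c * coef h n := by
  simp [coef, inner_smul_left]

lemma coef_add (h g : H) (n : Mode) : coef (h + g) n = coef h n + coef g n := by
  simp [coef, inner_add_left]

lemma coef_sub (h g : H) (n : Mode) : coef (h - g) n = coef h n - coef g n := by
  simp [coef, inner_sub_left]

lemma coef_zero (n : Mode) : coef 0 n = 0 := by simp [coef]

lemma coef_mode [DecidableEq Mode] (m n : Mode) :
    coef (testToH (modeField m)) n = if m = n then 1 else 0 :=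
  orthonormal_iff_ite.1 orthonormal_mode m n

/-- Square summable coefficients are those of an element of `H`. -/
lemma exists_coef_eq {c : Mode → ℝ} (hc : Summable fun n => c n ^ 2) :
    ∃ h : H, ∀ n, coef h n = c n := by
  have hm : Memℓp c 2 := by
    rw [memℓp_gen_iff (by norm_num)]
    simpa using hc
  refine ⟨hBasis.repr.symm ⟨c, hm⟩, fun n => ?_⟩
  have := hBasis.repr_apply_apply (hBasis.repr.symm ⟨c, hm⟩) n
  rw [LinearIsometryEquiv.apply_symm_apply, hBasis_apply] at this
  rw [coef, real_inner_comm, ← this]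

/-! ### Gradients of the modes and the space `V` -/

lemma coeFn_testGradToL2 (φ : testField) : testGradToL2 φ =ᵐ[cellMeasure] grad φ :=
  (memLp_of_continuous (continuous_grad φ)).coeFn_toLp

/-- Integration by parts: `⟨∇φ, ∇ψ⟩ = ⟨Aφ, ψ⟩`. -/
lemma inner_testGradToL2 (φ ψ : testField) :
    ⟪testGradToL2 φ, testGradToL2 ψ⟫ = ⟪testToL2 (stokes φ), testToL2 ψ⟫ := by
  have hcomp : ∀ (χ : Space → Vec), ContDiff ℝ (⊤ : ℕ∞) χ → ∀ j : Fin 3,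
      ContDiff ℝ (⊤ : ℕ∞) fun x => χ x j := fun χ h j =>
    (EuclideanSpace.proj j : Vec →L[ℝ] ℝ).contDiff.comp h
  have hder : ∀ (χ : Space → Vec), ContDiff ℝ (⊤ : ℕ∞) χ → ∀ (i j : Fin 3) x,
      HasFDerivAt (fun x => χ x j) ((EuclideanSpace.proj j : Vec →L[ℝ] ℝ) ∘L fderiv ℝ χ x) x :=
    fun χ h i j x => (EuclideanSpace.proj j : Vec →L[ℝ] ℝ).hasFDerivAt.comp x
      (h.differentiable (by simp) x).hasFDerivAt
  have hφ := φ.2.1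
  have hψ := ψ.2.1
  have hcont : ∀ (χ : Space → Vec), ContDiff ℝ (⊤ : ℕ∞) χ → ∀ j : Fin 3,
      Continuous fun x => χ x j := fun χ h j => (hcomp χ h j).continuous
  have key : ∀ i j : Fin 3,
      ∫ x, (pderiv i (pderiv i φ) x j * (ψ : Space → Vec) x j
        + pderiv i φ x j * pderiv i ψ x j) ∂cellMeasure = 0 := by
    intro i j
    rw [← integral_fderiv_scalar (g := fun x => pderiv i φ x j * (ψ : Space → Vec) x j)
      ((hcomp _ (contDiff_pderiv hφ i) j).mul (hcomp _ hψ j))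
      (fun x l => by simp only [pderiv_periodic φ.2.2.1, ψ.2.2.1]) i]
    refine integral_congr_ae (Filter.Eventually.of_forall fun x => ?_)
    simp only
    rw [((hder _ (contDiff_pderiv hφ i) i j x).fun_mul (hder _ hψ i j x)).fderiv]
    simp [pderiv]
    ring
  have hI1 : ∀ i j : Fin 3, Integrable
      (fun x => pderiv i (pderiv i φ) x j * (ψ : Space → Vec) x j) cellMeasure := fun i j =>
    integrable_of_continuous
      ((hcont _ (contDiff_pderiv (contDiff_pderiv hφ i) i) j).mul (hcont _ hψ j))
  have hI2 : ∀ i j : Fin 3, Integrable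
      (fun x => pderiv i φ x j * pderiv i ψ x j) cellMeasure := fun i j =>
    integrable_of_continuous
      ((hcont _ (contDiff_pderiv hφ i) j).mul (hcont _ (contDiff_pderiv hψ i) j))
  have hL : ⟪testGradToL2 φ, testGradToL2 ψ⟫
      = ∑ i, ∑ j, ∫ x, pderiv i φ x j * pderiv i ψ x j ∂cellMeasure := by
    rw [L2.inner_def]
    simp only [← integral_finsetSum _ fun j _ => hI2 _ j]
    rw [← integral_finsetSum _ fun i _ => integrable_finsetSum _ fun j _ => hI2 i j]
    refine integral_congr_ae ?_
    filter_upwards [coeFn_testGradToL2 φ, coeFn_testGradToL2 ψ] with x h1 h2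
    rw [h1, h2]
    simp only [PiLp.inner_apply, grad, Fintype.sum_prod_type, RCLike.inner_apply,
      RCLike.conj_to_real]
    exact Finset.sum_congr rfl fun i _ => Finset.sum_congr rfl fun j _ => mul_comm _ _
  have hR : ⟪testToL2 (stokes φ), testToL2 ψ⟫
      = -∑ i, ∑ j, ∫ x, pderiv i (pderiv i φ) x j * (ψ : Space → Vec) x j ∂cellMeasure := by
    rw [L2.inner_def]
    simp only [← integral_finsetSum _ fun j _ => hI1 _ j]
    rw [← integral_finsetSum _ fun i _ => integrable_finsetSum _ fun j _ => hI1 i j,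
      ← integral_neg]
    refine integral_congr_ae ?_
    filter_upwards [coeFn_testToL2 (stokes φ), coeFn_testToL2 ψ] with x h1 h2
    rw [h1, h2, stokes_apply, inner_neg_left, sum_inner]
    simp only [PiLp.inner_apply, RCLike.inner_apply, RCLike.conj_to_real]
    refine congrArg Neg.neg (Finset.sum_congr rfl fun i _ => Finset.sum_congr rfl fun j _ =>
      mul_comm _ _)
  rw [hL, hR, ← Finset.sum_neg_distrib]
  refine Finset.sum_congr rfl fun i _ => ?_
  rw [← Finset.sum_neg_distrib]
  refine Finset.sum_congr rfl fun j _ => ?_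
  have := key i j
  rw [integral_add (hI1 i j) (hI2 i j)] at this
  linarith

lemma inner_stokes_comm (φ ψ : testField) :
    ⟪testToL2 (stokes φ), testToL2 ψ⟫ = ⟪testToL2 φ, testToL2 (stokes ψ)⟫ := by
  rw [← inner_testGradToL2, real_inner_comm, inner_testGradToL2, real_inner_comm]

lemma coef_stokes (φ : testField) (n : Mode) :
    coef (testToH (stokes φ)) n = lam n * coef (testToH φ) n := by
  rw [coef, coef, inner_testToH, inner_stokes_comm, stokes_modeField, map_smul, inner_smul_right,
    inner_testToH]

/-- The partial sums of the expansion of a test field. -/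
def testPartial (φ : testField) (s : Finset Mode) : testField :=
  ∑ n ∈ s, coef (testToH φ) n • modeField n

lemma tendsto_testPartial (φ : testField) :
    Filter.Tendsto (fun s => testToH (testPartial φ s)) Filter.atTop (nhds (testToH φ)) := by
  have := hasSum_coef_smul (testToH φ)
  simpa only [HasSum, SummationFilter.unconditional_filter, testPartial, map_sum, map_smul]
    using this

lemma stokes_testPartial (φ : testField) (s : Finset Mode) :
    stokes (testPartial φ s) = testPartial (stokes φ) s := by
  simp only [testPartial, map_sum, map_smul, stokes_modeField, coef_stokes, smul_smul, mul_comm]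

lemma tendsto_grad_testPartial (φ : testField) :
    Filter.Tendsto (fun s => testGradToL2 (testPartial φ s)) Filter.atTop
      (nhds (testGradToL2 φ)) := by
  rw [tendsto_iff_norm_sub_tendsto_zero]
  have h1 : ∀ s, ‖testGradToL2 (testPartial φ s) - testGradToL2 φ‖ ^ 2
      = ⟪testToH (testPartial (stokes φ) s) - testToH (stokes φ),
          testToH (testPartial φ s) - testToH φ⟫ := by
    intro s
    rw [← real_inner_self_eq_norm_sq, ← map_sub, inner_testGradToL2, ← inner_testToH, map_sub,
      map_sub, map_sub, stokes_testPartial]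
  have h2 : Filter.Tendsto (fun s => ‖testGradToL2 (testPartial φ s) - testGradToL2 φ‖ ^ 2)
      Filter.atTop (nhds 0) := by
    simp only [h1]
    have := ((tendsto_testPartial (stokes φ)).sub_const (testToH (stokes φ))).inner (𝕜 := ℝ)
      ((tendsto_testPartial φ).sub_const (testToH φ))
    simpa using this
  have h3 := (Real.continuous_sqrt.tendsto 0).comp h2
  simpa [Function.comp_def, Real.sqrt_sq (norm_nonneg _)] using h3

/-- The closure in `L²` of the gradients of test fields. -/
def GradSub : Submodule ℝ L2Grad := (LinearMap.range testGradToL2).topologicalClosure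

instance : CompleteSpace GradSub :=
  (Submodule.isClosed_topologicalClosure _).completeSpace_coe

/-- The normalized gradient of a mode. -/
def gradMode (n : Mode) : GradSub :=
  (Real.sqrt (lam n))⁻¹ • ⟨testGradToL2 (modeField n),
    Submodule.le_topologicalClosure _ ⟨_, rfl⟩⟩

lemma coe_gradMode (n : Mode) :
    (gradMode n : L2Grad) = (Real.sqrt (lam n))⁻¹ • testGradToL2 (modeField n) := rfl

lemma orthonormal_gradMode : Orthonormal ℝ gradMode := by
  classical
  rw [orthonormal_iff_ite]
  intro m n
  rw [Submodule.coe_inner, coe_gradMode, coe_gradMode, inner_smul_left, inner_smul_right,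
    inner_testGradToL2, stokes_modeField, map_smul, inner_smul_left, ← inner_testToH,
    orthonormal_iff_ite.1 orthonormal_mode m n]
  simp only [RCLike.conj_to_real]
  by_cases h : m = n
  · subst h
    have hs : Real.sqrt (lam m) * Real.sqrt (lam m) = lam m := Real.mul_self_sqrt (lam_pos m).le
    have hp : Real.sqrt (lam m) ≠ 0 := (Real.sqrt_pos.2 (lam_pos m)).ne'
    simp only [if_true, mul_one]
    nth_rewrite 3 [← hs]
    field_simp
  · simp [h]

/-- The normalized gradients of the modes as a Hilbert basis. -/
def gradBasis : HilbertBasis Mode ℝ GradSub :=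
  HilbertBasis.mkOfOrthogonalEqBot orthonormal_gradMode (by
    rw [Submodule.eq_bot_iff]
    intro G hG
    have h0 : ∀ n, ⟪testGradToL2 (modeField n), (G : L2Grad)⟫ = 0 := by
      intro n
      have h := hG (gradMode n) (Submodule.subset_span ⟨n, rfl⟩)
      rw [Submodule.coe_inner, coe_gradMode, inner_smul_left] at h
      exact (mul_eq_zero.1 h).resolve_left
        (by simpa using (Real.sqrt_pos.2 (lam_pos n)).ne')
    have h1 : ∀ φ, ⟪testGradToL2 φ, (G : L2Grad)⟫ = 0 := by
      intro φ
      refine tendsto_nhds_unique ((tendsto_grad_testPartial φ).inner (𝕜 := ℝ) tendsto_const_nhds)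
        (Filter.Tendsto.congr (fun s => ?_) tendsto_const_nhds)
      simp [testPartial, sum_inner, inner_smul_left, h0]
    have h2 : ⟪(G : L2Grad), (G : L2Grad)⟫ = 0 := by
      have hc : IsClosed {u : L2Grad | ⟪u, (G : L2Grad)⟫ = 0} :=
        isClosed_eq (by fun_prop) continuous_const
      refine closure_minimal (s := (LinearMap.range testGradToL2 : Set L2Grad)) ?_ hc G.2
      rintro _ ⟨φ, rfl⟩
      exact h1 φ
    ext1
    exact inner_self_eq_zero.1 h2)

lemma gradBasis_apply (n : Mode) : gradBasis n = gradMode n := by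
  rw [gradBasis, HilbertBasis.coe_mkOfOrthogonalEqBot]

/-- The field of an element of `V`, as an element of `H`. -/
lemma fst_mem_HSub (p : V) : p.1.1 ∈ HSub := by
  have hc : IsClosed {q : L2Vec × L2Grad | q.1 ∈ HSub} :=
    (Submodule.isClosed_topologicalClosure _).preimage continuous_fst
  refine closure_minimal
    (s := (LinearMap.range (testToL2.prod testGradToL2) : Set (L2Vec × L2Grad))) ?_ hc p.2
  rintro _ ⟨φ, rfl⟩
  exact (testToH φ).2

lemma snd_mem_GradSub (p : V) : p.1.2 ∈ GradSub := by
  have hc : IsClosed {q : L2Vec × L2Grad | q.2 ∈ GradSub} :=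
    (Submodule.isClosed_topologicalClosure _).preimage continuous_snd
  refine closure_minimal
    (s := (LinearMap.range (testToL2.prod testGradToL2) : Set (L2Vec × L2Grad))) ?_ hc p.2
  rintro _ ⟨φ, rfl⟩
  exact Submodule.le_topologicalClosure _ ⟨φ, rfl⟩

/-- The inclusion of `V` in `H`. -/
def vToH : V →L[ℝ] H :=
  ((ContinuousLinearMap.fst ℝ L2Vec L2Grad).comp V.subtypeL).codRestrict HSub fst_mem_HSub

lemma coe_vToH (p : V) : (vToH p : L2Vec) = p.1.1 := rfl

/-- The gradient as a map on `V`. -/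
def vGrad : V →L[ℝ] L2Grad := (ContinuousLinearMap.snd ℝ L2Vec L2Grad).comp V.subtypeL

lemma vGrad_apply (p : V) : vGrad p = p.1.2 := rfl

/-- A test field as an element of `V`. -/
def testToV (φ : testField) : V :=
  ⟨(testToL2 φ, testGradToL2 φ), Submodule.le_topologicalClosure _ ⟨φ, rfl⟩⟩

lemma vToH_testToV (φ : testField) : vToH (testToV φ) = testToH φ := rfl

lemma vGrad_testToV (φ : testField) : vGrad (testToV φ) = testGradToL2 φ := rfl

lemma dense_testToV : DenseRange testToV := by
  intro p
  rw [mem_closure_iff_seq_limit]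
  have hp : (p : L2Vec × L2Grad) ∈
    closure (LinearMap.range (testToL2.prod testGradToL2) : Set (L2Vec × L2Grad)) := p.2
  obtain ⟨x, hx, hx'⟩ := mem_closure_iff_seq_limit.1 hp
  choose φ hφ using hx
  refine ⟨fun n => testToV (φ n), fun n => ⟨_, rfl⟩, tendsto_subtype_rng.2 ?_⟩
  convert hx' using 2 with n
  exact hφ n

lemma inner_vGrad_mode (p : V) (n : Mode) :
    ⟪vGrad p, testGradToL2 (modeField n)⟫ = lam n * coef (vToH p) n := by
  refine congrFun (DenseRange.equalizer (g := fun p : V => ⟪vGrad p, testGradToL2 (modeField n)⟫)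
    (h := fun p => lam n * coef (vToH p) n) dense_testToV (by fun_prop)
    (continuous_const.mul ((continuous_coef n).comp vToH.continuous)) ?_) p
  funext φ
  simp only [Function.comp_apply, vGrad_testToV, vToH_testToV]
  rw [inner_testGradToL2, ← inner_testToH, ← coef_stokes]
  rfl

lemma gradBasis_repr (p : V) (n : Mode) :
    ⟪(⟨vGrad p, snd_mem_GradSub p⟩ : GradSub), gradBasis n⟫
      = Real.sqrt (lam n) * coef (vToH p) n := by
  rw [gradBasis_apply, Submodule.coe_inner, coe_gradMode, inner_smul_right, inner_vGrad_mode]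
  have hs : Real.sqrt (lam n) * Real.sqrt (lam n) = lam n := Real.mul_self_sqrt (lam_pos n).le
  have hp : Real.sqrt (lam n) ≠ 0 := (Real.sqrt_pos.2 (lam_pos n)).ne'
  nth_rewrite 2 [← hs]
  field_simp

lemma hasSum_inner_vGrad (p q : V) :
    HasSum (fun n => lam n * coef (vToH p) n * coef (vToH q) n) ⟪vGrad p, vGrad q⟫ := by
  have h := gradBasis.hasSum_inner_mul_inner ⟨vGrad p, snd_mem_GradSub p⟩
    ⟨vGrad q, snd_mem_GradSub q⟩
  rw [Submodule.coe_inner] at h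
  refine h.congr_fun ?_
  intro n
  rw [gradBasis_repr, real_inner_comm, gradBasis_repr]
  nth_rewrite 1 [← Real.mul_self_sqrt (lam_pos n).le]
  ring

lemma hasSum_norm_vGrad_sq (p : V) :
    HasSum (fun n => lam n * coef (vToH p) n ^ 2) (‖vGrad p‖ ^ 2) := by
  rw [← real_inner_self_eq_norm_sq]
  simpa only [pow_two, mul_assoc] using hasSum_inner_vGrad p p

lemma ext_vCoef {p q : V} (h : ∀ n, coef (vToH p) n = coef (vToH q) n) : p = q := by
  have h1 : vToH p = vToH q := ext_coef h
  have h2 : ‖vGrad (p - q)‖ ^ 2 = 0 := by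
    refine (hasSum_norm_vGrad_sq (p - q)).unique ?_
    simp [map_sub, h1, coef_zero]
  have h3 : vGrad p = vGrad q := by
    rw [← sub_eq_zero, ← map_sub]
    simpa using h2
  ext1
  exact Prod.ext (congrArg (Subtype.val : H → L2Vec) h1) h3

/-- Coefficients with `∑ λ c² < ∞` are those of an element of `V`. -/
lemma exists_vCoef_eq {c : Mode → ℝ} (hc : Summable fun n => lam n * c n ^ 2) :
    ∃ p : V, ∀ n, coef (vToH p) n = c n := by
  have hc1 : Summable fun n => c n ^ 2 :=
    hc.of_nonneg_of_le (fun n => sq_nonneg _) fun n =>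
      le_mul_of_one_le_left (sq_nonneg _) (one_le_lam n)
  obtain ⟨h, hh⟩ := exists_coef_eq hc1
  have hm : Memℓp (fun n => Real.sqrt (lam n) * c n) 2 := by
    rw [memℓp_gen_iff (by norm_num)]
    simpa [mul_pow, Real.sq_sqrt (lam_pos _).le, abs_mul] using hc
  set G := gradBasis.repr.symm ⟨_, hm⟩ with hG
  have h1 : HasSum (fun n => c n • testToL2 (modeField n)) (h : L2Vec) := by
    have := (hasSum_coef_smul h).mapL (HSub.subtypeL)
    simpa [hh, coe_testToH] using this
  have h2 : HasSum (fun n => c n • testGradToL2 (modeField n)) (G : L2Grad) := by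
    have := (gradBasis.hasSum_repr G).mapL (GradSub.subtypeL)
    refine (this.congr_fun fun n => ?_)
    rw [hG, LinearIsometryEquiv.apply_symm_apply, gradBasis_apply]
    simp only [map_smul, Submodule.subtypeL_apply, coe_gradMode, smul_smul]
    congr 1
    have hp : Real.sqrt (lam n) ≠ 0 := (Real.sqrt_pos.2 (lam_pos n)).ne'
    field_simp
  have h3 := h1.prodMk h2
  have h4 : ((h : L2Vec), (G : L2Grad)) ∈ V := by
    refine (Submodule.isClosed_topologicalClosure _).mem_of_tendsto h3
      (Filter.Eventually.of_forall fun s => ?_)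
    refine Submodule.sum_mem _ fun n _ => ?_
    exact Submodule.smul_mem _ (c n) (testToV (modeField n)).2
  exact ⟨⟨_, h4⟩, fun n => hh n⟩

/-! ### The Ladyzhenskaya inequality on the torus -/

lemma eLpNorm_pow_eq_lintegral {α E : Type*} [MeasurableSpace α] {μ : Measure α}
    [NormedAddCommGroup E] (f : α → E) {n : ℕ} (hn : n ≠ 0) :
    eLpNorm f n μ ^ n = ∫⁻ x, ‖f x‖ₑ ^ n ∂μ := by
  have h := eLpNorm_nnreal_pow_eq_lintegral (f := f) (μ := μ) (p := (n : ℝ≥0))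
    (by exact_mod_cast hn)
  simpa only [NNReal.coe_natCast, ENNReal.rpow_natCast, ENNReal.coe_natCast] using h

lemma lintegral_mul_sq_le {α : Type*} [MeasurableSpace α] {μ : Measure α} {f g : α → ℝ≥0∞}
    (hf : AEMeasurable f μ) (hg : AEMeasurable g μ) :
    (∫⁻ x, f x * g x ∂μ) ^ 2 ≤ (∫⁻ x, f x ^ 2 ∂μ) * ∫⁻ x, g x ^ 2 ∂μ := by
  have h := ENNReal.lintegral_mul_le_Lp_mul_Lq μ Real.HolderConjugate.two_two hf hg
  simp only [ENNReal.rpow_two, Pi.mul_apply] at h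
  calc _ ≤ ((∫⁻ x, f x ^ 2 ∂μ) ^ (1 / 2 : ℝ) * (∫⁻ x, g x ^ 2 ∂μ) ^ (1 / 2 : ℝ)) ^ 2 := by gcongr
    _ = _ := by
      rw [mul_pow, ← ENNReal.rpow_natCast, ← ENNReal.rpow_natCast, ← ENNReal.rpow_mul,
        ← ENNReal.rpow_mul]
      norm_num

/-- Interpolation of `L⁴` between `L²` and `L⁶`. -/
lemma eLpNorm_four_pow_le {α E : Type*} [MeasurableSpace α] {μ : Measure α}
    [NormedAddCommGroup E] {f : α → E} (hf : AEStronglyMeasurable f μ) :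
    eLpNorm f 4 μ ^ 8 ≤ eLpNorm f 2 μ ^ 2 * eLpNorm f 6 μ ^ 6 := by
  have h4 := eLpNorm_pow_eq_lintegral (μ := μ) f (n := 4) (by norm_num)
  have h2 := eLpNorm_pow_eq_lintegral (μ := μ) f (n := 2) (by norm_num)
  have h6 := eLpNorm_pow_eq_lintegral (μ := μ) f (n := 6) (by norm_num)
  push_cast at h4 h2 h6
  rw [show 8 = 4 * 2 from rfl, pow_mul, h4, h2, h6]
  have := lintegral_mul_sq_le (μ := μ) hf.enorm (hf.enorm.pow_const 3)
  simpa only [← pow_mul, ← pow_succ', Nat.reduceAdd, Nat.reduceMul] using this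

/-- The translates of the periodicity cell that cover the neighbouring cells. -/
lemma lintegral_closedBall_le {g : Space → ℝ≥0∞} (hg : Measurable g)
    (hp : ∀ x i, g (x + Pi.single i (2 * Real.pi)) = g x) :
    ∫⁻ x in Metric.closedBall (fun _ => Real.pi) (3 * Real.pi), g x
      ≤ 27 * ∫⁻ x, g x ∂cellMeasure := by
  have hpi := Real.pi_pos
  set a : (Fin 3 → Fin 3) → Space := fun j i => 2 * Real.pi * ((j i : ℝ) - 1) with ha
  have hsub : Metric.closedBall (fun _ : Fin 3 => Real.pi) (3 * Real.pi)
      ⊆ ⋃ j, (fun x => x - a j) ⁻¹' cell := by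
    intro x hx
    rw [closedBall_pi _ (by positivity)] at hx
    have hx' : ∀ i, ∃ m : Fin 3, x i - 2 * Real.pi * ((m : ℝ) - 1) ∈ Set.Icc 0 (2 * Real.pi) := by
      intro i
      have := hx i (Set.mem_univ i)
      rw [Real.closedBall_eq_Icc] at this
      obtain ⟨h1, h2⟩ := this
      rcases le_or_gt (x i) 0 with h | h
      · exact ⟨0, by simp; constructor <;> linarith⟩
      rcases le_or_gt (x i) (2 * Real.pi) with h' | h'
      · exact ⟨1, by simp; constructor <;> linarith⟩
      · exact ⟨2, by norm_num; constructor <;> linarith⟩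
    choose j hj using hx'
    refine Set.mem_iUnion.2 ⟨j, ?_⟩
    exact ⟨fun i => (hj i).1, fun i => (hj i).2⟩
  have hperZ : ∀ (i : Fin 3) x, g (x - Pi.single i (2 * Real.pi)) = g x := fun i x => by
    rw [← hp _ i, sub_add_cancel]
  have hshift1 : ∀ (i : Fin 3) (m : Fin 3) x,
      g (x + Pi.single i (2 * Real.pi * ((m : ℝ) - 1))) = g x := by
    intro i m x
    fin_cases m
    · simpa [Pi.single_neg, ← sub_eq_add_neg] using hperZ i x
    · simp
    · have : (2 * Real.pi * ((2 : ℝ) - 1)) = 2 * Real.pi := by norm_num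
      simpa [this] using hp x i
  have hshift : ∀ j x, g (x + a j) = g x := by
    intro j x
    have : a j = Pi.single 0 (2 * Real.pi * ((j 0 : ℝ) - 1))
        + Pi.single 1 (2 * Real.pi * ((j 1 : ℝ) - 1))
        + Pi.single 2 (2 * Real.pi * ((j 2 : ℝ) - 1)) := by
      funext i
      fin_cases i <;> simp [a]
    rw [this, ← add_assoc, ← add_assoc, hshift1, hshift1, hshift1]
  have hcell : ∀ j, ∫⁻ x in (fun x => x - a j) ⁻¹' cell, g x = ∫⁻ x, g x ∂cellMeasure := by
    intro j
    have hm := (measurePreserving_sub_right (volume : Measure Space) (a j)).setLIntegral_comp_preimage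
      (s := cell) measurableSet_Icc (f := fun x => g (x + a j))
      (hg.comp (measurable_add_const _))
    simp only [sub_add_cancel] at hm
    rw [hm, cellMeasure]
    simp only [hshift]
  calc _ ≤ ∫⁻ x in ⋃ j, (fun x => x - a j) ⁻¹' cell, g x := lintegral_mono_set hsub
    _ ≤ ∑' j, ∫⁻ x in (fun x => x - a j) ⁻¹' cell, g x := lintegral_iUnion_le _ _
    _ = 27 * ∫⁻ x, g x ∂cellMeasure := by
      simp [hcell, tsum_fintype]

lemma norm_fderiv_le_grad (φ : testField) (x : Space) :
    ‖fderiv ℝ (φ : Space → Vec) x‖ ≤ 3 * ‖grad φ x‖ := by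
  have h1 : ∀ i, ‖pderiv i φ x‖ ≤ ‖grad φ x‖ := by
    intro i
    rw [← sq_le_sq₀ (norm_nonneg _) (norm_nonneg _), EuclideanSpace.norm_sq_eq,
      EuclideanSpace.norm_sq_eq, Fintype.sum_prod_type]
    exact Finset.single_le_sum (f := fun i => ∑ j, ‖grad φ x (i, j)‖ ^ 2)
      (fun j _ => Finset.sum_nonneg fun _ _ => sq_nonneg _) (Finset.mem_univ i)
  refine ContinuousLinearMap.opNorm_le_bound _ (by positivity) fun y => ?_
  have hy : y = ∑ i, y i • Pi.single (M := fun _ : Fin 3 => ℝ) i (1 : ℝ) := by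
    funext k; simp [Finset.sum_apply, Pi.single_apply]
  conv_lhs => rw [hy, map_sum]
  calc _ ≤ ∑ i, ‖fderiv ℝ (φ : Space → Vec) x (y i • Pi.single i 1)‖ := norm_sum_le _ _
    _ ≤ ∑ _i : Fin 3, ‖y‖ * ‖grad φ x‖ := by
      refine Finset.sum_le_sum fun i _ => ?_
      rw [map_smul, norm_smul]
      exact mul_le_mul (norm_le_pi_norm y i) (h1 i) (norm_nonneg _) (norm_nonneg _)
    _ = _ := by simp; ring

/-- A smooth cutoff that is `1` on the periodicity cell. -/
def cutoff : ContDiffBump (fun _ : Fin 3 => Real.pi) :=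
  ⟨Real.pi, 3 * Real.pi, Real.pi_pos, by linarith [Real.pi_pos]⟩

lemma cell_eq_closedBall : cell = Metric.closedBall (fun _ : Fin 3 => Real.pi) Real.pi := by
  rw [closedBall_pi _ Real.pi_pos.le, cell, ← Set.pi_univ_Icc]
  refine Set.pi_congr rfl fun i _ => ?_
  rw [Real.closedBall_eq_Icc]
  congr 1 <;> ring

lemma norm_le_norm_grad (φ : testField) : ‖testToL2 φ‖ ≤ ‖testGradToL2 φ‖ := by
  have h1 := hasSum_coef_sq (testToH φ)
  have h2 := hasSum_norm_vGrad_sq (testToV φ)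
  have := hasSum_le (fun n => le_mul_of_one_le_left (sq_nonneg _) (one_le_lam n)) h1 h2
  exact (sq_le_sq₀ (norm_nonneg _) (norm_nonneg _)).1 this

/-- The Sobolev embedding of `V` in `L⁶` on test fields. -/
lemma exists_eLpNorm_six_le : ∃ K : ℝ≥0, ∀ φ : testField,
    eLpNorm (φ : Space → Vec) 6 cellMeasure ≤ K * ‖testGradToL2 φ‖ₑ := by
  have hχ : ContDiff ℝ (⊤ : ℕ∞) (cutoff : Space → ℝ) := cutoff.contDiff
  obtain ⟨D, hD⟩ : ∃ D : ℝ, ∀ x, ‖fderiv ℝ (cutoff : Space → ℝ) x‖ ≤ D := by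
    obtain ⟨D, hD⟩ := (cutoff.hasCompactSupport.fderiv (𝕜 := ℝ)).exists_bound_of_continuous
      (hχ.continuous_fderiv (by simp))
    exact ⟨D, hD⟩
  have hD0 : 0 ≤ D := (norm_nonneg _).trans (hD 0)
  set B : Set Space := Metric.closedBall (fun _ => Real.pi) (3 * Real.pi) with hB
  set S : ℝ≥0 := SNormLESNormFDerivOfEqConst Vec (volume : Measure Space) (2 : ℝ≥0) with hS
  refine ⟨S * (27 * (3 + D.toNNReal)), fun φ => ?_⟩
  set u : Space → Vec := fun x => cutoff x • (φ : Space → Vec) x with hu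
  have hud : ContDiff ℝ 1 u := (hχ.smul φ.2.1).of_le (by exact_mod_cast le_top)
  have husupp : HasCompactSupport u := cutoff.hasCompactSupport.smul_right
  have hGNS := eLpNorm_le_eLpNorm_fderiv_of_eq (F := Vec) (volume : Measure Space) (u := u) hud
    husupp (p := 2) (p' := 6) (by norm_num) (by simp) (by simp; norm_num)
  have h1 : eLpNorm (φ : Space → Vec) 6 cellMeasure ≤ eLpNorm u 6 volume := by
    have : eLpNorm (φ : Space → Vec) 6 cellMeasure = eLpNorm u 6 cellMeasure := by
      refine eLpNorm_congr_ae ?_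
      refine (ae_restrict_mem measurableSet_Icc).mono fun x hx => ?_
      have hx' : x ∈ Metric.closedBall (fun _ : Fin 3 => Real.pi) cutoff.rIn := by
        change x ∈ Metric.closedBall (fun _ : Fin 3 => Real.pi) Real.pi
        rw [← cell_eq_closedBall]; exact hx
      simp [hu, cutoff.one_of_mem_closedBall hx']
    rw [this]
    exact eLpNorm_restrict_le _ _ _ _
  have hper : ∀ {E : Type} [NormedAddCommGroup E] (f : Space → E), Continuous f →
      (∀ x i, f (x + Pi.single i (2 * Real.pi)) = f x) →
      eLpNorm f 2 (volume.restrict B) ≤ 27 * eLpNorm f 2 cellMeasure := by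
    intro E _ f hf hfp
    have h := lintegral_closedBall_le (g := fun x => ‖f x‖ₑ ^ 2)
      (hf.enorm.measurable.pow_const 2) (fun x i => by simp only [hfp])
    have e1 := eLpNorm_pow_eq_lintegral (μ := volume.restrict B) f (n := 2) (by norm_num)
    have e2 := eLpNorm_pow_eq_lintegral (μ := cellMeasure) f (n := 2) (by norm_num)
    push_cast at e1 e2
    rw [← e1, ← e2] at h
    have h' : eLpNorm f 2 (volume.restrict B) ^ 2 ≤ (27 * eLpNorm f 2 cellMeasure) ^ 2 := by
      refine h.trans ?_
      rw [mul_pow]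
      gcongr
      norm_num
    exact (ENNReal.pow_le_pow_left_iff two_ne_zero).1 h'
  have hfd : ∀ x, fderiv ℝ u x = cutoff x • fderiv ℝ (φ : Space → Vec) x
      + (fderiv ℝ (cutoff : Space → ℝ) x).smulRight ((φ : Space → Vec) x) := by
    intro x
    exact fderiv_fun_smul (hχ.differentiable (by simp) x) (φ.2.1.differentiable (by simp) x)
  have h2 : eLpNorm (fderiv ℝ u) 2 volume
      ≤ eLpNorm (fun x => 3 * ‖grad φ x‖ + D * ‖(φ : Space → Vec) x‖) 2 (volume.restrict B) := by
    have hsupp : ∀ x, x ∉ B → fderiv ℝ u x = 0 := by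
      intro x hx
      by_contra hne
      apply hx
      have h3 := support_fderiv_subset ℝ (f := u) hne
      have h4 : tsupport u ⊆ tsupport (cutoff : Space → ℝ) :=
        closure_mono fun y hy h0 => hy (by simp [hu, h0])
      have := h4 h3
      rwa [cutoff.tsupport_eq] at this
    have h3 : eLpNorm (fderiv ℝ u) 2 volume = eLpNorm (fderiv ℝ u) 2 (volume.restrict B) := by
      have hBm : MeasurableSet B := Metric.isClosed_closedBall.measurableSet
      refine Eq.trans ?_ (eLpNorm_indicator_eq_eLpNorm_restrict (f := fderiv ℝ u) hBm)
      congr 1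
      funext x
      by_cases hx : x ∈ B
      · rw [Set.indicator_of_mem hx]
      · rw [Set.indicator_of_notMem hx, hsupp x hx]
    rw [h3]
    refine eLpNorm_mono_real fun x => ?_
    rw [hfd]
    refine (norm_add_le _ _).trans (add_le_add ?_ ?_)
    · rw [norm_smul, Real.norm_of_nonneg cutoff.nonneg]
      exact (mul_le_of_le_one_left (norm_nonneg _) cutoff.le_one).trans (norm_fderiv_le_grad φ x)
    · rw [ContinuousLinearMap.norm_smulRight_apply]
      exact mul_le_mul_of_nonneg_right (hD x) (norm_nonneg _)
  have hgc := continuous_grad φ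
  have hφc := φ.2.1.continuous
  have hgp : ∀ x i, grad φ (x + Pi.single i (2 * Real.pi)) = grad φ x := fun x i => by
    simp only [grad, pderiv_periodic φ.2.2.1]
  have e1 : ‖testGradToL2 φ‖ₑ = eLpNorm (grad φ) 2 cellMeasure := by
    rw [Lp.enorm_def]; exact eLpNorm_congr_ae (coeFn_testGradToL2 φ)
  have e2 : ‖testToL2 φ‖ₑ = eLpNorm (φ : Space → Vec) 2 cellMeasure := by
    rw [Lp.enorm_def]; exact eLpNorm_congr_ae (coeFn_testToL2 φ)
  have e3 : ‖testToL2 φ‖ₑ ≤ ‖testGradToL2 φ‖ₑ :=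
    enorm_le_iff_norm_le.2 (norm_le_norm_grad φ)
  have h3 : eLpNorm (fun x => 3 * ‖grad φ x‖ + D * ‖(φ : Space → Vec) x‖) 2 (volume.restrict B)
      ≤ 27 * (3 + D.toNNReal) * ‖testGradToL2 φ‖ₑ := by
    calc _ ≤ eLpNorm (fun x => (3 : ℝ) • ‖grad φ x‖) 2 (volume.restrict B)
          + eLpNorm (fun x => D • ‖(φ : Space → Vec) x‖) 2 (volume.restrict B) :=
          eLpNorm_add_le (by fun_prop) (by fun_prop) (by norm_num)
      _ ≤ 3 * (27 * ‖testGradToL2 φ‖ₑ) + D.toNNReal * (27 * ‖testGradToL2 φ‖ₑ) := by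
          refine add_le_add ?_ ?_
          · refine (eLpNorm_const_smul_le (c := (3 : ℝ)) (f := fun x => ‖grad φ x‖)).trans ?_
            rw [eLpNorm_norm, e1]
            refine mul_le_mul' (le_of_eq ?_) (hper _ hgc hgp)
            rw [Real.enorm_of_nonneg (by norm_num)]; norm_num
          · refine (eLpNorm_const_smul_le (c := D) (f := fun x => ‖(φ : Space → Vec) x‖)).trans ?_
            rw [eLpNorm_norm]
            refine mul_le_mul' (le_of_eq ?_) ((hper _ hφc φ.2.2.1).trans ?_)
            · rw [Real.enorm_of_nonneg hD0]; rfl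
            · rw [← e2]; gcongr
      _ = _ := by ring
  calc _ ≤ eLpNorm u 6 volume := h1
    _ ≤ S * eLpNorm (fderiv ℝ u) 2 volume := by simpa [hS] using hGNS
    _ ≤ S * (27 * (3 + D.toNNReal) * ‖testGradToL2 φ‖ₑ) := by gcongr; exact h2.trans h3
    _ = _ := by push_cast; ring

/-- The `L⁴` norm is lower semicontinuous on `L²`. -/
lemma lowerSemicontinuous_eLpNorm_four :
    LowerSemicontinuous fun h : L2Vec => eLpNorm h 4 cellMeasure := by
  rw [lowerSemicontinuous_iff_isClosed_preimage]
  intro c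
  refine IsSeqClosed.isClosed fun u h hu hlim => ?_
  obtain ⟨ns, hns, hae⟩ := (tendstoInMeasure_of_tendsto_Lp hlim).exists_seq_tendsto_ae
  refine (Lp.eLpNorm_lim_le_liminf_eLpNorm (fun n => Lp.aestronglyMeasurable _) _ hae).trans ?_
  refine Filter.liminf_le_of_frequently_le' (Filter.Frequently.of_forall fun n => ?_)
  exact hu (ns n)

/-- The Ladyzhenskaya inequality on `V`. -/
lemma exists_eLpNorm_four_le : ∃ K : ℝ≥0, ∀ p : V,
    eLpNorm p.1.1 4 cellMeasure ^ 8 ≤ K * (‖p.1.1‖ₑ ^ 2 * ‖p.1.2‖ₑ ^ 6) := by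
  obtain ⟨K, hK⟩ := exists_eLpNorm_six_le
  refine ⟨K ^ 6, fun p => ?_⟩
  have htest : ∀ φ : testField, eLpNorm (testToV φ).1.1 4 cellMeasure ^ 8
      ≤ K ^ 6 * (‖(testToV φ).1.1‖ₑ ^ 2 * ‖(testToV φ).1.2‖ₑ ^ 6) := by
    intro φ
    refine (eLpNorm_four_pow_le (Lp.aestronglyMeasurable _)).trans ?_
    have h2 : eLpNorm (testToV φ).1.1 2 cellMeasure = ‖(testToV φ).1.1‖ₑ := (Lp.enorm_def _).symm
    have h6 : eLpNorm (testToV φ).1.1 6 cellMeasure ≤ K * ‖(testToV φ).1.2‖ₑ := by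
      refine le_trans (le_of_eq ?_) (hK φ)
      exact eLpNorm_congr_ae (coeFn_testToL2 φ)
    rw [h2]
    calc _ ≤ ‖(testToV φ).1.1‖ₑ ^ 2 * (K * ‖(testToV φ).1.2‖ₑ) ^ 6 := by gcongr
      _ = _ := by ring
  obtain ⟨q, hq, hlim⟩ := mem_closure_iff_seq_limit.1 (dense_testToV p)
  have h1 : Filter.Tendsto (fun n => (q n).1.1) Filter.atTop (nhds p.1.1) :=
    (continuous_fst.comp continuous_subtype_val).continuousAt.tendsto.comp hlim
  have h2 : Filter.Tendsto (fun n => (q n).1.2) Filter.atTop (nhds p.1.2) :=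
    (continuous_snd.comp continuous_subtype_val).continuousAt.tendsto.comp hlim
  have hrhs : Filter.Tendsto (fun n => (K : ℝ≥0∞) ^ 6 * (‖(q n).1.1‖ₑ ^ 2 * ‖(q n).1.2‖ₑ ^ 6))
      Filter.atTop (nhds ((K : ℝ≥0∞) ^ 6 * (‖p.1.1‖ₑ ^ 2 * ‖p.1.2‖ₑ ^ 6))) := by
    refine ENNReal.Tendsto.const_mul (ENNReal.Tendsto.mul ?_ (Or.inr ?_) ?_ (Or.inr ?_))
      (Or.inr (by simp))
    · exact ENNReal.Tendsto.pow h1.enorm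
    · simp
    · exact ENNReal.Tendsto.pow h2.enorm
    · simp
  push_cast
  refine le_of_forall_lt fun c hc => ?_
  have hlsc : LowerSemicontinuous fun h : L2Vec => eLpNorm h 4 cellMeasure ^ 8 :=
    (ENNReal.continuous_pow 8).comp_lowerSemicontinuous lowerSemicontinuous_eLpNorm_four
      (fun a b hab => pow_le_pow_left' hab 8)
  obtain ⟨d, hcd, hd⟩ := exists_between hc
  refine hcd.trans_le (ge_of_tendsto hrhs ?_)
  filter_upwards [h1.eventually (hlsc p.1.1 d hd)] with n hn
  obtain ⟨φ, hφ⟩ := hq n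
  rw [← hφ] at hn ⊢
  exact hn.le.trans (htest φ)

/-! ### The trilinear form -/

/-- The integrand `∑ uᵢ Gᵢⱼ wⱼ` of the trilinear form. -/
def tripleFun (u : L2Vec) (G : L2Grad) (w : L2Vec) (x : Space) : ℝ :=
  ∑ i, ∑ j, u x i * G x (i, j) * w x j

/-- The trilinear form `∫ ∑ uᵢ Gᵢⱼ wⱼ dx`, where `G` stands for a gradient. -/
def triple (u : L2Vec) (G : L2Grad) (w : L2Vec) : ℝ := ∫ x, tripleFun u G w x ∂cellMeasure

lemma aestronglyMeasurable_tripleFun (u : L2Vec) (G : L2Grad) (w : L2Vec) :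
    AEStronglyMeasurable (tripleFun u G w) cellMeasure := by
  refine Finset.aestronglyMeasurable_fun_sum _ fun i _ =>
    Finset.aestronglyMeasurable_fun_sum _ fun j _ => ?_
  have hv : ∀ (u : L2Vec) (i : Fin 3), AEStronglyMeasurable (fun x => u x i) cellMeasure :=
    fun u i => (EuclideanSpace.proj i : Vec →L[ℝ] ℝ).continuous.comp_aestronglyMeasurable
      (Lp.aestronglyMeasurable u)
  have hG : AEStronglyMeasurable (fun x => G x (i, j)) cellMeasure :=
    (EuclideanSpace.proj (i, j) : Grad →L[ℝ] ℝ).continuous.comp_aestronglyMeasurable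
      (Lp.aestronglyMeasurable G)
  exact ((hv u i).mul hG).mul (hv w j)

/-- The pointwise estimate `|∑ uᵢ Gᵢⱼ wⱼ| ≤ |u| |G| |w|`. -/
lemma abs_sum_le (u w : Vec) (G : Grad) :
    |∑ i, ∑ j, u i * G (i, j) * w j| ≤ ‖u‖ * ‖G‖ * ‖w‖ := by
  have h1 : ∑ i, ∑ j, u i * G (i, j) * w j
      = ∑ q : Fin 3 × Fin 3, G q * (u q.1 * w q.2) := by
    rw [Fintype.sum_prod_type]
    exact Finset.sum_congr rfl fun i _ => Finset.sum_congr rfl fun j _ => by ring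
  have h2 : (∑ q : Fin 3 × Fin 3, G q * (u q.1 * w q.2)) ^ 2
      ≤ (∑ q, G q ^ 2) * ∑ q : Fin 3 × Fin 3, (u q.1 * w q.2) ^ 2 :=
    Finset.sum_mul_sq_le_sq_mul_sq _ _ _
  have h3 : ∑ q : Fin 3 × Fin 3, (u q.1 * w q.2) ^ 2 = ‖u‖ ^ 2 * ‖w‖ ^ 2 := by
    rw [Fintype.sum_prod_type, EuclideanSpace.norm_sq_eq, EuclideanSpace.norm_sq_eq,
      Finset.sum_mul_sum]
    simp [mul_pow]
  have h4 : ∑ q, G q ^ 2 = ‖G‖ ^ 2 := by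
    rw [EuclideanSpace.norm_sq_eq]; simp
  rw [h1]
  refine abs_le_of_sq_le_sq (h2.trans (le_of_eq ?_)) (by positivity)
  rw [h3, h4]; ring

lemma enorm_tripleFun_le (u : L2Vec) (G : L2Grad) (w : L2Vec) (x : Space) :
    ‖tripleFun u G w x‖ₑ ≤ ‖u x‖ₑ * ‖w x‖ₑ * ‖G x‖ₑ := by
  rw [← enorm_norm (u x), ← enorm_norm (w x), ← enorm_norm (G x), ← enorm_mul, ← enorm_mul]
  refine enorm_le_iff_norm_le.2 ?_
  rw [Real.norm_eq_abs, Real.norm_of_nonneg (by positivity)]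
  exact (abs_sum_le _ _ _).trans (le_of_eq (by ring))

/-- Hölder's inequality for the trilinear form. -/
lemma lintegral_tripleFun_le (u : L2Vec) (G : L2Grad) (w : L2Vec) :
    ∫⁻ x, ‖tripleFun u G w x‖ₑ ∂cellMeasure
      ≤ eLpNorm u 4 cellMeasure * eLpNorm w 4 cellMeasure * ‖G‖ₑ := by
  have hu := (Lp.aestronglyMeasurable u).enorm
  have hw := (Lp.aestronglyMeasurable w).enorm
  have hG := (Lp.aestronglyMeasurable G).enorm
  have h0 := lintegral_mono (μ := cellMeasure) (enorm_tripleFun_le u G w)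
  have h1 := lintegral_mul_sq_le (μ := cellMeasure) (hu.mul hw) hG
  have h2 := lintegral_mul_sq_le (μ := cellMeasure) (hu.pow_const 2) (hw.pow_const 2)
  have e4 : ∀ u : L2Vec, eLpNorm u 4 cellMeasure ^ 4 = ∫⁻ x, (‖u x‖ₑ ^ 2) ^ 2 ∂cellMeasure := by
    intro u
    have := eLpNorm_pow_eq_lintegral (μ := cellMeasure) u (n := 4) (by norm_num)
    push_cast at this
    simpa only [← pow_mul] using this
  have e2 : ‖G‖ₑ ^ 2 = ∫⁻ x, ‖G x‖ₑ ^ 2 ∂cellMeasure := by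
    have := eLpNorm_pow_eq_lintegral (μ := cellMeasure) G (n := 2) (by norm_num)
    push_cast at this
    rw [← this, Lp.enorm_def]
  simp only [Pi.mul_apply, mul_pow] at h1
  rw [← ENNReal.pow_le_pow_left_iff (n := 4) (by norm_num)]
  calc _ ≤ (∫⁻ x, ‖u x‖ₑ * ‖w x‖ₑ * ‖G x‖ₑ ∂cellMeasure) ^ 4 := by gcongr
    _ = ((∫⁻ x, ‖u x‖ₑ * ‖w x‖ₑ * ‖G x‖ₑ ∂cellMeasure) ^ 2) ^ 2 := by rw [← pow_mul]
    _ ≤ ((∫⁻ x, ‖u x‖ₑ ^ 2 * ‖w x‖ₑ ^ 2 ∂cellMeasure) * ∫⁻ x, ‖G x‖ₑ ^ 2 ∂cellMeasure) ^ 2 := by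
      gcongr
    _ = (∫⁻ x, ‖u x‖ₑ ^ 2 * ‖w x‖ₑ ^ 2 ∂cellMeasure) ^ 2 * ‖G‖ₑ ^ 4 := by
      rw [mul_pow, ← e2, ← pow_mul]
    _ ≤ (eLpNorm u 4 cellMeasure ^ 4 * eLpNorm w 4 cellMeasure ^ 4) * ‖G‖ₑ ^ 4 := by
      rw [e4, e4]; gcongr
    _ = _ := by ring

lemma exists_subseq_ae {E : Type*} [NormedAddCommGroup E] {u : ℕ → Lp E 2 cellMeasure}
    {v : Lp E 2 cellMeasure} (h : Filter.Tendsto u Filter.atTop (nhds v)) :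
    ∃ ns : ℕ → ℕ, StrictMono ns ∧ ∀ᵐ x ∂cellMeasure,
      Filter.Tendsto (fun i => u (ns i) x) Filter.atTop (nhds (v x)) :=
  (tendstoInMeasure_of_tendsto_Lp h).exists_seq_tendsto_ae

section Measurability

variable {X : Type*} [TopologicalSpace X] [SequentialSpace X]
  {a c : X → L2Vec} {G : X → L2Grad}

/-- Bounded truncations of the trilinear form are continuous. -/
lemma continuous_integral_comp_tripleFun (ha : Continuous a) (hG : Continuous G)
    (hc : Continuous c) {τ : ℝ → ℝ} (hτ : Continuous τ) {B : ℝ} (hB : ∀ y, |τ y| ≤ B) :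
    Continuous fun x => ∫ y, τ (tripleFun (a x) (G x) (c x) y) ∂cellMeasure := by
  rw [← continuous_iff_seqContinuous.symm]
  intro u x hu
  refine Filter.tendsto_of_subseq_tendsto fun ns hns => ?_
  have hu' := hu.comp hns
  obtain ⟨m1, hm1, h1⟩ := exists_subseq_ae ((ha.tendsto x).comp hu')
  obtain ⟨m2, hm2, h2⟩ := exists_subseq_ae ((hG.tendsto x).comp (hu'.comp hm1.tendsto_atTop))
  obtain ⟨m3, hm3, h3⟩ := exists_subseq_ae
    ((hc.tendsto x).comp (hu'.comp (hm1.comp hm2).tendsto_atTop))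
  refine ⟨fun i => m1 (m2 (m3 i)), ?_⟩
  refine tendsto_integral_of_dominated_convergence (fun _ => B) (fun n => ?_)
    (integrable_const _) (fun n => Filter.Eventually.of_forall fun y => hB _) ?_
  · exact hτ.comp_aestronglyMeasurable (aestronglyMeasurable_tripleFun _ _ _)
  · filter_upwards [h1, h2, h3] with y h1 h2 h3
    refine (hτ.tendsto _).comp ?_
    refine tendsto_finsetSum _ fun i _ => tendsto_finsetSum _ fun j _ => ?_
    have p1 := ((EuclideanSpace.proj i : Vec →L[ℝ] ℝ).continuous.tendsto _).comp
      (h1.comp (hm2.comp hm3).tendsto_atTop)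
    have p2 := ((EuclideanSpace.proj (i, j) : Grad →L[ℝ] ℝ).continuous.tendsto _).comp
      (h2.comp hm3.tendsto_atTop)
    have p3 := ((EuclideanSpace.proj j : Vec →L[ℝ] ℝ).continuous.tendsto _).comp h3
    exact (p1.mul p2).mul p3

variable [MeasurableSpace X] [OpensMeasurableSpace X]

lemma measurable_lintegral_tripleFun (ha : Continuous a) (hG : Continuous G) (hc : Continuous c) :
    Measurable fun x => ∫⁻ y, ‖tripleFun (a x) (G x) (c x) y‖ₑ ∂cellMeasure := by
  have h : ∀ x, ∫⁻ y, ‖tripleFun (a x) (G x) (c x) y‖ₑ ∂cellMeasure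
      = ⨆ n : ℕ, ENNReal.ofReal
        (∫ y, min |tripleFun (a x) (G x) (c x) y| n ∂cellMeasure) := by
    intro x
    have hm := aestronglyMeasurable_tripleFun (a x) (G x) (c x)
    have h1 : ∀ n : ℕ, ENNReal.ofReal (∫ y, min |tripleFun (a x) (G x) (c x) y| n ∂cellMeasure)
        = ∫⁻ y, min ‖tripleFun (a x) (G x) (c x) y‖ₑ n ∂cellMeasure := by
      intro n
      rw [ofReal_integral_eq_lintegral_ofReal]
      · refine lintegral_congr fun y => ?_
        rw [ENNReal.ofReal_min, ENNReal.ofReal_natCast, Real.enorm_eq_ofReal_abs]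
      · refine Integrable.of_bound (C := n)
          ((continuous_abs.min continuous_const).comp_aestronglyMeasurable hm)
          (Filter.Eventually.of_forall fun y => ?_)
        rw [Real.norm_of_nonneg (by positivity)]
        exact min_le_right _ _
      · exact Filter.Eventually.of_forall fun y => by positivity
    simp only [h1]
    rw [← lintegral_iSup']
    · refine lintegral_congr fun y => ?_
      rw [← inf_iSup_eq, ENNReal.iSup_natCast, inf_top_eq]
    · exact fun n => hm.enorm.min aemeasurable_const
    · exact Filter.Eventually.of_forall fun y m n hmn =>
        min_le_min le_rfl (by exact_mod_cast hmn)
  simp only [h]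
  refine Measurable.iSup fun n => ENNReal.measurable_ofReal.comp ?_
  refine (continuous_integral_comp_tripleFun ha hG hc (τ := fun y => min |y| n)
    (by fun_prop) (B := n) fun y => ?_).measurable
  rw [abs_of_nonneg (by positivity)]
  exact min_le_right _ _

lemma measurable_triple (ha : Continuous a) (hG : Continuous G) (hc : Continuous c) :
    Measurable fun x => triple (a x) (G x) (c x) := by
  set S : Set X := {x | ∫⁻ y, ‖tripleFun (a x) (G x) (c x) y‖ₑ ∂cellMeasure < ⊤} with hS
  have hSm : MeasurableSet S :=
    measurableSet_lt (measurable_lintegral_tripleFun ha hG hc) measurable_const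
  have hlim : ∀ x, Filter.Tendsto (fun n : ℕ => S.indicator (fun x =>
      ∫ y, max (-n : ℝ) (min (tripleFun (a x) (G x) (c x) y) n) ∂cellMeasure) x) Filter.atTop
      (nhds (triple (a x) (G x) (c x))) := by
    intro x
    have hm := aestronglyMeasurable_tripleFun (a x) (G x) (c x)
    by_cases hx : x ∈ S
    · simp only [Set.indicator_of_mem hx]
      refine tendsto_integral_of_dominated_convergence
        (fun y => ‖tripleFun (a x) (G x) (c x) y‖) (fun n => ?_)
        (Integrable.norm ⟨hm, hx⟩) (fun n => Filter.Eventually.of_forall fun y => ?_)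
        (Filter.Eventually.of_forall fun y => ?_)
      · exact (continuous_const.max (continuous_id.min continuous_const)).comp_aestronglyMeasurable
          hm
      · rw [Real.norm_eq_abs, Real.norm_eq_abs]
        have hn : (0 : ℝ) ≤ n := n.cast_nonneg
        have h0 := abs_nonneg (tripleFun (a x) (G x) (c x) y)
        exact abs_le.2 ⟨le_max_of_le_right (le_min (neg_abs_le _) (by linarith)),
          max_le (by linarith) ((min_le_left _ _).trans (le_abs_self _))⟩
      · refine tendsto_const_nhds.congr' ?_
        filter_upwards [Filter.eventually_ge_atTop ⌈|tripleFun (a x) (G x) (c x) y|⌉₊] with n hn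
        have h1 : |tripleFun (a x) (G x) (c x) y| ≤ n :=
          (Nat.le_ceil _).trans (by exact_mod_cast hn)
        have h2 := neg_abs_le (tripleFun (a x) (G x) (c x) y)
        rw [min_eq_left ((le_abs_self _).trans h1), max_eq_right (by linarith)]
    · simp only [Set.indicator_of_notMem hx]
      have : triple (a x) (G x) (c x) = 0 := by
        refine integral_undef fun hi => hx ?_
        exact hi.2
      rw [this]
      exact tendsto_const_nhds
  refine measurable_of_tendsto_metrizable (fun n => ?_) (tendsto_pi_nhds.2 hlim)
  refine Measurable.indicator ?_ hSm
  refine (continuous_integral_comp_tripleFun ha hG hc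
    (τ := fun y => max (-(n : ℝ)) (min y n)) (by fun_prop) (B := n) fun y => ?_).measurable
  have hn : (0 : ℝ) ≤ n := n.cast_nonneg
  exact abs_le.2 ⟨le_max_left _ _, max_le (by linarith) (min_le_right _ _)⟩

end Measurability

/-! ### Distributions and their coefficients -/

lemma finite_lam_eq (c : ℝ) : {n : Mode | lam n = c}.Finite := by
  set B : ℤ := ⌈c⌉ with hB
  have hsub : {n : Mode | lam n = c} ⊆
      (fun n : Mode => ((n.1.1 : Fin 3 → ℤ), n.2)) ⁻¹'
        ((Set.univ.pi fun _ => Set.Icc (-B) B) ×ˢ Set.univ) := by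
    intro n hn
    refine ⟨fun i _ => ?_, trivial⟩
    have h1 : ((n.1.1 i : ℝ)) ^ 2 ≤ c := by
      rw [← (show lam n = c from hn), lam, EuclideanSpace.norm_sq_eq]
      have := Finset.single_le_sum (f := fun i => ‖waveVec n.1.1 i‖ ^ 2)
        (fun j _ => by positivity) (Finset.mem_univ i)
      simpa [waveVec] using this
    have h2 : (n.1.1 i) ^ 2 ≤ B := by
      have : (((n.1.1 i) ^ 2 : ℤ) : ℝ) ≤ (B : ℝ) := by
        push_cast; exact h1.trans (Int.le_ceil c)
      exact_mod_cast this
    exact ⟨by nlinarith [sq_nonneg (n.1.1 i + 1)], by nlinarith [sq_nonneg (n.1.1 i - 1)]⟩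
  refine Set.Finite.subset (Set.Finite.preimage (Function.Injective.injOn ?_)
    ((Set.Finite.pi fun _ => Set.finite_Icc (-B) B).prod (Set.finite_univ (α := Fin 2)))) hsub
  rintro ⟨⟨k, hk⟩, i⟩ ⟨⟨l, hl⟩, j⟩ h
  simp only [Prod.mk.injEq] at h
  obtain ⟨h1, h2⟩ := h
  subst h1; subst h2; rfl

/-- The modes with the eigenvalue of `e`. -/
def modesOf (e : StokesEigen) : Finset Mode := (finite_lam_eq e.eigenvalue).toFinset

lemma mem_modesOf {e : StokesEigen} {n : Mode} : n ∈ modesOf e ↔ lam n = e.eigenvalue := by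
  simp [modesOf]

lemma coef_eigen_eq_zero {e : StokesEigen} {n : Mode} (h : n ∉ modesOf e) :
    coef (testToH e.field) n = 0 := by
  have h1 := coef_stokes e.field n
  rw [e.eq, map_smul, coef_smul] at h1
  have h2 : (e.eigenvalue - lam n) * coef (testToH e.field) n = 0 := by linarith
  refine (mul_eq_zero.1 h2).resolve_left fun h3 => h (mem_modesOf.2 ?_)
  linarith

lemma inner_eigen (h : H) (e : StokesEigen) :
    ⟪h, testToH e.field⟫ = ∑ n ∈ modesOf e, coef (testToH e.field) n * coef h n := by
  refine (hasSum_coef_mul h (testToH e.field)).unique ?_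
  simp only [mul_comm (coef h _)]
  exact hasSum_sum_of_ne_finset_zero fun n hn => by rw [coef_eigen_eq_zero hn, zero_mul]

/-- The values of a distribution on all the eigenfunctions are determined linearly by its values
on the basis. -/
def IsSpectral (T : Distr) : Prop :=
  ∀ e, T e = ∑ n ∈ modesOf e, coef (testToH e.field) n * T (modeEigen n)

lemma IsSpectral.add {S T : Distr} (hS : IsSpectral S) (hT : IsSpectral T) :
    IsSpectral fun e => S e + T e := fun e => by
  simp only [hS e, hT e, mul_add, Finset.sum_add_distrib]

lemma IsSpectral.sub {S T : Distr} (hS : IsSpectral S) (hT : IsSpectral T) :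
    IsSpectral fun e => S e - T e := fun e => by
  simp only [hS e, hT e, mul_sub, Finset.sum_sub_distrib]

lemma represents_iff {T : Distr} (hT : IsSpectral T) (h : H) :
    Represents T h ↔ ∀ n, T (modeEigen n) = coef h n := by
  constructor
  · intro hr n
    exact hr (modeEigen n)
  · intro hr e
    rw [hT e]
    simp only [hr]
    exact (inner_eigen h e).symm

lemma represents_coef {T : Distr} {h : H} (hr : Represents T h) (n : Mode) :
    T (modeEigen n) = coef h n := hr (modeEigen n)

lemma represents_unique {T : Distr} {h g : H} (hh : Represents T h) (hg : Represents T g) :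
    h = g :=
  ext_coef fun n => by rw [← represents_coef hh, represents_coef hg]

lemma represents_vToH {T : Distr} {p : V} : Represents T p.1.1 ↔ Represents T (vToH p) := Iff.rfl

lemma represents_unique_V {T : Distr} {p q : V} (hp : Represents T p.1.1)
    (hq : Represents T q.1.1) : p = q :=
  ext_vCoef fun n => by
    rw [← represents_coef (represents_vToH.1 hp), represents_coef (represents_vToH.1 hq)]

lemma normH_eq {T : Distr} {h : H} (hr : Represents T h) : normH T = ‖h‖ₑ := by
  refine le_antisymm (iInf₂_le h hr) (le_iInf₂ fun g hg => ?_)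
  rw [represents_unique hr hg]

lemma normV_eq {T : Distr} {p : V} (hr : Represents T p.1.1) : normV T = ‖p.1.2‖ₑ := by
  refine le_antisymm (iInf₂_le p hr) (le_iInf₂ fun q hq => ?_)
  rw [represents_unique_V hr hq]

lemma normL4_eq {T : Distr} {h : H} (hr : Represents T h) :
    normL4 T = eLpNorm (h : L2Vec) 4 cellMeasure := by
  refine le_antisymm (iInf₂_le h hr) (le_iInf₂ fun g hg => ?_)
  rw [represents_unique hr hg]

lemma exists_represents_of_normH_lt {T : Distr} (h : normH T < ⊤) :
    ∃ g : H, Represents T g := by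
  by_contra hc
  push Not at hc
  refine h.ne ?_
  simp [normH, hc]

lemma exists_represents_of_normV_lt {T : Distr} (h : normV T < ⊤) :
    ∃ p : V, Represents T p.1.1 := by
  by_contra hc
  push Not at hc
  refine h.ne ?_
  unfold normV
  simp only [iInf_eq_top]
  exact fun p hp => absurd hp (hc p)

lemma exists_represents_of_normL4_lt {T : Distr} (h : normL4 T < ⊤) :
    ∃ g : H, Represents T g := by
  by_contra hc
  push Not at hc
  refine h.ne ?_
  simp [normL4, hc]

lemma enorm_sq_eq_ofReal {E : Type*} [NormedAddCommGroup E] (x : E) :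
    ‖x‖ₑ ^ 2 = ENNReal.ofReal (‖x‖ ^ 2) := by
  rw [ENNReal.ofReal_pow (norm_nonneg _), ofReal_norm]

lemma tsum_ofReal_eq_of_hasSum {ι : Type*} {f : ι → ℝ} (hf : ∀ i, 0 ≤ f i) {a : ℝ}
    (h : HasSum f a) : ∑' i, ENNReal.ofReal (f i) = ENNReal.ofReal a := by
  rw [← ENNReal.ofReal_tsum_of_nonneg hf h.summable, h.tsum_eq]

lemma summable_of_tsum_ofReal_lt {ι : Type*} {f : ι → ℝ} (hf : ∀ i, 0 ≤ f i)
    (h : ∑' i, ENNReal.ofReal (f i) < ⊤) : Summable f := by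
  have := ENNReal.summable_toReal h.ne
  simpa only [ENNReal.toReal_ofReal (hf _)] using this

/-- The square of the `H` norm of a distribution is the sum of the squares of its coefficients. -/
lemma normH_sq {T : Distr} (hT : IsSpectral T) :
    normH T ^ 2 = ∑' n, ENNReal.ofReal (T (modeEigen n) ^ 2) := by
  by_cases hlt : ∑' n, ENNReal.ofReal (T (modeEigen n) ^ 2) < ⊤
  · obtain ⟨h, hh⟩ := exists_coef_eq (summable_of_tsum_ofReal_lt (fun n => sq_nonneg _) hlt)
    rw [normH_eq ((represents_iff hT h).2 fun n => (hh n).symm), enorm_sq_eq_ofReal,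
      ← tsum_ofReal_eq_of_hasSum (fun n => sq_nonneg _) (hasSum_coef_sq h)]
    simp only [hh]
  · have : normH T = ⊤ := by
      by_contra hne
      obtain ⟨h, hh⟩ := exists_represents_of_normH_lt (lt_top_iff_ne_top.2 hne)
      apply hlt
      simp only [represents_coef hh]
      rw [tsum_ofReal_eq_of_hasSum (fun n => sq_nonneg _) (hasSum_coef_sq h)]
      exact ENNReal.ofReal_lt_top
    rw [this, not_lt_top_iff.1 hlt]
    simp

lemma normV_sq {T : Distr} (hT : IsSpectral T) :
    normV T ^ 2 = ∑' n, ENNReal.ofReal (lam n * T (modeEigen n) ^ 2) := by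
  have h0 : ∀ n, 0 ≤ lam n * T (modeEigen n) ^ 2 := fun n =>
    mul_nonneg (lam_pos n).le (sq_nonneg _)
  by_cases hlt : ∑' n, ENNReal.ofReal (lam n * T (modeEigen n) ^ 2) < ⊤
  · obtain ⟨p, hp⟩ := exists_vCoef_eq (summable_of_tsum_ofReal_lt h0 hlt)
    have hr : Represents T p.1.1 :=
      represents_vToH.2 ((represents_iff hT (vToH p)).2 fun n => (hp n).symm)
    rw [normV_eq hr, enorm_sq_eq_ofReal, ← vGrad_apply,
      ← tsum_ofReal_eq_of_hasSum (fun n => mul_nonneg (lam_pos n).le (sq_nonneg _))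
        (hasSum_norm_vGrad_sq p)]
    simp only [hp]
  · have : normV T = ⊤ := by
      by_contra hne
      obtain ⟨p, hp⟩ := exists_represents_of_normV_lt (lt_top_iff_ne_top.2 hne)
      apply hlt
      simp only [represents_coef (represents_vToH.1 hp)]
      rw [tsum_ofReal_eq_of_hasSum (fun n => mul_nonneg (lam_pos n).le (sq_nonneg _))
        (hasSum_norm_vGrad_sq p)]
      exact ENNReal.ofReal_lt_top
    rw [this, not_lt_top_iff.1 hlt]
    simp

/-! ### Measurable reconstruction from the coefficients -/

instance fact_two_ne_top : Fact ((2 : ℝ≥0∞) ≠ ⊤) := ⟨by norm_num⟩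

instance secondCountable_L2Vec : SecondCountableTopology L2Vec := Lp.SecondCountableTopology

instance secondCountable_L2Grad : SecondCountableTopology L2Grad := Lp.SecondCountableTopology

instance secondCountable_V : SecondCountableTopology V :=
  TopologicalSpace.Subtype.secondCountableTopology _

instance measurableSpace_V : MeasurableSpace V := borel V

instance borelSpace_V : BorelSpace V := ⟨rfl⟩

/-- A measurable function of the coefficients is obtained as the limit of its finite sections. -/
lemma measurable_of_hasSum {E : Type*} [NormedAddCommGroup E] [NormedSpace ℝ E]
    [MeasurableSpace E] [BorelSpace E] {S : Set (Mode → ℝ)} (hS : MeasurableSet S) {b : Mode → E}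
    {F : (Mode → ℝ) → E} (h1 : ∀ c ∈ S, HasSum (fun n => c n • b n) (F c))
    (h2 : ∀ c ∉ S, F c = 0) : Measurable F := by
  have hlim : ∀ c, Filter.Tendsto
      (fun s : Finset Mode => S.indicator (fun c => ∑ n ∈ s, c n • b n) c) Filter.atTop
      (nhds (F c)) := by
    intro c
    by_cases hc : c ∈ S
    · simp only [Set.indicator_of_mem hc]
      have := h1 c hc
      rwa [HasSum, SummationFilter.unconditional_filter] at this
    · simp only [Set.indicator_of_notMem hc, h2 c hc]
      exact tendsto_const_nhds
  refine measurable_of_tendsto_metrizable' Filter.atTop (fun s => ?_) (tendsto_pi_nhds.2 hlim)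
  refine Measurable.indicator (Continuous.measurable ?_) hS
  exact continuous_finsetSum _ fun n _ => (continuous_apply n).smul continuous_const

/-- The set of coefficients of elements of `H`. -/
def hCoefSet : Set (Mode → ℝ) := {c | ∑' n, ENNReal.ofReal (c n ^ 2) < ⊤}

/-- The set of coefficients of elements of `V`. -/
def vCoefSet : Set (Mode → ℝ) := {c | ∑' n, ENNReal.ofReal (lam n * c n ^ 2) < ⊤}

lemma measurableSet_hCoefSet : MeasurableSet hCoefSet :=
  measurableSet_lt (Measurable.tsum fun n => by fun_prop) measurable_const

lemma measurableSet_vCoefSet : MeasurableSet vCoefSet :=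
  measurableSet_lt (Measurable.tsum fun n => by fun_prop) measurable_const

open Classical in
/-- The element of `H` with the given coefficients (and `0` if there is none). -/
def hOf (c : Mode → ℝ) : H :=
  if hc : c ∈ hCoefSet then
    (exists_coef_eq (summable_of_tsum_ofReal_lt (fun n => sq_nonneg (c n)) hc)).choose else 0

open Classical in
/-- The element of `V` with the given coefficients (and `0` if there is none). -/
def vOf (c : Mode → ℝ) : V :=
  if hc : c ∈ vCoefSet then
    (exists_vCoef_eq (summable_of_tsum_ofReal_lt
      (fun n => mul_nonneg (lam_pos n).le (sq_nonneg (c n))) hc)).choose else 0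

lemma coef_hOf {c : Mode → ℝ} (hc : c ∈ hCoefSet) (n : Mode) : coef (hOf c) n = c n := by
  rw [hOf, dif_pos hc]
  exact (exists_coef_eq (summable_of_tsum_ofReal_lt (fun n => sq_nonneg (c n)) hc)).choose_spec n

lemma coef_vOf {c : Mode → ℝ} (hc : c ∈ vCoefSet) (n : Mode) : coef (vToH (vOf c)) n = c n := by
  rw [vOf, dif_pos hc]
  exact (exists_vCoef_eq (summable_of_tsum_ofReal_lt
      (fun n => mul_nonneg (lam_pos n).le (sq_nonneg (c n))) hc)).choose_spec n

lemma coef_mem_hCoefSet (h : H) : coef h ∈ hCoefSet := by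
  change ∑' n, ENNReal.ofReal (coef h n ^ 2) < ⊤
  rw [tsum_ofReal_eq_of_hasSum (fun n => sq_nonneg _) (hasSum_coef_sq h)]
  exact ENNReal.ofReal_lt_top

lemma coef_mem_vCoefSet (p : V) : coef (vToH p) ∈ vCoefSet := by
  change ∑' n, ENNReal.ofReal (lam n * coef (vToH p) n ^ 2) < ⊤
  rw [tsum_ofReal_eq_of_hasSum (fun n => mul_nonneg (lam_pos n).le (sq_nonneg _))
    (hasSum_norm_vGrad_sq p)]
  exact ENNReal.ofReal_lt_top

lemma hOf_coef (h : H) : hOf (coef h) = h := ext_coef (coef_hOf (coef_mem_hCoefSet h))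

lemma vOf_coef (p : V) : vOf (coef (vToH p)) = p := ext_vCoef (coef_vOf (coef_mem_vCoefSet p))

lemma measurable_hOf : Measurable hOf := by
  refine measurable_of_hasSum measurableSet_hCoefSet (b := fun n => testToH (modeField n))
    (fun c hc => ?_) fun c hc => by rw [hOf, dif_neg hc]
  have := hasSum_coef_smul (hOf c)
  simpa only [coef_hOf hc] using this

lemma hasSum_vCoef_smul (p : V) :
    HasSum (fun n => coef (vToH p) n • testToV (modeField n)) p := by
  have h1 : HasSum (fun n => coef (vToH p) n • testToL2 (modeField n)) p.1.1 := by
    have := (hasSum_coef_smul (vToH p)).mapL (HSub.subtypeL)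
    simpa only [map_smul, Submodule.subtypeL_apply, coe_testToH, coe_vToH] using this
  have h2 : HasSum (fun n => coef (vToH p) n • testGradToL2 (modeField n)) p.1.2 := by
    have := (gradBasis.hasSum_repr ⟨vGrad p, snd_mem_GradSub p⟩).mapL (GradSub.subtypeL)
    refine (this.congr_fun fun n => ?_)
    rw [gradBasis.repr_apply_apply, real_inner_comm, gradBasis_repr, gradBasis_apply]
    simp only [map_smul, Submodule.subtypeL_apply, coe_gradMode, smul_smul]
    congr 1
    have hp : Real.sqrt (lam n) ≠ 0 := (Real.sqrt_pos.2 (lam_pos n)).ne'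
    field_simp
  have h3 := h1.prodMk h2
  have hi : Topology.IsInducing V.subtypeL := Topology.IsInducing.subtypeVal
  exact (hi.hasSum_iff _ _).1 h3

lemma measurable_vOf : Measurable vOf := by
  refine measurable_of_hasSum measurableSet_vCoefSet (b := fun n => testToV (modeField n))
    (fun c hc => ?_) fun c hc => by rw [vOf, dif_neg hc]
  have := hasSum_vCoef_smul (vOf c)
  simpa only [coef_vOf hc] using this

/-- The coefficients of a distribution. -/
def coefOf (T : Distr) (n : Mode) : ℝ := T (modeEigen n)

lemma represents_hOf {T : Distr} (hT : IsSpectral T) (hc : coefOf T ∈ hCoefSet) :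
    Represents T (hOf (coefOf T)) :=
  (represents_iff hT _).2 fun n => (coef_hOf hc n).symm

lemma represents_vOf {T : Distr} (hT : IsSpectral T) (hc : coefOf T ∈ vCoefSet) :
    Represents T (vOf (coefOf T)).1.1 :=
  represents_vToH.2 ((represents_iff hT _).2 fun n => (coef_vOf hc n).symm)

lemma coefOf_eq_of_represents {T : Distr} {h : H} (hr : Represents T h) : coefOf T = coef h :=
  funext (represents_coef hr)

lemma coefOf_mem_hCoefSet_iff {T : Distr} (hT : IsSpectral T) :
    coefOf T ∈ hCoefSet ↔ ∃ h : H, Represents T h :=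
  ⟨fun h => ⟨_, represents_hOf hT h⟩, fun ⟨h, hh⟩ => by
    rw [coefOf_eq_of_represents hh]; exact coef_mem_hCoefSet h⟩

lemma coefOf_mem_vCoefSet_iff {T : Distr} (hT : IsSpectral T) :
    coefOf T ∈ vCoefSet ↔ ∃ p : V, Represents T p.1.1 :=
  ⟨fun h => ⟨_, represents_vOf hT h⟩, fun ⟨p, hp⟩ => by
    rw [coefOf_eq_of_represents (represents_vToH.1 hp)]; exact coef_mem_vCoefSet p⟩

/-! ### Integration over time -/

lemma measurableEmbedding_coe : MeasurableEmbedding ((↑) : ℝ≥0 → ℝ) :=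
  MeasurableEmbedding.subtype_coe measurableSet_Ici

lemma map_timeMeasure : timeMeasure.map ((↑) : ℝ≥0 → ℝ) = volume.restrict (Set.Ici 0) := by
  rw [timeMeasure, measurableEmbedding_coe.map_comap]
  congr 1
  exact Subtype.range_coe

lemma timeMeasure_image (A : Set ℝ≥0) : timeMeasure A = volume ((↑) '' A : Set ℝ) := by
  rw [timeMeasure, measurableEmbedding_coe.comap_apply]

lemma timeMeasure_singleton (t : ℝ≥0) : timeMeasure {t} = 0 := by
  rw [timeMeasure_image]; simp

instance noAtoms_timeMeasure : NullSingletonClass timeMeasure := ⟨timeMeasure_singleton⟩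

lemma image_Iic (t : ℝ≥0) : ((↑) '' Set.Iic t : Set ℝ) = Set.Icc 0 (t : ℝ) := by
  ext x
  constructor
  · rintro ⟨s, hs, rfl⟩
    exact ⟨s.2, by exact_mod_cast hs⟩
  · rintro ⟨h0, h1⟩
    exact ⟨⟨x, h0⟩, by exact_mod_cast h1, rfl⟩

lemma timeMeasure_Iic (t : ℝ≥0) : timeMeasure (Set.Iic t) = t := by
  rw [timeMeasure_image, image_Iic]; simp

instance isFinite_timeMeasure_Iic (t : ℝ≥0) : IsFiniteMeasure (timeMeasure.restrict (Set.Iic t)) :=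
  ⟨by rw [Measure.restrict_apply_univ, timeMeasure_Iic]; exact ENNReal.coe_lt_top⟩

instance isFiniteOnCompacts_timeMeasure : IsFiniteMeasureOnCompacts timeMeasure :=
  ⟨fun K hK => by
    obtain ⟨t, ht⟩ := hK.bddAbove
    exact (measure_mono fun x hx => ht hx).trans_lt
      (by rw [timeMeasure_Iic]; exact ENNReal.coe_lt_top : timeMeasure (Set.Iic t) < ⊤)⟩

instance sigmaFinite_timeMeasure : SigmaFinite timeMeasure :=
  ⟨⟨{ set := fun n => Set.Iic (n : ℝ≥0)
      set_mem := fun _ => trivial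
      finite := fun n => by rw [timeMeasure_Iic]; exact ENNReal.coe_lt_top
      spanning := Set.eq_univ_of_forall fun x => by
        obtain ⟨n, hn⟩ := exists_nat_ge x
        exact Set.mem_iUnion.2 ⟨n, hn⟩ }⟩⟩

lemma isCompact_Iic_time (t : ℝ≥0) : IsCompact (Set.Iic t) := by
  rw [← Set.Icc_bot]; exact isCompact_Icc

lemma integrableOn_Iic_of_continuousOn {E : Type*} [NormedAddCommGroup E] {f : ℝ≥0 → E} {t : ℝ≥0}
    (hf : ContinuousOn f (Set.Iic t)) : IntegrableOn f (Set.Iic t) timeMeasure :=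
  hf.integrableOn_compact (isCompact_Iic_time t)

/-- Integrals over `[0, t]` as integrals over an interval of the real line. -/
lemma setIntegral_Iic_eq (f : ℝ → ℝ) (t : ℝ≥0) :
    ∫ s in Set.Iic t, f s ∂timeMeasure = ∫ s in (0 : ℝ)..t, f s := by
  have h1 : ∫ s in Set.Iic t, f s ∂timeMeasure
      = ∫ s in Set.Iic (t : ℝ), f s ∂(timeMeasure.map ((↑) : ℝ≥0 → ℝ)) := by
    rw [measurableEmbedding_coe.setIntegral_map]
    rfl
  rw [h1, map_timeMeasure, Measure.restrict_restrict measurableSet_Iic,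
    Set.inter_comm, Set.Ici_inter_Iic, integral_Icc_eq_integral_Ioc,
    intervalIntegral.integral_of_le t.coe_nonneg]

lemma continuous_setIntegral_Iic {f : ℝ≥0 → ℝ}
    (hf : ∀ t, IntegrableOn f (Set.Iic t) timeMeasure) :
    Continuous fun t => ∫ s in Set.Iic t, f s ∂timeMeasure := by
  rw [continuous_iff_continuousAt]
  intro t₀
  have h1 : ∀ t, ∫ s in Set.Iic t, f s ∂timeMeasure
      = ∫ s, (Set.Iic t).indicator f s ∂timeMeasure :=
    fun t => (integral_indicator measurableSet_Iic).symm
  simp only [h1]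
  refine continuousAt_of_dominated (bound := (Set.Iic (t₀ + 1)).indicator fun s => ‖f s‖)
    ?_ ?_ ((integrable_indicator_iff measurableSet_Iic).2 (hf (t₀ + 1)).norm) ?_
  · exact Filter.Eventually.of_forall fun t =>
      ((hf t).integrable_indicator measurableSet_Iic).aestronglyMeasurable
  · filter_upwards [gt_mem_nhds (show t₀ < t₀ + 1 by simp)] with t ht
    refine Filter.Eventually.of_forall fun s => ?_
    by_cases hs : s ≤ t
    · rw [Set.indicator_of_mem (show s ∈ Set.Iic t from hs),
        Set.indicator_of_mem (show s ∈ Set.Iic (t₀ + 1) from hs.trans ht.le)]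
    · rw [Set.indicator_of_notMem (show s ∉ Set.Iic t from hs), norm_zero]
      exact Set.indicator_nonneg (fun _ _ => norm_nonneg _) _
  · have : ∀ᵐ s ∂timeMeasure, s ≠ t₀ := by
      rw [ae_iff]; simp
    filter_upwards [this] with s hs
    rcases lt_or_gt_of_ne hs with h | h
    · refine (continuousAt_const (y := f s)).congr ?_
      filter_upwards [lt_mem_nhds h] with t ht
      rw [Set.indicator_of_mem (show s ∈ Set.Iic t from le_of_lt ht)]
    · refine (continuousAt_const (y := (0 : ℝ))).congr ?_
      filter_upwards [gt_mem_nhds h] with t ht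
      rw [Set.indicator_of_notMem (show s ∉ Set.Iic t from not_le.2 ht)]

lemma continuousOn_setIntegral_Iic {f : ℝ≥0 → ℝ} {t : ℝ≥0}
    (hf : IntegrableOn f (Set.Iic t) timeMeasure) :
    ContinuousOn (fun s => ∫ r in Set.Iic s, f r ∂timeMeasure) (Set.Iic t) := by
  have h1 : Integrable ((Set.Iic t).indicator f) timeMeasure :=
    hf.integrable_indicator measurableSet_Iic
  refine (continuous_setIntegral_Iic fun s => h1.integrableOn).continuousOn.congr fun s hs => ?_
  refine setIntegral_congr_fun measurableSet_Iic fun r hr => ?_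
  rw [Set.indicator_of_mem]
  exact le_trans (show r ≤ s from hr) (show s ≤ t from hs)

/-! ### The embedding of `H` in `D(A)'` -/

lemma pair_add (u : DomADual) (φ ψ : testField) : pair u (φ + ψ) = pair u φ + pair u ψ :=
  map_add u _ _

lemma pair_smul (u : DomADual) (c : ℝ) (φ : testField) : pair u (c • φ) = c * pair u φ :=
  map_smul u _ _

lemma pair_sub_left (u v : DomADual) (φ : testField) :
    pair (u - v) φ = pair u φ - pair v φ := rfl

lemma tendsto_pair_testPartial (u : DomADual) (φ : testField) :
    Filter.Tendsto (fun s => ∑ n ∈ s, coef (testToH φ) n * pair u (modeField n)) Filter.atTop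
      (nhds (pair u φ)) := by
  have h1 : ∀ s, ∑ n ∈ s, coef (testToH φ) n * pair u (modeField n) = pair u (testPartial φ s) := by
    intro s
    simp only [← pair_smul]
    exact (map_sum u (fun n => (show DomA from coef (testToH φ) n • modeField n)) s).symm
  simp only [h1]
  refine (u.continuous.tendsto (show DomA from φ)).comp
    (f := fun s => (show DomA from testPartial φ s)) ?_
  rw [tendsto_iff_norm_sub_tendsto_zero]
  have h2 : ∀ ψ : testField, Filter.Tendsto (fun s => ‖testToL2 (testPartial ψ s) - testToL2 ψ‖)
      Filter.atTop (nhds 0) := fun ψ => by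
    have := tendsto_iff_norm_sub_tendsto_zero.1 (tendsto_testPartial ψ)
    exact this
  have h3 := (h2 φ).max (h2 (stokes φ))
  rw [max_self] at h3
  refine h3.congr fun s => ?_
  rw [← map_sub, ← stokes_testPartial, ← map_sub, ← map_sub]
  rfl

lemma embed_eq_iff (h : H) (u : DomADual) :
    embed h = u ↔ ∀ n, pair u (modeField n) = coef h n := by
  constructor
  · rintro rfl n; rfl
  · intro hn
    ext φ
    refine tendsto_nhds_unique (tendsto_pair_testPartial (embed h) φ) ?_
    refine (tendsto_pair_testPartial u φ).congr fun s => Finset.sum_congr rfl fun n _ => ?_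
    rw [hn]; rfl

lemma embed_injective : Function.Injective embed := fun h g e =>
  ext_coef fun n => ((embed_eq_iff h (embed g)).1 e n).symm

/-- The coefficients of an element of `D(A)'`. -/
def dualCoef (u : DomADual) (n : Mode) : ℝ := pair u (modeField n)

lemma embed_hOf {u : DomADual} (hu : dualCoef u ∈ hCoefSet) : embed (hOf (dualCoef u)) = u :=
  (embed_eq_iff _ _).2 fun n => (coef_hOf hu n).symm

lemma hPart_embed (h : H) : hPart (embed h) = h := by
  have hu : ∃ g, embed g = embed h := ⟨h, rfl⟩
  rw [hPart, dif_pos hu]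
  exact embed_injective hu.choose_spec

lemma hPart_eq_hOf (u : DomADual) : hPart u = hOf (dualCoef u) := by
  by_cases hu : dualCoef u ∈ hCoefSet
  · conv_lhs => rw [← embed_hOf hu, hPart_embed]
  · rw [hOf, dif_neg hu, hPart, dif_neg]
    rintro ⟨h, rfl⟩
    exact hu (coef_mem_hCoefSet h)

lemma dualHNorm_embed (h : H) : dualHNorm (embed h) = ‖h‖ₑ := by
  refine le_antisymm (iInf₂_le (f := fun g (_ : embed g = embed h) => ‖g‖ₑ) h rfl)
    (le_iInf₂ fun g hg => ?_)
  rw [embed_injective hg]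

lemma exists_embed_of_dualHNorm_lt {u : DomADual} (hu : dualHNorm u < ⊤) : ∃ h, embed h = u := by
  by_contra hc
  push Not at hc
  refine hu.ne ?_
  simp [dualHNorm, hc]

lemma embed_hPart {u : DomADual} (hu : dualHNorm u < ⊤) : embed (hPart u) = u := by
  obtain ⟨h, rfl⟩ := exists_embed_of_dualHNorm_lt hu
  rw [hPart_embed]

lemma enorm_hPart_le (u : DomADual) : ‖hPart u‖ₑ ≤ dualHNorm u := by
  by_cases hu : dualHNorm u < ⊤
  · conv_rhs => rw [← embed_hPart hu, dualHNorm_embed]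
  · rw [not_lt_top_iff.1 hu]; exact le_top

lemma dualHNorm_sq (u : DomADual) :
    dualHNorm u ^ 2 = ∑' n, ENNReal.ofReal (dualCoef u n ^ 2) := by
  by_cases hu : dualCoef u ∈ hCoefSet
  · conv_lhs => rw [← embed_hOf hu, dualHNorm_embed, enorm_sq_eq_ofReal,
      ← tsum_ofReal_eq_of_hasSum (fun n => sq_nonneg _) (hasSum_coef_sq _)]
    simp only [coef_hOf hu]
  · have h1 : dualHNorm u = ⊤ := by
      by_contra hne
      obtain ⟨h, rfl⟩ := exists_embed_of_dualHNorm_lt (lt_top_iff_ne_top.2 hne)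
      exact hu (coef_mem_hCoefSet h)
    have hu' : ¬ (∑' n, ENNReal.ofReal (dualCoef u n ^ 2) < ⊤) := hu
    rw [h1, not_lt_top_iff.1 hu']
    simp

/-! ### The convection term -/

lemma convection_eq_triple (u : H) (φ : testField) :
    convection u φ = triple u (testGradToL2 φ) u := by
  refine integral_congr_ae ?_
  filter_upwards [coeFn_testGradToL2 φ] with x hx
  simp only [tripleFun, hx]

/-- A pointwise bound of the gradient of a test field on the periodicity cell. -/
lemma exists_grad_bound (φ : testField) : ∃ C : ℝ≥0, ∀ x ∈ cell, ‖grad φ x‖ₑ ≤ C := by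
  obtain ⟨C, hC⟩ := isCompact_cell.exists_bound_of_continuousOn (continuous_grad φ).continuousOn
  exact ⟨C.toNNReal, fun x hx => by
    rw [← ofReal_norm]; exact ENNReal.ofReal_le_ofReal (hC x hx)⟩

lemma enorm_convection_le {φ : testField} {C : ℝ≥0} (hC : ∀ x ∈ cell, ‖grad φ x‖ₑ ≤ C) (u : H) :
    ‖convection u φ‖ₑ ≤ C * ‖u‖ₑ ^ 2 := by
  rw [convection_eq_triple]
  refine (enorm_integral_le_lintegral_enorm _).trans ?_
  have h2 : ‖u‖ₑ ^ 2 = ∫⁻ x, ‖(u : L2Vec) x‖ₑ ^ 2 ∂cellMeasure := by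
    have := eLpNorm_pow_eq_lintegral (μ := cellMeasure) (u : L2Vec) (n := 2) (by norm_num)
    push_cast at this
    rw [← this, ← Lp.enorm_def]
    rfl
  rw [h2, ← lintegral_const_mul' _ _ ENNReal.coe_ne_top]
  refine lintegral_mono_ae ?_
  filter_upwards [coeFn_testGradToL2 φ, ae_restrict_mem measurableSet_Icc] with x hx hc
  refine (enorm_tripleFun_le _ _ _ x).trans ?_
  rw [hx, ← pow_two, mul_comm]
  gcongr
  exact hC x hc

/-! ### The martingale functional on a path -/

lemma integrable_tripleFun_test (u : H) (φ : testField) :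
    Integrable (tripleFun u (testGradToL2 φ) u) cellMeasure := by
  obtain ⟨C, hC⟩ := exists_grad_bound φ
  refine ⟨aestronglyMeasurable_tripleFun _ _ _, ?_⟩
  have h2 : ∫⁻ x, ‖(u : L2Vec) x‖ₑ ^ 2 ∂cellMeasure < ⊤ := by
    have := eLpNorm_pow_eq_lintegral (μ := cellMeasure) (u : L2Vec) (n := 2) (by norm_num)
    push_cast at this
    rw [← this, ← Lp.enorm_def]
    exact ENNReal.pow_lt_top enorm_lt_top
  refine lt_of_le_of_lt (b := ∫⁻ x, C * ‖(u : L2Vec) x‖ₑ ^ 2 ∂cellMeasure) ?_ ?_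
  · refine lintegral_mono_ae ?_
    filter_upwards [coeFn_testGradToL2 φ, ae_restrict_mem measurableSet_Icc] with x hx hc
    refine (enorm_tripleFun_le _ _ _ x).trans ?_
    rw [hx, ← pow_two, mul_comm]
    gcongr
    exact hC x hc
  · rw [lintegral_const_mul' _ _ ENNReal.coe_ne_top]
    exact ENNReal.mul_lt_top ENNReal.coe_lt_top h2

lemma tripleFun_add (u w : L2Vec) (F G : L2Grad) :
    tripleFun u (F + G) w =ᵐ[cellMeasure] fun x => tripleFun u F w x + tripleFun u G w x := by
  filter_upwards [Lp.coeFn_add F G] with x hx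
  simp only [tripleFun, hx, Pi.add_apply, PiLp.add_apply, ← Finset.sum_add_distrib]
  exact Finset.sum_congr rfl fun i _ => Finset.sum_congr rfl fun j _ => by ring

lemma tripleFun_smul (u w : L2Vec) (c : ℝ) (G : L2Grad) :
    tripleFun u (c • G) w =ᵐ[cellMeasure] fun x => c * tripleFun u G w x := by
  filter_upwards [Lp.coeFn_smul c G] with x hx
  simp only [tripleFun, hx, Pi.smul_apply, PiLp.smul_apply, smul_eq_mul, Finset.mul_sum]
  exact Finset.sum_congr rfl fun i _ => Finset.sum_congr rfl fun j _ => by ring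

lemma convection_add (u : H) (φ ψ : testField) :
    convection u (φ + ψ) = convection u φ + convection u ψ := by
  simp only [convection_eq_triple, triple]
  rw [← integral_add (integrable_tripleFun_test u φ) (integrable_tripleFun_test u ψ), map_add]
  exact integral_congr_ae (tripleFun_add _ _ _ _)

lemma convection_smul (u : H) (c : ℝ) (φ : testField) :
    convection u (c • φ) = c * convection u φ := by
  simp only [convection_eq_triple, triple]
  rw [← integral_const_mul, map_smul]
  exact integral_congr_ae (tripleFun_smul _ _ _ _)

lemma measurable_convection (φ : testField) : Measurable fun u => convection u φ := by
  simp only [convection_eq_triple]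
  exact measurable_triple (X := H) continuous_subtype_val continuous_const continuous_subtype_val

lemma continuous_pair_path (ω : PathSpace) (φ : testField) : Continuous fun s => pair (ω s) φ :=
  (ContinuousLinearMap.apply ℝ ℝ (show DomA from φ)).continuous.comp ω.continuous

lemma measurable_hPart_path (ω : PathSpace) : Measurable fun s => hPart (ω s) := by
  simp only [hPart_eq_hOf]
  exact measurable_hOf.comp (measurable_pi_lambda _ fun n => (continuous_pair_path ω _).measurable)

lemma integrableOn_convection {ω : PathSpace} {t : ℝ≥0} (h : InL2H ω t) (φ : testField) :
    IntegrableOn (fun s => convection (hPart (ω s)) φ) (Set.Iic t) timeMeasure := by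
  obtain ⟨C, hC⟩ := exists_grad_bound φ
  refine ⟨((measurable_convection φ).comp (measurable_hPart_path ω)).aestronglyMeasurable, ?_⟩
  refine lt_of_le_of_lt (b := ∫⁻ s in Set.Iic t, C * dualHNorm (ω s) ^ 2 ∂timeMeasure) ?_ ?_
  · refine lintegral_mono fun s => (enorm_convection_le hC _).trans ?_
    gcongr
    exact enorm_hPart_le _
  · rw [lintegral_const_mul' _ _ ENNReal.coe_ne_top]
    exact ENNReal.mul_lt_top ENNReal.coe_lt_top h

lemma InL2H.mono {ω : PathSpace} {s t : ℝ≥0} (h : InL2H ω t) (hs : s ≤ t) : InL2H ω s :=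
  (lintegral_mono_set (Set.Iic_subset_Iic.2 hs)).trans_lt h

lemma isLinearMap_mart (ν : ℝ) {ω : PathSpace} {t : ℝ≥0} (h : InL2H ω t) :
    IsLinearMap ℝ fun φ => mart ν φ t ω := by
  have hc : ∀ φ, IntegrableOn (fun s => pair (ω s) φ) (Set.Iic t) timeMeasure := fun φ =>
    integrableOn_Iic_of_continuousOn (continuous_pair_path ω φ).continuousOn
  constructor
  · intro φ ψ
    simp only [mart, map_add, pair_add, convection_add]
    rw [integral_add (hc _) (hc _),
      integral_add (integrableOn_convection h _) (integrableOn_convection h _)]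
    ring
  · intro c φ
    simp only [mart, map_smul, pair_smul, convection_smul, integral_const_mul, smul_eq_mul]
    ring

lemma pair_congr (u : DomADual) {φ ψ : testField} (h : testToH φ = testToH ψ) :
    pair u φ = pair u ψ :=
  tendsto_nhds_unique (tendsto_pair_testPartial u φ)
    (by rw [h]; exact tendsto_pair_testPartial u ψ)

lemma testToH_stokes_congr {φ ψ : testField} (h : testToH φ = testToH ψ) :
    testToH (stokes φ) = testToH (stokes ψ) :=
  ext_coef fun n => by rw [coef_stokes, coef_stokes, h]

lemma testGradToL2_congr {φ ψ : testField} (h : testToH φ = testToH ψ) :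
    testGradToL2 φ = testGradToL2 ψ := by
  have : testToV φ = testToV ψ := ext_vCoef fun n => by
    rw [vToH_testToV, vToH_testToV, h]
  rw [← vGrad_testToV, this, vGrad_testToV]

lemma mart_congr (ν : ℝ) {φ ψ : testField} (h : testToH φ = testToH ψ) (t : ℝ≥0)
    (ω : PathSpace) : mart ν φ t ω = mart ν ψ t ω := by
  simp only [mart, pair_congr _ h, pair_congr _ (testToH_stokes_congr h), convection_eq_triple,
    testGradToL2_congr h]

lemma testToH_eigen (e : StokesEigen) :
    testToH e.field = testToH (∑ n ∈ modesOf e, coef (testToH e.field) n • modeField n) := by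
  rw [map_sum]
  refine (hasSum_coef_smul (testToH e.field)).unique ?_
  simp only [map_smul]
  exact hasSum_sum_of_ne_finset_zero fun n hn => by rw [coef_eigen_eq_zero hn, zero_smul]

lemma mart_eigen (ν : ℝ) {ω : PathSpace} {t : ℝ≥0} (h : InL2H ω t) (e : StokesEigen) :
    mart ν e.field t ω
      = ∑ n ∈ modesOf e, coef (testToH e.field) n * mart ν (modeField n) t ω := by
  rw [mart_congr ν (testToH_eigen e)]
  have := map_sum (isLinearMap_mart ν h).mk' (fun n => coef (testToH e.field) n • modeField n)
    (modesOf e)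
  simpa only [map_smul, IsLinearMap.mk'_apply, smul_eq_mul] using this

lemma continuousOn_mart (ν : ℝ) (φ : testField) {ω : PathSpace} {t : ℝ≥0} (h : InL2H ω t) :
    ContinuousOn (fun s => mart ν φ s ω) (Set.Iic t) := by
  refine ContinuousOn.sub (ContinuousOn.add ?_ ?_)
    (continuousOn_setIntegral_Iic (integrableOn_convection h φ))
  · simp only [pair_sub_left]
    exact ((continuous_pair_path ω φ).sub continuous_const).continuousOn
  · exact continuousOn_const.mul (continuousOn_setIntegral_Iic
      (integrableOn_Iic_of_continuousOn (continuous_pair_path ω (stokes φ)).continuousOn))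

lemma continuous_mart (ν : ℝ) (φ : testField) {ω : PathSpace} (h : ∀ t, InL2H ω t) :
    Continuous fun s => mart ν φ s ω := by
  rw [continuous_iff_continuousAt]
  exact fun t => (continuousOn_mart ν φ (h (t + 1))).continuousAt
    (Iic_mem_nhds (show t < t + 1 by simp))

lemma mart_zero (ν : ℝ) (φ : testField) (ω : PathSpace) : mart ν φ 0 ω = 0 := by
  have : (timeMeasure.restrict (Set.Iic 0)) = 0 := by
    rw [Measure.restrict_eq_zero, timeMeasure_Iic]; rfl
  have h0 : pair 0 φ = 0 := rfl
  simp [mart, this, h0]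

/-! ### The Ornstein-Uhlenbeck process and its complement on a path -/

lemma isSpectral_pair (u : DomADual) : IsSpectral fun e => pair u e.field := fun e => by
  have h := map_sum u (fun n => (show DomA from coef (testToH e.field) n • modeField n)) (modesOf e)
  refine (pair_congr u (testToH_eigen e)).trans (h.trans ?_)
  exact Finset.sum_congr rfl fun n _ => pair_smul u _ _

lemma isSpectral_ou (ν : ℝ) (t : ℝ≥0) (ω : PathSpace) : IsSpectral (ou ν t ω) := fun e => by
  by_cases h : InL2H ω t
  · simp only [ou, if_pos h, modeEigen]
    rw [mart_eigen ν h, show (∫ s in Set.Iic t, e.eigenvalue *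
        Real.exp (-(ν * e.eigenvalue * ((t : ℝ) - s))) * mart ν e.field s ω ∂timeMeasure)
        = ∑ n ∈ modesOf e, coef (testToH e.field) n * ∫ s in Set.Iic t, lam n *
          Real.exp (-(ν * lam n * ((t : ℝ) - s))) * mart ν (modeField n) s ω ∂timeMeasure by
      simp only [← integral_const_mul]
      rw [← integral_finsetSum]
      · refine setIntegral_congr_fun measurableSet_Iic fun s hs => ?_
        rw [mart_eigen ν (h.mono hs), Finset.mul_sum]
        refine Finset.sum_congr rfl fun n hn => ?_
        rw [mem_modesOf.1 hn]
        ring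
      · intro n _
        refine Integrable.const_mul ?_ _
        refine integrableOn_Iic_of_continuousOn (ContinuousOn.mul ?_ (continuousOn_mart ν _ h))
        exact Continuous.continuousOn (by fun_prop)]
    rw [Finset.mul_sum, ← Finset.sum_sub_distrib]
    exact Finset.sum_congr rfl fun n _ => by ring
  · simp [ou, if_neg h]

lemma isSpectral_heat (ν : ℝ) (x : H) (t : ℝ≥0) :
    IsSpectral fun e => Real.exp (-(ν * e.eigenvalue * t)) * ⟪x, testToH e.field⟫ := fun e => by
  dsimp only
  rw [inner_eigen, Finset.mul_sum]
  refine Finset.sum_congr rfl fun n hn => ?_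
  simp only [modeEigen, mem_modesOf.1 hn, coef]
  ring

lemma isSpectral_zProc (ν : ℝ) (x : H) (ω : PathSpace) (t : ℝ≥0) : IsSpectral (zProc ν x ω t) :=
  (isSpectral_ou ν t ω).add (isSpectral_heat ν x t)

lemma isSpectral_vProc (ν : ℝ) (x : H) (ω : PathSpace) (t : ℝ≥0) : IsSpectral (vProc ν x ω t) :=
  (isSpectral_pair (ω t)).sub (isSpectral_zProc ν x ω t)

/-! ### Joint measurability of the energy in time and path -/

lemma trilinearIntegrand_ae (h : H) (p : V) :
    trilinearIntegrand h p =ᵐ[cellMeasure] tripleFun (p.1.1 + h) p.1.2 h := by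
  filter_upwards [Lp.coeFn_add p.1.1 (h : L2Vec)] with x hx
  simp only [trilinearIntegrand, tripleFun, hx, Pi.add_apply, PiLp.add_apply]

/-- The pairs `(z, v)` for which `⟨z, B(v + z, v)⟩` is well defined. -/
def triGood : Set (H × V) :=
  {q | ∫⁻ y, ‖tripleFun (q.2.1.1 + q.1) q.2.1.2 q.1 y‖ₑ ∂cellMeasure < ⊤}

/-- The value of `⟨z, B(v + z, v)⟩`. -/
def triVal (q : H × V) : ℝ := triple (q.2.1.1 + q.1) q.2.1.2 q.1

lemma continuous_triArg : Continuous fun q : H × V => q.2.1.1 + (q.1 : L2Vec) :=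
  (continuous_fst.comp (continuous_subtype_val.comp continuous_snd)).add
    (continuous_subtype_val.comp continuous_fst)

lemma continuous_triGrad : Continuous fun q : H × V => q.2.1.2 :=
  continuous_snd.comp (continuous_subtype_val.comp continuous_snd)

lemma measurableSet_triGood : MeasurableSet triGood :=
  measurableSet_lt (measurable_lintegral_tripleFun (X := H × V) continuous_triArg
    continuous_triGrad (continuous_subtype_val.comp continuous_fst)) measurable_const

lemma measurable_triVal : Measurable triVal :=
  measurable_triple (X := H × V) continuous_triArg
    continuous_triGrad (continuous_subtype_val.comp continuous_fst)

lemma integrable_trilinearIntegrand_iff (h : H) (p : V) :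
    Integrable (trilinearIntegrand h p) cellMeasure ↔ (h, p) ∈ triGood := by
  rw [integrable_congr (trilinearIntegrand_ae h p)]
  exact ⟨fun hi => hi.2, fun hi => ⟨aestronglyMeasurable_tripleFun _ _ _, hi⟩⟩

lemma hasTrilinear_of_represents {z v : Distr} {h : H} {p : V} (hz : Represents z h)
    (hv : Represents v p.1.1) (hg : (h, p) ∈ triGood) : HasTrilinear z v (triVal (h, p)) :=
  ⟨h, p, hz, hv, (integrable_trilinearIntegrand_iff h p).2 hg,
    integral_congr_ae (trilinearIntegrand_ae h p)⟩

lemma HasTrilinear.unique {z v : Distr} {c d : ℝ} (hc : HasTrilinear z v c)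
    (hd : HasTrilinear z v d) : c = d := by
  obtain ⟨h, p, hz, hv, -, rfl⟩ := hc
  obtain ⟨h', p', hz', hv', -, rfl⟩ := hd
  rw [represents_unique hz hz', represents_unique_V hv hv']

lemma HasTrilinear.trilinear_eq {z v : Distr} {c : ℝ} (hc : HasTrilinear z v c) :
    trilinear z v = c := by
  have hex : ∃ c, HasTrilinear z v c := ⟨c, hc⟩
  rw [trilinear, dif_pos hex]
  exact hex.choose_spec.unique hc

/-- The coefficients of the pairs `(z, v)` for which `⟨z, B(v + z, v)⟩` is well defined. -/
def triCoefSet : Set ((Mode → ℝ) × (Mode → ℝ)) :=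
  {c | c.1 ∈ hCoefSet ∧ c.2 ∈ vCoefSet ∧ (hOf c.1, vOf c.2) ∈ triGood}

/-- The value of `⟨z, B(v + z, v)⟩` as a function of the coefficients. -/
def triCoef : (Mode → ℝ) × (Mode → ℝ) → ℝ :=
  triCoefSet.indicator fun c => triVal (hOf c.1, vOf c.2)

lemma measurable_hOf_vOf :
    Measurable fun c : (Mode → ℝ) × (Mode → ℝ) => (hOf c.1, vOf c.2) :=
  (measurable_hOf.comp measurable_fst).prodMk (measurable_vOf.comp measurable_snd)

lemma measurableSet_triCoefSet : MeasurableSet triCoefSet :=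
  (measurable_fst measurableSet_hCoefSet).inter ((measurable_snd measurableSet_vCoefSet).inter
    (measurable_hOf_vOf measurableSet_triGood))

lemma measurable_triCoef : Measurable triCoef :=
  (measurable_triVal.comp measurable_hOf_vOf).indicator measurableSet_triCoefSet

lemma exists_hasTrilinear_iff {z v : Distr} (hz : IsSpectral z) (hv : IsSpectral v) :
    (∃ c, HasTrilinear z v c) ↔ (coefOf z, coefOf v) ∈ triCoefSet := by
  constructor
  · rintro ⟨c, h, p, hh, hp, hi, -⟩
    have h1 := coefOf_eq_of_represents hh
    have h2 := coefOf_eq_of_represents (represents_vToH.1 hp)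
    refine ⟨(coefOf_mem_hCoefSet_iff hz).2 ⟨h, hh⟩, (coefOf_mem_vCoefSet_iff hv).2 ⟨p, hp⟩, ?_⟩
    simp only [h1, h2, hOf_coef, vOf_coef]
    exact (integrable_trilinearIntegrand_iff h p).1 hi
  · rintro ⟨h1, h2, h3⟩
    exact ⟨_, hasTrilinear_of_represents (represents_hOf hz h1) (represents_vOf hv h2) h3⟩

lemma trilinear_eq_triCoef {z v : Distr} (hz : IsSpectral z) (hv : IsSpectral v) :
    trilinear z v = triCoef (coefOf z, coefOf v) := by
  by_cases hc : (coefOf z, coefOf v) ∈ triCoefSet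
  · rw [triCoef, Set.indicator_of_mem hc]
    exact (hasTrilinear_of_represents (represents_hOf hz hc.1)
      (represents_vOf hv hc.2.1) hc.2.2).trilinear_eq
  · rw [triCoef, Set.indicator_of_notMem hc, trilinear, dif_neg]
    rwa [exists_hasTrilinear_iff hz hv]

lemma normH_eq_coef {T : Distr} (hT : IsSpectral T) :
    normH T = (∑' n, ENNReal.ofReal (coefOf T n ^ 2)) ^ (2⁻¹ : ℝ) := by
  rw [show (∑' n, ENNReal.ofReal (coefOf T n ^ 2)) = normH T ^ 2 from (normH_sq hT).symm,
    ← ENNReal.rpow_natCast, ← ENNReal.rpow_mul]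
  norm_num

lemma normL4_eq_coef {T : Distr} (hT : IsSpectral T) :
    normL4 T = hCoefSetᶜ.indicator (fun _ => ⊤) (coefOf T)
      + eLpNorm (hOf (coefOf T) : L2Vec) 4 cellMeasure := by
  by_cases hc : coefOf T ∈ hCoefSet
  · rw [Set.indicator_of_notMem (by simpa using hc), zero_add,
      normL4_eq (represents_hOf hT hc)]
  · rw [Set.indicator_of_mem (by simpa using hc), top_add]
    by_contra hne
    exact hc ((coefOf_mem_hCoefSet_iff hT).2
      (exists_represents_of_normL4_lt (lt_top_iff_ne_top.2 hne)))

section Joint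

variable {X : Type*} [MeasurableSpace X]

lemma measurable_setLIntegral_Iic {F : ℝ≥0 × X → ℝ≥0 → ℝ≥0∞}
    (hF : Measurable (Function.uncurry F)) :
    Measurable fun p => ∫⁻ s in Set.Iic p.1, F p s ∂timeMeasure := by
  have h1 : ∀ p : ℝ≥0 × X, ∫⁻ s in Set.Iic p.1, F p s ∂timeMeasure
      = ∫⁻ s, {q : (ℝ≥0 × X) × ℝ≥0 | q.2 ≤ q.1.1}.indicator (Function.uncurry F) (p, s)
        ∂timeMeasure := by
    intro p
    rw [← lintegral_indicator measurableSet_Iic]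
    rfl
  simp only [h1]
  refine Measurable.lintegral_prod_right' (f := {q : (ℝ≥0 × X) × ℝ≥0 | q.2 ≤ q.1.1}.indicator
    (Function.uncurry F)) (hF.indicator ?_)
  exact measurableSet_le measurable_snd (measurable_fst.comp measurable_fst)

lemma measurable_setIntegral_Iic {F : ℝ≥0 × X → ℝ≥0 → ℝ} (hF : Measurable (Function.uncurry F)) :
    Measurable fun p => ∫ s in Set.Iic p.1, F p s ∂timeMeasure := by
  have h1 : ∀ p : ℝ≥0 × X, ∫ s in Set.Iic p.1, F p s ∂timeMeasure
      = ∫ s, {q : (ℝ≥0 × X) × ℝ≥0 | q.2 ≤ q.1.1}.indicator (Function.uncurry F) (p, s)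
        ∂timeMeasure := by
    intro p
    rw [← integral_indicator measurableSet_Iic]
    rfl
  simp only [h1]
  refine (StronglyMeasurable.integral_prod_right (f := fun p s =>
    {q : (ℝ≥0 × X) × ℝ≥0 | q.2 ≤ q.1.1}.indicator (Function.uncurry F) (p, s))
    (Measurable.stronglyMeasurable (hF.indicator ?_))).measurable
  exact measurableSet_le measurable_snd (measurable_fst.comp measurable_fst)

lemma measurable_timeLIntegral {f : ℝ≥0 × X → ℝ≥0∞} (hf : Measurable f) :
    Measurable fun p : ℝ≥0 × X => ∫⁻ s in Set.Iic p.1, f (s, p.2) ∂timeMeasure :=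
  measurable_setLIntegral_Iic (F := fun q s => f (s, q.2))
    (hf.comp (measurable_snd.prodMk (measurable_snd.comp measurable_fst)))

lemma measurable_timeIntegral {f : ℝ≥0 × X → ℝ} (hf : Measurable f) :
    Measurable fun p : ℝ≥0 × X => ∫ s in Set.Iic p.1, f (s, p.2) ∂timeMeasure :=
  measurable_setIntegral_Iic (F := fun q s => f (s, q.2))
    (hf.comp (measurable_snd.prodMk (measurable_snd.comp measurable_fst)))

lemma continuous_coe_sub_coe :
    Continuous fun q : ℝ≥0∞ × ℝ => (q.1 : EReal) - (q.2 : EReal) := by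
  rw [continuous_iff_continuousAt]
  intro q
  simp only [sub_eq_add_neg]
  refine ContinuousAt.comp (g := fun q : EReal × EReal => q.1 + q.2)
    (f := fun q : ℝ≥0∞ × ℝ => ((q.1 : EReal), -(q.2 : EReal)))
    (EReal.continuousAt_add (Or.inr ?_) (Or.inl ?_)) ?_
  · rw [← EReal.coe_neg]; exact EReal.coe_ne_bot _
  · exact EReal.coe_ennreal_ne_bot _
  · exact ((continuous_coe_ennreal_ereal.comp continuous_fst).prodMk
      (continuous_coe_real_ereal.comp continuous_snd).neg).continuousAt

/-- A family of distributions, given by spectral functionals with jointly measurable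
coefficients. -/
structure MeasurableFamily (T : ℝ≥0 → X → Distr) : Prop where
  spectral : ∀ t x, IsSpectral (T t x)
  measurable : ∀ n, Measurable fun q : ℝ≥0 × X => T q.1 q.2 (modeEigen n)

lemma MeasurableFamily.measurable_coefOf {T : ℝ≥0 → X → Distr} (hT : MeasurableFamily T) :
    Measurable fun q : ℝ≥0 × X => coefOf (T q.1 q.2) :=
  measurable_pi_lambda _ hT.measurable

lemma MeasurableFamily.normH {T : ℝ≥0 → X → Distr} (hT : MeasurableFamily T) :
    Measurable fun q : ℝ≥0 × X => normH (T q.1 q.2) := by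
  simp only [normH_eq_coef (hT.spectral _ _)]
  refine (Measurable.tsum fun n => ?_).pow_const _
  exact ENNReal.measurable_ofReal.comp ((hT.measurable n).pow_const 2)

lemma MeasurableFamily.normV_sq {T : ℝ≥0 → X → Distr} (hT : MeasurableFamily T) :
    Measurable fun q : ℝ≥0 × X => normV (T q.1 q.2) ^ 2 := by
  simp only [NavierStokes.normV_sq (hT.spectral _ _)]
  refine Measurable.tsum fun n => ?_
  exact ENNReal.measurable_ofReal.comp (((hT.measurable n).pow_const 2).const_mul _)

lemma MeasurableFamily.normL4 {T : ℝ≥0 → X → Distr} (hT : MeasurableFamily T) :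
    Measurable fun q : ℝ≥0 × X => normL4 (T q.1 q.2) := by
  simp only [normL4_eq_coef (hT.spectral _ _)]
  refine Measurable.add ?_ ?_
  · exact (measurable_const.indicator measurableSet_hCoefSet.compl).comp hT.measurable_coefOf
  · have h1 : LowerSemicontinuous fun h : H => eLpNorm (h : L2Vec) 4 cellMeasure :=
      lowerSemicontinuous_eLpNorm_four.comp continuous_subtype_val
    exact h1.measurable.comp (measurable_hOf.comp hT.measurable_coefOf)

lemma MeasurableFamily.trilinear {z v : ℝ≥0 → X → Distr} (hz : MeasurableFamily z)
    (hv : MeasurableFamily v) :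
    Measurable fun q : ℝ≥0 × X => trilinear (z q.1 q.2) (v q.1 q.2) := by
  simp only [trilinear_eq_triCoef (hz.spectral _ _) (hv.spectral _ _)]
  exact measurable_triCoef.comp (hz.measurable_coefOf.prodMk hv.measurable_coefOf)

lemma MeasurableFamily.measurableSet_trilinearIntegrable {z v : ℝ≥0 → X → Distr}
    (hz : MeasurableFamily z) (hv : MeasurableFamily v) :
    MeasurableSet {q : ℝ≥0 × X | TrilinearIntegrable (v · q.2) (z · q.2) q.1} := by
  have hc : Measurable fun q : ℝ≥0 × X => (coefOf (z q.1 q.2), coefOf (v q.1 q.2)) :=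
    hz.measurable_coefOf.prodMk hv.measurable_coefOf
  have htri := hz.trilinear hv
  have hind : Measurable fun q : ℝ≥0 × X =>
      triCoefSetᶜ.indicator (fun _ => (1 : ℝ≥0∞)) (coefOf (z q.1 q.2), coefOf (v q.1 q.2)) :=
    (measurable_const.indicator measurableSet_triCoefSet.compl).comp hc
  have heq : {q : ℝ≥0 × X | TrilinearIntegrable (v · q.2) (z · q.2) q.1}
      = {q | ∫⁻ r in Set.Iic q.1, triCoefSetᶜ.indicator (fun _ => (1 : ℝ≥0∞))
            (coefOf (z r q.2), coefOf (v r q.2)) ∂timeMeasure = 0}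
        ∩ {q | ∫⁻ r in Set.Iic q.1, ‖NavierStokes.trilinear (z r q.2) (v r q.2)‖ₑ
            ∂timeMeasure < ⊤} := by
    ext q
    have hq : Measurable fun r : ℝ≥0 => (r, q.2) := measurable_id.prodMk measurable_const
    have htri' : Measurable fun r => NavierStokes.trilinear (z r q.2) (v r q.2) :=
      by have := htri.comp hq; simpa only [Function.comp_def] using this
    simp only [Set.mem_ofPred_eq, Set.mem_inter_iff, TrilinearIntegrable]
    refine and_congr ?_ (show Integrable (fun r => NavierStokes.trilinear (z r q.2) (v r q.2))
      (timeMeasure.restrict (Set.Iic q.1)) ↔ _ by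
        simp only [Integrable, htri'.aestronglyMeasurable, HasFiniteIntegral, true_and])
    have hind' : Measurable fun r => triCoefSetᶜ.indicator (fun _ => (1 : ℝ≥0∞))
        (coefOf (z r q.2), coefOf (v r q.2)) := by
      have := hind.comp hq
      simpa only [Function.comp_def] using this
    rw [lintegral_eq_zero_iff hind']
    refine Filter.eventually_congr (Filter.Eventually.of_forall fun r => ?_)
    rw [exists_hasTrilinear_iff (hz.spectral _ _) (hv.spectral _ _)]
    simp
  rw [heq]
  have h1 : Measurable fun q : ℝ≥0 × X => ∫⁻ r in Set.Iic q.1,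
      triCoefSetᶜ.indicator (fun _ => (1 : ℝ≥0∞)) (coefOf (z r q.2), coefOf (v r q.2))
      ∂timeMeasure := measurable_timeLIntegral (f := fun q => triCoefSetᶜ.indicator
        (fun _ => (1 : ℝ≥0∞)) (coefOf (z q.1 q.2), coefOf (v q.1 q.2))) hind
  have h2 : Measurable fun q : ℝ≥0 × X => ∫⁻ r in Set.Iic q.1,
      ‖NavierStokes.trilinear (z r q.2) (v r q.2)‖ₑ ∂timeMeasure :=
    measurable_timeLIntegral (f := fun q => ‖NavierStokes.trilinear (z q.1 q.2) (v q.1 q.2)‖ₑ)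
      htri.enorm
  exact (measurableSet_eq_fun h1 measurable_const).inter (measurableSet_lt h2 measurable_const)

lemma MeasurableFamily.energy (ν : ℝ) {z v : ℝ≥0 → X → Distr} (hz : MeasurableFamily z)
    (hv : MeasurableFamily v) :
    Measurable fun q : ℝ≥0 × X => energy ν (v · q.2) (z · q.2) q.1 := by
  refine Measurable.ite (hz.measurableSet_trilinearIntegrable hv) ?_ measurable_const
  exact continuous_coe_sub_coe.measurable.comp (Measurable.prodMk
    (((hv.normH.pow_const 2).const_mul _).add ((measurable_timeLIntegral hv.normV_sq).const_mul _))
    (measurable_timeIntegral (hz.trilinear hv)))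

variable {Y : X → PathSpace}

/-- The values of a random path are measurable. -/
def MeasurablePaths (Y : X → PathSpace) : Prop := ∀ s φ, Measurable fun x => pair (Y x s) φ

lemma MeasurablePaths.pair (hY : MeasurablePaths Y) (φ : testField) :
    Measurable fun q : ℝ≥0 × X => pair (Y q.2 q.1) φ :=
  measurable_uncurry_of_continuous_of_measurable
    (u := fun s x => NavierStokes.pair (Y x s) φ) (fun x => continuous_pair_path (Y x) φ)
    fun s => hY s φ

lemma MeasurablePaths.dualCoef (hY : MeasurablePaths Y) :
    Measurable fun q : ℝ≥0 × X => dualCoef (Y q.2 q.1) :=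
  measurable_pi_lambda _ fun _ => hY.pair _

lemma MeasurablePaths.convection (hY : MeasurablePaths Y) (φ : testField) :
    Measurable fun q : ℝ≥0 × X => convection (hPart (Y q.2 q.1)) φ := by
  simp only [hPart_eq_hOf]
  exact (measurable_convection φ).comp (measurable_hOf.comp hY.dualCoef)

lemma MeasurablePaths.mart (hY : MeasurablePaths Y) (ν : ℝ) (φ : testField) :
    Measurable fun q : ℝ≥0 × X => mart ν φ q.1 (Y q.2) := by
  refine Measurable.sub (Measurable.add ?_ ?_) (measurable_timeIntegral (hY.convection φ))
  · simp only [pair_sub_left]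
    exact (hY.pair φ).sub ((hY 0 φ).comp measurable_snd)
  · exact (measurable_timeIntegral (hY.pair (stokes φ))).const_mul _

lemma MeasurablePaths.measurableSet_inL2H (hY : MeasurablePaths Y) :
    MeasurableSet {q : ℝ≥0 × X | InL2H (Y q.2) q.1} := by
  have h1 : Measurable fun q : ℝ≥0 × X => dualHNorm (Y q.2 q.1) ^ 2 := by
    simp only [dualHNorm_sq]
    exact Measurable.tsum fun n => ENNReal.measurable_ofReal.comp ((hY.pair _).pow_const 2)
  exact measurableSet_lt (measurable_timeLIntegral h1) measurable_const

lemma MeasurablePaths.heatIntegral (hY : MeasurablePaths Y) (ν : ℝ) (e : StokesEigen) :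
    Measurable fun q : ℝ≥0 × X => ∫ s in Set.Iic q.1, e.eigenvalue *
      Real.exp (-(ν * e.eigenvalue * ((q.1 : ℝ) - s))) * NavierStokes.mart ν e.field s (Y q.2)
      ∂timeMeasure := by
  have hs : Measurable fun q : (ℝ≥0 × X) × ℝ≥0 => (q.2, q.1.2) :=
    measurable_snd.prodMk (measurable_snd.comp measurable_fst)
  have h1 : Measurable fun q : (ℝ≥0 × X) × ℝ≥0 => NavierStokes.mart ν e.field q.2 (Y q.1.2) := by
    have := (hY.mart ν e.field).comp hs
    simpa only [Function.comp_def] using this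
  have h2 : Measurable fun q : (ℝ≥0 × X) × ℝ≥0 =>
      e.eigenvalue * Real.exp (-(ν * e.eigenvalue * ((q.1.1 : ℝ) - q.2))) := by
    refine Measurable.const_mul (Measurable.exp (Measurable.neg (Measurable.const_mul ?_ _))) _
    exact (measurable_fst.fst.coe_nnreal_real).sub measurable_snd.coe_nnreal_real
  have h3 := h2.mul h1
  refine measurable_setIntegral_Iic (F := fun q s => e.eigenvalue *
    Real.exp (-(ν * e.eigenvalue * ((q.1 : ℝ) - s))) * NavierStokes.mart ν e.field s (Y q.2)) ?_
  simp only [Function.uncurry_def]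
  exact h3

lemma MeasurablePaths.ou (hY : MeasurablePaths Y) (ν : ℝ) (e : StokesEigen) :
    Measurable fun q : ℝ≥0 × X => ou ν q.1 (Y q.2) e := by
  have h3 := ((hY.mart ν e.field).sub ((hY.heatIntegral ν e).const_mul ν))
  simp only [NavierStokes.ou]
  exact Measurable.ite hY.measurableSet_inL2H h3 measurable_const

lemma MeasurablePaths.zProc (hY : MeasurablePaths Y) (ν : ℝ) (x : H) :
    MeasurableFamily fun t y => zProc ν x (Y y) t :=
  ⟨fun _ _ => isSpectral_zProc _ _ _ _, fun n => (hY.ou ν _).add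
    (Measurable.mul_const (Measurable.exp (by fun_prop)) _)⟩

lemma MeasurablePaths.vProc (hY : MeasurablePaths Y) (ν : ℝ) (x : H) :
    MeasurableFamily fun t y => vProc ν x (Y y) t :=
  ⟨fun _ _ => isSpectral_vProc _ _ _ _, fun n => (hY.pair _).sub ((hY.zProc ν x).measurable n)⟩

lemma MeasurablePaths.energyAt (hY : MeasurablePaths Y) (ν : ℝ) (x : H) :
    Measurable fun q : ℝ≥0 × X => energyAt ν x q.1 (Y q.2) :=
  (hY.zProc ν x).energy ν (hY.vProc ν x)

end Joint

/-! ### Adaptedness of the energy -/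

lemma mart_congr_path (ν : ℝ) (φ : testField) {t : ℝ≥0} {ω ω' : PathSpace}
    (h : ∀ s ≤ t, ω s = ω' s) : mart ν φ t ω = mart ν φ t ω' := by
  have h1 : ∫ s in Set.Iic t, pair (ω s) (stokes φ) ∂timeMeasure
      = ∫ s in Set.Iic t, pair (ω' s) (stokes φ) ∂timeMeasure :=
    setIntegral_congr_fun measurableSet_Iic fun s hs => by rw [h s hs]
  have h2 : ∫ s in Set.Iic t, convection (hPart (ω s)) φ ∂timeMeasure
      = ∫ s in Set.Iic t, convection (hPart (ω' s)) φ ∂timeMeasure :=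
    setIntegral_congr_fun measurableSet_Iic fun s hs => by rw [h s hs]
  have h3 : ω 0 = ω' 0 := h 0 zero_le
  rw [mart, mart, h1, h2, h t le_rfl, h3]

lemma inL2H_congr_path {t : ℝ≥0} {ω ω' : PathSpace} (h : ∀ s ≤ t, ω s = ω' s) :
    InL2H ω t ↔ InL2H ω' t := by
  have h1 : ∫⁻ s in Set.Iic t, dualHNorm (ω s) ^ 2 ∂timeMeasure
      = ∫⁻ s in Set.Iic t, dualHNorm (ω' s) ^ 2 ∂timeMeasure :=
    setLIntegral_congr_fun measurableSet_Iic fun s hs => by rw [h s hs]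
  rw [InL2H, InL2H, h1]

lemma ou_congr_path (ν : ℝ) {t : ℝ≥0} {ω ω' : PathSpace} (h : ∀ s ≤ t, ω s = ω' s) :
    ou ν t ω = ou ν t ω' := by
  funext e
  have h1 : ∫ s in Set.Iic t, e.eigenvalue * Real.exp (-(ν * e.eigenvalue * ((t : ℝ) - s)))
        * mart ν e.field s ω ∂timeMeasure
      = ∫ s in Set.Iic t, e.eigenvalue * Real.exp (-(ν * e.eigenvalue * ((t : ℝ) - s)))
        * mart ν e.field s ω' ∂timeMeasure :=
    setIntegral_congr_fun measurableSet_Iic fun s hs => by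
      rw [mart_congr_path ν e.field fun r hr => h r (hr.trans hs)]
  unfold ou
  rw [h1, mart_congr_path ν e.field h]
  classical exact if_congr (inL2H_congr_path h) rfl rfl

lemma zProc_congr_path (ν : ℝ) (x : H) {t : ℝ≥0} {ω ω' : PathSpace} (h : ∀ s ≤ t, ω s = ω' s) :
    zProc ν x ω t = zProc ν x ω' t := by
  funext e
  rw [zProc, zProc, ou_congr_path ν h]

lemma vProc_congr_path (ν : ℝ) (x : H) {t : ℝ≥0} {ω ω' : PathSpace} (h : ∀ s ≤ t, ω s = ω' s) :
    vProc ν x ω t = vProc ν x ω' t := by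
  funext e
  rw [vProc, vProc, zProc_congr_path ν x h, h t le_rfl]

lemma energy_congr (ν : ℝ) {v v' z z' : ℝ≥0 → Distr} {t : ℝ≥0} (hv : ∀ s ≤ t, v s = v' s)
    (hz : ∀ s ≤ t, z s = z' s) : energy ν v z t = energy ν v' z' t := by
  have h1 : TrilinearIntegrable v z t ↔ TrilinearIntegrable v' z' t := by
    refine and_congr (Filter.eventually_congr ?_) (integrableOn_congr_fun (fun s hs => ?_)
      measurableSet_Iic)
    · filter_upwards [ae_restrict_mem measurableSet_Iic] with s hs
      rw [hv s hs, hz s hs]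
    · rw [hv s hs, hz s hs]
  have h2 : ∫⁻ r in Set.Iic t, normV (v r) ^ 2 ∂timeMeasure
      = ∫⁻ r in Set.Iic t, normV (v' r) ^ 2 ∂timeMeasure :=
    setLIntegral_congr_fun measurableSet_Iic fun s hs => by rw [hv s hs]
  have h3 : ∫ r in Set.Iic t, trilinear (z r) (v r) ∂timeMeasure
      = ∫ r in Set.Iic t, trilinear (z' r) (v' r) ∂timeMeasure :=
    setIntegral_congr_fun measurableSet_Iic fun s hs => by rw [hv s hs, hz s hs]
  unfold energy
  rw [h2, h3, hv t le_rfl]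
  classical exact if_congr h1 rfl rfl

lemma energyAt_congr_path (ν : ℝ) (x : H) {t : ℝ≥0} {ω ω' : PathSpace}
    (h : ∀ s ≤ t, ω s = ω' s) : energyAt ν x t ω = energyAt ν x t ω' :=
  energy_congr ν (fun _ hs => vProc_congr_path ν x fun r hr => h r (hr.trans hs))
    fun _ hs => zProc_congr_path ν x fun r hr => h r (hr.trans hs)

/-- The path stopped at the time `t`. -/
def stopPath (t : ℝ≥0) (ω : PathSpace) : PathSpace :=
  ω.comp ⟨fun s => min s t, continuous_id.min continuous_const⟩

lemma stopPath_apply (t : ℝ≥0) (ω : PathSpace) (s : ℝ≥0) : stopPath t ω s = ω (min s t) := rfl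

lemma energyAt_stopPath (ν : ℝ) (x : H) {s t : ℝ≥0} (h : s ≤ t) (ω : PathSpace) :
    energyAt ν x s (stopPath t ω) = energyAt ν x s ω :=
  energyAt_congr_path ν x fun r hr => by rw [stopPath_apply, min_eq_left (hr.trans h)]

lemma continuous_pair_left (φ : testField) : Continuous fun u : DomADual => pair u φ :=
  (ContinuousLinearMap.apply ℝ ℝ (show DomA from φ)).continuous

lemma measurable_eval_canonical {s t : ℝ≥0} (h : s ≤ t) :
    Measurable[canonicalFiltration t] fun ω : PathSpace => ω s :=
  Measurable.of_comap_le (le_iSup₂_of_le (f := fun s (_ : s ≤ t) =>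
    MeasurableSpace.comap (fun ω : PathSpace => ω s) inferInstance) s h le_rfl)

lemma measurablePaths_stopPath (t : ℝ≥0) :
    @MeasurablePaths PathSpace (canonicalFiltration t) (stopPath t) := fun s φ =>
  (continuous_pair_left φ).measurable.comp (measurable_eval_canonical (min_le_right s t))

lemma measurablePaths_id : MeasurablePaths (fun ω : PathSpace => ω) := fun s φ =>
  ((continuous_pair_left φ).comp (ContinuousEvalConst.continuous_eval_const s)).measurable

lemma measurableSet_ae_time {X : Type*} [MeasurableSpace X] {S : Set (ℝ≥0 × X)}
    (hS : MeasurableSet S) : MeasurableSet {x | ∀ᵐ s ∂timeMeasure, (s, x) ∈ S} := by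
  have h1 := measurable_measure_prodMk_right (μ := timeMeasure) hS.compl
  exact h1 (measurableSet_singleton 0)

section Generic

variable {X : Type*} [MeasurableSpace X] {Y : X → PathSpace}

lemma MeasurablePaths.energyAt_time (hY : MeasurablePaths Y) (ν : ℝ) (x : H) (t : ℝ≥0) :
    Measurable fun y => NavierStokes.energyAt ν x t (Y y) := by
  have := (hY.energyAt ν x).comp
    (measurable_const.prodMk measurable_id : Measurable fun y => (t, y))
  simpa only [Function.comp_def] using this

lemma MeasurablePaths.energyAt_Iic (hY : MeasurablePaths Y) (ν : ℝ) (x : H) (t : ℝ≥0) :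
    StronglyMeasurable fun q : Set.Iic t × X => NavierStokes.energyAt ν x q.1 (Y q.2) := by
  have := (hY.energyAt ν x).comp
    ((measurable_subtype_coe.comp measurable_fst).prodMk measurable_snd :
    Measurable fun q : Set.Iic t × X => ((q.1 : ℝ≥0), q.2))
  refine Measurable.stronglyMeasurable ?_
  simpa only [Function.comp_def] using this

lemma MeasurablePaths.measurableSet_between (hY : MeasurablePaths Y) (ν : ℝ) (x : H)
    (s t : ℝ≥0) :
    MeasurableSet {y | NavierStokes.energyAt ν x t (Y y) ≤ NavierStokes.energyAt ν x s (Y y)} :=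
  measurableSet_le (hY.energyAt_time ν x t) (hY.energyAt_time ν x s)

lemma MeasurablePaths.measurableSet_upTo (hY : MeasurablePaths Y) (ν : ℝ) (x : H) (t : ℝ≥0) :
    MeasurableSet {y | ∀ᵐ s ∂timeMeasure, s ≤ t →
      NavierStokes.energyAt ν x t (Y y) ≤ NavierStokes.energyAt ν x s (Y y)} := by
  have h2 : Measurable fun q : ℝ≥0 × X => NavierStokes.energyAt ν x t (Y q.2) := by
    have := (hY.energyAt_time ν x t).comp (measurable_snd : Measurable fun q : ℝ≥0 × X => q.2)
    simpa only [Function.comp_def] using this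
  have h3 : MeasurableSet {q : ℝ≥0 × X | q.1 ≤ t →
      NavierStokes.energyAt ν x t (Y q.2) ≤ NavierStokes.energyAt ν x q.1 (Y q.2)} :=
    (measurableSet_le measurable_fst measurable_const).imp (measurableSet_le h2 (hY.energyAt ν x))
  exact measurableSet_ae_time h3

end Generic

/-- The energy is progressively measurable. -/
theorem isStronglyProgressive_energyAt (ν : ℝ) (x : H) :
    IsStronglyProgressive canonicalFiltration (energyAt ν x) := by
  intro t
  have h1 := @MeasurablePaths.energyAt_Iic PathSpace (canonicalFiltration t) _
    (measurablePaths_stopPath t) ν x t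
  have h2 : (fun q : Set.Iic t × PathSpace => energyAt ν x q.1 (stopPath t q.2))
      = fun q => energyAt ν x q.1 q.2 := funext fun q => energyAt_stopPath ν x q.1.2 q.2
  rwa [h2] at h1

theorem measurableSet_energySetBetween (ν : ℝ) (x : H) {s t : ℝ≥0} (h : s ≤ t) :
    MeasurableSet[canonicalFiltration t] (energySetBetween ν x s t) := by
  have h1 := @MeasurablePaths.measurableSet_between PathSpace (canonicalFiltration t) _
    (measurablePaths_stopPath t) ν x s t
  simp only [energyAt_stopPath ν x h, energyAt_stopPath ν x le_rfl] at h1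
  exact h1

theorem measurableSet_energySetUpTo (ν : ℝ) (x : H) (t : ℝ≥0) :
    MeasurableSet[canonicalFiltration t] (energySetUpTo ν x t) := by
  have h1 := @MeasurablePaths.measurableSet_upTo PathSpace (canonicalFiltration t) _
    (measurablePaths_stopPath t) ν x t
  have h2 : {ω | ∀ᵐ s ∂timeMeasure, s ≤ t →
      energyAt ν x t (stopPath t ω) ≤ energyAt ν x s (stopPath t ω)}
      = {ω | ∀ᵐ s ∂timeMeasure, s ≤ t → energyAt ν x t ω ≤ energyAt ν x s ω} := by
    ext ω
    simp only [Set.mem_ofPred_eq]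
    refine Filter.eventually_congr (Filter.Eventually.of_forall fun s => ?_)
    refine forall_congr' fun hs => ?_
    rw [energyAt_stopPath ν x hs, energyAt_stopPath ν x le_rfl]
  rw [h2] at h1
  exact MeasurableSet.inter (measurableSet_energySetBetween ν x zero_le) h1

lemma measurable_timeLIntegral_path {X : Type*} [MeasurableSpace X] {f : ℝ≥0 × X → ℝ≥0∞}
    (hf : Measurable f) (t : ℝ≥0) :
    Measurable fun x => ∫⁻ s in Set.Iic t, f (s, x) ∂timeMeasure :=
  (measurable_timeLIntegral hf).comp
    (measurable_const.prodMk measurable_id : Measurable fun x => (t, x))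

lemma essSup_lt_top_iff {α : Type*} [MeasurableSpace α] {μ : Measure α} (f : α → ℝ≥0∞) :
    essSup f μ < ⊤ ↔ ∃ N : ℕ, ∀ᵐ x ∂μ, f x ≤ N := by
  constructor
  · intro h
    obtain ⟨N, hN⟩ := ENNReal.exists_nat_gt h.ne
    exact ⟨N, (ENNReal.ae_le_essSup f).mono fun x hx => hx.trans hN.le⟩
  · rintro ⟨N, hN⟩
    exact (essSup_le_of_ae_le _ hN).trans_lt (ENNReal.natCast_lt_top N)

lemma forall_nnreal_iff_nat {p : ℝ≥0 → Prop} (hp : ∀ s t, s ≤ t → p t → p s) :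
    (∀ t, p t) ↔ ∀ n : ℕ, p n :=
  ⟨fun h n => h n, fun h t => by
    obtain ⟨n, hn⟩ := exists_nat_ge t
    exact hp _ _ hn (h n)⟩

lemma isEnergyClass_iff (v : ℝ≥0 → Distr) : IsEnergyClass v ↔ ∀ n : ℕ,
    (∃ N : ℕ, ∀ᵐ t ∂timeMeasure, t ≤ (n : ℝ≥0) → normH (v t) ≤ N) ∧
    ∫⁻ t in Set.Iic (n : ℝ≥0), normV (v t) ^ 2 ∂timeMeasure < ⊤ := by
  rw [IsEnergyClass, forall_nnreal_iff_nat]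
  · refine forall_congr' fun n => and_congr_left fun _ => ?_
    rw [essSup_lt_top_iff]
    exact exists_congr fun N => ae_restrict_iff' measurableSet_Iic
  · rintro s t hst ⟨h1, h2⟩
    exact ⟨(essSup_mono_measure (Measure.restrict_mono_set _
      (Set.Iic_subset_Iic.2 hst)).absolutelyContinuous).trans_lt h1,
      (lintegral_mono_set (Set.Iic_subset_Iic.2 hst)).trans_lt h2⟩

lemma measurableSet_isEnergyClass (ν : ℝ) :
    MeasurableSet {ω | IsEnergyClass (vProc ν 0 ω)} := by
  have hv := measurablePaths_id.vProc ν 0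
  simp only [isEnergyClass_iff, Set.ofPred_forall, Set.ofPred_and, Set.ofPred_exists]
  refine MeasurableSet.iInter fun n => MeasurableSet.inter ?_ ?_
  · refine MeasurableSet.iUnion fun N => ?_
    have h1 : MeasurableSet {q : ℝ≥0 × PathSpace | q.1 ≤ (n : ℝ≥0) →
        normH (vProc ν 0 q.2 q.1) ≤ N} :=
      (measurableSet_le measurable_fst measurable_const).imp
        (measurableSet_le hv.normH measurable_const)
    exact measurableSet_ae_time h1
  · exact measurableSet_lt (measurable_timeLIntegral_path hv.normV_sq n) measurable_const

lemma measurableSet_regularSet (ν : ℝ) : MeasurableSet (regularSet ν) := by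
  have h1 : {ω : PathSpace | ∀ T : ℝ≥0,
      ∫⁻ t in Set.Iic T, normL4 (zProc ν 0 ω t) ^ 8 ∂timeMeasure < ⊤}
      = ⋂ n : ℕ, {ω | ∫⁻ t in Set.Iic (n : ℝ≥0),
        normL4 (zProc ν 0 ω t) ^ 8 ∂timeMeasure < ⊤} := by
    ext ω
    simp only [Set.mem_iInter, Set.mem_ofPred_eq]
    exact forall_nnreal_iff_nat fun s t hst h =>
      (lintegral_mono_set (Set.Iic_subset_Iic.2 hst)).trans_lt h
  rw [regularSet, Set.ofPred_and, h1]
  refine MeasurableSet.inter ?_ (measurableSet_isEnergyClass ν)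
  exact MeasurableSet.iInter fun n => measurableSet_lt
    (measurable_timeLIntegral_path ((measurablePaths_id.zProc ν 0).normL4.pow_const 8) n)
    measurable_const

/-! ### Regular paths and lower semicontinuity of the energy -/

lemma dualHNorm_le_add (ν : ℝ) (x : H) (ω : PathSpace) (t : ℝ≥0) :
    dualHNorm (ω t) ≤ normH (zProc ν x ω t) + normH (vProc ν x ω t) := by
  by_cases hz : normH (zProc ν x ω t) < ⊤
  · by_cases hv : normH (vProc ν x ω t) < ⊤
    · obtain ⟨h, hh⟩ := exists_represents_of_normH_lt hz
      obtain ⟨g, hg⟩ := exists_represents_of_normH_lt hv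
      have h1 : embed (h + g) = ω t := (embed_eq_iff _ _).2 fun n => by
        rw [coef_add, ← represents_coef hh, ← represents_coef hg]
        simp [vProc, modeEigen]
      rw [← h1, dualHNorm_embed, normH_eq hh, normH_eq hg]
      exact enorm_add_le _ _
    · rw [not_lt_top_iff.1 hv]; simp
  · rw [not_lt_top_iff.1 hz]; simp

/-- The constant in the embedding of `L⁴` in `L²` on the periodicity cell. -/
lemma exists_normH_le_normL4 : ∃ C : ℝ≥0, ∀ T, normH T ≤ C * normL4 T := by
  have hfin : cellMeasure Set.univ ^ (1 / (2 : ℝ≥0∞).toReal - 1 / (4 : ℝ≥0∞).toReal) ≠ ⊤ :=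
    ENNReal.rpow_ne_top_of_nonneg (by norm_num) (measure_ne_top _ _)
  refine ⟨(cellMeasure Set.univ ^ (1 / (2 : ℝ≥0∞).toReal - 1 / (4 : ℝ≥0∞).toReal)).toNNReal,
    fun T => ?_⟩
  rw [ENNReal.coe_toNNReal hfin]
  by_cases hT : normL4 T < ⊤
  · obtain ⟨h, hh⟩ := exists_represents_of_normL4_lt hT
    rw [normH_eq hh, normL4_eq hh, mul_comm]
    have := eLpNorm_le_eLpNorm_mul_rpow_measure_univ (p := 2) (q := 4) (μ := cellMeasure)
      (by norm_num) (Lp.aestronglyMeasurable (h : L2Vec))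
    rwa [← Lp.enorm_def] at this
  · rw [not_lt_top_iff.1 hT, ENNReal.mul_top]
    · exact le_top
    · have : cellMeasure Set.univ ≠ 0 := by
        intro h0
        have h1 := cellMeasure_univ
        rw [Measure.real, h0, ENNReal.toReal_zero] at h1
        exact cellVolume_pos.ne h1
      exact (ENNReal.rpow_pos (pos_iff_ne_zero.2 this) (measure_ne_top _ _)).ne'

lemma IsEnergyClass.lintegral_normH_sq_lt {v : ℝ≥0 → Distr} (hv : IsEnergyClass v) (t : ℝ≥0) :
    ∫⁻ s in Set.Iic t, normH (v s) ^ 2 ∂timeMeasure < ⊤ := by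
  have h1 := (hv t).1
  have h2 : ∫⁻ s in Set.Iic t, normH (v s) ^ 2 ∂timeMeasure
      ≤ ∫⁻ _ in Set.Iic t, essSup (fun s => normH (v s)) (timeMeasure.restrict (Set.Iic t)) ^ 2
        ∂timeMeasure := by
    refine lintegral_mono_ae ?_
    filter_upwards [ENNReal.ae_le_essSup (μ := timeMeasure.restrict (Set.Iic t))
      (fun s => normH (v s))] with s hs
    gcongr
  refine h2.trans_lt ?_
  rw [lintegral_const]
  exact ENNReal.mul_lt_top (ENNReal.pow_lt_top h1) (measure_lt_top _ _)

lemma pow_le_one_add_pow (a : ℝ≥0∞) {m n : ℕ} (h : m ≤ n) : a ^ m ≤ 1 + a ^ n := by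
  rcases le_total a 1 with ha | ha
  · exact (pow_le_one' ha m).trans le_self_add
  · exact (pow_le_pow_right₀ ha h).trans le_add_self

/-- Regular paths are locally square integrable with values in `H`. -/
lemma inL2H_of_mem_regularSet {ν : ℝ} {ω : PathSpace} (h : ω ∈ regularSet ν) (t : ℝ≥0) :
    InL2H ω t := by
  obtain ⟨C, hC⟩ := exists_normH_le_normL4
  have hz := (measurablePaths_id.zProc ν 0).normL4
  have hv := (measurablePaths_id.vProc ν 0).normH
  have hs : Measurable fun s : ℝ≥0 => (s, ω) := measurable_id.prodMk measurable_const
  have hz' : Measurable fun s => normL4 (zProc ν 0 ω s) := by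
    have := hz.comp hs; simpa only [Function.comp_def] using this
  have hv' : Measurable fun s => normH (vProc ν 0 ω s) := by
    have := hv.comp hs; simpa only [Function.comp_def] using this
  have h1 : ∀ s, dualHNorm (ω s) ^ 2 ≤ 4 * (C ^ 2 * (1 + normL4 (zProc ν 0 ω s) ^ 8))
      + 4 * normH (vProc ν 0 ω s) ^ 2 := by
    intro s
    calc dualHNorm (ω s) ^ 2 ≤ (C * normL4 (zProc ν 0 ω s) + normH (vProc ν 0 ω s)) ^ 2 := by
          gcongr
          exact (dualHNorm_le_add ν 0 ω s).trans (add_le_add_left (hC _) _)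
      _ ≤ (2 * max (C * normL4 (zProc ν 0 ω s)) (normH (vProc ν 0 ω s))) ^ 2 := by
          gcongr
          rw [two_mul]
          exact add_le_add (le_max_left _ _) (le_max_right _ _)
      _ = 4 * max (C * normL4 (zProc ν 0 ω s)) (normH (vProc ν 0 ω s)) ^ 2 := by
          rw [mul_pow]; norm_num
      _ ≤ 4 * ((C * normL4 (zProc ν 0 ω s)) ^ 2 + normH (vProc ν 0 ω s) ^ 2) := by
          gcongr
          rcases le_total (C * normL4 (zProc ν 0 ω s)) (normH (vProc ν 0 ω s)) with h | h
          · rw [max_eq_right h]; exact le_add_self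
          · rw [max_eq_left h]; exact le_self_add
      _ ≤ _ := by
          rw [mul_add, mul_pow]
          gcongr
          exact pow_le_one_add_pow _ (by norm_num)
  refine (lintegral_mono h1).trans_lt ?_
  rw [lintegral_add_left (by fun_prop), lintegral_const_mul _ (by fun_prop),
    lintegral_const_mul _ (by fun_prop), lintegral_const_mul _ (by fun_prop),
    lintegral_add_left measurable_const]
  refine ENNReal.add_lt_top.2 ⟨ENNReal.mul_lt_top (by norm_num) (ENNReal.mul_lt_top
    (ENNReal.pow_lt_top ENNReal.coe_lt_top) (ENNReal.add_lt_top.2 ⟨?_, h.1 t⟩)),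
    ENNReal.mul_lt_top (by norm_num) (h.2.lintegral_normH_sq_lt t)⟩
  rw [lintegral_const]
  exact ENNReal.mul_lt_top (by norm_num) (measure_lt_top _ _)

lemma setIntegral_heat_eq (κ c : ℝ) (f : ℝ≥0 → ℝ) (t : ℝ≥0) :
    ∫ s in Set.Iic t, c * Real.exp (-(κ * ((t : ℝ) - s))) * f s ∂timeMeasure
      = c * Real.exp (-(κ * t)) * ∫ s in Set.Iic t, Real.exp (κ * s) * f s ∂timeMeasure := by
  rw [← integral_const_mul]
  refine integral_congr_ae (Filter.Eventually.of_forall fun s => ?_)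
  have : Real.exp (-(κ * ((t : ℝ) - s))) = Real.exp (-(κ * t)) * Real.exp (κ * s) := by
    rw [← Real.exp_add]; ring_nf
  simp only [this]
  ring

lemma ou_eq (ν : ℝ) {t : ℝ≥0} {ω : PathSpace} (h : InL2H ω t) (n : Mode) :
    ou ν t ω (modeEigen n) = mart ν (modeField n) t ω - ν * (lam n * Real.exp (-(ν * lam n * t)) *
      ∫ s in Set.Iic t, Real.exp (ν * lam n * s) * mart ν (modeField n) s ω ∂timeMeasure) := by
  rw [← setIntegral_heat_eq]
  exact if_pos h

lemma continuous_ou (ν : ℝ) {ω : PathSpace} (h : ∀ t, InL2H ω t) (n : Mode) :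
    Continuous fun t => ou ν t ω (modeEigen n) := by
  simp only [ou_eq ν (h _)]
  have hm := continuous_mart ν (modeField n) h
  refine hm.sub (continuous_const.mul ((Continuous.mul (by fun_prop)
    (continuous_setIntegral_Iic fun t => ?_))))
  exact integrableOn_Iic_of_continuousOn (Continuous.continuousOn (by fun_prop))

lemma continuous_zProc (ν : ℝ) (x : H) {ω : PathSpace} (h : ∀ t, InL2H ω t) (n : Mode) :
    Continuous fun t => zProc ν x ω t (modeEigen n) :=
  (continuous_ou ν h n).add (by fun_prop)

lemma continuous_vProc (ν : ℝ) (x : H) {ω : PathSpace} (h : ∀ t, InL2H ω t) (n : Mode) :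
    Continuous fun t => vProc ν x ω t (modeEigen n) :=
  (continuous_pair_path ω _).sub (continuous_zProc ν x h n)

lemma lowerSemicontinuous_normH_sq {T : ℝ≥0 → Distr} (hT : ∀ t, IsSpectral (T t))
    (hc : ∀ n, Continuous fun t => T t (modeEigen n)) :
    LowerSemicontinuous fun t => normH (T t) ^ 2 := by
  simp only [normH_sq (hT _)]
  exact lowerSemicontinuous_tsum fun n =>
    (ENNReal.continuous_ofReal.comp ((hc n).pow 2)).lowerSemicontinuous

lemma TrilinearIntegrable.mono {v z : ℝ≥0 → Distr} {s t : ℝ≥0} (h : TrilinearIntegrable v z t)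
    (hs : s ≤ t) : TrilinearIntegrable v z s :=
  ⟨ae_mono (Measure.restrict_mono_set _ (Set.Iic_subset_Iic.2 hs)) h.1,
    h.2.mono_set (Set.Iic_subset_Iic.2 hs)⟩

/-- The part of the energy that has a sign. -/
def posEnergy (ν : ℝ) (v : ℝ≥0 → Distr) (t : ℝ≥0) : ℝ≥0∞ :=
  2⁻¹ * normH (v t) ^ 2 + ENNReal.ofReal ν * ∫⁻ r in Set.Iic t, normV (v r) ^ 2 ∂timeMeasure

lemma energy_eq_of_integrable (ν : ℝ) {v z : ℝ≥0 → Distr} {t : ℝ≥0}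
    (h : TrilinearIntegrable v z t) : energy ν v z t
      = (posEnergy ν v t : EReal) - ((∫ r in Set.Iic t, trilinear (z r) (v r) ∂timeMeasure : ℝ)) :=
  if_pos h

lemma trilinearIntegrable_of_energy_lt {ν : ℝ} {v z : ℝ≥0 → Distr} {t : ℝ≥0}
    (h : energy ν v z t < ⊤) : TrilinearIntegrable v z t := by
  by_contra hc
  exact h.ne (if_neg hc)

lemma energy_le_coe_iff {ν : ℝ} {v z : ℝ≥0 → Distr} {t : ℝ≥0} (h : TrilinearIntegrable v z t)
    (c : ℝ) : energy ν v z t ≤ c ↔ (posEnergy ν v t : EReal)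
      ≤ ((c + ∫ r in Set.Iic t, trilinear (z r) (v r) ∂timeMeasure : ℝ) : EReal) := by
  rw [energy_eq_of_integrable ν h, EReal.sub_le_iff_le_add (Or.inl (EReal.coe_ne_bot _))
    (Or.inl (EReal.coe_ne_top _)), EReal.coe_add]

lemma bot_lt_energy (ν : ℝ) (v z : ℝ≥0 → Distr) (t : ℝ≥0) : ⊥ < energy ν v z t := by
  by_cases h : TrilinearIntegrable v z t
  · rw [energy_eq_of_integrable ν h, sub_eq_add_neg, ← EReal.coe_neg, bot_lt_iff_ne_bot, ne_eq,
      EReal.add_eq_bot_iff, not_or]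
    exact ⟨EReal.coe_ennreal_ne_bot _, EReal.coe_ne_bot _⟩
  · rw [energy, if_neg h]; exact bot_lt_top

/-- The energy is lower semicontinuous from the right. -/
lemma energy_le_of_frequently {ν : ℝ} {v z : ℝ≥0 → Distr} (hv : ∀ t, IsSpectral (v t))
    (hc : ∀ n, Continuous fun t => v t (modeEigen n)) {t : ℝ≥0} {c : EReal}
    (h : ∃ᶠ q in nhdsWithin t (Set.Ioi t), energy ν v z q ≤ c) : energy ν v z t ≤ c := by
  induction c using EReal.rec with
  | bot =>
    obtain ⟨q, hq⟩ := h.exists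
    exact absurd hq (not_le.2 (bot_lt_energy ν v z q))
  | top => exact le_top
  | coe c =>
    obtain ⟨q₀, hq₀, htq⟩ := (h.and_eventually self_mem_nhdsWithin).exists
    have hi₀ : TrilinearIntegrable v z q₀ :=
      trilinearIntegrable_of_energy_lt (hq₀.trans_lt (EReal.coe_lt_top c))
    have htq' : t < q₀ := htq
    rw [energy_le_coe_iff (hi₀.mono htq'.le)]
    by_contra hlt
    rw [not_le] at hlt
    obtain ⟨d, hd1, hd2⟩ := EReal.lt_iff_exists_real_btwn.1 hlt
    set B : ℝ≥0∞ := ENNReal.ofReal ν * ∫⁻ r in Set.Iic t, normV (v r) ^ 2 ∂timeMeasure with hB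
    have hlsc : LowerSemicontinuous fun q => 2⁻¹ * normH (v q) ^ 2 + B := by
      refine LowerSemicontinuous.add ?_ lowerSemicontinuous_const
      exact (ENNReal.continuous_const_mul (by norm_num)).comp_lowerSemicontinuous
        (lowerSemicontinuous_normH_sq hv hc) fun a b hab => mul_le_mul_right hab _
    have hlsc' : LowerSemicontinuous fun q => ((2⁻¹ * normH (v q) ^ 2 + B : ℝ≥0∞) : EReal) :=
      continuous_coe_ennreal_ereal.comp_lowerSemicontinuous hlsc
        fun a b hab => EReal.coe_ennreal_le_coe_ennreal_iff.2 hab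
    have h1 : ∀ᶠ q in nhdsWithin t (Set.Ioi t),
        (d : EReal) < ((2⁻¹ * normH (v q) ^ 2 + B : ℝ≥0∞) : EReal) :=
      nhdsWithin_le_nhds (hlsc' t d hd2)
    have h2 : ContinuousAt (fun q => c + ∫ r in Set.Iic q, trilinear (z r) (v r) ∂timeMeasure) t :=
      continuousAt_const.add ((continuousOn_setIntegral_Iic hi₀.2).continuousAt
        (Iic_mem_nhds htq'))
    have h3 : ∀ᶠ q in nhdsWithin t (Set.Ioi t),
        c + ∫ r in Set.Iic q, trilinear (z r) (v r) ∂timeMeasure < d :=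
      nhdsWithin_le_nhds (h2.eventually_lt continuousAt_const (EReal.coe_lt_coe_iff.1 hd1))
    obtain ⟨q, hq, hq1, hq3, hqt⟩ :=
      (h.and_eventually (h1.and (h3.and self_mem_nhdsWithin))).exists
    have hqt' : t < q := hqt
    have hi : TrilinearIntegrable v z q :=
      trilinearIntegrable_of_energy_lt (hq.trans_lt (EReal.coe_lt_top c))
    rw [energy_le_coe_iff hi] at hq
    have h4 : ((2⁻¹ * normH (v q) ^ 2 + B : ℝ≥0∞) : EReal) ≤ (posEnergy ν v q : EReal) := by
      refine EReal.coe_ennreal_le_coe_ennreal_iff.2 (add_le_add_right ?_ _)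
      exact mul_le_mul_right (lintegral_mono_set (Set.Iic_subset_Iic.2 hqt'.le)) _
    exact absurd ((hq1.trans_le h4).trans_le (hq.trans (EReal.coe_lt_coe_iff.2 hq3).le))
      (lt_irrefl _)

/-- It suffices to check the energy inequality at a dense set of later times. -/
lemma energyAt_le_of_dense {ν : ℝ} {x : H} {ω : PathSpace} (h : ∀ t, InL2H ω t) {s t : ℝ≥0}
    (hst : s ≤ t) {D : Set ℝ≥0} (hD : Dense D)
    (hq : ∀ q ∈ D, s ≤ q → energyAt ν x q ω ≤ energyAt ν x s ω) :
    energyAt ν x t ω ≤ energyAt ν x s ω := by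
  refine energy_le_of_frequently (isSpectral_vProc ν x ω) (continuous_vProc ν x h) ?_
  rw [(nhdsGT_basis t).frequently_iff]
  intro b hb
  obtain ⟨q, hq1, hq2⟩ := hD.exists_mem_open isOpen_Ioo (Set.nonempty_Ioo.2 hb)
  exact ⟨q, hq2, hq q hq1 (hst.trans hq2.1.le)⟩

lemma measurableSet_energyAt_le_of_le (ν : ℝ) (x : H) (q : ℝ≥0) :
    MeasurableSet {p : ℝ≥0 × PathSpace |
      p.1 ≤ q → energyAt ν x q p.2 ≤ energyAt ν x p.1 p.2} := by
  have h : Measurable fun p : ℝ≥0 × PathSpace => energyAt ν x q p.2 := by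
    have := (measurablePaths_id.energyAt_time ν x q).comp
      (measurable_snd : Measurable fun p : ℝ≥0 × PathSpace => p.2)
    simpa only [Function.comp_def] using this
  exact (measurableSet_le measurable_fst measurable_const).imp
    (measurableSet_le h (measurablePaths_id.energyAt ν x))

theorem measurableSet_energySet (ν : ℝ) (x : H) : MeasurableSet (energySet ν x) := by
  set D : Set ℝ≥0 := Set.range (TopologicalSpace.denseSeq ℝ≥0) with hD
  have hDd : Dense D := TopologicalSpace.denseRange_denseSeq ℝ≥0
  have hDc : D.Countable := Set.countable_range _
  have hEt := fun t => measurablePaths_id.energyAt_time ν x t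
  have heq : energySet ν x = regularSet ν ∩ ((⋂ q ∈ D, {ω | energyAt ν x q ω ≤ energyAt ν x 0 ω})
      ∩ {ω | ∀ᵐ s ∂timeMeasure, (s, ω) ∈ ⋂ q ∈ D, {p : ℝ≥0 × PathSpace | p.1 ≤ q →
        energyAt ν x q p.2 ≤ energyAt ν x p.1 p.2}}) := by
    ext ω
    refine and_congr_right fun hω => ?_
    have hL := inL2H_of_mem_regularSet hω
    simp only [Set.mem_ofPred_eq, Set.mem_inter_iff, Set.mem_iInter]
    refine and_congr ⟨fun h q _ => h q, fun h t =>
      energyAt_le_of_dense hL zero_le hDd fun q hq _ => h q hq⟩ ?_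
    exact Filter.eventually_congr (Filter.Eventually.of_forall fun s =>
      ⟨fun h q _ => h q, fun h t hst => energyAt_le_of_dense hL hst hDd h⟩)
  rw [heq]
  refine (measurableSet_regularSet ν).inter (MeasurableSet.inter
    (MeasurableSet.biInter hDc fun q _ => measurableSet_le (hEt q) (hEt 0))
    (measurableSet_ae_time (MeasurableSet.biInter hDc fun q _ =>
      measurableSet_energyAt_le_of_le ν x q)))

/-! ### A central limit theorem for martingale increments of constant conditional variance -/

section Increments

variable {Ω : Type*} {m : MeasurableSpace Ω} {P : Measure Ω} {𝓖 : Filtration ℕ m}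
  {X : ℕ → Ω → ℝ} {δ : ℝ}

/-- A square integrable discrete martingale starting at `0` whose increments have the constant
conditional variance `δ`. The conditional moments are expressed by integrals against functions of
the past. -/
structure HasConstantVariance (P : Measure Ω) (𝓖 : Filtration ℕ m) (X : ℕ → Ω → ℝ) (δ : ℝ) :
    Prop where
  zero : ∀ ω, X 0 ω = 0
  adapted : ∀ k, StronglyMeasurable[𝓖 k] (X k)
  memLp : ∀ k, MemLp (X k) 2 P
  mean : ∀ k g, StronglyMeasurable[𝓖 k] g → MemLp g 2 P →
    ∫ ω, g ω * (X (k + 1) ω - X k ω) ∂P = 0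
  var : ∀ k g, StronglyMeasurable[𝓖 k] g → (∀ ω, |g ω| ≤ 1) →
    ∫ ω, g ω * (X (k + 1) ω - X k ω) ^ 2 ∂P = δ * ∫ ω, g ω ∂P

lemma measurableSet_abs_gt {m' : MeasurableSpace Ω} {f : Ω → ℝ} (hf : StronglyMeasurable[m'] f)
    (ε : ℝ) : MeasurableSet[m'] {ω | ε < |f ω|} :=
  measurableSet_lt measurable_const hf.measurable.abs

/-- The remainder in the second order expansion of the cosine. -/
lemma abs_cos_add_sub_le (y h : ℝ) :
    |Real.cos (y + h) - (Real.cos y - h * Real.sin y - h ^ 2 / 2 * Real.cos y)| ≤ 3 * h ^ 2 ∧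
    |Real.cos (y + h) - (Real.cos y - h * Real.sin y - h ^ 2 / 2 * Real.cos y)| ≤ 3 * |h| ^ 3 := by
  have h1 : Real.cos (y + h) - (Real.cos y - h * Real.sin y - h ^ 2 / 2 * Real.cos y)
      = Real.cos y * (Real.cos h - (1 - h ^ 2 / 2)) - Real.sin y * (Real.sin h - h) := by
    rw [Real.cos_add]; ring
  have h2 : |Real.cos y * (Real.cos h - (1 - h ^ 2 / 2)) - Real.sin y * (Real.sin h - h)|
      ≤ |Real.cos h - (1 - h ^ 2 / 2)| + |Real.sin h - h| := by
    refine (abs_sub _ _).trans (add_le_add ?_ ?_)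
    · rw [abs_mul]
      exact mul_le_of_le_one_left (abs_nonneg _) (Real.abs_cos_le_one y)
    · rw [abs_mul]
      exact mul_le_of_le_one_left (abs_nonneg _) (Real.abs_sin_le_one y)
  rw [h1]
  have h0 := abs_nonneg h
  have hsq : h ^ 2 = |h| ^ 2 := (sq_abs h).symm
  rcases le_or_gt |h| 1 with hle | hgt
  · have hc := Real.cos_bound hle
    have hs := Real.sin_bound hle
    have h4 : |h| ^ 4 ≤ |h| ^ 3 := pow_le_pow_of_le_one h0 hle (by norm_num)
    have h3 : |h| ^ 3 ≤ |h| ^ 2 := pow_le_pow_of_le_one h0 hle (by norm_num)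
    have h7 : |h| ^ 5 ≤ |h| ^ 3 := pow_le_pow_of_le_one h0 hle (by norm_num)
    have hs' : |Real.sin h - h| ≤ |h| ^ 3 / 6 + |h| ^ 5 / 100 := by
      have : Real.sin h - h = (Real.sin h - (h - h ^ 3 / 6)) - h ^ 3 / 6 := by ring
      rw [this]
      refine (abs_sub _ _).trans ?_
      have h6 : |h ^ 3 / 6| = |h| ^ 3 / 6 := by rw [abs_div, abs_pow]; norm_num
      linarith
    have h5 : 0 ≤ |h| ^ 3 := by positivity
    constructor <;> linarith
  · have h3 : |h| ^ 2 ≤ |h| ^ 3 := pow_le_pow_right₀ hgt.le (by norm_num)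
    have h4 : |h| ≤ |h| ^ 2 := le_self_pow₀ hgt.le (by norm_num)
    have hc : |Real.cos h - (1 - h ^ 2 / 2)| ≤ h ^ 2 / 2 := by
      have := Real.one_sub_sq_div_two_le_cos (x := h)
      have := Real.cos_le_one h
      rw [abs_le]
      constructor <;> nlinarith [sq_nonneg h]
    have hs : |Real.sin h - h| ≤ 2 * |h| := by
      refine (abs_sub _ _).trans ?_
      have := Real.abs_sin_le_one h
      linarith
    constructor <;> nlinarith

lemma abs_one_sub_sub_exp_neg_le {u : ℝ} (hu : 0 ≤ u) : |1 - u - Real.exp (-u)| ≤ u ^ 2 := by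
  rcases le_or_gt u 1 with h | h
  · have := Real.abs_exp_sub_one_sub_id_le (x := -u) (by rw [abs_neg, abs_of_nonneg hu]; exact h)
    rw [abs_sub_comm]
    calc |Real.exp (-u) - (1 - u)| = |Real.exp (-u) - 1 - -u| := by ring_nf
      _ ≤ (-u) ^ 2 := this
      _ = u ^ 2 := by ring
  · have h1 := Real.add_one_le_exp (-u)
    have h2 : Real.exp (-u) ≤ 1 := Real.exp_le_one_iff.2 (by linarith)
    rw [abs_le]
    constructor <;> nlinarith

namespace HasConstantVariance

lemma stronglyMeasurable (hX : HasConstantVariance P 𝓖 X δ) (k : ℕ) :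
    StronglyMeasurable (X k) := (hX.adapted k).mono (𝓖.le k)

lemma memLp_sub (hX : HasConstantVariance P 𝓖 X δ) (k : ℕ) :
    MemLp (fun ω => X (k + 1) ω - X k ω) 2 P :=
  (hX.memLp (k + 1)).sub (hX.memLp k)

lemma integrable_sq_sub (hX : HasConstantVariance P 𝓖 X δ) (k : ℕ) :
    Integrable (fun ω => (X (k + 1) ω - X k ω) ^ 2) P :=
  (hX.memLp_sub k).integrable_sq

lemma integral_indicator_mul_sq (hX : HasConstantVariance P 𝓖 X δ) {k : ℕ} {A : Set Ω}
    (hA : MeasurableSet[𝓖 k] A) :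
    ∫ ω, A.indicator 1 ω * (X (k + 1) ω - X k ω) ^ 2 ∂P = δ * P.real A := by
  rw [hX.var k (A.indicator 1) ((stronglyMeasurable_const (b := (1 : ℝ))).indicator hA) fun ω => by
    by_cases h : ω ∈ A <;> simp [h]]
  rw [integral_indicator_one (𝓖.le k _ hA)]

lemma integral_sq_sub [IsProbabilityMeasure P] (hX : HasConstantVariance P 𝓖 X δ) (k : ℕ) :
    ∫ ω, (X (k + 1) ω - X k ω) ^ 2 ∂P = δ := by
  have h := hX.integral_indicator_mul_sq (k := k) (A := Set.univ) MeasurableSet.univ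
  simpa using h

lemma nonneg [IsProbabilityMeasure P] (hX : HasConstantVariance P 𝓖 X δ) : 0 ≤ δ := by
  rw [← hX.integral_sq_sub 0]
  exact integral_nonneg fun ω => sq_nonneg _

lemma integral_sq [IsProbabilityMeasure P] (hX : HasConstantVariance P 𝓖 X δ) (k : ℕ) :
    ∫ ω, X k ω ^ 2 ∂P = k * δ := by
  induction k with
  | zero => simp [hX.zero]
  | succ k ih =>
    have h1 : ∀ ω, X (k + 1) ω ^ 2 = X k ω ^ 2 + 2 * (X k ω * (X (k + 1) ω - X k ω))
        + (X (k + 1) ω - X k ω) ^ 2 := fun ω => by ring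
    have h2 : Integrable (fun ω => X k ω * (X (k + 1) ω - X k ω)) P :=
      (hX.memLp k).integrable_mul (hX.memLp_sub k)
    simp only [h1]
    rw [integral_add ((hX.memLp k).integrable_sq.fun_add (h2.const_mul 2)) (hX.integrable_sq_sub k),
      integral_add (hX.memLp k).integrable_sq (h2.const_mul 2), integral_const_mul,
      hX.mean k _ (hX.adapted k) (hX.memLp k), ih, hX.integral_sq_sub]
    push_cast; ring

lemma measureReal_gt_le [IsProbabilityMeasure P] (hX : HasConstantVariance P 𝓖 X δ) (k : ℕ)
    {K : ℝ} (hK : 0 < K) :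
    P.real {ω | K < |X k ω|} ≤ k * δ / K ^ 2 := by
  have hm : MeasurableSet {ω | K < |X k ω|} :=
    measurableSet_lt measurable_const (hX.stronglyMeasurable k).measurable.abs
  rw [le_div_iff₀ (by positivity), ← hX.integral_sq k, ← integral_indicator_one hm,
    ← integral_mul_const]
  refine integral_mono (((integrable_const (1 : ℝ)).indicator hm).mul_const _)
    (hX.memLp k).integrable_sq fun ω => ?_
  by_cases h : ω ∈ {ω | K < |X k ω|}
  · simp only [Set.indicator_of_mem h, Pi.one_apply, one_mul]
    rw [← sq_abs (X k ω)]
    exact pow_le_pow_left₀ hK.le (le_of_lt h) 2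
  · simp only [Set.indicator_of_notMem h, zero_mul]
    positivity

end HasConstantVariance

/-- The part of a real number beyond the interval `[-K, K]`. -/
def excess (K x : ℝ) : ℝ := x - max (-K) (min x K)

lemma continuous_excess (K : ℝ) : Continuous (excess K) := by
  unfold excess; fun_prop

lemma abs_excess_le {K : ℝ} (hK : 0 ≤ K) (x : ℝ) : |excess K x| ≤ |x| := by
  unfold excess
  rcases le_total x K with h | h
  · rw [min_eq_left h]
    rcases le_total (-K) x with h' | h'
    · rw [max_eq_right h']; simp
    · rw [max_eq_left h', abs_of_nonpos (by linarith), abs_of_nonpos (by linarith)]; linarith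
  · rw [min_eq_right h, max_eq_right (by linarith), abs_of_nonneg (by linarith),
      abs_of_nonneg (by linarith)]; linarith

/-- The Bregman divergence of the convex function `excess K ^ 2` is nonnegative, and it controls
the square of the increments from `[-K, K]` to the complement of `[-2K, 2K]`. -/
lemma bregman_excess {K : ℝ} (hK : 0 ≤ K) (a b : ℝ) :
    0 ≤ excess K b ^ 2 - excess K a ^ 2 - 2 * (excess K a * (b - a)) ∧
    (|a| ≤ K → 2 * K < |b| →
      (b - a) ^ 2 ≤ 9 * (excess K b ^ 2 - excess K a ^ 2 - 2 * (excess K a * (b - a)))) := by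
  constructor
  · have h1 : 0 ≤ excess K a * (max (-K) (min a K) - max (-K) (min b K)) := by
      have hb1 : max (-K) (min b K) ≤ K := max_le (by linarith) (min_le_right _ _)
      have hb2 : -K ≤ max (-K) (min b K) := le_max_left _ _
      unfold excess
      rcases le_total a K with h | h
      · rw [min_eq_left h]
        rcases le_total (-K) a with h' | h'
        · rw [max_eq_right h']; simp
        · rw [max_eq_left h']
          exact mul_nonneg_of_nonpos_of_nonpos (by linarith) (by linarith)
      · rw [min_eq_right h, max_eq_right (by linarith : -K ≤ K)]
        exact mul_nonneg (by linarith) (by linarith)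
    have h2 : excess K b ^ 2 - excess K a ^ 2 - 2 * (excess K a * (b - a))
        = (excess K b - excess K a) ^ 2
          + 2 * (excess K a * (max (-K) (min a K) - max (-K) (min b K))) := by
      unfold excess; ring
    rw [h2]
    positivity
  · intro ha hb
    have ha' := abs_le.1 ha
    have h1 : excess K a = 0 := by
      unfold excess
      rw [min_eq_left ha'.2, max_eq_right ha'.1, sub_self]
    rw [h1]
    rcases lt_abs.1 hb with h | h
    · have : excess K b = b - K := by
        unfold excess
        rw [min_eq_right (by linarith), max_eq_right (by linarith)]
      rw [this]
      nlinarith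
    · have : excess K b = b + K := by
        unfold excess
        rw [min_eq_left (by linarith), max_eq_left (by linarith)]; ring
      rw [this]
      nlinarith

namespace HasConstantVariance

lemma memLp_excess [IsProbabilityMeasure P] (hX : HasConstantVariance P 𝓖 X δ) (k : ℕ) {K : ℝ}
    (hK : 0 ≤ K) : MemLp (fun ω => excess K (X k ω)) 2 P :=
  (hX.memLp k).mono ((continuous_excess K).comp_aestronglyMeasurable
    (hX.stronglyMeasurable k).aestronglyMeasurable)
    (Filter.Eventually.of_forall fun ω => by
      simpa only [Real.norm_eq_abs] using abs_excess_le hK (X k ω))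

/-- The Lindeberg condition: the contribution of the large increments is controlled by the
probability that a large increment occurs and by the tail of the last variable. -/
lemma sum_integral_large_le [IsProbabilityMeasure P] (hX : HasConstantVariance P 𝓖 X δ) (N : ℕ)
    {K ε : ℝ} (hK : 0 < K) :
    ∑ k ∈ Finset.range N, ∫ ω, {ω | ε < |X (k + 1) ω - X k ω|}.indicator
        (fun ω => (X (k + 1) ω - X k ω) ^ 2) ω ∂P
      ≤ (N * δ + 9 * K ^ 2) * P.real {ω | ∃ k < N, ε < |X (k + 1) ω - X k ω|}
        + (N * δ) ^ 2 / K ^ 2 + 9 * ∫ ω, excess K (X N ω) ^ 2 ∂P := by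
  -- `J k`: a large increment occurs before time `k`.
  set J : ℕ → Set Ω := fun k => {ω | ∃ j < k, ε < |X (j + 1) ω - X j ω|} with hJ
  have hδ := hX.nonneg
  have hA : ∀ k, MeasurableSet[𝓖 (k + 1)] {ω | ε < |X (k + 1) ω - X k ω|} := fun k =>
    measurableSet_abs_gt ((hX.adapted (k + 1)).sub ((hX.adapted k).mono (𝓖.mono k.le_succ))) ε
  have hJm : ∀ k, MeasurableSet[𝓖 k] (J k) := by
    intro k
    have : J k = ⋃ j ∈ Finset.range k, {ω | ε < |X (j + 1) ω - X j ω|} := by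
      ext ω; simp [hJ]
    rw [this]
    exact Finset.measurableSet_biUnion _ fun j hj =>
      𝓖.mono (Nat.succ_le_of_lt (Finset.mem_range.1 hj)) _ (hA j)
  have hJm' : ∀ k, MeasurableSet (J k) := fun k => 𝓖.le k _ (hJm k)
  have hJmono : ∀ k ≤ N, P.real (J k) ≤ P.real (J N) := fun k hk =>
    measureReal_mono fun ω ⟨j, hj, h⟩ => ⟨j, hj.trans_le hk, h⟩
  have hKm : ∀ k, MeasurableSet[𝓖 k] {ω | K < |X k ω|} := fun k =>
    measurableSet_abs_gt (hX.adapted k) K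
  have hi1 : ∀ (A : Set Ω), MeasurableSet A → Integrable (A.indicator (1 : Ω → ℝ)) P :=
    fun A h => (integrable_const (1 : ℝ)).indicator h
  have hi2 : ∀ k (A : Set Ω), MeasurableSet A →
      Integrable (fun ω => A.indicator 1 ω * (X (k + 1) ω - X k ω) ^ 2) P := fun k A h => by
    refine ((hX.integrable_sq_sub k).indicator h).congr (Filter.Eventually.of_forall fun ω => ?_)
    by_cases hω : ω ∈ A <;> simp [hω]
  have hψ : ∀ k, Integrable (fun ω => excess K (X k ω) ^ 2) P := fun k =>
    (hX.memLp_excess k hK.le).integrable_sq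
  have hψD : ∀ k, Integrable (fun ω => excess K (X k ω) * (X (k + 1) ω - X k ω)) P := fun k =>
    (hX.memLp_excess k hK.le).integrable_mul (hX.memLp_sub k)
  have hterm : ∀ k < N, ∫ ω, {ω | ε < |X (k + 1) ω - X k ω|}.indicator
      (fun ω => (X (k + 1) ω - X k ω) ^ 2) ω ∂P ≤ δ * P.real (J N) + N * δ ^ 2 / K ^ 2
        + 9 * K ^ 2 * (P.real (J (k + 1)) - P.real (J k))
        + 9 * (∫ ω, excess K (X (k + 1) ω) ^ 2 ∂P - ∫ ω, excess K (X k ω) ^ 2 ∂P) := by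
    intro k hk
    -- A large increment comes after another one, or starts beyond `[-K, K]`, or is the first one
    -- and at most `3K`, or leads from `[-K, K]` beyond `[-2K, 2K]`. The first two events are known
    -- at time `k`, and the bounds of the other two telescope in `k`.
    have hpt : ∀ ω, {ω | ε < |X (k + 1) ω - X k ω|}.indicator
        (fun ω => (X (k + 1) ω - X k ω) ^ 2) ω
        ≤ (J k).indicator 1 ω * (X (k + 1) ω - X k ω) ^ 2
          + {ω | K < |X k ω|}.indicator 1 ω * (X (k + 1) ω - X k ω) ^ 2
          + 9 * K ^ 2 * ((J (k + 1)).indicator 1 ω - (J k).indicator 1 ω)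
          + 9 * (excess K (X (k + 1) ω) ^ 2 - excess K (X k ω) ^ 2
            - 2 * (excess K (X k ω) * (X (k + 1) ω - X k ω))) := by
      intro ω
      obtain ⟨hb1, hb2⟩ := bregman_excess hK.le (X k ω) (X (k + 1) ω)
      have hsq := sq_nonneg (X (k + 1) ω - X k ω)
      have hK2 := sq_nonneg K
      by_cases hJk : ω ∈ J k
      · have hJk1 : ω ∈ J (k + 1) := by
          obtain ⟨j, hj, h⟩ := hJk
          exact ⟨j, hj.trans k.lt_succ_self, h⟩
        have h0 : 0 ≤ {ω | K < |X k ω|}.indicator (1 : Ω → ℝ) ω :=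
          Set.indicator_nonneg (fun _ _ => zero_le_one) _
        have h1 := Set.indicator_le_self' (s := {ω | ε < |X (k + 1) ω - X k ω|})
          (f := fun ω => (X (k + 1) ω - X k ω) ^ 2) (fun _ _ => sq_nonneg _) ω
        rw [Set.indicator_of_mem hJk, Set.indicator_of_mem hJk1]
        simp only [Pi.one_apply, one_mul, sub_self, mul_zero, add_zero]
        have := mul_nonneg h0 hsq
        linarith
      · rw [Set.indicator_of_notMem hJk]
        by_cases hε : ε < |X (k + 1) ω - X k ω|
        · have hJk1 : ω ∈ J (k + 1) := ⟨k, k.lt_succ_self, hε⟩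
          rw [Set.indicator_of_mem (show ω ∈ {ω | ε < |X (k + 1) ω - X k ω|} from hε),
            Set.indicator_of_mem hJk1]
          by_cases hKk : K < |X k ω|
          · rw [Set.indicator_of_mem (show ω ∈ {ω | K < |X k ω|} from hKk)]
            simp only [Pi.one_apply]
            linarith
          · rw [Set.indicator_of_notMem (show ω ∉ {ω | K < |X k ω|} from hKk)]
            simp only [Pi.one_apply]
            rw [not_lt] at hKk
            rcases le_or_gt |X (k + 1) ω| (2 * K) with h | h
            · have h3 : |X (k + 1) ω - X k ω| ≤ 3 * K := (abs_sub _ _).trans (by linarith)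
              have h4 := pow_le_pow_left₀ (abs_nonneg _) h3 2
              rw [sq_abs] at h4
              nlinarith
            · have := hb2 hKk h
              linarith
        · have hJk1 : ω ∉ J (k + 1) := by
            rintro ⟨j, hj, h⟩
            rcases Nat.lt_succ_iff_lt_or_eq.1 hj with hj | rfl
            · exact hJk ⟨j, hj, h⟩
            · exact hε h
          have h0 : 0 ≤ {ω | K < |X k ω|}.indicator (1 : Ω → ℝ) ω :=
            Set.indicator_nonneg (fun _ _ => zero_le_one) _
          rw [Set.indicator_of_notMem (show ω ∉ {ω | ε < |X (k + 1) ω - X k ω|} from hε),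
            Set.indicator_of_notMem hJk1]
          have := mul_nonneg h0 hsq
          linarith
    have hia := hi2 k _ (hJm' k)
    have hib := hi2 k _ (𝓖.le k _ (hKm k))
    have hic := (((hi1 _ (hJm' (k + 1))).sub' (hi1 _ (hJm' k))).const_mul (9 * K ^ 2))
    have hid := (((hψ (k + 1)).sub' (hψ k)).sub' ((hψD k).const_mul 2)).const_mul 9
    refine (integral_mono ((hX.integrable_sq_sub k).indicator (𝓖.le _ _ (hA k)))
      (((hia.fun_add hib).fun_add hic).fun_add hid) hpt).trans ?_
    have e1 : ∫ ω, ((J k).indicator 1 ω * (X (k + 1) ω - X k ω) ^ 2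
          + {ω | K < |X k ω|}.indicator 1 ω * (X (k + 1) ω - X k ω) ^ 2
          + 9 * K ^ 2 * ((J (k + 1)).indicator 1 ω - (J k).indicator 1 ω)
          + 9 * (excess K (X (k + 1) ω) ^ 2 - excess K (X k ω) ^ 2
            - 2 * (excess K (X k ω) * (X (k + 1) ω - X k ω)))) ∂P
        = δ * P.real (J k) + δ * P.real {ω | K < |X k ω|}
          + 9 * K ^ 2 * (P.real (J (k + 1)) - P.real (J k))
          + 9 * (∫ ω, excess K (X (k + 1) ω) ^ 2 ∂P - ∫ ω, excess K (X k ω) ^ 2 ∂P) := by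
      rw [integral_add ((hia.fun_add hib).fun_add hic) hid, integral_add (hia.fun_add hib) hic,
        integral_add hia hib, hX.integral_indicator_mul_sq (hJm k),
        hX.integral_indicator_mul_sq (hKm k), integral_const_mul, integral_const_mul,
        integral_sub (hi1 _ (hJm' (k + 1))) (hi1 _ (hJm' k)), integral_indicator_one (hJm' _),
        integral_indicator_one (hJm' _),
        integral_sub ((hψ (k + 1)).sub' (hψ k)) ((hψD k).const_mul 2),
        integral_sub (hψ (k + 1)) (hψ k), integral_const_mul,
        hX.mean k _ ((continuous_excess K).comp_stronglyMeasurable (hX.adapted k))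
          (hX.memLp_excess k hK.le)]
      ring
    refine e1.le.trans ?_
    have h1 := mul_le_mul_of_nonneg_left (hJmono k hk.le) hδ
    have h2 : δ * P.real {ω | K < |X k ω|} ≤ N * δ ^ 2 / K ^ 2 := by
      refine (mul_le_mul_of_nonneg_left (hX.measureReal_gt_le k hK) hδ).trans ?_
      rw [mul_div_assoc', div_le_div_iff_of_pos_right (by positivity)]
      have : (k : ℝ) ≤ N := by exact_mod_cast hk.le
      nlinarith [sq_nonneg δ]
    linarith
  refine (Finset.sum_le_sum fun k hk => hterm k (Finset.mem_range.1 hk)).trans ?_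
  rw [Finset.sum_add_distrib, Finset.sum_add_distrib, Finset.sum_const, Finset.card_range,
    ← Finset.mul_sum, ← Finset.mul_sum, Finset.sum_range_sub (fun k => P.real (J k)),
    Finset.sum_range_sub (fun k => ∫ ω, excess K (X k ω) ^ 2 ∂P)]
  have hJ0 : P.real (J 0) = 0 := by simp [hJ]
  have hψ0 : ∫ ω, excess K (X 0 ω) ^ 2 ∂P = 0 := by
    simp [hX.zero, excess, hK.le]
  rw [hJ0, hψ0, nsmul_eq_mul]
  refine le_of_eq ?_
  ring

/-- The characteristic function of a weighted sum of the increments is close to that of a Gaussian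
law. The phase `α` allows to treat the cosine and the sine together. -/
lemma abs_integral_cos_sub_le [IsProbabilityMeasure P] (hX : HasConstantVariance P 𝓖 X δ)
    {w : ℕ → ℝ} (hw : ∀ k, |w k| ≤ 1) (θ α : ℝ) {ε : ℝ} (hε : 0 ≤ ε) (N : ℕ) :
    |∫ ω, Real.cos (θ * ∑ k ∈ Finset.range N, w k * (X (k + 1) ω - X k ω) + α) ∂P
        - (∏ k ∈ Finset.range N, Real.exp (-(θ ^ 2 * w k ^ 2 * δ / 2))) * Real.cos α|
      ≤ ∑ k ∈ Finset.range N, (3 * |θ| ^ 3 * ε * δ + (θ ^ 2 * δ / 2) ^ 2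
        + 3 * θ ^ 2 * ∫ ω, {ω | ε < |X (k + 1) ω - X k ω|}.indicator
          (fun ω => (X (k + 1) ω - X k ω) ^ 2) ω ∂P) := by
  have hδ := hX.nonneg
  have hS : ∀ N, StronglyMeasurable[𝓖 N] fun ω =>
      θ * ∑ k ∈ Finset.range N, w k * (X (k + 1) ω - X k ω) + α := by
    intro N
    refine StronglyMeasurable.add (StronglyMeasurable.const_mul ?_ _) stronglyMeasurable_const
    refine Finset.stronglyMeasurable_fun_sum _ fun k hk => StronglyMeasurable.const_mul ?_ _
    have hk' := Finset.mem_range.1 hk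
    exact ((hX.adapted (k + 1)).mono (𝓖.mono hk')).sub ((hX.adapted k).mono (𝓖.mono hk'.le))
  induction N with
  | zero => simp
  | succ N ih =>
    set S : Ω → ℝ := fun ω => θ * ∑ k ∈ Finset.range N, w k * (X (k + 1) ω - X k ω) + α with hSdef
    set u : ℝ := θ ^ 2 * w N ^ 2 * δ / 2 with hu
    have hu0 : 0 ≤ u := by positivity
    have hw2 : w N ^ 2 ≤ 1 := by
      rw [← sq_abs]; exact pow_le_one₀ (abs_nonneg _) (hw N)
    have hule : u ≤ θ ^ 2 * δ / 2 := by
      have : θ ^ 2 * w N ^ 2 * δ ≤ θ ^ 2 * 1 * δ := by gcongr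
      rw [hu]; linarith
    have hcos : StronglyMeasurable[𝓖 N] fun ω => Real.cos (S ω) :=
      Real.continuous_cos.comp_stronglyMeasurable (hS N)
    have hsin : StronglyMeasurable[𝓖 N] fun ω => Real.sin (S ω) :=
      Real.continuous_sin.comp_stronglyMeasurable (hS N)
    have hcosL : MemLp (fun ω => Real.cos (S ω)) 2 P :=
      MemLp.of_bound (hcos.mono (𝓖.le N)).aestronglyMeasurable 1
        (Filter.Eventually.of_forall fun ω => Real.abs_cos_le_one _)
    have hsinL : MemLp (fun ω => Real.sin (S ω)) 2 P :=
      MemLp.of_bound (hsin.mono (𝓖.le N)).aestronglyMeasurable 1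
        (Filter.Eventually.of_forall fun ω => Real.abs_sin_le_one _)
    set D : Ω → ℝ := fun ω => X (N + 1) ω - X N ω with hD
    have hDm : Measurable D := ((hX.stronglyMeasurable _).sub (hX.stronglyMeasurable _)).measurable
    have hi1 : Integrable (fun ω => Real.cos (S ω)) P := hcosL.integrable (by norm_num)
    have hi2 : Integrable (fun ω => θ * w N * (Real.sin (S ω) * D ω)) P :=
      (hsinL.integrable_mul (hX.memLp_sub N)).const_mul _
    have hi3 : Integrable (fun ω => θ ^ 2 * w N ^ 2 / 2 * (Real.cos (S ω) * D ω ^ 2)) P := by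
      refine Integrable.const_mul ?_ _
      exact (hX.integrable_sq_sub N).bdd_mul (c := 1) hcosL.1
        (Filter.Eventually.of_forall fun ω => Real.abs_cos_le_one _)
    have hi4 : Integrable (fun ω => Real.cos (S ω + θ * w N * D ω)) P := by
      refine Integrable.of_bound (Measurable.aestronglyMeasurable ?_) 1
        (Filter.Eventually.of_forall fun ω => Real.abs_cos_le_one _)
      exact Real.measurable_cos.comp (((hS N).mono (𝓖.le N)).measurable.add (hDm.const_mul _))
    set A : Set Ω := {ω | ε < |D ω|} with hA
    have hAm : MeasurableSet A := measurableSet_lt measurable_const hDm.abs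
    have hi5 : Integrable (A.indicator fun ω => D ω ^ 2) P :=
      (hX.integrable_sq_sub N).indicator hAm
    have hi6 : Integrable (fun ω => 3 * |θ| ^ 3 * ε * D ω ^ 2
        + 3 * θ ^ 2 * A.indicator (fun ω => D ω ^ 2) ω) P :=
      ((hX.integrable_sq_sub N).const_mul _).fun_add (hi5.const_mul _)
    have hrem : ∀ ω, |Real.cos (S ω + θ * w N * D ω) - (Real.cos (S ω)
          - θ * w N * (Real.sin (S ω) * D ω) - θ ^ 2 * w N ^ 2 / 2 * (Real.cos (S ω) * D ω ^ 2))|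
        ≤ 3 * |θ| ^ 3 * ε * D ω ^ 2 + 3 * θ ^ 2 * A.indicator (fun ω => D ω ^ 2) ω := by
      intro ω
      obtain ⟨h1, h2⟩ := abs_cos_add_sub_le (S ω) (θ * w N * D ω)
      have e1 : Real.cos (S ω + θ * w N * D ω) - (Real.cos (S ω)
          - θ * w N * (Real.sin (S ω) * D ω) - θ ^ 2 * w N ^ 2 / 2 * (Real.cos (S ω) * D ω ^ 2))
          = Real.cos (S ω + θ * w N * D ω) - (Real.cos (S ω)
          - (θ * w N * D ω) * Real.sin (S ω) - (θ * w N * D ω) ^ 2 / 2 * Real.cos (S ω)) := by ring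
      rw [e1]
      by_cases hω : ω ∈ A
      · rw [Set.indicator_of_mem hω]
        refine h1.trans ?_
        have h3 : (θ * w N * D ω) ^ 2 ≤ θ ^ 2 * D ω ^ 2 := by
          calc (θ * w N * D ω) ^ 2 = θ ^ 2 * D ω ^ 2 * w N ^ 2 := by ring
            _ ≤ θ ^ 2 * D ω ^ 2 * 1 := by gcongr
            _ = _ := mul_one _
        have h4 : 0 ≤ 3 * |θ| ^ 3 * ε * D ω ^ 2 := by positivity
        linarith
      · rw [Set.indicator_of_notMem hω, mul_zero, add_zero]
        refine h2.trans ?_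
        have hDε : |D ω| ≤ ε := not_lt.1 hω
        have h5 : |w N| ^ 3 ≤ 1 := pow_le_one₀ (abs_nonneg _) (hw N)
        calc 3 * |θ * w N * D ω| ^ 3 = 3 * |θ| ^ 3 * |w N| ^ 3 * (|D ω| * |D ω| ^ 2) := by
              rw [abs_mul, abs_mul]; ring
          _ ≤ 3 * |θ| ^ 3 * 1 * (ε * |D ω| ^ 2) := by gcongr
          _ = 3 * |θ| ^ 3 * ε * D ω ^ 2 := by rw [sq_abs]; ring
    have hstep : |∫ ω, Real.cos (S ω + θ * w N * D ω) ∂P - (1 - u) * ∫ ω, Real.cos (S ω) ∂P|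
        ≤ 3 * |θ| ^ 3 * ε * δ + 3 * θ ^ 2 * ∫ ω, A.indicator (fun ω => D ω ^ 2) ω ∂P := by
      have e2 : ∫ ω, Real.cos (S ω + θ * w N * D ω) ∂P - (1 - u) * ∫ ω, Real.cos (S ω) ∂P
          = ∫ ω, (Real.cos (S ω + θ * w N * D ω) - (Real.cos (S ω)
          - θ * w N * (Real.sin (S ω) * D ω)
          - θ ^ 2 * w N ^ 2 / 2 * (Real.cos (S ω) * D ω ^ 2))) ∂P := by
        rw [integral_sub hi4 ((hi1.sub' hi2).sub' hi3), integral_sub (hi1.sub' hi2) hi3,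
          integral_sub hi1 hi2, integral_const_mul, integral_const_mul,
          hX.mean N _ hsin hsinL, hX.var N _ hcos fun ω => Real.abs_cos_le_one _, hu]
        ring
      rw [e2]
      refine abs_integral_le_integral_abs.trans ?_
      refine (integral_mono_of_nonneg (Filter.Eventually.of_forall fun ω => abs_nonneg _) hi6
        (Filter.Eventually.of_forall hrem)).trans (le_of_eq ?_)
      rw [integral_add ((hX.integrable_sq_sub N).const_mul _) (hi5.const_mul _),
        integral_const_mul, integral_const_mul, hX.integral_sq_sub]
    have hcos1 : |∫ ω, Real.cos (S ω) ∂P| ≤ 1 := by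
      refine abs_integral_le_integral_abs.trans ?_
      refine (integral_mono hi1.abs (integrable_const (1 : ℝ))
        fun ω => Real.abs_cos_le_one _).trans ?_
      simp
    have hexp1 : Real.exp (-u) ≤ 1 := Real.exp_le_one_iff.2 (by linarith)
    have hu2 : u ^ 2 ≤ (θ ^ 2 * δ / 2) ^ 2 := pow_le_pow_left₀ hu0 hule 2
    have h8 := abs_one_sub_sub_exp_neg_le hu0
    have e3 : ∀ ω, θ * ∑ k ∈ Finset.range (N + 1), w k * (X (k + 1) ω - X k ω) + α
        = S ω + θ * w N * D ω := fun ω => by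
      rw [Finset.sum_range_succ]; ring
    simp only [e3]
    rw [Finset.prod_range_succ, Finset.sum_range_succ]
    set Z : ℝ := ∏ k ∈ Finset.range N, Real.exp (-(θ ^ 2 * w k ^ 2 * δ / 2)) with hZ
    set I : ℝ := ∫ ω, Real.cos (S ω) ∂P with hI
    have e4 : ∫ ω, Real.cos (S ω + θ * w N * D ω) ∂P - Z * Real.exp (-u) * Real.cos α
        = (∫ ω, Real.cos (S ω + θ * w N * D ω) ∂P - (1 - u) * I)
          + (1 - u - Real.exp (-u)) * I + Real.exp (-u) * (I - Z * Real.cos α) := by ring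
    rw [e4]
    have h9 : |(1 - u - Real.exp (-u)) * I| ≤ (θ ^ 2 * δ / 2) ^ 2 := by
      rw [abs_mul]
      exact (mul_le_of_le_one_right (abs_nonneg _) hcos1).trans (h8.trans hu2)
    have h10 : |Real.exp (-u) * (I - Z * Real.cos α)| ≤ |I - Z * Real.cos α| := by
      rw [abs_mul, abs_of_pos (Real.exp_pos _)]
      exact mul_le_of_le_one_left (abs_nonneg _) hexp1
    refine (abs_add_three _ _ _).trans ?_
    linarith

end HasConstantVariance
end Increments

/-! ### The Ornstein-Uhlenbeck functional of a continuous martingale is Gaussian -/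

/-- Riemann-Stieltjes sums against an exponential weight, after summation by parts. -/
lemma tendsto_sum_exp_mul_sub {F : ℝ → ℝ} (hF : Continuous F) (hF0 : F 0 = 0) {κ T : ℝ}
    (hκ : 0 ≤ κ) (hT : 0 ≤ T) :
    Filter.Tendsto (fun N : ℕ => ∑ k ∈ Finset.range (N + 1), Real.exp (κ * (k * (T / (N + 1)))) *
        (F ((k + 1) * (T / (N + 1))) - F (k * (T / (N + 1))))) Filter.atTop
      (nhds (Real.exp (κ * T) * F T - ∫ s in (0 : ℝ)..T, κ * Real.exp (κ * s) * F s)) := by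
  have hderiv : ∀ s : ℝ, HasDerivAt (fun s => Real.exp (κ * s)) (κ * Real.exp (κ * s)) s :=
    fun s => by
    have := ((hasDerivAt_id s).const_mul κ).exp
    simpa [mul_comm] using this
  have hg : ∀ a b : ℝ, ∫ s in a..b, κ * Real.exp (κ * s) = Real.exp (κ * b) - Real.exp (κ * a) :=
    fun a b => intervalIntegral.integral_eq_sub_of_hasDerivAt (fun s _ => hderiv s)
      (Continuous.intervalIntegrable (by fun_prop) _ _)
  have huc : UniformContinuousOn F (Set.Icc 0 T) :=
    isCompact_Icc.uniformContinuousOn_of_continuous hF.continuousOn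
  rw [Metric.tendsto_atTop]
  intro η hη
  set G : ℝ := Real.exp (κ * T) with hG
  have hG0 : 0 < G := Real.exp_pos _
  obtain ⟨d, hd, hdF⟩ := Metric.uniformContinuousOn_iff.1 huc (η / (2 * G)) (by positivity)
  obtain ⟨N₀, hN₀⟩ := exists_nat_gt (T / d)
  refine ⟨N₀, fun N hN => ?_⟩
  set h : ℝ := T / (N + 1) with hh
  have hN1 : (0 : ℝ) < N + 1 := by positivity
  have hh0 : 0 ≤ h := by positivity
  have hhd : h < d := by
    rw [hh, div_lt_iff₀ hN1]
    rw [div_lt_iff₀ hd] at hN₀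
    have : (N₀ : ℝ) ≤ N := by exact_mod_cast hN
    nlinarith
  have hNh : ((N : ℝ) + 1) * h = T := by rw [hh]; field_simp
  have habel : ∀ n : ℕ, ∑ k ∈ Finset.range n, Real.exp (κ * (k * h)) *
      (F ((k + 1) * h) - F (k * h)) = Real.exp (κ * (n * h)) * F (n * h)
        - ∑ k ∈ Finset.range n, (Real.exp (κ * ((k + 1) * h)) - Real.exp (κ * (k * h)))
          * F ((k + 1) * h) := by
    intro n
    induction n with
    | zero => simp [hF0]
    | succ n ih =>
      rw [Finset.sum_range_succ, ih, Finset.sum_range_succ]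
      push_cast
      ring
  have hint : ∀ n : ℕ, ∫ s in (0 : ℝ)..(n * h), κ * Real.exp (κ * s) * F s
      = ∑ k ∈ Finset.range n, ∫ s in (k * h)..((k + 1) * h), κ * Real.exp (κ * s) * F s := by
    intro n
    induction n with
    | zero => simp
    | succ n ih =>
      rw [Finset.sum_range_succ, ← ih, intervalIntegral.integral_add_adjacent_intervals]
      · push_cast; rfl
      · exact Continuous.intervalIntegrable (by fun_prop) _ _
      · exact Continuous.intervalIntegrable (by fun_prop) _ _
  have hterm : ∀ k : ℕ, k < N + 1 →
      |(∫ s in (k * h)..((k + 1) * h), κ * Real.exp (κ * s) * F s)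
        - (Real.exp (κ * ((k + 1) * h)) - Real.exp (κ * (k * h))) * F ((k + 1) * h)|
      ≤ η / (2 * G) * (Real.exp (κ * ((k + 1) * h)) - Real.exp (κ * (k * h))) := by
    intro k hk
    have hkk : (k : ℝ) * h ≤ (k + 1) * h := by nlinarith
    have hk0 : 0 ≤ (k : ℝ) * h := by positivity
    have hkT : ((k : ℝ) + 1) * h ≤ T := by
      rw [← hNh]
      have : (k : ℝ) + 1 ≤ N + 1 := by exact_mod_cast hk
      exact mul_le_mul_of_nonneg_right this hh0
    have e1 : (∫ s in (k * h)..((k + 1) * h), κ * Real.exp (κ * s) * F s)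
        - (Real.exp (κ * ((k + 1) * h)) - Real.exp (κ * (k * h))) * F ((k + 1) * h)
        = ∫ s in (k * h)..((k + 1) * h), κ * Real.exp (κ * s) * (F s - F ((k + 1) * h)) := by
      rw [← hg, ← intervalIntegral.integral_mul_const, ← intervalIntegral.integral_sub]
      · simp only [mul_sub]
      · exact Continuous.intervalIntegrable (by fun_prop) _ _
      · exact Continuous.intervalIntegrable (by fun_prop) _ _
    rw [e1, ← hg, ← intervalIntegral.integral_const_mul, ← Real.norm_eq_abs]
    refine intervalIntegral.norm_integral_le_of_norm_le hkk ?_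
      (Continuous.intervalIntegrable (by fun_prop) _ _)
    refine Filter.Eventually.of_forall fun s hs => ?_
    have hs0 : s ∈ Set.Icc 0 T := ⟨hk0.trans hs.1.le, hs.2.trans hkT⟩
    have hlast : ((k : ℝ) + 1) * h ∈ Set.Icc 0 T := ⟨hk0.trans hkk, hkT⟩
    have hdist : dist s ((k + 1) * h) < d := by
      rw [Real.dist_eq, abs_sub_comm, abs_of_nonneg (by linarith [hs.2])]
      have := hs.1
      linarith
    have := hdF s hs0 _ hlast hdist
    rw [Real.dist_eq] at this
    have hpos : 0 ≤ κ * Real.exp (κ * s) := by positivity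
    rw [Real.norm_eq_abs, abs_mul, abs_of_nonneg hpos, mul_comm]
    exact mul_le_mul_of_nonneg_right this.le hpos
  have hh' := habel (N + 1)
  have hi' := hint (N + 1)
  push_cast at hh' hi'
  rw [hNh] at hh' hi'
  rw [hh', hi', Real.dist_eq]
  have e2 : ∀ a b c : ℝ, a - b - (a - c) = c - b := fun a b c => by ring
  rw [e2, ← Finset.sum_sub_distrib]
  refine (Finset.abs_sum_le_sum_abs _ _).trans_lt ?_
  refine (Finset.sum_le_sum fun k hk => hterm k (Finset.mem_range.1 hk)).trans_lt ?_
  have htel := Finset.sum_range_sub (fun k : ℕ => Real.exp (κ * (k * h))) (N + 1)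
  push_cast at htel
  rw [← Finset.mul_sum, htel, hNh]
  have : η / (2 * G) * (G - Real.exp (κ * (0 * h))) < η := by
    have h1 : η / (2 * G) * (G - Real.exp (κ * (0 * h))) ≤ η / (2 * G) * G := by
      gcongr
      linarith [Real.exp_pos (κ * (0 * h))]
    have h2 : η / (2 * G) * G = η / 2 := by field_simp
    linarith
  exact this

section Martingale

variable {Ω : Type*} {m : MeasurableSpace Ω} {P : Measure Ω} [IsProbabilityMeasure P]
  {𝓕 : Filtration ℝ≥0 m} {M : ℝ≥0 → Ω → ℝ} {c : ℝ}

/-- A square integrable martingale with continuous paths, starting at `0`, and with quadratic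
variation `c t`. -/
structure IsLinearVariation (P : Measure Ω) (𝓕 : Filtration ℝ≥0 m) (M : ℝ≥0 → Ω → ℝ) (c : ℝ) :
    Prop where
  zero : ∀ ω, M 0 ω = 0
  memLp : ∀ t, MemLp (M t) 2 P
  martingale : Martingale M 𝓕 P
  variation : Martingale (fun t ω => M t ω ^ 2 - (t : ℝ) * c) 𝓕 P
  continuous : ∀ᵐ ω ∂P, Continuous fun t => M t ω

lemma integral_mul_martingale {N : ℝ≥0 → Ω → ℝ} (hN : Martingale N 𝓕 P) {s t : ℝ≥0} (hst : s ≤ t)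
    {g : Ω → ℝ} (hg : StronglyMeasurable[𝓕 s] g) (hi : Integrable (g * N t) P) :
    ∫ ω, g ω * N t ω ∂P = ∫ ω, g ω * N s ω ∂P := by
  have h1 := condExp_mul_of_stronglyMeasurable_left hg hi (hN.integrable t)
  have h2 := integral_condExp (μ := P) (f := g * N t) (𝓕.le s)
  rw [show (∫ ω, g ω * N t ω ∂P) = ∫ ω, (g * N t) ω ∂P from rfl, ← h2]
  refine integral_congr_ae ?_
  filter_upwards [h1, hN.condExp_ae_eq hst] with ω hω hω'
  rw [hω, Pi.mul_apply, hω']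

/-- The filtration at the multiples of a time step. -/
def gridFiltration (𝓕 : Filtration ℝ≥0 m) (h : ℝ≥0) : Filtration ℕ m where
  seq k := 𝓕 (k * h)
  mono' i j hij := 𝓕.mono (by gcongr)
  le' k := 𝓕.le _

lemma IsLinearVariation.hasConstantVariance (hM : IsLinearVariation P 𝓕 M c) (h : ℝ≥0) :
    HasConstantVariance P (gridFiltration 𝓕 h) (fun k => M (k * h)) (c * h) := by
  have hle : ∀ k : ℕ, (k : ℝ≥0) * h ≤ ((k + 1 : ℕ) : ℝ≥0) * h := fun k => by
    gcongr; exact_mod_cast k.le_succ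
  refine ⟨fun ω => by simp [hM.zero], fun k => hM.martingale.stronglyMeasurable _,
    fun k => hM.memLp _, fun k g hg hgL => ?_, fun k g hg hg1 => ?_⟩
  · have h1 : Integrable (fun ω => g ω * M (((k + 1 : ℕ) : ℝ≥0) * h) ω) P :=
      hgL.integrable_mul (hM.memLp _)
    have h2 : Integrable (fun ω => g ω * M ((k : ℝ≥0) * h) ω) P := hgL.integrable_mul (hM.memLp _)
    have h3 := integral_mul_martingale hM.martingale (hle k) hg h1
    simp only [mul_sub]
    rw [integral_sub h1 h2, h3, sub_self]
  · set s : ℝ≥0 := (k : ℝ≥0) * h with hs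
    set t : ℝ≥0 := ((k + 1 : ℕ) : ℝ≥0) * h with ht
    have hgm : AEStronglyMeasurable g P :=
      (hg.mono ((gridFiltration 𝓕 h).le k)).aestronglyMeasurable
    have hb : ∀ᵐ ω ∂P, ‖g ω‖ ≤ 1 := Filter.Eventually.of_forall hg1
    have hgi : Integrable g P := Integrable.of_bound hgm 1 hb
    have hsm : StronglyMeasurable[𝓕 s] (M s) := hM.martingale.stronglyMeasurable s
    have hgs : MemLp (fun ω => g ω * M s ω) 2 P := by
      refine (hM.memLp s).mono (hgm.mul (hM.memLp s).1) (Filter.Eventually.of_forall fun ω => ?_)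
      rw [norm_mul]
      exact mul_le_of_le_one_left (norm_nonneg _) (hg1 ω)
    have i1 : ∀ r, Integrable (fun ω => g ω * M r ω ^ 2) P := fun r =>
      (hM.memLp r).integrable_sq.bdd_mul hgm hb
    have i2 : Integrable (fun ω => g ω * M s ω * M t ω) P := hgs.integrable_mul (hM.memLp t)
    have e1 : ∫ ω, g ω * M s ω * M t ω ∂P = ∫ ω, g ω * M s ω ^ 2 ∂P := by
      rw [integral_mul_martingale hM.martingale (hle k) (g := fun ω => g ω * M s ω)
        (StronglyMeasurable.mul hg hsm) i2]
      exact integral_congr_ae (Filter.Eventually.of_forall fun ω => by ring)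
    have i3 : ∀ r : ℝ≥0, Integrable (fun ω => g ω * (M r ω ^ 2 - (r : ℝ) * c)) P := fun r => by
      simp only [mul_sub]
      exact (i1 r).sub' (hgi.mul_const _)
    have e2 := integral_mul_martingale hM.variation (hle k) hg (i3 t)
    have e3 : ∀ r : ℝ≥0, ∫ ω, g ω * (M r ω ^ 2 - (r : ℝ) * c) ∂P
        = ∫ ω, g ω * M r ω ^ 2 ∂P - (∫ ω, g ω ∂P) * ((r : ℝ) * c) := fun r => by
      simp only [mul_sub]
      rw [integral_sub (i1 r) (hgi.mul_const _), integral_mul_const]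
    rw [e3, e3] at e2
    have e4 : ∀ ω, g ω * (M t ω - M s ω) ^ 2
        = g ω * M t ω ^ 2 - 2 * (g ω * M s ω * M t ω) + g ω * M s ω ^ 2 := fun ω => by ring
    simp only [e4]
    rw [integral_add ((i1 t).sub' (i2.const_mul 2)) (i1 s), integral_sub (i1 t) (i2.const_mul 2),
      integral_const_mul, e1]
    have hts : (t : ℝ) = s + h := by rw [ht, hs]; push_cast; ring
    rw [hts] at e2
    linarith

lemma sum_exp_sq_le {κ h : ℝ} (hκ : 0 < κ) (T : ℝ) (n : ℕ) (hn : n * h ≤ T) :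
    ∑ k ∈ Finset.range n, Real.exp (-(κ * (T - k * h))) ^ 2 * h ≤ 1 / (2 * κ) := by
  have h1 : ∀ k : ℕ, Real.exp (-(κ * (T - k * h))) ^ 2 * h
      ≤ (Real.exp (-(2 * κ * (T - ((k + 1 : ℕ) : ℝ) * h))) - Real.exp (-(2 * κ * (T - k * h))))
        / (2 * κ) := by
    intro k
    rw [le_div_iff₀ (by positivity), ← Real.exp_nat_mul]
    have e1 : ((2 : ℕ) : ℝ) * -(κ * (T - k * h)) = -(2 * κ * (T - k * h)) := by push_cast; ring
    have e2 : Real.exp (-(2 * κ * (T - ((k + 1 : ℕ) : ℝ) * h)))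
        = Real.exp (-(2 * κ * (T - k * h))) * Real.exp (2 * κ * h) := by
      rw [← Real.exp_add]; push_cast; ring_nf
    rw [e1, e2]
    have := Real.add_one_le_exp (2 * κ * h)
    have hp := Real.exp_pos (-(2 * κ * (T - k * h)))
    nlinarith
  refine (Finset.sum_le_sum fun k _ => h1 k).trans ?_
  rw [← Finset.sum_div, Finset.sum_range_sub (fun k : ℕ => Real.exp (-(2 * κ * (T - k * h))))]
  have h2 : Real.exp (-(2 * κ * (T - n * h))) ≤ 1 := Real.exp_le_one_iff.2 (by
    have : 0 ≤ 2 * κ * (T - n * h) := mul_nonneg (by positivity) (by linarith)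
    linarith)
  have h3 := Real.exp_pos (-(2 * κ * (T - ((0 : ℕ) : ℝ) * h)))
  gcongr
  linarith

/-- A large increment over a fine grid has small probability, by continuity of the paths. -/
lemma IsLinearVariation.tendsto_measure_large (hM : IsLinearVariation P 𝓕 M c) (T : ℝ≥0) {ε : ℝ}
    (hε : 0 < ε) :
    Filter.Tendsto (fun N : ℕ => P.real {ω | ∃ k < N + 1,
      ε < |M (((k + 1 : ℕ) : ℝ≥0) * (T / (N + 1))) ω - M ((k : ℝ≥0) * (T / (N + 1))) ω|})
      Filter.atTop (nhds 0) := by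
  set J : ℕ → Set Ω := fun N => {ω | ∃ k < N + 1,
      ε < |M (((k + 1 : ℕ) : ℝ≥0) * (T / (N + 1))) ω - M ((k : ℝ≥0) * (T / (N + 1))) ω|} with hJ
  have hMm : ∀ t, Measurable (M t) := fun t =>
    ((hM.martingale.stronglyMeasurable t).mono (𝓕.le t)).measurable
  have hJm : ∀ N, MeasurableSet (J N) := by
    intro N
    have : J N = ⋃ k ∈ Finset.range (N + 1), {ω | ε < |M (((k + 1 : ℕ) : ℝ≥0) * (T / (N + 1))) ω
        - M ((k : ℝ≥0) * (T / (N + 1))) ω|} := by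
      ext ω; simp [hJ]
    rw [this]
    exact Finset.measurableSet_biUnion _ fun k _ =>
      measurableSet_lt measurable_const ((hMm _).sub (hMm _)).abs
  have h1 : ∀ᵐ ω ∂P, ∀ᶠ N in Filter.atTop, ω ∉ J N := by
    filter_upwards [hM.continuous] with ω hω
    have huc : UniformContinuousOn (fun t => M t ω) (Set.Iic T) :=
      (isCompact_Iic_time T).uniformContinuousOn_of_continuous hω.continuousOn
    obtain ⟨d, hd, hdF⟩ := Metric.uniformContinuousOn_iff.1 huc ε hε
    obtain ⟨N₀, hN₀⟩ := exists_nat_gt ((T : ℝ) / d)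
    filter_upwards [Filter.eventually_ge_atTop N₀] with N hN
    rintro ⟨k, hk, hlt⟩
    have hN1 : (0 : ℝ) < N + 1 := by positivity
    have hstep : (T : ℝ) / (N + 1) < d := by
      rw [div_lt_iff₀ hN1]
      rw [div_lt_iff₀ hd] at hN₀
      have : (N₀ : ℝ) ≤ N := by exact_mod_cast hN
      nlinarith
    have hmem : ∀ j : ℕ, j ≤ N + 1 → (j : ℝ≥0) * (T / (N + 1)) ∈ Set.Iic T := by
      intro j hj
      have hj' : (j : ℝ≥0) ≤ N + 1 := by exact_mod_cast hj
      calc (j : ℝ≥0) * (T / (N + 1)) ≤ (N + 1) * (T / (N + 1)) := by gcongr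
        _ = T := by field_simp
    have hlt' := hdF _ (hmem (k + 1) hk) _ (hmem k hk.le) (by
      rw [NNReal.dist_eq]
      push_cast
      have : ((k : ℝ) + 1) * (T / (N + 1)) - k * (T / (N + 1)) = T / (N + 1) := by ring
      rw [this, abs_of_nonneg (by positivity)]
      exact hstep)
    rw [Real.dist_eq] at hlt'
    exact absurd hlt (not_lt.2 hlt'.le)
  have h2 : Filter.Tendsto (fun N => ∫ ω, (J N).indicator (1 : Ω → ℝ) ω ∂P) Filter.atTop
      (nhds (∫ _, (0 : ℝ) ∂P)) := by
    refine tendsto_integral_of_dominated_convergence (fun _ => 1)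
      (fun N => (measurable_one.indicator (hJm N)).aestronglyMeasurable) (integrable_const _)
      (fun N => Filter.Eventually.of_forall fun ω => ?_) ?_
    · by_cases hω : ω ∈ J N <;> simp [hω]
    · filter_upwards [h1] with ω hω
      exact (tendsto_const_nhds).congr' (hω.mono fun N hN => by
        dsimp only
        rw [Set.indicator_of_notMem hN])
  simpa only [integral_indicator_one (hJm _), integral_zero] using h2

lemma IsLinearVariation.tendsto_excess (hM : IsLinearVariation P 𝓕 M c) (T : ℝ≥0) :
    Filter.Tendsto (fun K : ℕ => ∫ ω, excess K (M T ω) ^ 2 ∂P) Filter.atTop (nhds 0) := by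
  have h : Filter.Tendsto (fun K : ℕ => ∫ ω, excess K (M T ω) ^ 2 ∂P) Filter.atTop
      (nhds (∫ _, (0 : ℝ) ∂P)) := by
    refine tendsto_integral_of_dominated_convergence (fun ω => M T ω ^ 2) (fun K => ?_)
      (hM.memLp T).integrable_sq (fun K => Filter.Eventually.of_forall fun ω => ?_)
      (Filter.Eventually.of_forall fun ω => ?_)
    · exact ((continuous_excess K).pow 2).comp_aestronglyMeasurable (hM.memLp T).1
    · rw [Real.norm_eq_abs, abs_pow, ← sq_abs (M T ω)]
      exact pow_le_pow_left₀ (abs_nonneg _) (abs_excess_le K.cast_nonneg _) 2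
    · obtain ⟨K₀, hK₀⟩ := exists_nat_ge |M T ω|
      refine tendsto_const_nhds.congr' ?_
      filter_upwards [Filter.eventually_ge_atTop K₀] with K hK
      have h1 : |M T ω| ≤ K := hK₀.trans (by exact_mod_cast hK)
      have h2 := abs_le.1 h1
      rw [excess, min_eq_left h2.2, max_eq_right h2.1]
      simp
  simpa using h

end Martingale

/-- The functional `M_T - κ ∫₀ᵀ e^{-κ(T-s)} M_s ds` of a path `M`. -/
def ouFunctional (κ : ℝ) (T : ℝ≥0) (f : ℝ≥0 → ℝ) : ℝ :=
  f T - κ * Real.exp (-(κ * T)) * ∫ s in Set.Iic T, Real.exp (κ * s) * f s ∂timeMeasure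

/-- The weighted sum of the increments of a path over a grid of `N + 1` steps. -/
def gridSum (κ : ℝ) (T : ℝ≥0) (N : ℕ) (f : ℝ≥0 → ℝ) : ℝ :=
  ∑ k ∈ Finset.range (N + 1), Real.exp (-(κ * ((T : ℝ) - k * ((T : ℝ) / (N + 1))))) *
    (f (((k + 1 : ℕ) : ℝ≥0) * (T / (N + 1))) - f ((k : ℝ≥0) * (T / (N + 1))))

lemma tendsto_gridSum {f : ℝ≥0 → ℝ} (hf : Continuous f) (hf0 : f 0 = 0) {κ : ℝ} (hκ : 0 ≤ κ)
    (T : ℝ≥0) :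
    Filter.Tendsto (fun N => gridSum κ T N f) Filter.atTop (nhds (ouFunctional κ T f)) := by
  set F : ℝ → ℝ := fun x => f x.toNNReal with hF
  have hFc : Continuous F := hf.comp continuous_real_toNNReal
  have hF0 : F 0 = 0 := by simp [hF, hf0]
  have h1 := (tendsto_sum_exp_mul_sub hFc hF0 hκ T.coe_nonneg).const_mul (Real.exp (-(κ * T)))
  have hFN : ∀ t : ℝ≥0, F t = f t := fun t => by simp [hF]
  have e1 : ∫ s in Set.Iic T, Real.exp (κ * s) * f s ∂timeMeasure
      = ∫ s in (0 : ℝ)..T, Real.exp (κ * s) * F s := by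
    rw [← setIntegral_Iic_eq]
    simp only [hFN]
  have e2 : Real.exp (-(κ * T)) * (Real.exp (κ * T) * F T
      - ∫ s in (0 : ℝ)..T, κ * Real.exp (κ * s) * F s) = ouFunctional κ T f := by
    rw [ouFunctional, e1, hFN, mul_sub, ← mul_assoc, ← Real.exp_add]
    simp only [mul_assoc, intervalIntegral.integral_const_mul]
    rw [neg_add_cancel, Real.exp_zero, one_mul]
    ring
  rw [e2] at h1
  refine h1.congr fun N => ?_
  rw [gridSum, Finset.mul_sum]
  refine Finset.sum_congr rfl fun k _ => ?_
  have e3 : ((k : ℝ) + 1) * ((T : ℝ) / (N + 1))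
      = ((((k + 1 : ℕ) : ℝ≥0) * (T / (N + 1)) : ℝ≥0) : ℝ) := by push_cast; rfl
  have e4 : (k : ℝ) * ((T : ℝ) / (N + 1)) = (((k : ℝ≥0) * (T / (N + 1)) : ℝ≥0) : ℝ) := by
    push_cast; rfl
  rw [← mul_assoc, ← Real.exp_add, e3, hFN, e4, hFN, ← e4]
  congr 2
  ring

section Martingale

variable {Ω : Type*} {m : MeasurableSpace Ω} {P : Measure Ω} [IsProbabilityMeasure P]
  {𝓕 : Filtration ℝ≥0 m} {M : ℝ≥0 → Ω → ℝ} {c : ℝ}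

lemma IsLinearVariation.variance_nonneg (hM : IsLinearVariation P 𝓕 M c) : 0 ≤ c := by
  simpa using (hM.hasConstantVariance 1).nonneg

/-- The variance of the Gaussian law that approximates the weighted sum. -/
def gridVariance (κ c : ℝ) (T : ℝ≥0) (N : ℕ) : ℝ :=
  ∑ k ∈ Finset.range (N + 1), Real.exp (-(κ * ((T : ℝ) - k * ((T : ℝ) / (N + 1))))) ^ 2
    * (c * ((T / (N + 1) : ℝ≥0) : ℝ))

lemma gridVariance_mem {κ : ℝ} (hκ : 0 < κ) {c : ℝ} (hc : 0 ≤ c) (T : ℝ≥0) (N : ℕ) :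
    gridVariance κ c T N ∈ Set.Icc 0 (c / (2 * κ)) := by
  constructor
  · exact Finset.sum_nonneg fun k _ => by positivity
  · have h := sum_exp_sq_le (h := (T : ℝ) / (N + 1)) hκ T (N + 1) (by
      push_cast; rw [mul_div_cancel₀ _ (by positivity)])
    have e : gridVariance κ c T N = c * ∑ k ∈ Finset.range (N + 1),
        Real.exp (-(κ * ((T : ℝ) - k * ((T : ℝ) / (N + 1))))) ^ 2 * ((T : ℝ) / (N + 1)) := by
      rw [gridVariance, Finset.mul_sum]
      refine Finset.sum_congr rfl fun k _ => ?_
      push_cast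
      ring
    rw [e]
    calc _ ≤ c * (1 / (2 * κ)) := mul_le_mul_of_nonneg_left h hc
      _ = _ := by ring

/-- Lindeberg's theorem for the weighted sums of the increments. -/
lemma IsLinearVariation.tendsto_cos_gridSum (hM : IsLinearVariation P 𝓕 M c) {κ : ℝ} (hκ : 0 < κ)
    (T : ℝ≥0) (θ α : ℝ) :
    Filter.Tendsto (fun N => ∫ ω, Real.cos (θ * gridSum κ T N (fun t => M t ω) + α) ∂P
      - Real.exp (-(θ ^ 2 * gridVariance κ c T N / 2)) * Real.cos α) Filter.atTop (nhds 0) := by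
  have hc := hM.variance_nonneg
  set A : ℝ := c * T with hA
  have hA0 : 0 ≤ A := by positivity
  set p : ℝ → ℕ → ℝ := fun ε N => P.real {ω | ∃ k < N + 1,
      ε < |M (((k + 1 : ℕ) : ℝ≥0) * (T / (N + 1))) ω - M ((k : ℝ≥0) * (T / (N + 1))) ω|} with hp
  set ex : ℕ → ℝ := fun K => ∫ ω, excess K (M T ω) ^ 2 ∂P with hex
  have hbound : ∀ (N K : ℕ) (ε : ℝ), 0 < ε → 0 < K →
      |∫ ω, Real.cos (θ * gridSum κ T N (fun t => M t ω) + α) ∂P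
        - Real.exp (-(θ ^ 2 * gridVariance κ c T N / 2)) * Real.cos α|
      ≤ 3 * |θ| ^ 3 * A * ε + (θ ^ 2 * A / 2) ^ 2 * (1 / ((N : ℝ) + 1))
        + 3 * θ ^ 2 * ((A + 9 * K ^ 2) * p ε N + A ^ 2 / K ^ 2 + 9 * ex K) := by
    intro N K ε hε hK
    have hX := hM.hasConstantVariance (T / (N + 1))
    have hN1 : (0 : ℝ) < N + 1 := by positivity
    set δ : ℝ := c * ((T / (N + 1) : ℝ≥0) : ℝ) with hδ
    have hNδ : ((N : ℝ) + 1) * δ = A := by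
      rw [hδ, hA]; push_cast; field_simp
    have hw : ∀ k : ℕ, |(if k < N + 1 then
        Real.exp (-(κ * ((T : ℝ) - k * ((T : ℝ) / (N + 1))))) else 0)| ≤ 1 := by
      intro k
      split_ifs with hk
      · rw [abs_of_pos (Real.exp_pos _), Real.exp_le_one_iff]
        have hk' : (k : ℝ) ≤ N + 1 := by exact_mod_cast hk.le
        have : (k : ℝ) * ((T : ℝ) / (N + 1)) ≤ T := by
          calc (k : ℝ) * ((T : ℝ) / (N + 1)) ≤ (N + 1) * ((T : ℝ) / (N + 1)) := by gcongr
            _ = T := by field_simp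
        have := mul_nonneg hκ.le (sub_nonneg.2 this)
        linarith
      · simp
    have h1 := hX.abs_integral_cos_sub_le hw θ α hε.le (N + 1)
    have h2 := hX.sum_integral_large_le (N + 1) (K := K) (ε := ε) (by exact_mod_cast hK)
    have e1 : ∀ ω, ∑ k ∈ Finset.range (N + 1), (if k < N + 1 then
        Real.exp (-(κ * ((T : ℝ) - k * ((T : ℝ) / (N + 1))))) else 0)
          * (M (((k + 1 : ℕ) : ℝ≥0) * (T / (N + 1))) ω - M ((k : ℝ≥0) * (T / (N + 1))) ω)
        = gridSum κ T N fun t => M t ω := fun ω =>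
      Finset.sum_congr rfl fun k hk => by rw [if_pos (Finset.mem_range.1 hk)]
    have e2 : ∏ k ∈ Finset.range (N + 1), Real.exp (-(θ ^ 2 * (if k < N + 1 then
        Real.exp (-(κ * ((T : ℝ) - k * ((T : ℝ) / (N + 1))))) else 0) ^ 2 * δ / 2))
        = Real.exp (-(θ ^ 2 * gridVariance κ c T N / 2)) := by
      rw [← Real.exp_sum, gridVariance, Finset.mul_sum, Finset.sum_div, ← Finset.sum_neg_distrib]
      congr 1
      refine Finset.sum_congr rfl fun k hk => ?_
      rw [if_pos (Finset.mem_range.1 hk), hδ]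
      ring
    simp only [e1] at h1
    rw [e2, Finset.sum_add_distrib, Finset.sum_add_distrib, Finset.sum_const, Finset.sum_const,
      Finset.card_range, ← Finset.mul_sum] at h1
    have e3 : (((N + 1 : ℕ) : ℝ)) * δ = A := by push_cast; exact hNδ
    have e4 : (((K : ℕ) : ℝ≥0) : ℝ) = K := by simp
    have e5 : ((N + 1 : ℕ) : ℝ≥0) * (T / (N + 1)) = T := by
      push_cast; field_simp
    rw [e3, e5] at h2
    refine h1.trans ?_
    have h3 := mul_le_mul_of_nonneg_left h2 (by positivity : 0 ≤ 3 * θ ^ 2)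
    have e6 : (N + 1) • (3 * |θ| ^ 3 * ε * δ) = 3 * |θ| ^ 3 * A * ε := by
      rw [nsmul_eq_mul, ← e3]; ring
    have e7 : (N + 1) • (θ ^ 2 * δ / 2) ^ 2 = (θ ^ 2 * A / 2) ^ 2 * (1 / ((N : ℝ) + 1)) := by
      rw [nsmul_eq_mul, ← e3]; push_cast; field_simp
    rw [e6, e7]
    linarith
  rw [Metric.tendsto_atTop]
  intro η hη
  obtain ⟨ε, hε, hε'⟩ : ∃ ε > 0, 3 * |θ| ^ 3 * A * ε ≤ η / 8 := by
    refine ⟨η / (8 * (3 * |θ| ^ 3 * A + 1)), by positivity, ?_⟩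
    rw [mul_div_assoc', div_le_div_iff₀ (by positivity) (by norm_num)]
    have : 0 ≤ 3 * |θ| ^ 3 * A := by positivity
    nlinarith
  have hK : ∀ᶠ K : ℕ in Filter.atTop,
      3 * θ ^ 2 * (A ^ 2 / (K : ℝ) ^ 2 + 9 * ex K) < η / 8 ∧ 0 < K := by
    refine Filter.Eventually.and ?_ (Filter.eventually_gt_atTop 0)
    have h1 : Filter.Tendsto (fun K : ℕ => A ^ 2 / (K : ℝ) ^ 2) Filter.atTop (nhds 0) :=
      Filter.Tendsto.div_atTop tendsto_const_nhds
        ((Filter.tendsto_pow_atTop (by norm_num)).comp tendsto_natCast_atTop_atTop)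
    have h2 := (h1.add ((hM.tendsto_excess T).const_mul 9)).const_mul (3 * θ ^ 2)
    simp only [mul_zero, add_zero] at h2
    exact h2.eventually_lt_const (by positivity)
  obtain ⟨K, hK1, hK0⟩ := hK.exists
  have hN : ∀ᶠ N : ℕ in Filter.atTop, (θ ^ 2 * A / 2) ^ 2 * (1 / ((N : ℝ) + 1))
      + 3 * θ ^ 2 * ((A + 9 * (K : ℝ) ^ 2) * p ε N) < η / 8 := by
    have h1 := (tendsto_one_div_add_atTop_nhds_zero_nat (𝕜 := ℝ)).const_mul ((θ ^ 2 * A / 2) ^ 2)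
    have h2 := ((hM.tendsto_measure_large T hε).const_mul (A + 9 * (K : ℝ) ^ 2)).const_mul
      (3 * θ ^ 2)
    have h3 := h1.add h2
    simp only [mul_zero, add_zero] at h3
    exact h3.eventually_lt_const (by positivity)
  obtain ⟨N₀, hN₀⟩ := Filter.eventually_atTop.1 hN
  refine ⟨N₀, fun N hNN => ?_⟩
  rw [Real.dist_eq, sub_zero]
  refine (hbound N K ε hε hK0).trans_lt ?_
  have := hN₀ N hNN
  nlinarith

lemma IsLinearVariation.tendsto_gridSum_ae (hM : IsLinearVariation P 𝓕 M c) {κ : ℝ} (hκ : 0 < κ)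
    (T : ℝ≥0) : ∀ᵐ ω ∂P, Filter.Tendsto (fun N => gridSum κ T N fun t => M t ω) Filter.atTop
      (nhds (ouFunctional κ T fun t => M t ω)) := by
  filter_upwards [hM.continuous] with ω hω
  exact tendsto_gridSum hω (hM.zero ω) hκ.le T

lemma IsLinearVariation.measurable_gridSum (hM : IsLinearVariation P 𝓕 M c) (κ : ℝ)
    (T : ℝ≥0) (N : ℕ) : Measurable fun ω => gridSum κ T N fun t => M t ω := by
  have hMm : ∀ t, Measurable (M t) := fun t =>
    ((hM.martingale.stronglyMeasurable t).mono (𝓕.le t)).measurable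
  exact Finset.measurable_fun_sum _ fun k _ => ((hMm _).sub (hMm _)).const_mul _

/-- The Ornstein-Uhlenbeck functional of the martingale has a centered Gaussian law, with variance
at most `c / 2κ`. -/
theorem IsLinearVariation.exists_map_eq_gaussianReal (hM : IsLinearVariation P 𝓕 M c) {κ : ℝ}
    (hκ : 0 < κ) (T : ℝ≥0) : ∃ V : ℝ≥0, (V : ℝ) ≤ c / (2 * κ) ∧
      P.map (fun ω => ouFunctional κ T fun t => M t ω) = gaussianReal 0 V := by
  have hc := hM.variance_nonneg
  obtain ⟨V, hV, ns, hns, hlim⟩ := isCompact_Icc.tendsto_subseq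
    (fun N => gridVariance_mem hκ hc T N)
  lift V to ℝ≥0 using hV.1
  refine ⟨V, hV.2, ?_⟩
  set z : Ω → ℝ := fun ω => ouFunctional κ T fun t => M t ω with hz
  have hzm : AEMeasurable z P := aemeasurable_of_tendsto_metrizable_ae Filter.atTop
    (fun N => (hM.measurable_gridSum κ T N).aemeasurable) (hM.tendsto_gridSum_ae hκ T)
  have hcos : ∀ θ α : ℝ, ∫ ω, Real.cos (θ * z ω + α) ∂P
      = Real.exp (-(θ ^ 2 * V / 2)) * Real.cos α := by
    intro θ α
    have h1 : Filter.Tendsto (fun N => ∫ ω, Real.cos (θ * gridSum κ T N (fun t => M t ω) + α) ∂P)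
        Filter.atTop (nhds (∫ ω, Real.cos (θ * z ω + α) ∂P)) := by
      refine tendsto_integral_of_dominated_convergence (fun _ => 1) (fun N => ?_)
        (integrable_const _) (fun N => Filter.Eventually.of_forall fun ω =>
          Real.abs_cos_le_one _) ?_
      · exact (Real.measurable_cos.comp
          (((hM.measurable_gridSum κ T N).const_mul θ).add_const α)).aestronglyMeasurable
      · filter_upwards [hM.tendsto_gridSum_ae hκ T] with ω hω
        exact (Real.continuous_cos.tendsto _).comp ((hω.const_mul θ).add_const α)
    have h2 := (h1.comp hns.tendsto_atTop).sub
      ((hM.tendsto_cos_gridSum hκ T θ α).comp hns.tendsto_atTop)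
    have h3 : Filter.Tendsto (fun k => Real.exp (-(θ ^ 2 * gridVariance κ c T (ns k) / 2))
        * Real.cos α) Filter.atTop (nhds (Real.exp (-(θ ^ 2 * V / 2)) * Real.cos α)) :=
      ((Real.continuous_exp.tendsto _).comp
        (((hlim.const_mul (θ ^ 2)).div_const 2).neg)).mul_const _
    rw [sub_zero] at h2
    refine tendsto_nhds_unique h2 (h3.congr fun k => ?_)
    simp
  have : IsProbabilityMeasure (P.map z) := Measure.isProbabilityMeasure_map hzm
  refine Measure.ext_of_charFun (funext fun θ => ?_)
  rw [charFun_gaussianReal, charFun_apply_real,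
    integral_map hzm (by fun_prop : Continuous fun x : ℝ =>
      Complex.exp (θ * x * Complex.I)).aestronglyMeasurable]
  have hsplit : ∀ ω, Complex.exp (θ * z ω * Complex.I)
      = ((Real.cos (θ * z ω + 0) : ℝ) : ℂ)
        + ((Real.cos (θ * z ω + -(Real.pi / 2)) : ℝ) : ℂ) * Complex.I := by
    intro ω
    rw [← Complex.ofReal_mul, Complex.exp_mul_I, add_zero, ← sub_eq_add_neg,
      Real.cos_sub_pi_div_two, Complex.ofReal_cos, Complex.ofReal_sin]
  have hint : ∀ α : ℝ, Integrable (fun ω => Real.cos (θ * z ω + α)) P := fun α =>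
    Integrable.of_bound (Real.continuous_cos.comp_aestronglyMeasurable
      ((hzm.const_mul θ).add_const α).aestronglyMeasurable) 1
      (Filter.Eventually.of_forall fun ω => Real.abs_cos_le_one _)
  simp only [hsplit]
  rw [integral_add (hint 0).ofReal ((hint _).ofReal.mul_const _), integral_mul_const,
    integral_complex_ofReal, integral_complex_ofReal, hcos, hcos]
  simp only [Real.cos_zero, Real.cos_neg, Real.cos_pi_div_two, mul_zero, mul_one,
    Complex.ofReal_zero, zero_mul, add_zero, Complex.ofReal_exp]
  congr 1
  push_cast
  ring

/-- The moments of a centered Gaussian law. -/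
lemma lintegral_pow_gaussianReal (V : ℝ≥0) (n : ℕ) :
    ∫⁻ x, ‖x‖ₑ ^ (2 * n) ∂(gaussianReal 0 V)
      = (V : ℝ≥0∞) ^ n * ∫⁻ x, ‖x‖ₑ ^ (2 * n) ∂(gaussianReal 0 1) := by
  have h1 : gaussianReal 0 V = (gaussianReal 0 1).map (fun x : ℝ => (NNReal.sqrt V : ℝ) * x) := by
    rw [gaussianReal_map_const_mul, mul_zero, mul_one]
    congr 1
    ext
    simp
  conv_lhs => rw [h1]
  rw [lintegral_map (by fun_prop) (by fun_prop)]
  have h2 : ∀ x : ℝ, ‖(NNReal.sqrt V : ℝ) * x‖ₑ ^ (2 * n) = (V : ℝ≥0∞) ^ n * ‖x‖ₑ ^ (2 * n) := by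
    intro x
    rw [enorm_mul, mul_pow, pow_mul]
    congr 2
    have : ‖(NNReal.sqrt V : ℝ)‖ₑ = (NNReal.sqrt V : ℝ≥0∞) := by
      rw [Real.enorm_eq_ofReal (NNReal.coe_nonneg _), ENNReal.ofReal_coe_nnreal]
    rw [this, ← ENNReal.coe_pow, NNReal.sq_sqrt]
  simp only [h2]
  rw [lintegral_const_mul _ (by fun_prop)]

lemma lintegral_pow_gaussianReal_lt_top (n : ℕ) :
    ∫⁻ x, ‖x‖ₑ ^ (2 * n) ∂(gaussianReal 0 1) < ⊤ := by
  rcases Nat.eq_zero_or_pos n with rfl | hn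
  · simp
  have h := (memLp_id_gaussianReal (μ := 0) (v := 1) ((2 * n : ℕ) : ℝ≥0)).2
  have h2 := eLpNorm_pow_eq_lintegral (μ := gaussianReal 0 1) (id : ℝ → ℝ) (n := 2 * n) (by omega)
  have h3 : (((2 * n : ℕ) : ℝ≥0) : ℝ≥0∞) = ((2 * n : ℕ) : ℝ≥0∞) := by simp
  rw [h3] at h
  simp only [id] at h2
  rw [← h2]
  exact ENNReal.pow_lt_top h

end Martingale

/-! ### The trace of the covariance in the eigenbasis -/

section Trace

variable {E : Type*} [NormedAddCommGroup E] [InnerProductSpace ℝ E] {Q : E →L[ℝ] E}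

/-- Bessel's inequality for the semi-inner product `⟪Q x, y⟫`, with respect to a finite family that
is orthogonal for it. -/
lemma sum_inner_sq_div_le (hQ : Q.IsPositive) {n : ℕ} {f : Fin n → E} {μ : Fin n → ℝ}
    (hf : ∀ i j, ⟪Q (f i), f j⟫ = if i = j then μ i else 0) (x : E) :
    ∑ i, ⟪x, Q (f i)⟫ ^ 2 / μ i ≤ ⟪Q x, x⟫ := by
  have hsymm : ∀ a b, ⟪Q a, b⟫ = ⟪a, Q b⟫ := fun a b => hQ.isSymmetric a b
  set y : E := ∑ i, (⟪x, Q (f i)⟫ / μ i) • f i with hy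
  have h1 : ⟪Q x, y⟫ = ∑ i, ⟪x, Q (f i)⟫ ^ 2 / μ i := by
    rw [hy, inner_sum]
    refine Finset.sum_congr rfl fun i _ => ?_
    rw [inner_smul_right, hsymm]; ring
  have h2 : ⟪Q y, y⟫ = ∑ i, ⟪x, Q (f i)⟫ ^ 2 / μ i := by
    conv_lhs => rw [hy]
    rw [map_sum, sum_inner]
    refine Finset.sum_congr rfl fun i _ => ?_
    rw [map_smul, inner_smul_left, inner_sum, Finset.sum_eq_single i]
    · rw [inner_smul_right, hf, if_pos rfl, RCLike.conj_to_real]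
      by_cases hμ : μ i = 0
      · simp [hμ]
      · field_simp
    · intro j _ hj
      rw [inner_smul_right, hf, if_neg hj.symm, mul_zero]
    · simp
  have h3 := hQ.inner_nonneg_left (x - y)
  have h4 : ⟪Q (x - y), x - y⟫ = ⟪Q x, x⟫ - 2 * ⟪Q x, y⟫ + ⟪Q y, y⟫ := by
    have h5 : ⟪Q y, x⟫ = ⟪Q x, y⟫ := by rw [hsymm, real_inner_comm]
    rw [map_sub, inner_sub_left, inner_sub_right, inner_sub_right, h5]
    ring
  rw [h4, h1, h2] at h3
  linarith

/-- The trace of a positive operator does not increase by passing from a Hilbert basis to an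
orthonormal family. The compression of the operator to the span of the family is diagonalized. -/
lemma sum_inner_le_tsum (hQ : Q.IsPositive) (e : HilbertBasis ℕ ℝ E)
    (he : Summable fun m => ⟪Q (e m), e m⟫) {ι : Type*} {v : ι → E} (hv : Orthonormal ℝ v)
    (F : Finset ι) : ∑ i ∈ F, ⟪Q (v i), v i⟫ ≤ ∑' m, ⟪Q (e m), e m⟫ := by
  classical
  set W : Submodule ℝ E := Submodule.span ℝ (Finset.image v F : Set E) with hW
  have hfd : FiniteDimensional ℝ W := FiniteDimensional.span_finset ℝ _
  set T : W →ₗ[ℝ] W :=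
    ((W.orthogonalProjectionOnto ∘L Q ∘L W.subtypeL : W →L[ℝ] W) : W →ₗ[ℝ] W) with hT
  have hTin : ∀ a b : W, ⟪T a, b⟫ = ⟪Q a, (b : E)⟫ := fun a b =>
    Submodule.inner_orthogonalProjectionOnto_eq_of_mem_right b (Q a)
  have hTs : T.IsSymmetric := fun a b => by
    rw [real_inner_comm (T b) a, hTin, hTin, real_inner_comm (a : E)]
    exact hQ.isSymmetric a b
  set g := hTs.eigenvectorBasis rfl with hg
  set μ := hTs.eigenvalues rfl with hμ
  have hgf : ∀ i j, ⟪Q (g i : E), (g j : E)⟫ = if i = j then μ i else 0 := by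
    intro i j
    rw [← hTin, hTs.apply_eigenvectorBasis rfl i, inner_smul_left,
      orthonormal_iff_ite.1 g.orthonormal i j]
    split_ifs <;> simp [hμ]
  have htr : ∑ i ∈ F, ⟪Q (v i), v i⟫ = ∑ i, μ i := by
    have h1 := LinearMap.trace_eq_sum_inner T (OrthonormalBasis.span hv F)
    have h2 := hTs.trace_eq_sum_eigenvalues rfl
    rw [h1] at h2
    rw [← Finset.sum_coe_sort F]
    refine Eq.trans (Finset.sum_congr rfl fun i _ => ?_) h2
    have h3 := hTin (OrthonormalBasis.span hv F i) (OrthonormalBasis.span hv F i)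
    have h4 : ⟪Q (v i), v i⟫ =
      ⟪T (OrthonormalBasis.span hv F i), OrthonormalBasis.span hv F i⟫ := by
      rw [h3, OrthonormalBasis.span_apply]
    exact h4.trans (real_inner_comm _ _)
  have hpars : ∀ i, HasSum (fun m => ⟪e m, Q (g i : E)⟫ ^ 2) (‖Q (g i : E)‖ ^ 2) := by
    intro i
    have := e.hasSum_inner_mul_inner (Q (g i : E)) (Q (g i : E))
    rw [real_inner_self_eq_norm_sq] at this
    refine this.congr_fun fun m => ?_
    rw [real_inner_comm, pow_two]
  have hsum : HasSum (fun m => ∑ i, ⟪e m, Q (g i : E)⟫ ^ 2 / μ i)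
      (∑ i, ‖Q (g i : E)‖ ^ 2 / μ i) := hasSum_sum fun i _ => (hpars i).div_const _
  have hle := hasSum_le (fun m => sum_inner_sq_div_le hQ hgf (e m)) hsum he.hasSum
  rw [htr]
  refine le_trans (Finset.sum_le_sum fun i _ => ?_) hle
  have h1 : μ i = ⟪Q (g i : E), (g i : E)⟫ := by rw [hgf, if_pos rfl]
  have h0 : 0 ≤ μ i := h1 ▸ hQ.inner_nonneg_left _
  have h2 : μ i ≤ ‖Q (g i : E)‖ := by
    have h3 := real_inner_le_norm (Q (g i : E)) (g i : E)
    have h4 : ‖(g i : E)‖ = 1 := g.orthonormal.1 i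
    rw [h4, mul_one] at h3
    rwa [h1]
  rcases h0.eq_or_lt with h | h
  · rw [← h]; simp
  · rw [le_div_iff₀ h, ← pow_two]
    exact pow_le_pow_left₀ h0 h2 2

end Trace

/-- The variance of the noise in the direction of a mode. -/
def noiseVar (Q : H →L[ℝ] H) (n : Mode) : ℝ := ⟪Q (testToH (modeField n)), testToH (modeField n)⟫

lemma noiseVar_nonneg {Q : H →L[ℝ] H} (hQ : Q.IsPositive) (n : Mode) : 0 ≤ noiseVar Q n :=
  hQ.inner_nonneg_left _

lemma summable_noiseVar {Q : H →L[ℝ] H} (hQ : Q.IsPositive) (ht : HasFiniteTrace Q) :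
    Summable (noiseVar Q) := by
  obtain ⟨e, he⟩ := ht
  exact summable_of_sum_le (noiseVar_nonneg hQ) fun F => sum_inner_le_tsum hQ e he
    orthonormal_mode F

/-! ### Regularity of the Ornstein-Uhlenbeck process -/

/-- Jensen's inequality for weighted sums. -/
lemma tsum_pow_four_le {ι : Type*} {p : ι → ℝ≥0} (hp : ∀ i, p i ≠ 0) (a : ι → ℝ≥0∞) :
    (∑' i, a i) ^ 4 ≤ (∑' i, (p i : ℝ≥0∞)) ^ 3 * ∑' i, a i ^ 4 / (p i : ℝ≥0∞) ^ 3 := by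
  let _ : MeasurableSpace ι := ⊤
  set μ : Measure ι := Measure.sum fun i => (p i : ℝ≥0∞) • Measure.dirac i with hμ
  have hint : ∀ f : ι → ℝ≥0∞, ∫⁻ i, f i ∂μ = ∑' i, p i * f i := by
    intro f
    rw [hμ, lintegral_sum_measure]
    refine tsum_congr fun i => ?_
    rw [lintegral_smul_measure, lintegral_dirac]
    rfl
  have hm : ∀ f : ι → ℝ≥0∞, AEMeasurable f μ := fun f => (measurable_from_top).aemeasurable
  set f : ι → ℝ≥0∞ := fun i => a i / p i with hf
  have h1 := lintegral_mul_sq_le (μ := μ) (hm f) (hm 1)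
  have h2 := lintegral_mul_sq_le (μ := μ) (hm fun i => f i ^ 2) (hm 1)
  simp only [Pi.one_apply, mul_one, one_pow, hint] at h1 h2
  have e1 : ∀ i, (p i : ℝ≥0∞) * f i = a i := fun i =>
    ENNReal.mul_div_cancel (by exact_mod_cast hp i) ENNReal.coe_ne_top
  have e2 : ∀ i, (p i : ℝ≥0∞) * (f i ^ 2) ^ 2 = a i ^ 4 / (p i : ℝ≥0∞) ^ 3 := by
    intro i
    have hpi : (p i : ℝ≥0∞) ^ 3 ≠ 0 := pow_ne_zero _ (by exact_mod_cast hp i)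
    have hpt : (p i : ℝ≥0∞) ^ 3 ≠ ⊤ := ENNReal.pow_ne_top ENNReal.coe_ne_top
    rw [ENNReal.eq_div_iff hpi hpt, ← e1 i]
    ring
  simp only [e1, e2] at h1 h2
  set S : ℝ≥0∞ := ∑' i, (p i : ℝ≥0∞)
  set B : ℝ≥0∞ := ∑' i, (p i : ℝ≥0∞) * f i ^ 2
  calc (∑' i, a i) ^ 4 = ((∑' i, a i) ^ 2) ^ 2 := by ring
    _ ≤ (B * S) ^ 2 := by gcongr
    _ = B ^ 2 * S ^ 2 := by ring
    _ ≤ (∑' i, a i ^ 4 / (p i : ℝ≥0∞) ^ 3) * S * S ^ 2 := by gcongr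
    _ = _ := by ring

lemma normH_le_normV (T : Distr) : normH T ≤ normV T := by
  by_cases hT : normV T < ⊤
  · obtain ⟨p, hp⟩ := exists_represents_of_normV_lt hT
    rw [normV_eq hp, normH_eq (represents_vToH.1 hp)]
    have h1 := hasSum_coef_sq (vToH p)
    have h2 := hasSum_norm_vGrad_sq p
    have h3 := hasSum_le (fun n => le_mul_of_one_le_left (sq_nonneg _) (one_le_lam n)) h1 h2
    exact enorm_le_iff_norm_le.2 ((sq_le_sq₀ (norm_nonneg _) (norm_nonneg _)).1 h3)
  · rw [not_lt_top_iff.1 hT]; exact le_top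

/-- The embedding of `V` in `L⁴`. -/
lemma exists_normL4_le_normV : ∃ K : ℝ≥0, ∀ T, normL4 T ^ 8 ≤ K * (normH T ^ 2 * normV T ^ 6) := by
  obtain ⟨K, hK⟩ := exists_eLpNorm_four_le
  refine ⟨K + 1, fun T => ?_⟩
  by_cases hT : normV T < ⊤
  · obtain ⟨p, hp⟩ := exists_represents_of_normV_lt hT
    rw [normV_eq hp, normH_eq (represents_vToH.1 hp), normL4_eq (represents_vToH.1 hp)]
    refine (hK p).trans ?_
    gcongr
    · exact le_self_add
    · exact le_rfl
  · rw [not_lt_top_iff.1 hT]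
    by_cases h0 : normH T = 0
    · have hlt : normH T < ⊤ := by rw [h0]; exact ENNReal.zero_lt_top
      obtain ⟨h, hh⟩ := exists_represents_of_normH_lt hlt
      rw [normH_eq hh] at h0
      have h2 : ‖h‖ = 0 := by
        rw [← toReal_enorm h, h0, ENNReal.toReal_zero]
      obtain rfl : h = 0 := norm_eq_zero.1 h2
      rw [normL4_eq hh]
      have : eLpNorm ((0 : H) : L2Vec) 4 cellMeasure = 0 := by
        rw [eLpNorm_congr_ae (show ((0 : H) : L2Vec) =ᵐ[cellMeasure] (0 : Space → Vec) from
          Lp.coeFn_zero _ _ _)]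
        exact eLpNorm_zero
      rw [this]; simp
    · rw [ENNReal.top_pow (by norm_num), ENNReal.mul_top (pow_ne_zero _ h0), ENNReal.mul_top]
      · exact le_top
      · simp

lemma zProc_zero (ν : ℝ) (ω : PathSpace) (t : ℝ≥0) : zProc ν 0 ω t = ou ν t ω := by
  funext e; simp [zProc]

lemma IsWeakMartingaleSolution.isLinearVariation {ν : ℝ} {Q : H →L[ℝ] H} {μ₀ : Measure H}
    {P : Measure PathSpace} (h : IsWeakMartingaleSolution ν Q μ₀ P) (φ : testField) :
    IsLinearVariation P canonicalFiltration (mart ν φ) ⟪Q (testToH φ), testToH φ⟫ :=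
  ⟨mart_zero ν φ, h.memLp φ, h.martingale φ, h.quadratic_variation φ, h.continuous φ⟩

/-- The eighth moments of the coefficients of the Ornstein-Uhlenbeck process. -/
lemma lintegral_ou_pow_le {ν : ℝ} (hν : 0 < ν) {Q : H →L[ℝ] H} {μ₀ : Measure H}
    {P : Measure PathSpace} [IsProbabilityMeasure P] (h : IsWeakMartingaleSolution ν Q μ₀ P)
    (t : ℝ≥0) (n : Mode) :
    ∫⁻ ω, ‖ou ν t ω (modeEigen n)‖ₑ ^ 8 ∂P
      ≤ ENNReal.ofReal (noiseVar Q n / (2 * (ν * lam n))) ^ 4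
        * ∫⁻ x, ‖x‖ₑ ^ 8 ∂(gaussianReal 0 1) := by
  have hM := h.isLinearVariation (modeField n)
  have hκ : 0 < ν * lam n := mul_pos hν (lam_pos n)
  obtain ⟨V, hV, hmap⟩ := hM.exists_map_eq_gaussianReal hκ t
  have hzm : AEMeasurable (fun ω => ouFunctional (ν * lam n) t
    fun s => mart ν (modeField n) s ω) P :=
    aemeasurable_of_tendsto_metrizable_ae Filter.atTop
      (fun N => (hM.measurable_gridSum _ t N).aemeasurable) (hM.tendsto_gridSum_ae hκ t)
  have h1 : ∫⁻ ω, ‖ou ν t ω (modeEigen n)‖ₑ ^ 8 ∂P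
      = ∫⁻ ω, ‖ouFunctional (ν * lam n) t fun s => mart ν (modeField n) s ω‖ₑ ^ 8 ∂P := by
    refine lintegral_congr_ae ?_
    filter_upwards [h.square_integrable_paths] with ω hω
    rw [ou_eq ν (hω t), ouFunctional]
    congr 3
    ring
  have h2 := lintegral_map' (μ := P) (f := fun x : ℝ => ‖x‖ₑ ^ 8) (by fun_prop) hzm
  rw [h1, ← h2, hmap, lintegral_pow_gaussianReal V 4]
  gcongr
  rw [← ENNReal.ofReal_coe_nnreal]
  exact ENNReal.ofReal_le_ofReal hV

/-- The eighth moment of the `V` norm of the Ornstein-Uhlenbeck process is bounded uniformly in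
time. -/
lemma exists_lintegral_normV_le {ν : ℝ} (hν : 0 < ν) {Q : H →L[ℝ] H} (hQ : Q.IsPositive)
    (ht : HasFiniteTrace Q) {μ₀ : Measure H} {P : Measure PathSpace} [IsProbabilityMeasure P]
    (h : IsWeakMartingaleSolution ν Q μ₀ P) :
    ∃ C : ℝ≥0∞, C < ⊤ ∧ ∀ t, ∫⁻ ω, normV (ou ν t ω) ^ 8 ∂P ≤ C := by
  obtain ⟨r, hr, hrs⟩ := ENNReal.exists_pos_sum_of_countable one_ne_zero Mode
  set q : Mode → ℝ≥0 := fun n => (noiseVar Q n).toNNReal with hq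
  set p : Mode → ℝ≥0 := fun n => q n + r n with hp
  have hp0 : ∀ n, p n ≠ 0 := fun n => (add_pos_of_nonneg_of_pos (zero_le) (hr n)).ne'
  have hqs : ∑' n, (q n : ℝ≥0∞) < ⊤ := by
    have := (summable_noiseVar hQ ht).hasSum
    have h2 := tsum_ofReal_eq_of_hasSum (noiseVar_nonneg hQ) this
    change ∑' n, ENNReal.ofReal (noiseVar Q n) < ⊤
    rw [h2]
    exact ENNReal.ofReal_lt_top
  have hps : ∑' n, (p n : ℝ≥0∞) < ⊤ := by
    simp only [hp, ENNReal.coe_add]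
    rw [ENNReal.tsum_add]
    exact ENNReal.add_lt_top.2 ⟨hqs, hrs.trans ENNReal.one_lt_top⟩
  set G : ℝ≥0∞ := ∫⁻ x, ‖x‖ₑ ^ 8 ∂(gaussianReal 0 1) with hG
  have hGt : G < ⊤ := lintegral_pow_gaussianReal_lt_top 4
  set D : ℝ≥0∞ := ENNReal.ofReal (1 / (2 * ν)) ^ 4 * G with hD
  have hDt : D < ⊤ := ENNReal.mul_lt_top (ENNReal.pow_lt_top ENNReal.ofReal_lt_top) hGt
  set S : ℝ≥0∞ := ∑' n, (p n : ℝ≥0∞) with hS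
  refine ⟨S ^ 3 * (D * S), ENNReal.mul_lt_top (ENNReal.pow_lt_top hps)
    (ENNReal.mul_lt_top hDt hps), fun t => ?_⟩
  have hom : ∀ n, Measurable fun ω => ou ν t ω (modeEigen n) := fun n => by
    have := (measurablePaths_id.ou ν (modeEigen n)).comp
      (measurable_const.prodMk measurable_id : Measurable fun ω : PathSpace => (t, ω))
    simpa only [Function.comp_def] using this
  have hpt : ∀ ω, normV (ou ν t ω) ^ 8 ≤ S ^ 3 * ∑' n,
      ENNReal.ofReal (lam n) ^ 4 / (p n : ℝ≥0∞) ^ 3 * ‖ou ν t ω (modeEigen n)‖ₑ ^ 8 := by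
    intro ω
    have e1 : normV (ou ν t ω) ^ 8 = (normV (ou ν t ω) ^ 2) ^ 4 := by ring
    rw [e1, normV_sq (isSpectral_ou ν t ω)]
    refine (tsum_pow_four_le hp0 _).trans (le_of_eq ?_)
    congr 1
    refine tsum_congr fun n => ?_
    have h8 : ENNReal.ofReal (ou ν t ω (modeEigen n) ^ 2) ^ 4 = ‖ou ν t ω (modeEigen n)‖ₑ ^ 8 := by
      rw [← sq_abs, ← Real.norm_eq_abs, ← enorm_sq_eq_ofReal, ← pow_mul]
    rw [ENNReal.ofReal_mul (lam_pos n).le, mul_pow, h8]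
    rw [div_eq_mul_inv, div_eq_mul_inv]
    ring
  refine (lintegral_mono hpt).trans ?_
  have hmeas : ∀ n, Measurable fun ω => ‖ou ν t ω (modeEigen n)‖ₑ ^ 8 := fun n =>
    (hom n).enorm.pow_const 8
  rw [lintegral_const_mul _ (Measurable.tsum fun n => (hmeas n).const_mul _),
    lintegral_tsum fun n => ((hmeas n).const_mul _).aemeasurable]
  gcongr
  rw [← ENNReal.tsum_mul_left]
  refine ENNReal.tsum_le_tsum fun n => ?_
  rw [lintegral_const_mul _ (hmeas n)]
  have hb := lintegral_ou_pow_le hν h t n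
  have e2 : ENNReal.ofReal (noiseVar Q n / (2 * (ν * lam n)))
      = ENNReal.ofReal (1 / (2 * ν)) * (q n : ℝ≥0∞) * (ENNReal.ofReal (lam n))⁻¹ := by
    have e3 : noiseVar Q n / (2 * (ν * lam n)) = 1 / (2 * ν) * noiseVar Q n * (lam n)⁻¹ := by
      have := (lam_pos n).ne'
      field_simp
    rw [e3, ENNReal.ofReal_mul (mul_nonneg (by positivity) (noiseVar_nonneg hQ n)),
      ENNReal.ofReal_mul (by positivity), ENNReal.ofReal_inv_of_pos (lam_pos n)]
    rfl
  have hl0 : ENNReal.ofReal (lam n) ≠ 0 := by simpa using lam_pos n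
  have hqp : (q n : ℝ≥0∞) ≤ p n := by
    rw [hp]; push_cast; exact le_self_add
  have hpn : (p n : ℝ≥0∞) ≠ 0 := by exact_mod_cast hp0 n
  calc ENNReal.ofReal (lam n) ^ 4 / (p n : ℝ≥0∞) ^ 3 * ∫⁻ ω, ‖ou ν t ω (modeEigen n)‖ₑ ^ 8 ∂P
      ≤ ENNReal.ofReal (lam n) ^ 4 / (p n : ℝ≥0∞) ^ 3 * ((ENNReal.ofReal (1 / (2 * ν))
          * (q n : ℝ≥0∞) * (ENNReal.ofReal (lam n))⁻¹) ^ 4 * G) := by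
        rw [← e2]; gcongr
    _ = D * ((q n : ℝ≥0∞) ^ 4 / (p n : ℝ≥0∞) ^ 3)
          * (ENNReal.ofReal (lam n) * (ENNReal.ofReal (lam n))⁻¹) ^ 4 := by
        rw [hD]
        generalize ENNReal.ofReal (1 / (2 * ν)) = c
        simp only [div_eq_mul_inv]
        ring
    _ = D * ((q n : ℝ≥0∞) ^ 4 / (p n : ℝ≥0∞) ^ 3) := by
        rw [ENNReal.mul_inv_cancel hl0 ENNReal.ofReal_ne_top, one_pow, mul_one]
    _ ≤ D * p n := by
        gcongr
        rw [ENNReal.div_le_iff (pow_ne_zero _ hpn) (ENNReal.pow_ne_top ENNReal.coe_ne_top)]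
        calc (q n : ℝ≥0∞) ^ 4 ≤ (p n : ℝ≥0∞) ^ 4 := by gcongr
          _ = _ := by ring

/-- Almost surely the Ornstein-Uhlenbeck process is in `L⁸_loc([0, ∞); V)`. -/
lemma ae_lintegral_normV_lt {ν : ℝ} (hν : 0 < ν) {Q : H →L[ℝ] H} (hQ : Q.IsPositive)
    (ht : HasFiniteTrace Q) {μ₀ : Measure H} {P : Measure PathSpace} [IsProbabilityMeasure P]
    (h : IsWeakMartingaleSolution ν Q μ₀ P) :
    ∀ᵐ ω ∂P, ∀ T : ℝ≥0, ∫⁻ t in Set.Iic T, normV (zProc ν 0 ω t) ^ 8 ∂timeMeasure < ⊤ := by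
  obtain ⟨C, hC, hCt⟩ := exists_lintegral_normV_le hν hQ ht h
  have hm : Measurable fun q : ℝ≥0 × PathSpace => normV (zProc ν 0 q.2 q.1) ^ 8 := by
    have e : ∀ q : ℝ≥0 × PathSpace,
        normV (zProc ν 0 q.2 q.1) ^ 8 = (normV (zProc ν 0 q.2 q.1) ^ 2) ^ 4 := fun q => by ring
    simp only [e]
    exact ((measurablePaths_id.zProc ν 0).normV_sq).pow_const 4
  have h1 : ∀ N : ℕ, ∀ᵐ ω ∂P,
      ∫⁻ t in Set.Iic (N : ℝ≥0), normV (zProc ν 0 ω t) ^ 8 ∂timeMeasure < ⊤ := by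
    intro N
    refine ae_lt_top (measurable_timeLIntegral_path hm N) (ne_of_lt ?_)
    rw [lintegral_lintegral_swap (by
      exact (hm.comp measurable_swap).aemeasurable)]
    refine (lintegral_mono (g := fun _ => C) fun t => ?_).trans_lt ?_
    · simp only [zProc_zero]; exact hCt t
    · rw [lintegral_const]
      exact ENNReal.mul_lt_top hC (measure_lt_top _ _)
  filter_upwards [ae_all_iff.2 h1] with ω hω
  exact (forall_nnreal_iff_nat fun s t hst h =>
    (lintegral_mono_set (Set.Iic_subset_Iic.2 hst)).trans_lt h).2 hω

lemma ae_mem_regularSet {ν : ℝ} (hν : 0 < ν) {Q : H →L[ℝ] H} (hQ : Q.IsPositive)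
    (ht : HasFiniteTrace Q) {μ₀ : Measure H} {P : Measure PathSpace} [IsProbabilityMeasure P]
    (h : IsWeakMartingaleSolution ν Q μ₀ P) (hv : HasEnergyClassPaths ν P) :
    ∀ᵐ ω ∂P, ω ∈ regularSet ν := by
  obtain ⟨K, hK⟩ := exists_normL4_le_normV
  filter_upwards [ae_lintegral_normV_lt hν hQ ht h, hv] with ω hω hω'
  refine ⟨fun T => ?_, hω'⟩
  refine lt_of_le_of_lt (b := ∫⁻ t in Set.Iic T, K * normV (zProc ν 0 ω t) ^ 8 ∂timeMeasure)
    (lintegral_mono fun t => (hK _).trans ?_) ?_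
  · have := normH_le_normV (zProc ν 0 ω t)
    calc (K : ℝ≥0∞) * (normH (zProc ν 0 ω t) ^ 2 * normV (zProc ν 0 ω t) ^ 6)
        ≤ K * (normV (zProc ν 0 ω t) ^ 2 * normV (zProc ν 0 ω t) ^ 6) := by gcongr
      _ = _ := by ring
  · rw [lintegral_const_mul' _ _ ENNReal.coe_ne_top]
    exact ENNReal.mul_lt_top ENNReal.coe_lt_top (hω T)

/-! ### The trilinear form on `L⁴` -/

lemma integrable_tripleFun {u w : L2Vec} (hu : eLpNorm u 4 cellMeasure < ⊤)
    (hw : eLpNorm w 4 cellMeasure < ⊤) (G : L2Grad) : Integrable (tripleFun u G w) cellMeasure :=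
  ⟨aestronglyMeasurable_tripleFun u G w, (lintegral_tripleFun_le u G w).trans_lt
    (ENNReal.mul_lt_top (ENNReal.mul_lt_top hu hw) enorm_lt_top)⟩

lemma abs_triple_le {u w : L2Vec} (hu : eLpNorm u 4 cellMeasure < ⊤)
    (hw : eLpNorm w 4 cellMeasure < ⊤) (G : L2Grad) :
    |triple u G w| ≤ (eLpNorm u 4 cellMeasure).toReal * (eLpNorm w 4 cellMeasure).toReal * ‖G‖ := by
  have h1 : ‖triple u G w‖ₑ ≤ eLpNorm u 4 cellMeasure * eLpNorm w 4 cellMeasure * ‖G‖ₑ :=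
    (enorm_integral_le_lintegral_enorm _).trans (lintegral_tripleFun_le u G w)
  have h2 := ENNReal.toReal_mono
    (ENNReal.mul_lt_top (ENNReal.mul_lt_top hu hw) enorm_lt_top).ne h1
  rwa [ENNReal.toReal_mul, ENNReal.toReal_mul, toReal_enorm, toReal_enorm, Real.norm_eq_abs] at h2

lemma tripleFun_add_right (u : L2Vec) (G : L2Grad) (w w' : L2Vec) :
    tripleFun u G (w + w') =ᵐ[cellMeasure] fun x => tripleFun u G w x + tripleFun u G w' x := by
  filter_upwards [Lp.coeFn_add w w'] with x hx
  simp only [tripleFun, hx, Pi.add_apply, PiLp.add_apply, mul_add, Finset.sum_add_distrib]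

lemma tripleFun_smul_right (u : L2Vec) (G : L2Grad) (c : ℝ) (w : L2Vec) :
    tripleFun u G (c • w) =ᵐ[cellMeasure] fun x => c * tripleFun u G w x := by
  filter_upwards [Lp.coeFn_smul c w] with x hx
  simp only [tripleFun, hx, Pi.smul_apply, PiLp.smul_apply, smul_eq_mul, Finset.mul_sum]
  exact Finset.sum_congr rfl fun i _ => Finset.sum_congr rfl fun j _ => by ring

section Bilinear

variable {u w w' : L2Vec}

lemma triple_add_grad (hu : eLpNorm u 4 cellMeasure < ⊤) (hw : eLpNorm w 4 cellMeasure < ⊤)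
    (F G : L2Grad) : triple u (F + G) w = triple u F w + triple u G w := by
  rw [triple, integral_congr_ae (tripleFun_add u w F G),
    integral_add (integrable_tripleFun hu hw F) (integrable_tripleFun hu hw G)]
  rfl

lemma triple_smul_grad (c : ℝ) (G : L2Grad) : triple u (c • G) w = c * triple u G w := by
  rw [triple, integral_congr_ae (tripleFun_smul u w c G), integral_const_mul]
  rfl

lemma triple_add_right (hu : eLpNorm u 4 cellMeasure < ⊤) (hw : eLpNorm w 4 cellMeasure < ⊤)
    (hw' : eLpNorm w' 4 cellMeasure < ⊤) (G : L2Grad) :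
    triple u G (w + w') = triple u G w + triple u G w' := by
  rw [triple, integral_congr_ae (tripleFun_add_right u G w w'),
    integral_add (integrable_tripleFun hu hw G) (integrable_tripleFun hu hw' G)]
  rfl

lemma triple_smul_right (c : ℝ) (G : L2Grad) : triple u G (c • w) = c * triple u G w := by
  rw [triple, integral_congr_ae (tripleFun_smul_right u G c w), integral_const_mul]
  rfl

end Bilinear

/-- The trilinear form as a continuous linear functional of the gradient. -/
def tripleGrad {u w : L2Vec} (hu : eLpNorm u 4 cellMeasure < ⊤)
    (hw : eLpNorm w 4 cellMeasure < ⊤) : L2Grad →L[ℝ] ℝ :=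
  LinearMap.mkContinuous
    { toFun := fun G => triple u G w
      map_add' := triple_add_grad hu hw
      map_smul' := fun c G => triple_smul_grad c G }
    ((eLpNorm u 4 cellMeasure).toReal * (eLpNorm w 4 cellMeasure).toReal) (abs_triple_le hu hw)

lemma tripleGrad_apply {u w : L2Vec} (hu : eLpNorm u 4 cellMeasure < ⊤)
    (hw : eLpNorm w 4 cellMeasure < ⊤) (G : L2Grad) : tripleGrad hu hw G = triple u G w := rfl

lemma hasSum_vGrad (q : V) :
    HasSum (fun n => coef (vToH q) n • testGradToL2 (modeField n)) (vGrad q) := by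
  have h1 := gradBasis.hasSum_repr ⟨vGrad q, snd_mem_GradSub q⟩
  have h2 := h1.mapL GradSub.subtypeL
  refine h2.congr_fun fun n => ?_
  rw [gradBasis.repr_apply_apply, real_inner_comm, gradBasis_repr, gradBasis_apply, map_smul]
  change _ = _ • ((gradMode n : GradSub) : L2Grad)
  rw [coe_gradMode, smul_smul]
  congr 1
  have := (Real.sqrt_pos.2 (lam_pos n)).ne'
  field_simp

lemma coef_sum_smul_mode [DecidableEq Mode] (F : Finset Mode) (c : Mode → ℝ) (n : Mode) :
    coef (∑ m ∈ F, c m • testToH (modeField m)) n = if n ∈ F then c n else 0 := by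
  have h : coef (∑ m ∈ F, c m • testToH (modeField m)) n
      = ∑ m ∈ F, c m * coef (testToH (modeField m)) n := by
    rw [coef, sum_inner]
    exact Finset.sum_congr rfl fun m _ => coef_smul _ _ n
  rw [h]
  simp only [coef_mode, mul_ite, mul_one, mul_zero, Finset.sum_ite_eq']

lemma norm_sum_vGrad_le (q : V) (F : Finset Mode) :
    ‖∑ n ∈ F, coef (vToH q) n • testGradToL2 (modeField n)‖ ≤ ‖vGrad q‖ := by
  have h1 : ∑ n ∈ F, coef (vToH q) n • testGradToL2 (modeField n)
      = vGrad (testToV (∑ n ∈ F, coef (vToH q) n • modeField n)) := by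
    rw [vGrad_testToV, map_sum]
    exact Finset.sum_congr rfl fun n _ => (map_smul _ _ _).symm
  rw [h1]
  refine (sq_le_sq₀ (norm_nonneg _) (norm_nonneg _)).1 ?_
  refine hasSum_le (fun n => ?_) (hasSum_norm_vGrad_sq _) (hasSum_norm_vGrad_sq q)
  classical
  refine mul_le_mul_of_nonneg_left ?_ (lam_pos n).le
  have h2 : coef (vToH (testToV (∑ n ∈ F, coef (vToH q) n • modeField n))) n
      = if n ∈ F then coef (vToH q) n else 0 := by
    rw [vToH_testToV, map_sum, ← coef_sum_smul_mode]
    simp only [map_smul]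
  rw [h2]
  split_ifs
  · exact le_rfl
  · simpa using sq_nonneg _

/-- The expansion of `⟨B(u, q), u⟩` in the modes of `q`. -/
lemma hasSum_convection {u : H} (hu : eLpNorm (u : L2Vec) 4 cellMeasure < ⊤) (q : V) :
    HasSum (fun n => coef (vToH q) n * convection u (modeField n)) (triple u (vGrad q) u) := by
  have h1 := (hasSum_vGrad q).mapL (tripleGrad hu hu)
  rw [tripleGrad_apply] at h1
  refine h1.congr_fun fun n => ?_
  rw [map_smul, tripleGrad_apply, smul_eq_mul, convection_eq_triple]

lemma abs_sum_convection_le {u : H} (hu : eLpNorm (u : L2Vec) 4 cellMeasure < ⊤) (q : V)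
    (F : Finset Mode) : |∑ n ∈ F, coef (vToH q) n * convection u (modeField n)|
      ≤ (eLpNorm (u : L2Vec) 4 cellMeasure).toReal ^ 2 * ‖vGrad q‖ := by
  have h1 : ∑ n ∈ F, coef (vToH q) n * convection u (modeField n)
      = tripleGrad hu hu (∑ n ∈ F, coef (vToH q) n • testGradToL2 (modeField n)) := by
    rw [map_sum]
    refine Finset.sum_congr rfl fun n _ => ?_
    rw [map_smul, tripleGrad_apply, smul_eq_mul, convection_eq_triple]
  rw [h1, pow_two]
  refine (abs_triple_le hu hu _).trans ?_
  exact mul_le_mul_of_nonneg_left (norm_sum_vGrad_le q F) (by positivity)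

/-! ### Skew-symmetry of the trilinear form -/

lemma exists_eLpNorm_four_le_norm : ∃ K : ℝ≥0, ∀ p : V,
    eLpNorm p.1.1 4 cellMeasure ≤ K * ‖p‖ₑ := by
  obtain ⟨K, hK⟩ := exists_eLpNorm_four_le
  refine ⟨K + 1, fun p => ?_⟩
  have h1 : ‖p.1.1‖ₑ ≤ ‖p‖ₑ := enorm_le_iff_norm_le.2 (norm_fst_le p.1)
  have h2 : ‖p.1.2‖ₑ ≤ ‖p‖ₑ := enorm_le_iff_norm_le.2 (norm_snd_le p.1)
  refine (ENNReal.pow_right_strictMono (n := 8) (by norm_num)).le_iff_le.1 ?_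
  have h3 : (K : ℝ≥0∞) ≤ (K + 1 : ℝ≥0) ^ 8 := by
    calc (K : ℝ≥0∞) ≤ ((K + 1 : ℝ≥0) : ℝ≥0∞) := by push_cast; exact le_self_add
      _ = ((K + 1 : ℝ≥0) : ℝ≥0∞) ^ 1 := (pow_one _).symm
      _ ≤ _ := pow_le_pow_right₀ (by push_cast; exact le_add_self) (by norm_num)
  calc eLpNorm p.1.1 4 cellMeasure ^ 8 ≤ K * (‖p.1.1‖ₑ ^ 2 * ‖p.1.2‖ₑ ^ 6) := hK p
    _ ≤ (K + 1 : ℝ≥0) ^ 8 * (‖p‖ₑ ^ 2 * ‖p‖ₑ ^ 6) := by gcongr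
    _ = _ := by rw [mul_pow]; ring

lemma eLpNorm_four_lt_top (p : V) : eLpNorm p.1.1 4 cellMeasure < ⊤ := by
  obtain ⟨K, hK⟩ := exists_eLpNorm_four_le_norm
  exact (hK p).trans_lt (ENNReal.mul_lt_top ENNReal.coe_lt_top enorm_lt_top)

lemma triple_skew_test (u : H) (hu : eLpNorm (u : L2Vec) 4 cellMeasure < ⊤) (φ ψ : testField) :
    triple u (testGradToL2 φ) (testToL2 ψ) + triple u (testGradToL2 ψ) (testToL2 φ) = 0 := by
  have hc : ∀ (χ : testField) (j : Fin 3), ContDiff ℝ (⊤ : ℕ∞) fun x => (χ : Space → Vec) x j :=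
    fun χ j => (EuclideanSpace.proj j : Vec →L[ℝ] ℝ).contDiff.comp χ.2.1
  have hd : ∀ (χ : testField) (j i : Fin 3) (x : Space),
      fderiv ℝ (fun y => (χ : Space → Vec) y j) x (Pi.single i 1) = pderiv i χ x j := by
    intro χ j i x
    have := ((EuclideanSpace.proj j : Vec →L[ℝ] ℝ).hasFDerivAt.comp x
      (χ.2.1.differentiable (by simp) x).hasFDerivAt).fderiv
    change fderiv ℝ ((EuclideanSpace.proj j : Vec →L[ℝ] ℝ) ∘ (χ : Space → Vec)) x _ = _
    rw [this]
    rfl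
  set g : Space → ℝ := fun x => ∑ j, (φ : Space → Vec) x j * (ψ : Space → Vec) x j with hg
  have hgc : ContDiff ℝ (⊤ : ℕ∞) g := ContDiff.sum fun j _ => (hc φ j).mul (hc ψ j)
  have hgp : ∀ x i, g (x + Pi.single i (2 * Real.pi)) = g x := fun x i => by
    simp only [hg, φ.2.2.1 x i, ψ.2.2.1 x i]
  have h0 := integral_inner_gradient u.2 hgc hgp
  have hgrad : ∀ x i, fderiv ℝ g x (Pi.single i 1)
      = ∑ j, (pderiv i φ x j * (ψ : Space → Vec) x j + pderiv i ψ x j * (φ : Space → Vec) x j) := by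
    intro x i
    have hs := HasFDerivAt.fun_sum (u := Finset.univ) fun (j : Fin 3) _ =>
      ((hc φ j).differentiable (by simp) x).hasFDerivAt.mul
        ((hc ψ j).differentiable (by simp) x).hasFDerivAt
    have hs' : fderiv ℝ g x = _ := hs.fderiv
    rw [hs']
    simp only [sum_apply, add_apply,
      smul_apply, smul_eq_mul, hd]
    exact Finset.sum_congr rfl fun j _ => by ring
  have hφ : eLpNorm (testToL2 φ) 4 cellMeasure < ⊤ := eLpNorm_four_lt_top (testToV φ)
  have hψ : eLpNorm (testToL2 ψ) 4 cellMeasure < ⊤ := eLpNorm_four_lt_top (testToV ψ)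
  rw [triple, triple, ← integral_add (integrable_tripleFun hu hψ _)
    (integrable_tripleFun hu hφ _), ← h0]
  refine integral_congr_ae ?_
  filter_upwards [coeFn_testToL2 φ, coeFn_testToL2 ψ, coeFn_testGradToL2 φ,
    coeFn_testGradToL2 ψ] with x h1 h2 h3 h4
  simp only [tripleFun, h1, h2, h3, h4, grad]
  rw [← Finset.sum_add_distrib, PiLp.inner_apply]
  refine Finset.sum_congr rfl fun i _ => ?_
  rw [← Finset.sum_add_distrib]
  simp only [gradient, hgrad, RCLike.inner_apply, conj_trivial, Finset.sum_mul]
  exact Finset.sum_congr rfl fun j _ => by ring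

lemma exists_triple_bilinear (u : H) (hu : eLpNorm (u : L2Vec) 4 cellMeasure < ⊤) :
    ∃ F : V →L[ℝ] V →L[ℝ] ℝ, ∀ p q, F p q = triple u (vGrad p) (vToH q) := by
  obtain ⟨K, hK⟩ := exists_eLpNorm_four_le_norm
  have h4 : ∀ q : V, eLpNorm (vToH q : L2Vec) 4 cellMeasure < ⊤ := eLpNorm_four_lt_top
  set C := (eLpNorm (u : L2Vec) 4 cellMeasure).toReal
  obtain ⟨f, hf⟩ : ∃ f : V →ₗ[ℝ] V →ₗ[ℝ] ℝ, ∀ p q, f p q = triple u (vGrad p) (vToH q) :=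
    ⟨LinearMap.mk₂ ℝ (fun p q => triple u (vGrad p) (vToH q))
      (fun p p' q => by rw [map_add, triple_add_grad hu (h4 q)])
      (fun c p q => by rw [map_smul, triple_smul_grad, smul_eq_mul])
      (fun p q q' => by
        rw [map_add, Submodule.coe_add, triple_add_right hu (h4 q) (h4 q')])
      (fun c p q => by rw [map_smul, Submodule.coe_smul, triple_smul_right, smul_eq_mul]),
      fun p q => rfl⟩
  have hb : ∀ p q, ‖f p q‖ ≤ C * K * ‖p‖ * ‖q‖ := by
    intro p q
    have h1 := abs_triple_le hu (h4 q) (vGrad p)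
    have h2 : (eLpNorm (vToH q : L2Vec) 4 cellMeasure).toReal ≤ K * ‖q‖ := by
      have := ENNReal.toReal_mono (ENNReal.mul_lt_top ENNReal.coe_lt_top enorm_lt_top).ne (hK q)
      rwa [ENNReal.toReal_mul, toReal_enorm, ENNReal.coe_toReal] at this
    have h3 : ‖vGrad p‖ ≤ ‖p‖ := norm_snd_le p.1
    rw [hf, Real.norm_eq_abs]
    calc _ ≤ C * (eLpNorm (vToH q : L2Vec) 4 cellMeasure).toReal * ‖vGrad p‖ := h1
      _ ≤ C * (K * ‖q‖) * ‖p‖ := by gcongr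
      _ = _ := by ring
  exact ⟨LinearMap.mkContinuous₂ f (C * K) hb, hf⟩

/-- `⟨q, B(u, p)⟩ = -⟨p, B(u, q)⟩` for `u ∈ H ∩ L⁴` and `p, q ∈ V`. -/
lemma triple_skew (u : H) (hu : eLpNorm (u : L2Vec) 4 cellMeasure < ⊤) (p q : V) :
    triple u (vGrad p) (vToH q) + triple u (vGrad q) (vToH p) = 0 := by
  obtain ⟨F, hF⟩ := exists_triple_bilinear u hu
  have hcont : Continuous fun r : V × V => F r.1 r.2 :=
    (F.continuous.comp continuous_fst).clm_apply continuous_snd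
  have hcl : IsClosed {r : V × V | F r.1 r.2 + F r.2 r.1 = 0} :=
    isClosed_eq (hcont.add (hcont.comp continuous_swap)) continuous_const
  have key := isClosed_property2 (p := fun p q => F p q + F q p = 0) dense_testToV hcl
    (fun φ ψ => by
      rw [hF, hF]
      exact triple_skew_test u hu φ ψ) p q
  rwa [hF, hF] at key

lemma eLpNorm_four_add_lt_top {u w : L2Vec} (hu : eLpNorm u 4 cellMeasure < ⊤)
    (hw : eLpNorm w 4 cellMeasure < ⊤) : eLpNorm (u + w : L2Vec) 4 cellMeasure < ⊤ :=
  ((memLp_congr_ae (Lp.coeFn_add _ _)).2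
    (MemLp.add ⟨Lp.aestronglyMeasurable _, hu⟩ ⟨Lp.aestronglyMeasurable _, hw⟩)).2

/-- The change of the trilinear term if `q` is moved from the first to the second summand of
`u = p + h`. -/
lemma triVal_sub_triVal (h u : H) (p q : V) (hh : eLpNorm (h : L2Vec) 4 cellMeasure < ⊤)
    (hu : u = vToH p + h) :
    triVal (h, p) - triVal (h + vToH q, p - q) = triple u (vGrad q) u := by
  have hp : eLpNorm (vToH p : L2Vec) 4 cellMeasure < ⊤ := eLpNorm_four_lt_top p
  have hq : eLpNorm (vToH q : L2Vec) 4 cellMeasure < ⊤ := eLpNorm_four_lt_top q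
  have hu' : (u : L2Vec) = vToH p + h := by rw [hu, Submodule.coe_add]
  have hu4 : eLpNorm (u : L2Vec) 4 cellMeasure < ⊤ := by
    rw [hu']; exact eLpNorm_four_add_lt_top hp hh
  have e1 : triVal (h, p) = triple u (vGrad p) h := by
    rw [hu']; rfl
  have e2 : triVal (h + vToH q, p - q)
      = triple u (vGrad p + (-1 : ℝ) • vGrad q) (h + vToH q) := by
    have a1 : ((vToH (p - q) : H) : L2Vec) + ((h + vToH q : H) : L2Vec) = (u : L2Vec) := by
      rw [map_sub, Submodule.coe_sub, Submodule.coe_add, hu']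
      abel
    have a2 : vGrad (p - q) = vGrad p + (-1 : ℝ) • vGrad q := by
      rw [neg_one_smul, ← sub_eq_add_neg, map_sub]
    have a3 : triVal (h + vToH q, p - q) = triple (((vToH (p - q) : H) : L2Vec)
      + ((h + vToH q : H) : L2Vec)) (vGrad (p - q)) (h + vToH q : H) := rfl
    rw [a3, a1, a2, Submodule.coe_add]
  have e3 : triple u (vGrad q) u
      = triple u (vGrad q) (vToH p) + triple u (vGrad q) h := by
    rw [← triple_add_right hu4 hp hh, ← hu']
  rw [e1, e2, e3, triple_add_grad hu4 (eLpNorm_four_add_lt_top hh hq), triple_smul_grad,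
    triple_add_right hu4 hh hq, triple_add_right hu4 hh hq]
  have s1 := triple_skew u hu4 p q
  have s2 := triple_skew u hu4 q q
  linarith

/-! ### The evolution of the coefficients -/

lemma intervalIntegrable_of_timeMeasure {w : ℝ≥0 → ℝ} {t : ℝ≥0}
    (hw : IntegrableOn w (Set.Iic t) timeMeasure) :
    IntervalIntegrable (fun s : ℝ => w s.toNNReal) volume 0 t := by
  rw [intervalIntegrable_iff_integrableOn_Icc_of_le (NNReal.coe_nonneg t)]
  have h1 : IntegrableOn (fun s : ℝ => w s.toNNReal) (Set.Iic (t : ℝ))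
      (timeMeasure.map ((↑) : ℝ≥0 → ℝ)) := by
    rw [measurableEmbedding_coe.integrableOn_map_iff]
    refine (integrableOn_congr_fun (fun s _ => ?_) measurableSet_Iic).2 hw
    simp
  rw [map_timeMeasure, IntegrableOn, Measure.restrict_restrict measurableSet_Iic] at h1
  have h2 : Set.Iic (t : ℝ) ∩ Set.Ici 0 = Set.Icc 0 (t : ℝ) := by
    rw [Set.inter_comm, Set.Ici_inter_Iic]
  rwa [h2] at h1

lemma setIntegral_eq_intervalIntegral (w : ℝ≥0 → ℝ) (t : ℝ≥0) :
    ∫ s in Set.Iic t, w s ∂timeMeasure = ∫ s in (0 : ℝ)..t, w s.toNNReal := by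
  rw [← setIntegral_Iic_eq]
  simp

/-- The product rule for the product of an absolutely continuous function and an exponential. -/
lemma mul_exp_eq_add_integral {f w : ℝ≥0 → ℝ}
    (hw : ∀ t, IntegrableOn w (Set.Iic t) timeMeasure)
    (hf : ∀ t, f t = f 0 + ∫ s in Set.Iic t, w s ∂timeMeasure) (κ : ℝ) (t : ℝ≥0) :
    f t * Real.exp (-(κ * t))
      = f 0 + ∫ s in Set.Iic t, (w s - κ * f s) * Real.exp (-(κ * s)) ∂timeMeasure := by
  set W : ℝ → ℝ := fun s => w s.toNNReal with hW
  set F : ℝ → ℝ := fun s => f 0 + ∫ r in (0 : ℝ)..s, W r with hF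
  have hFf : ∀ s : ℝ≥0, F s = f s := fun s => by
    rw [hf s, setIntegral_eq_intervalIntegral]
  have hi : IntervalIntegrable W volume 0 t := intervalIntegrable_of_timeMeasure (hw t)
  have hac := hi.absolutelyContinuousOnInterval_intervalIntegral (c := 0) (by simp)
  have hFac : AbsolutelyContinuousOnInterval F 0 t :=
    (contDiffOn_const (c := f 0)).absolutelyContinuousOnInterval.fun_add hac
  have hE : ∀ s : ℝ, HasDerivAt (fun s => Real.exp (-(κ * s))) (-κ * Real.exp (-(κ * s))) s := by
    intro s
    have := (((hasDerivAt_id s).const_mul κ).neg).exp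
    simpa [mul_comm] using this
  have hEac : AbsolutelyContinuousOnInterval (fun s : ℝ => Real.exp (-(κ * s))) 0 t :=
    ContDiffOn.absolutelyContinuousOnInterval (ContDiff.contDiffOn (by fun_prop))
  have key := hFac.integral_deriv_mul_eq_sub hEac
  have h0 : F 0 = f 0 := by simp [hF]
  rw [h0, hFf] at key
  have e1 : ∫ s in Set.Iic t, (w s - κ * f s) * Real.exp (-(κ * s)) ∂timeMeasure
      = ∫ s in (0 : ℝ)..t, (W s - κ * F s) * Real.exp (-(κ * s)) := by
    rw [← setIntegral_Iic_eq]
    refine setIntegral_congr_fun measurableSet_Iic fun s _ => ?_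
    simp only [hFf, hW, Real.toNNReal_coe]
  have e2 : ∫ s in (0 : ℝ)..t, (W s - κ * F s) * Real.exp (-(κ * s))
      = ∫ s in (0 : ℝ)..t, (deriv F s * Real.exp (-(κ * s))
        + F s * deriv (fun s => Real.exp (-(κ * s))) s) := by
    refine intervalIntegral.integral_congr_ae ?_
    filter_upwards [hi.ae_hasDerivAt_integral] with s hs hs'
    have h1 := (hs (Set.uIoc_subset_uIcc hs') 0 (by simp)).const_add (f 0)
    rw [(hE s).deriv, HasDerivAt.deriv h1]
    ring
  rw [e1, e2, key]
  simp

lemma ou_eq_mart_sub_integral (ν : ℝ) {ω : PathSpace} (h : ∀ t, InL2H ω t) (n : Mode) (t : ℝ≥0) :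
    ou ν t ω (modeEigen n) = mart ν (modeField n) t ω
      - ν * lam n * ∫ s in Set.Iic t, ou ν s ω (modeEigen n) ∂timeMeasure := by
  set κ := ν * lam n with hκ
  set m : ℝ≥0 → ℝ := fun s => mart ν (modeField n) s ω with hm
  have hmc : Continuous m := continuous_mart ν (modeField n) h
  set w : ℝ≥0 → ℝ := fun s => Real.exp (κ * s) * m s with hw
  have hwc : Continuous w := by fun_prop
  have hwi : ∀ t, IntegrableOn w (Set.Iic t) timeMeasure :=
    fun t => integrableOn_Iic_of_continuousOn hwc.continuousOn
  set f : ℝ≥0 → ℝ := fun t => ∫ s in Set.Iic t, w s ∂timeMeasure with hf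
  have hf0 : f 0 = 0 := by
    have h1 : Set.Iic (0 : ℝ≥0) = {0} := by ext; simp
    simp only [hf, h1]
    rw [Measure.restrict_eq_zero.2 (timeMeasure_singleton 0), integral_zero_measure]
  have key := mul_exp_eq_add_integral (f := f) hwi (fun t => by rw [hf0, zero_add]) κ t
  have hou : ∀ s, ou ν s ω (modeEigen n) = m s - κ * (f s * Real.exp (-(κ * s))) := by
    intro s
    rw [ou_eq ν (h s) n]
    simp only [hm, hκ, hf, hw]
    ring
  rw [hou, key, hf0, zero_add]
  congr 2
  refine integral_congr_ae (Filter.Eventually.of_forall fun s => ?_)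
  simp only [hou, hw]
  have : Real.exp (κ * s) * Real.exp (-(κ * s)) = 1 := by rw [← Real.exp_add]; simp
  linear_combination m s * this

/-- The equation for the coefficients of `v`. -/
lemma vProc_eq_add_integral (ν : ℝ) {ω : PathSpace} (h : ∀ t, InL2H ω t) (n : Mode) (t : ℝ≥0) :
    vProc ν 0 ω t (modeEigen n) = vProc ν 0 ω 0 (modeEigen n)
      + ∫ s in Set.Iic t, (convection (hPart (ω s)) (modeField n)
        - ν * lam n * vProc ν 0 ω s (modeEigen n)) ∂timeMeasure := by
  have hv : ∀ s, vProc ν 0 ω s (modeEigen n) = pair (ω s) (modeField n) - ou ν s ω (modeEigen n) :=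
    fun s => by rw [vProc, zProc_zero]; rfl
  have hp : IntegrableOn (fun s => pair (ω s) (modeField n)) (Set.Iic t) timeMeasure :=
    integrableOn_Iic_of_continuousOn (continuous_pair_path ω _).continuousOn
  have ho : IntegrableOn (fun s => ou ν s ω (modeEigen n)) (Set.Iic t) timeMeasure :=
    integrableOn_Iic_of_continuousOn (continuous_ou ν h n).continuousOn
  have hc := integrableOn_convection (h t) (modeField n)
  have h0 : ou ν 0 ω (modeEigen n) = 0 := by
    rw [ou_eq_mart_sub_integral ν h n 0, mart_zero]
    have h1 : Set.Iic (0 : ℝ≥0) = {0} := by ext; simp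
    rw [h1, Measure.restrict_eq_zero.2 (timeMeasure_singleton 0), integral_zero_measure]
    ring
  have e1 : ∀ s, convection (hPart (ω s)) (modeField n) - ν * lam n * vProc ν 0 ω s (modeEigen n)
      = convection (hPart (ω s)) (modeField n) - (ν * lam n * pair (ω s) (modeField n)
        - ν * lam n * ou ν s ω (modeEigen n)) := fun s => by rw [hv]; ring
  simp only [e1]
  rw [integral_sub hc ((hp.const_mul _).sub' (ho.const_mul _)),
    integral_sub (hp.const_mul _) (ho.const_mul _), integral_const_mul, integral_const_mul,
    hv, hv, ou_eq_mart_sub_integral ν h n t, h0, mart, stokes_modeField]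
  simp only [pair_smul, pair_sub_left, integral_const_mul]
  ring

/-! ### The heat flow -/

lemma exp_mul_sq_le {a b : ℝ} (h : 0 ≤ a) : (Real.exp (-a) * b) ^ 2 ≤ b ^ 2 := by
  rw [mul_pow]
  refine mul_le_of_le_one_left (sq_nonneg _) (pow_le_one₀ (Real.exp_pos _).le ?_)
  rw [Real.exp_le_one_iff]; linarith

/-- The heat flow `e^{-νAt} x`. -/
lemma exists_heat {ν : ℝ} (hν : 0 < ν) (x : H) :
    ∃ y : ℝ≥0 → H, ∀ t n, coef (y t) n = Real.exp (-(ν * lam n * t)) * coef x n := by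
  have h : ∀ t : ℝ≥0, ∃ y : H, ∀ n, coef y n = Real.exp (-(ν * lam n * t)) * coef x n := fun t =>
    exists_coef_eq ((hasSum_coef_sq x).summable.of_nonneg_of_le (fun n => sq_nonneg _) fun n =>
      exp_mul_sq_le (mul_nonneg (mul_pos hν (lam_pos n)).le t.2))
  choose y hy using h
  exact ⟨y, hy⟩

/-- The heat flow is in `V` at positive times. -/
lemma exists_heat_V {ν : ℝ} (hν : 0 < ν) (x : H) {t : ℝ≥0} (ht : 0 < t) :
    ∃ q : V, (∀ n, coef (vToH q) n = Real.exp (-(ν * lam n * t)) * coef x n) ∧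
      ‖vGrad q‖ ^ 2 ≤ ‖x‖ ^ 2 / (2 * ν * t) := by
  have ht' : (0 : ℝ) < t := ht
  have hle : ∀ n, lam n * (Real.exp (-(ν * lam n * t)) * coef x n) ^ 2
      ≤ coef x n ^ 2 / (2 * ν * t) := by
    intro n
    have hl := lam_pos n
    have h1 := Real.add_one_le_exp (2 * (ν * lam n * t))
    have h2 : Real.exp (-(ν * lam n * t)) ^ 2 * Real.exp (2 * (ν * lam n * t)) = 1 := by
      rw [← Real.exp_nat_mul, ← Real.exp_add]; simp
    rw [le_div_iff₀ (by positivity)]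
    have h3 : Real.exp (-(ν * lam n * t)) ^ 2 * (2 * (ν * lam n * t)) ≤ 1 := by
      rw [← h2]
      exact mul_le_mul_of_nonneg_left (by linarith) (sq_nonneg _)
    calc _ = Real.exp (-(ν * lam n * t)) ^ 2 * (2 * (ν * lam n * t)) * coef x n ^ 2 := by ring
      _ ≤ 1 * coef x n ^ 2 := by gcongr
      _ = _ := one_mul _
  have hs := (hasSum_coef_sq x).div_const (2 * ν * t)
  obtain ⟨q, hq⟩ := exists_vCoef_eq (hs.summable.of_nonneg_of_le
    (fun n => mul_nonneg (lam_pos n).le (sq_nonneg _)) hle)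
  exact ⟨q, hq, hasSum_le (fun n => by rw [hq]; exact hle n) (hasSum_norm_vGrad_sq q) hs⟩

/-- `e^{-νAt} x` as a distribution. -/
def heatDistr (ν : ℝ) (x : H) (t : ℝ≥0) : Distr :=
  fun e => Real.exp (-(ν * e.eigenvalue * t)) * ⟪x, testToH e.field⟫

lemma represents_heat {ν : ℝ} {x y : H} {t : ℝ≥0}
    (hy : ∀ n, coef y n = Real.exp (-(ν * lam n * t)) * coef x n) :
    Represents (heatDistr ν x t) y :=
  (represents_iff (isSpectral_heat ν x t) y).2 fun n => (hy n).symm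

lemma Represents.zProc_add {ν : ℝ} {x h y : H} {ω : PathSpace} {t : ℝ≥0}
    (hz : Represents (zProc ν 0 ω t) h) (hy : Represents (heatDistr ν x t) y) :
    Represents (zProc ν x ω t) (h + y : H) := fun e => by
  rw [Submodule.coe_add, inner_add_left, ← hz e, ← hy e, heatDistr, zProc, zProc]
  simp

lemma Represents.vProc_sub {ν : ℝ} {x : H} {g y : L2Vec} {ω : PathSpace} {t : ℝ≥0}
    (hv : Represents (vProc ν 0 ω t) g) (hy : Represents (heatDistr ν x t) y) :
    Represents (vProc ν x ω t) (g - y) := fun e => by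
  rw [inner_sub_left, ← hv e, ← hy e, heatDistr, vProc, vProc, zProc, zProc]
  simp
  ring

lemma hPart_eq_add {ν : ℝ} {x g h : H} {ω : PathSpace} {t : ℝ≥0}
    (hv : Represents (vProc ν x ω t) g) (hz : Represents (zProc ν x ω t) h) :
    hPart (ω t) = g + h := by
  have h1 : embed (g + h) = ω t := (embed_eq_iff _ _).2 fun n => by
    rw [coef_add, ← represents_coef hv, ← represents_coef hz]
    simp [vProc, modeEigen]
  rw [← h1, hPart_embed]

/-! ### The change of the energy density with the initial value of the linear part -/

/-- The difference between the time derivatives of the integral terms in the energies of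
`(v, z)` and `(v_x, z_x)`. -/
def energyDefect (ν : ℝ) (x : H) (ω : PathSpace) (r : ℝ≥0) : ℝ :=
  ν * ((normV (vProc ν 0 ω r) ^ 2).toReal - (normV (vProc ν x ω r) ^ 2).toReal)
    - (trilinear (zProc ν 0 ω r) (vProc ν 0 ω r) - trilinear (zProc ν x ω r) (vProc ν x ω r))

/-- The contribution of a mode to `energyDefect`. -/
def modeDefect (ν : ℝ) (x : H) (ω : PathSpace) (r : ℝ≥0) (n : Mode) : ℝ :=
  2 * (ν * lam n) * vProc ν 0 ω r (modeEigen n) * (Real.exp (-(ν * lam n * r)) * coef x n)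
    - ν * lam n * (Real.exp (-(ν * lam n * r)) * coef x n) ^ 2
    - Real.exp (-(ν * lam n * r)) * coef x n * convection (hPart (ω r)) (modeField n)

lemma enorm_fst_le_enorm_snd (p : V) : ‖p.1.1‖ₑ ≤ ‖p.1.2‖ₑ := by
  have h1 := hasSum_coef_sq (vToH p)
  have h2 := hasSum_norm_vGrad_sq p
  have h3 := hasSum_le (fun n => le_mul_of_one_le_left (sq_nonneg _) (one_le_lam n)) h1 h2
  exact enorm_le_iff_norm_le.2 ((sq_le_sq₀ (norm_nonneg _) (norm_nonneg _)).1 h3)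

lemma exists_eLpNorm_four_le_grad : ∃ K : ℝ≥0, ∀ p : V,
    eLpNorm p.1.1 4 cellMeasure ≤ K * ‖p.1.2‖ₑ := by
  obtain ⟨K, hK⟩ := exists_eLpNorm_four_le_norm
  refine ⟨K, fun p => (hK p).trans ?_⟩
  gcongr
  have h1 := enorm_le_iff_norm_le.1 (enorm_fst_le_enorm_snd p)
  exact enorm_le_iff_norm_le.2 (max_le h1 le_rfl)

lemma mem_triGood {h : H} (hh : eLpNorm (h : L2Vec) 4 cellMeasure < ⊤) (p : V) :
    (h, p) ∈ triGood :=
  (lintegral_tripleFun_le _ _ _).trans_lt (ENNReal.mul_lt_top (ENNReal.mul_lt_top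
    (eLpNorm_four_add_lt_top (eLpNorm_four_lt_top p) hh) hh) enorm_lt_top)

/-- The expansion of `energyDefect` in modes; the terms that are quadratic in the nonlinearity
combine by the skew-symmetry of the trilinear form. -/
lemma hasSum_modeDefect {ν : ℝ} (hν : 0 < ν) (x : H) {ω : PathSpace} {r : ℝ≥0} (hr : 0 < r)
    (hv : normV (vProc ν 0 ω r) < ⊤) (hz : normL4 (zProc ν 0 ω r) < ⊤) :
    HasSum (modeDefect ν x ω r) (energyDefect ν x ω r) := by
  obtain ⟨p, hp⟩ := exists_represents_of_normV_lt hv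
  obtain ⟨h, hh⟩ := exists_represents_of_normL4_lt hz
  obtain ⟨q, hq, -⟩ := exists_heat_V hν x hr
  have hqr := represents_heat hq
  have hpq : Represents (vProc ν x ω r) (p - q).1.1 := hp.vProc_sub hqr
  have hhq := hh.zProc_add hqr
  have hh4 : eLpNorm (h : L2Vec) 4 cellMeasure < ⊤ := by rwa [← normL4_eq hh]
  have hq4 : eLpNorm (vToH q : L2Vec) 4 cellMeasure < ⊤ := eLpNorm_four_lt_top q
  have hhq4 : eLpNorm ((h + vToH q : H) : L2Vec) 4 cellMeasure < ⊤ :=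
    eLpNorm_four_add_lt_top hh4 hq4
  have hu : hPart (ω r) = vToH p + h := hPart_eq_add (represents_vToH.1 hp) hh
  have hu4 : eLpNorm (hPart (ω r) : L2Vec) 4 cellMeasure < ⊤ := by
    rw [hu]
    exact eLpNorm_four_add_lt_top (eLpNorm_four_lt_top p) hh4
  have hN : ∀ p : V, (‖p.1.2‖ₑ ^ 2).toReal = ‖vGrad p‖ ^ 2 := fun p => by
    rw [ENNReal.toReal_pow, toReal_enorm]; rfl
  rw [energyDefect, normV_eq hp, normV_eq hpq,
    (hasTrilinear_of_represents hh hp (mem_triGood hh4 p)).trilinear_eq,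
    (hasTrilinear_of_represents hhq hpq (mem_triGood hhq4 _)).trilinear_eq,
    triVal_sub_triVal h _ p q hh4 hu, hN, hN]
  have e1 : ‖vGrad p‖ ^ 2 - ‖vGrad (p - q)‖ ^ 2 = 2 * ⟪vGrad p, vGrad q⟫ - ‖vGrad q‖ ^ 2 := by
    rw [map_sub, norm_sub_sq_real]; ring
  rw [e1]
  have key := ((((hasSum_inner_vGrad p q).mul_left 2).sub (hasSum_norm_vGrad_sq q)).mul_left ν).sub
    (hasSum_convection hu4 q)
  refine key.congr_fun fun n => ?_
  rw [modeDefect, represents_coef (represents_vToH.1 hp), hq]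
  ring

/-- A bound for the partial sums of the expansion. -/
lemma exists_abs_sum_modeDefect_le {ν : ℝ} (hν : 0 < ν) (x : H) : ∃ K : ℝ, ∀ (ω : PathSpace)
    (r : ℝ≥0), 0 < r → normV (vProc ν 0 ω r) < ⊤ → normL4 (zProc ν 0 ω r) < ⊤ →
    ∀ F : Finset Mode, |∑ n ∈ F, modeDefect ν x ω r n|
      ≤ ν * (normV (vProc ν 0 ω r)).toReal ^ 2 + 2 * ν * (‖x‖ ^ 2 / (2 * ν * r))
        + (K * (normV (vProc ν 0 ω r)).toReal + (normL4 (zProc ν 0 ω r)).toReal) ^ 2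
          * Real.sqrt (‖x‖ ^ 2 / (2 * ν * r)) := by
  obtain ⟨K, hK⟩ := exists_eLpNorm_four_le_grad
  refine ⟨K, fun ω r hr hv hz F => ?_⟩
  obtain ⟨p, hp⟩ := exists_represents_of_normV_lt hv
  obtain ⟨h, hh⟩ := exists_represents_of_normL4_lt hz
  obtain ⟨q, hq, hqn⟩ := exists_heat_V hν x hr
  have hh4 : eLpNorm (h : L2Vec) 4 cellMeasure < ⊤ := by rwa [← normL4_eq hh]
  have hp4 : eLpNorm (vToH p : L2Vec) 4 cellMeasure < ⊤ := eLpNorm_four_lt_top p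
  have hu : hPart (ω r) = vToH p + h := hPart_eq_add (represents_vToH.1 hp) hh
  have hu4 : eLpNorm (hPart (ω r) : L2Vec) 4 cellMeasure < ⊤ := by
    rw [hu]
    exact eLpNorm_four_add_lt_top hp4 hh4
  have hu' : (eLpNorm (hPart (ω r) : L2Vec) 4 cellMeasure).toReal
      ≤ K * (normV (vProc ν 0 ω r)).toReal + (normL4 (zProc ν 0 ω r)).toReal := by
    have h1 : eLpNorm (hPart (ω r) : L2Vec) 4 cellMeasure ≤ K * ‖p.1.2‖ₑ
        + eLpNorm (h : L2Vec) 4 cellMeasure := by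
      have h2 : eLpNorm (hPart (ω r) : L2Vec) 4 cellMeasure
          = eLpNorm ((vToH p : L2Vec) + (h : L2Vec) : Space → Vec) 4 cellMeasure := by
        rw [hu]
        exact eLpNorm_congr_ae (Lp.coeFn_add _ _)
      rw [h2]
      refine (eLpNorm_add_le (Lp.aestronglyMeasurable _) (Lp.aestronglyMeasurable _)
        (by norm_num)).trans ?_
      gcongr
      exact hK p
    have h3 := ENNReal.toReal_mono (ENNReal.add_lt_top.2
      ⟨ENNReal.mul_lt_top ENNReal.coe_lt_top enorm_lt_top, hh4⟩).ne h1
    rw [normV_eq hp, normL4_eq hh]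
    rwa [ENNReal.toReal_add (ENNReal.mul_lt_top ENNReal.coe_lt_top enorm_lt_top).ne hh4.ne,
      ENNReal.toReal_mul, ENNReal.coe_toReal] at h3
  have hsum : ∑ n ∈ F, modeDefect ν x ω r n
      = ν * ∑ n ∈ F, (2 * (lam n * coef (vToH p) n * coef (vToH q) n)
          - lam n * coef (vToH q) n ^ 2)
        - ∑ n ∈ F, coef (vToH q) n * convection (hPart (ω r)) (modeField n) := by
    rw [Finset.mul_sum, ← Finset.sum_sub_distrib]
    refine Finset.sum_congr rfl fun n _ => ?_
    rw [modeDefect, represents_coef (represents_vToH.1 hp), hq]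
    ring
  have h1 : |∑ n ∈ F, (2 * (lam n * coef (vToH p) n * coef (vToH q) n)
      - lam n * coef (vToH q) n ^ 2)| ≤ ‖vGrad p‖ ^ 2 + 2 * ‖vGrad q‖ ^ 2 := by
    have hs := (hasSum_norm_vGrad_sq p).add ((hasSum_norm_vGrad_sq q).mul_left 2)
    refine le_trans ?_ (sum_le_hasSum F (fun n _ => ?_) hs)
    · refine (Finset.abs_sum_le_sum_abs _ _).trans (Finset.sum_le_sum fun n _ => ?_)
      have hl := (lam_pos n).le
      rw [abs_le]
      constructor <;> nlinarith [mul_nonneg hl (sq_nonneg (coef (vToH p) n - coef (vToH q) n)),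
        mul_nonneg hl (sq_nonneg (coef (vToH p) n + coef (vToH q) n)),
        mul_nonneg hl (sq_nonneg (coef (vToH q) n))]
    · have hl := (lam_pos n).le
      positivity
  have h2 := abs_sum_convection_le hu4 q F
  have hqs : ‖vGrad q‖ ≤ Real.sqrt (‖x‖ ^ 2 / (2 * ν * r)) := Real.le_sqrt_of_sq_le hqn
  have hpn : ‖vGrad p‖ = (normV (vProc ν 0 ω r)).toReal := by
    rw [normV_eq hp, toReal_enorm]; rfl
  rw [hsum]
  refine (abs_sub _ _).trans (add_le_add ?_ ?_)
  · rw [abs_mul, abs_of_pos hν, ← hpn]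
    calc _ ≤ ν * (‖vGrad p‖ ^ 2 + 2 * ‖vGrad q‖ ^ 2) := by gcongr
      _ ≤ ν * (‖vGrad p‖ ^ 2 + 2 * (‖x‖ ^ 2 / (2 * ν * r))) := by gcongr
      _ = _ := by ring
  · refine h2.trans ?_
    gcongr

/-! ### Paths of the energy class -/

lemma timeMeasure_Ioc {s t : ℝ≥0} (h : s ≤ t) : timeMeasure (Set.Ioc s t) = t - s := by
  have h0 : Set.Ioc s t = Set.Iic t \ Set.Iic s := by
    ext r; simp [and_comm]
  rw [h0, measure_sdiff (Set.Iic_subset_Iic.2 h) nullMeasurableSet_Iic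
    (by rw [timeMeasure_Iic]; exact ENNReal.coe_ne_top), timeMeasure_Iic, timeMeasure_Iic]

lemma frequently_of_ae {p : ℝ≥0 → Prop} {s t : ℝ≥0} (hst : s < t)
    (h : ∀ᵐ r ∂(timeMeasure.restrict (Set.Iic t)), p r) :
    ∃ᶠ r in nhdsWithin s (Set.Ioi s), p r := by
  rw [(nhdsGT_basis s).frequently_iff]
  intro b hb
  by_contra hc
  push Not at hc
  rw [ae_restrict_iff' measurableSet_Iic] at h
  obtain ⟨c, hc1, hc2⟩ := exists_between (lt_min hb hst)
  have h1 : timeMeasure (Set.Ioc s c) = 0 := by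
    refine measure_mono_null (fun r hr => ?_) h
    rw [Set.mem_compl_iff, Set.mem_ofPred_eq]
    exact fun h2 => hc r ⟨hr.1, hr.2.trans_lt (hc2.trans_le (min_le_left _ _))⟩
      (h2 (hr.2.trans (hc2.trans_le (min_le_right _ _)).le))
  rw [timeMeasure_Ioc hc1.le, tsub_eq_zero_iff_le] at h1
  exact absurd hc1 (not_lt.2 (by exact_mod_cast h1))

section Regular

variable {ν : ℝ} {ω : PathSpace}

/-- By weak continuity, the essential bound in the energy class is a bound at every time. -/
lemma exists_normH_vProc_le (h : ω ∈ regularSet ν) (T : ℝ≥0) :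
    ∃ C : ℝ≥0, ∀ t ≤ T, normH (vProc ν 0 ω t) ≤ C := by
  have hL := inL2H_of_mem_regularSet h
  obtain ⟨C, hC⟩ := (essSup_lt_top_iff _).1 (h.2 (T + 1)).1
  refine ⟨C, fun t ht => ?_⟩
  by_contra hlt
  rw [not_le] at hlt
  have hlsc := lowerSemicontinuous_normH_sq (isSpectral_vProc ν 0 ω) (continuous_vProc ν 0 hL)
  have h1 : ((C : ℝ≥0) : ℝ≥0∞) ^ 2 < normH (vProc ν 0 ω t) ^ 2 :=
    ENNReal.pow_right_strictMono (by norm_num) hlt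
  have h2 := (nhdsWithin_le_nhds (hlsc t _ h1) :
    ∀ᶠ r in nhdsWithin t (Set.Ioi t), ((C : ℝ≥0) : ℝ≥0∞) ^ 2 < normH (vProc ν 0 ω r) ^ 2)
  obtain ⟨r, hr1, hr2⟩ := ((frequently_of_ae (ht.trans_lt (by simp)) hC).and_eventually h2).exists
  have h3 : normH (vProc ν 0 ω r) ^ 2 ≤ ((C : ℝ≥0) : ℝ≥0∞) ^ 2 := by
    gcongr
    simpa using hr1
  exact absurd hr2 (not_lt.2 h3)

lemma exists_represents_vProc (h : ω ∈ regularSet ν) (T : ℝ≥0) :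
    ∃ (C : ℝ) (g : ℝ≥0 → H), 0 ≤ C ∧
      ∀ t ≤ T, Represents (vProc ν 0 ω t) (g t) ∧ ‖g t‖ ≤ C := by
  obtain ⟨C, hC⟩ := exists_normH_vProc_le h T
  have h1 : ∀ t : ℝ≥0, ∃ g : H, t ≤ T → Represents (vProc ν 0 ω t) g := by
    intro t
    by_cases ht : t ≤ T
    · obtain ⟨g, hg⟩ := exists_represents_of_normH_lt ((hC t ht).trans_lt ENNReal.coe_lt_top)
      exact ⟨g, fun _ => hg⟩
    · exact ⟨0, fun h => absurd h ht⟩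
  choose g hg using h1
  refine ⟨C, g, C.2, fun t ht => ⟨hg t ht, ?_⟩⟩
  have := hC t ht
  rw [normH_eq (hg t ht)] at this
  exact_mod_cast enorm_le_iff_norm_le.1 (this.trans_eq (by simp : (C : ℝ≥0∞) = ‖(C : ℝ)‖ₑ)) |>.trans
    (by simp)

lemma measurable_path {β : Type*} [MeasurableSpace β] {f : ℝ≥0 × PathSpace → β}
    (hf : Measurable f) (ω : PathSpace) : Measurable fun r => f (r, ω) := by
  have := hf.comp (measurable_id.prodMk measurable_const : Measurable fun s : ℝ≥0 => (s, ω))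
  simpa only [Function.comp_def, id] using this

lemma ae_normV_vProc_lt (h : ω ∈ regularSet ν) (T : ℝ≥0) :
    ∀ᵐ r ∂(timeMeasure.restrict (Set.Iic T)), normV (vProc ν 0 ω r) < ⊤ := by
  have hm : Measurable fun r => normV (vProc ν 0 ω r) ^ 2 :=
    measurable_path (measurablePaths_id.vProc ν 0).normV_sq ω
  filter_upwards [ae_lt_top hm (h.2 T).2.ne] with r hr
  exact (ENNReal.pow_lt_top_iff.1 hr).resolve_right (by norm_num)

lemma ae_normL4_zProc_lt (h : ω ∈ regularSet ν) (T : ℝ≥0) :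
    ∀ᵐ r ∂(timeMeasure.restrict (Set.Iic T)), normL4 (zProc ν 0 ω r) < ⊤ := by
  have hm : Measurable fun r => normL4 (zProc ν 0 ω r) :=
    measurable_path (measurablePaths_id.zProc ν 0).normL4 ω
  filter_upwards [ae_lt_top (hm.pow_const 8) (h.1 T).ne] with r hr
  exact (ENNReal.pow_lt_top_iff.1 hr).resolve_right (by norm_num)

lemma integrableOn_normV_sq {x : H} {t : ℝ≥0}
    (h : ∫⁻ r in Set.Iic t, normV (vProc ν x ω r) ^ 2 ∂timeMeasure < ⊤) :
    IntegrableOn (fun r => (normV (vProc ν x ω r) ^ 2).toReal) (Set.Iic t) timeMeasure :=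
  integrable_toReal_of_lintegral_ne_top
    (measurable_path (measurablePaths_id.vProc ν x).normV_sq ω).aemeasurable h.ne

lemma integrableOn_normL4_sq (h : ω ∈ regularSet ν) (t : ℝ≥0) :
    IntegrableOn (fun r => (normL4 (zProc ν 0 ω r) ^ 2).toReal) (Set.Iic t) timeMeasure := by
  have hm : Measurable fun r => normL4 (zProc ν 0 ω r) :=
    measurable_path (measurablePaths_id.zProc ν 0).normL4 ω
  refine integrable_toReal_of_lintegral_ne_top (hm.pow_const 2).aemeasurable (ne_of_lt ?_)
  refine (lintegral_mono fun r => pow_le_one_add_pow _ (by norm_num : 2 ≤ 8)).trans_lt ?_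
  rw [lintegral_add_left measurable_const, lintegral_one]
  exact ENNReal.add_lt_top.2 ⟨measure_lt_top _ _, h.1 t⟩

/-- On regular paths the trilinear term of the energy is integrable. By the interpolation
inequality `|v|_{L⁴}⁸ ≤ K |v|_H² |v|_V⁶`, it is bounded by a multiple of `|v|_V² + |z|_{L⁴}⁸`. -/
lemma trilinearIntegrable_of_mem_regularSet (h : ω ∈ regularSet ν) (t : ℝ≥0) :
    TrilinearIntegrable (vProc ν 0 ω) (zProc ν 0 ω) t := by
  obtain ⟨K, hK⟩ := exists_eLpNorm_four_le
  obtain ⟨C, hC⟩ := exists_normH_vProc_le h t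
  set L : ℝ≥0∞ := K * C ^ 2 + 1 with hL
  have hLt : L < ⊤ := ENNReal.add_lt_top.2 ⟨ENNReal.mul_lt_top ENNReal.coe_lt_top
    (ENNReal.pow_lt_top ENNReal.coe_lt_top), ENNReal.one_lt_top⟩
  have key : ∀ᵐ r ∂(timeMeasure.restrict (Set.Iic t)),
      HasTrilinear (zProc ν 0 ω r) (vProc ν 0 ω r) (trilinear (zProc ν 0 ω r) (vProc ν 0 ω r)) ∧
      ‖trilinear (zProc ν 0 ω r) (vProc ν 0 ω r)‖ₑ
        ≤ (L + 1) * (normV (vProc ν 0 ω r) ^ 2 + (1 + normL4 (zProc ν 0 ω r) ^ 8)) := by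
    filter_upwards [ae_normV_vProc_lt h t, ae_normL4_zProc_lt h t,
      ae_restrict_mem measurableSet_Iic] with r hv hz hr
    obtain ⟨p, hp⟩ := exists_represents_of_normV_lt hv
    obtain ⟨g, hg⟩ := exists_represents_of_normL4_lt hz
    have hCr := hC r hr
    rw [normH_eq (represents_vToH.1 hp)] at hCr
    have hg4 : eLpNorm (g : L2Vec) 4 cellMeasure < ⊤ := by rwa [← normL4_eq hg]
    have ht := hasTrilinear_of_represents hg hp (mem_triGood hg4 p)
    rw [ht.trilinear_eq]
    refine ⟨ht, ?_⟩
    rw [normV_eq hp, normL4_eq hg]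
    set a := eLpNorm p.1.1 4 cellMeasure with ha
    set b := eLpNorm (g : L2Vec) 4 cellMeasure with hb
    set d := ‖p.1.2‖ₑ with hd
    have h1 : ‖triVal (g, p)‖ₑ ≤ (a + b) * b * d := by
      refine (enorm_integral_le_lintegral_enorm _).trans ((lintegral_tripleFun_le _ _ _).trans ?_)
      gcongr
      refine (eLpNorm_congr_ae (Lp.coeFn_add _ _)).le.trans ?_
      exact eLpNorm_add_le (Lp.aestronglyMeasurable _) (Lp.aestronglyMeasurable _) (by norm_num)
    have h2 : a * b * d ≤ L * (d ^ 2 + b ^ 8) := by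
      refine (ENNReal.pow_right_strictMono (n := 8) (by norm_num)).le_iff_le.1 ?_
      have hKC : (K : ℝ≥0∞) * C ^ 2 ≤ L ^ 8 := by
        refine le_trans (le_self_add : _ ≤ L) ?_
        calc L = L ^ 1 := (pow_one L).symm
          _ ≤ L ^ 8 := pow_le_pow_right₀ le_add_self (by norm_num)
      calc (a * b * d) ^ 8 = a ^ 8 * b ^ 8 * d ^ 8 := by ring
        _ ≤ (K * (C ^ 2 * d ^ 6)) * b ^ 8 * d ^ 8 := by
          gcongr
          refine (hK p).trans ?_
          gcongr
          exact hCr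
        _ = K * C ^ 2 * ((d ^ 2) ^ 7 * b ^ 8) := by ring
        _ ≤ L ^ 8 * ((d ^ 2 + b ^ 8) ^ 7 * (d ^ 2 + b ^ 8)) := by
          gcongr
          · exact le_self_add
          · exact le_add_self
        _ = _ := by ring
    have h3 : b * b * d ≤ d ^ 2 + (1 + b ^ 8) := by
      calc b * b * d = b ^ 2 * d := by ring
        _ ≤ (b ^ 2) ^ 2 + d ^ 2 := by
          rcases le_total (b ^ 2) d with hbd | hbd
          · calc b ^ 2 * d ≤ d * d := by gcongr
              _ = d ^ 2 := by ring
              _ ≤ _ := le_add_self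
          · calc b ^ 2 * d ≤ b ^ 2 * b ^ 2 := by gcongr
              _ = (b ^ 2) ^ 2 := by ring
              _ ≤ _ := le_self_add
        _ = d ^ 2 + b ^ 4 := by ring
        _ ≤ _ := by
          gcongr
          exact pow_le_one_add_pow b (by norm_num)
    calc ‖triVal (g, p)‖ₑ ≤ a * b * d + b * b * d := by rw [← add_mul, ← add_mul]; exact h1
      _ ≤ L * (d ^ 2 + (1 + b ^ 8)) + (d ^ 2 + (1 + b ^ 8)) := by
        refine add_le_add (h2.trans ?_) h3
        gcongr
        exact le_add_self
      _ = _ := by ring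
  refine ⟨key.mono fun r hr => ⟨_, hr.1⟩, ?_, ?_⟩
  · exact (measurable_path ((measurablePaths_id.zProc ν 0).trilinear
      (measurablePaths_id.vProc ν 0)) ω).aestronglyMeasurable
  · refine (lintegral_mono_ae (key.mono fun r hr => hr.2)).trans_lt ?_
    have hm : Measurable fun r => normV (vProc ν 0 ω r) ^ 2 :=
      measurable_path (measurablePaths_id.vProc ν 0).normV_sq ω
    have hm' : Measurable fun r => normL4 (zProc ν 0 ω r) :=
      measurable_path (measurablePaths_id.zProc ν 0).normL4 ω
    rw [lintegral_const_mul _ (by fun_prop), lintegral_add_left hm,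
      lintegral_add_left measurable_const, lintegral_one]
    exact ENNReal.mul_lt_top (ENNReal.add_lt_top.2 ⟨hLt, ENNReal.one_lt_top⟩)
      (ENNReal.add_lt_top.2 ⟨(h.2 t).2, ENNReal.add_lt_top.2 ⟨measure_lt_top _ _, h.1 t⟩⟩)

end Regular

/-! ### Independence of the energy inequality of the initial value of the linear part -/

lemma setIntegral_Ioc_eq_sub {f : ℝ≥0 → ℝ} {s t : ℝ≥0} (hst : s ≤ t)
    (hf : IntegrableOn f (Set.Iic t) timeMeasure) :
    ∫ r in Set.Ioc s t, f r ∂timeMeasure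
      = ∫ r in Set.Iic t, f r ∂timeMeasure - ∫ r in Set.Iic s, f r ∂timeMeasure := by
  conv_rhs => rw [← Set.Iic_union_Ioc_eq_Iic hst]
  rw [setIntegral_union (s := Set.Iic s) (Set.disjoint_left.2 fun r h1 h2 => not_lt.2 h1 h2.1)
    measurableSet_Ioc
    (hf.mono_set (Set.Iic_subset_Iic.2 hst)) (hf.mono_set fun r hr => hr.2)]
  ring

/-- The contribution of a mode to `⟨v, y⟩ - |y|² / 2`, where `y = e^{-νAt} x`. -/
def modeEnergy (ν : ℝ) (x : H) (ω : PathSpace) (t : ℝ≥0) (n : Mode) : ℝ :=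
  vProc ν 0 ω t (modeEigen n) * (Real.exp (-(ν * lam n * t)) * coef x n)
    - 2⁻¹ * (Real.exp (-(ν * lam n * t)) * coef x n) ^ 2

lemma integrableOn_modeDefect (ν : ℝ) (x : H) {ω : PathSpace} (h : ∀ t, InL2H ω t) (t : ℝ≥0)
    (n : Mode) : IntegrableOn (fun r => modeDefect ν x ω r n) (Set.Iic t) timeMeasure := by
  have hv := continuous_vProc ν 0 h n
  have h1 : Continuous fun r : ℝ≥0 => 2 * (ν * lam n) * vProc ν 0 ω r (modeEigen n)
      * (Real.exp (-(ν * lam n * r)) * coef x n)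
      - ν * lam n * (Real.exp (-(ν * lam n * r)) * coef x n) ^ 2 := by fun_prop
  have h2 : Continuous fun r : ℝ≥0 => Real.exp (-(ν * lam n * r)) * coef x n := by fun_prop
  exact (integrableOn_Iic_of_continuousOn h1.continuousOn).sub'
    ((integrableOn_convection (h t) (modeField n)).continuousOn_mul h2.continuousOn
      (isCompact_Iic_time t))

lemma modeEnergy_eq_sub_integral (ν : ℝ) (x : H) {ω : PathSpace} (h : ∀ t, InL2H ω t) (n : Mode)
    (t : ℝ≥0) : modeEnergy ν x ω t n
      = modeEnergy ν x ω 0 n - ∫ r in Set.Iic t, modeDefect ν x ω r n ∂timeMeasure := by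
  set κ := ν * lam n with hκ
  have hv := continuous_vProc ν 0 h n
  have hw : ∀ t, IntegrableOn (fun s => convection (hPart (ω s)) (modeField n)
      - κ * vProc ν 0 ω s (modeEigen n)) (Set.Iic t) timeMeasure := fun t =>
    (integrableOn_convection (h t) _).sub'
      (integrableOn_Iic_of_continuousOn (Continuous.continuousOn (by fun_prop)))
  have h1 := mul_exp_eq_add_integral hw (vProc_eq_add_integral ν h n) κ t
  have h2 := mul_exp_eq_add_integral (f := fun _ => 1) (w := fun _ => 0)
    (fun t => integrableOn_zero) (fun t => by simp) (2 * κ) t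
  have hexp : ∀ s : ℝ≥0, Real.exp (-(2 * κ * s)) = Real.exp (-(κ * s)) ^ 2 := fun s => by
    rw [← Real.exp_nat_mul]; congr 1; push_cast; ring
  have hi1 : IntegrableOn (fun s : ℝ≥0 => (convection (hPart (ω s)) (modeField n)
      - κ * vProc ν 0 ω s (modeEigen n) - κ * vProc ν 0 ω s (modeEigen n))
        * Real.exp (-(κ * s))) (Set.Iic t) timeMeasure :=
    IntegrableOn.mul_continuousOn ((hw t).sub' (integrableOn_Iic_of_continuousOn
        (f := fun s => κ * vProc ν 0 ω s (modeEigen n)) (Continuous.continuousOn (by fun_prop))))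
      (Continuous.continuousOn (by fun_prop)) (isCompact_Iic_time t)
  have hi2 : IntegrableOn (fun s : ℝ≥0 => (0 - 2 * κ * 1) * Real.exp (-(2 * κ * s)))
      (Set.Iic t) timeMeasure :=
    integrableOn_Iic_of_continuousOn (Continuous.continuousOn (by fun_prop))
  have e : ∀ s : ℝ≥0, modeDefect ν x ω s n
      = (2⁻¹ * coef x n ^ 2) * ((0 - 2 * κ * 1) * Real.exp (-(2 * κ * s)))
        - coef x n * ((convection (hPart (ω s)) (modeField n)
      - κ * vProc ν 0 ω s (modeEigen n) - κ * vProc ν 0 ω s (modeEigen n))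
        * Real.exp (-(κ * s))) := by
    intro s
    rw [modeDefect, hexp, ← hκ]
    ring
  have e2 : ∫ s in Set.Iic t, modeDefect ν x ω s n ∂timeMeasure
      = (2⁻¹ * coef x n ^ 2) *
        ∫ s in Set.Iic t, (0 - 2 * κ * 1) * Real.exp (-(2 * κ * s)) ∂timeMeasure
        - coef x n * ∫ s in Set.Iic t, (convection (hPart (ω s)) (modeField n)
          - κ * vProc ν 0 ω s (modeEigen n) - κ * vProc ν 0 ω s (modeEigen n))
            * Real.exp (-(κ * s)) ∂timeMeasure := by
    rw [← integral_const_mul (2⁻¹ * coef x n ^ 2), ← integral_const_mul (coef x n),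
      ← integral_sub (hi2.const_mul _) (hi1.const_mul _)]
    exact integral_congr_ae (Filter.Eventually.of_forall e)
  rw [e2, modeEnergy, modeEnergy, ← hκ]
  rw [hexp, one_mul] at h2
  have h0 : Real.exp (-(κ * ((0 : ℝ≥0) : ℝ))) = 1 := by simp
  rw [h0]
  linear_combination coef x n * h1 - 2⁻¹ * coef x n ^ 2 * h2

lemma sum_modeEnergy_sub (ν : ℝ) (x : H) {ω : PathSpace} (h : ∀ t, InL2H ω t) {s t : ℝ≥0}
    (hst : s ≤ t) (F : Finset Mode) :
    ∑ n ∈ F, modeEnergy ν x ω t n - ∑ n ∈ F, modeEnergy ν x ω s n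
      = -∫ r in Set.Ioc s t, ∑ n ∈ F, modeDefect ν x ω r n ∂timeMeasure := by
  have hi := fun n => integrableOn_modeDefect ν x h t n
  rw [integral_finsetSum _ fun n _ => (hi n).mono_set fun r hr => hr.2, ← Finset.sum_sub_distrib,
    ← Finset.sum_neg_distrib]
  refine Finset.sum_congr rfl fun n _ => ?_
  rw [setIntegral_Ioc_eq_sub hst (hi n), modeEnergy_eq_sub_integral ν x h n t,
    modeEnergy_eq_sub_integral ν x h n s]
  ring

lemma hasSum_modeEnergy {ν : ℝ} {x g y : H} {ω : PathSpace} {t : ℝ≥0}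
    (hg : Represents (vProc ν 0 ω t) g)
    (hy : ∀ n, coef y n = Real.exp (-(ν * lam n * t)) * coef x n) :
    HasSum (modeEnergy ν x ω t) (⟪g, y⟫ - 2⁻¹ * ‖y‖ ^ 2) := by
  refine ((hasSum_coef_mul g y).sub ((hasSum_coef_sq y).mul_left 2⁻¹)).congr_fun fun n => ?_
  rw [modeEnergy, represents_coef hg, hy]

/-- The finite sections of the inner products converge uniformly, since the coefficients of `y`
are dominated by those of `x`. -/
lemma abs_sum_modeEnergy_sub_le {ν : ℝ} (hν : 0 < ν) {x g y : H} {ω : PathSpace} {t : ℝ≥0} {C : ℝ}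
    (hg : Represents (vProc ν 0 ω t) g) (hC : ‖g‖ ≤ C)
    (hy : ∀ n, coef y n = Real.exp (-(ν * lam n * t)) * coef x n) (F : Finset Mode) :
    |⟪g, y⟫ - 2⁻¹ * ‖y‖ ^ 2 - ∑ n ∈ F, modeEnergy ν x ω t n|
      ≤ (C + ‖x‖) * ‖x - ∑ n ∈ F, coef x n • testToH (modeField n)‖ := by
  classical
  have hyx : ∀ n, coef y n ^ 2 ≤ coef x n ^ 2 := fun n => by
    rw [hy]; exact exp_mul_sq_le (mul_nonneg (mul_pos hν (lam_pos n)).le t.2)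
  have hynorm : ‖y‖ ≤ ‖x‖ := (sq_le_sq₀ (norm_nonneg _) (norm_nonneg _)).1
    (hasSum_le hyx (hasSum_coef_sq y) (hasSum_coef_sq x))
  have htail : ‖y - ∑ n ∈ F, coef y n • testToH (modeField n)‖
      ≤ ‖x - ∑ n ∈ F, coef x n • testToH (modeField n)‖ := by
    refine (sq_le_sq₀ (norm_nonneg _) (norm_nonneg _)).1
      (hasSum_le (fun n => ?_) (hasSum_coef_sq _) (hasSum_coef_sq _))
    rw [coef_sub, coef_sub, coef_sum_smul_mode, coef_sum_smul_mode]
    split_ifs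
    · simp
    · simpa using hyx n
  have hsm : ∀ (c : ℝ) (a b : H), ⟪c • a, b⟫ = c * ⟪a, b⟫ := fun c a b => real_inner_smul_left a b c
  have hG : ⟪g, y⟫ - 2⁻¹ * ‖y‖ ^ 2 = ⟪g - (2⁻¹ : ℝ) • y, y⟫ := by
    rw [inner_sub_left, hsm, real_inner_self_eq_norm_sq]
  have hS : ∑ n ∈ F, modeEnergy ν x ω t n
      = ⟪g - (2⁻¹ : ℝ) • y, ∑ n ∈ F, coef y n • testToH (modeField n)⟫ := by
    rw [inner_sum]
    refine Finset.sum_congr rfl fun n _ => ?_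
    have h1 : ⟪g - (2⁻¹ : ℝ) • y, testToH (modeField n)⟫ = coef g n - 2⁻¹ * coef y n := by
      rw [← coef_smul, ← coef_sub]; rfl
    rw [real_inner_comm, hsm, real_inner_comm, h1, modeEnergy, represents_coef hg, hy]
    ring
  rw [hG, hS, ← inner_sub_right]
  refine (abs_real_inner_le_norm _ _).trans (mul_le_mul ?_ htail (norm_nonneg _) ?_)
  · refine (norm_sub_le _ _).trans (add_le_add hC ?_)
    rw [norm_smul]
    rw [Real.norm_of_nonneg (by norm_num)]
    linarith [norm_nonneg y]
  · exact add_nonneg ((norm_nonneg _).trans hC) (norm_nonneg _)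

section Regular

variable {ν : ℝ} {ω : PathSpace}

lemma continuousOn_inner_sub (hν : 0 < ν) (h : ω ∈ regularSet ν) {T : ℝ≥0} {C : ℝ}
    {g : ℝ≥0 → H} (hg : ∀ t ≤ T, Represents (vProc ν 0 ω t) (g t) ∧ ‖g t‖ ≤ C)
    {x : H} {y : ℝ≥0 → H} (hy : ∀ t n, coef (y t) n = Real.exp (-(ν * lam n * t)) * coef x n) :
    ContinuousOn (fun t => ⟪g t, y t⟫ - 2⁻¹ * ‖y t‖ ^ 2) (Set.Iic T) := by
  have hL := inL2H_of_mem_regularSet h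
  have hu : TendstoUniformlyOn (fun (F : Finset Mode) t => ∑ n ∈ F, modeEnergy ν x ω t n)
      (fun t => ⟪g t, y t⟫ - 2⁻¹ * ‖y t‖ ^ 2) Filter.atTop (Set.Iic T) := by
    rw [Metric.tendstoUniformlyOn_iff]
    intro ε hε
    have h1 : Filter.Tendsto (fun F : Finset Mode =>
        (C + ‖x‖) * ‖x - ∑ n ∈ F, coef x n • testToH (modeField n)‖) Filter.atTop (nhds 0) := by
      have h2 : Filter.Tendsto (fun F : Finset Mode => ∑ n ∈ F, coef x n • testToH (modeField n))
        Filter.atTop (nhds x) := hasSum_coef_smul x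
      have h3 := ((tendsto_const_nhds (x := x)).sub h2).norm.const_mul (C + ‖x‖)
      simpa using h3
    filter_upwards [h1.eventually_lt_const hε] with F hF t ht
    rw [Real.dist_eq]
    exact (abs_sum_modeEnergy_sub_le hν (hg t ht).1 (hg t ht).2 (hy t) F).trans_lt hF
  refine hu.continuousOn (Filter.Eventually.frequently (Filter.Eventually.of_forall fun F =>
    Continuous.continuousOn (continuous_finsetSum _ fun n _ => ?_)))
  have hv := continuous_vProc ν 0 hL n
  unfold modeEnergy
  fun_prop

lemma inner_sub_eq_of_pos (hν : 0 < ν) (h : ω ∈ regularSet ν) {x : H} {s t : ℝ≥0} (hs : 0 < s)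
    (hst : s ≤ t) {C : ℝ} {g : ℝ≥0 → H}
    (hg : ∀ r ≤ t, Represents (vProc ν 0 ω r) (g r) ∧ ‖g r‖ ≤ C)
    {y : ℝ≥0 → H} (hy : ∀ t n, coef (y t) n = Real.exp (-(ν * lam n * t)) * coef x n) :
    (⟪g t, y t⟫ - 2⁻¹ * ‖y t‖ ^ 2) - (⟪g s, y s⟫ - 2⁻¹ * ‖y s‖ ^ 2)
      = -∫ r in Set.Ioc s t, energyDefect ν x ω r ∂timeMeasure := by
  have hL := inL2H_of_mem_regularSet h
  have hs' : (0 : ℝ) < s := hs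
  obtain ⟨K, hK⟩ := exists_abs_sum_modeDefect_le hν x
  have h1 : Filter.Tendsto (fun F : Finset Mode =>
      ∑ n ∈ F, modeEnergy ν x ω t n - ∑ n ∈ F, modeEnergy ν x ω s n) Filter.atTop
      (nhds ((⟪g t, y t⟫ - 2⁻¹ * ‖y t‖ ^ 2) - (⟪g s, y s⟫ - 2⁻¹ * ‖y s‖ ^ 2))) :=
    Filter.Tendsto.sub (hasSum_modeEnergy (hg t le_rfl).1 (hy t))
      (hasSum_modeEnergy (hg s hst).1 (hy s))
  simp only [sum_modeEnergy_sub ν x hL hst] at h1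
  refine tendsto_nhds_unique h1 (Filter.Tendsto.neg ?_)
  have hsub : Set.Ioc s t ⊆ Set.Iic t := fun r hr => hr.2
  have hae : ∀ᵐ r ∂(timeMeasure.restrict (Set.Ioc s t)), s < r ∧ normV (vProc ν 0 ω r) < ⊤ ∧
      normL4 (zProc ν 0 ω r) < ⊤ := by
    filter_upwards [ae_restrict_mem measurableSet_Ioc,
      ae_mono (Measure.restrict_mono_set _ hsub) (ae_normV_vProc_lt h t),
      ae_mono (Measure.restrict_mono_set _ hsub) (ae_normL4_zProc_lt h t)] with r h1 h2 h3
    exact ⟨h1.1, h2, h3⟩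
  set d : ℝ := ‖x‖ ^ 2 / (2 * ν * s) with hd
  set bound : ℝ≥0 → ℝ := fun r => ν * (normV (vProc ν 0 ω r) ^ 2).toReal + 2 * ν * d
    + (2 * (K ^ 2 * (normV (vProc ν 0 ω r) ^ 2).toReal)
      + 2 * (normL4 (zProc ν 0 ω r) ^ 2).toReal) * Real.sqrt d with hbound
  have hbi : Integrable bound (timeMeasure.restrict (Set.Ioc s t)) := by
    have hV := (integrableOn_normV_sq (ω := ω) (h.2 t).2).mono_set hsub
    have hZ := (integrableOn_normL4_sq h t).mono_set hsub
    have : IsFiniteMeasure (timeMeasure.restrict (Set.Ioc s t)) :=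
      ⟨by rw [Measure.restrict_apply_univ, timeMeasure_Ioc hst]
          exact lt_of_le_of_lt tsub_le_self ENNReal.coe_lt_top⟩
    exact ((hV.const_mul ν).fun_add (integrable_const _)).fun_add
      ((((hV.const_mul _).const_mul 2).fun_add (hZ.const_mul 2)).mul_const _)
  refine tendsto_integral_filter_of_dominated_convergence bound ?_ ?_ hbi ?_
  · refine Filter.Eventually.of_forall fun F => ?_
    have := integrable_finsetSum F fun n _ => (integrableOn_modeDefect ν x hL t n).mono_set hsub
    exact this.aestronglyMeasurable
  · refine Filter.Eventually.of_forall fun F => ?_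
    filter_upwards [hae] with r hr
    have hr0 : 0 < r := hs.trans hr.1
    have hsr : (s : ℝ) ≤ r := by exact_mod_cast hr.1.le
    have hdr : ‖x‖ ^ 2 / (2 * ν * r) ≤ d := by
      rw [hd]; gcongr
    rw [Real.norm_eq_abs, hbound]
    refine (hK ω r hr0 hr.2.1 hr.2.2 F).trans ?_
    simp only [ENNReal.toReal_pow]
    gcongr
    nlinarith [sq_nonneg (K * (normV (vProc ν 0 ω r)).toReal - (normL4 (zProc ν 0 ω r)).toReal)]
  · filter_upwards [hae] with r hr
    exact hasSum_modeDefect hν x (hs.trans hr.1) hr.2.1 hr.2.2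

/-- The difference of the energies of `(v, z)` and `(v_x, z_x)` does not depend on time. -/
lemma inner_add_integral_eq (hν : 0 < ν) (h : ω ∈ regularSet ν) {x : H} {s t : ℝ≥0}
    (hst : s ≤ t) {C : ℝ} {g : ℝ≥0 → H}
    (hg : ∀ r ≤ t, Represents (vProc ν 0 ω r) (g r) ∧ ‖g r‖ ≤ C)
    {y : ℝ≥0 → H} (hy : ∀ t n, coef (y t) n = Real.exp (-(ν * lam n * t)) * coef x n)
    (hi : IntegrableOn (energyDefect ν x ω) (Set.Iic t) timeMeasure) :
    ⟪g t, y t⟫ - 2⁻¹ * ‖y t‖ ^ 2 + ∫ r in Set.Iic t, energyDefect ν x ω r ∂timeMeasure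
      = ⟪g s, y s⟫ - 2⁻¹ * ‖y s‖ ^ 2 + ∫ r in Set.Iic s, energyDefect ν x ω r ∂timeMeasure := by
  have hpos : ∀ s, 0 < s → s ≤ t →
      ⟪g t, y t⟫ - 2⁻¹ * ‖y t‖ ^ 2 + ∫ r in Set.Iic t, energyDefect ν x ω r ∂timeMeasure
      = ⟪g s, y s⟫ - 2⁻¹ * ‖y s‖ ^ 2 + ∫ r in Set.Iic s, energyDefect ν x ω r ∂timeMeasure := by
    intro s hs hst
    have h1 := inner_sub_eq_of_pos hν h hs hst hg hy
    rw [setIntegral_Ioc_eq_sub hst hi] at h1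
    linarith
  rcases eq_zero_or_pos s with rfl | hs
  · rcases eq_zero_or_pos t with rfl | ht
    · rfl
    · have hc : ContinuousOn (fun s => ⟪g s, y s⟫ - 2⁻¹ * ‖y s‖ ^ 2
          + ∫ r in Set.Iic s, energyDefect ν x ω r ∂timeMeasure) (Set.Iic t) :=
        (continuousOn_inner_sub hν h hg hy).add (continuousOn_setIntegral_Iic hi)
      have h1 := ((hc 0 ht.le).continuousAt (Iic_mem_nhds ht)).tendsto.mono_left
        (nhdsWithin_le_nhds (s := Set.Ioi 0))
      refine tendsto_nhds_unique (Filter.Tendsto.congr' ?_ tendsto_const_nhds) h1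
      filter_upwards [Ioc_mem_nhdsGT ht] with r hr
      exact hpos r hr.1 hr.2
  · exact hpos s hs hst

lemma energy_eq_coe (hν : 0 ≤ ν) {v z : ℝ≥0 → Distr} {t : ℝ≥0} {g : H}
    (hT : TrilinearIntegrable v z t) (hg : Represents (v t) g)
    (hm : Measurable fun r => normV (v r) ^ 2)
    (hV : ∫⁻ r in Set.Iic t, normV (v r) ^ 2 ∂timeMeasure < ⊤) :
    energy ν v z t = ((2⁻¹ * ‖g‖ ^ 2 + ν * ∫ r in Set.Iic t, (normV (v r) ^ 2).toReal ∂timeMeasure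
      - ∫ r in Set.Iic t, trilinear (z r) (v r) ∂timeMeasure : ℝ) : EReal) := by
  have h1 : posEnergy ν v t = ENNReal.ofReal (2⁻¹ * ‖g‖ ^ 2
      + ν * ∫ r in Set.Iic t, (normV (v r) ^ 2).toReal ∂timeMeasure) := by
    have h0 : 0 ≤ ∫ r in Set.Iic t, (normV (v r) ^ 2).toReal ∂timeMeasure :=
      integral_nonneg fun r => ENNReal.toReal_nonneg
    rw [ENNReal.ofReal_add (by positivity) (mul_nonneg hν h0), ENNReal.ofReal_mul (by norm_num),
      ENNReal.ofReal_mul hν, ← enorm_sq_eq_ofReal, posEnergy, normH_eq hg,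
      integral_toReal hm.aemeasurable (ae_lt_top hm hV.ne), ENNReal.ofReal_toReal hV.ne,
      ENNReal.ofReal_inv_of_pos (by norm_num)]
    norm_num
  have h0 : 0 ≤ ∫ r in Set.Iic t, (normV (v r) ^ 2).toReal ∂timeMeasure :=
    integral_nonneg fun r => ENNReal.toReal_nonneg
  rw [energy_eq_of_integrable ν hT, h1, EReal.coe_ennreal_ofReal,
    max_eq_left (add_nonneg (by positivity) (mul_nonneg hν h0)), ← EReal.coe_sub]

/-- If the energy inequality holds for `(v_x, z_x)`, it holds for `(v, z)`. -/
theorem energyAt_zero_le (hν : 0 < ν) (h : ω ∈ regularSet ν) {x : H} {s t : ℝ≥0} (hst : s ≤ t)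
    (hfin : energyAt ν x t ω < ⊤) (hle : energyAt ν x t ω ≤ energyAt ν x s ω) :
    energyAt ν 0 t ω ≤ energyAt ν 0 s ω := by
  have hT := trilinearIntegrable_of_energy_lt hfin
  have hT0 := trilinearIntegrable_of_mem_regularSet h t
  have hm := measurable_path (measurablePaths_id.vProc ν x).normV_sq ω
  have hm0 := measurable_path (measurablePaths_id.vProc ν 0).normV_sq ω
  have hV : ∫⁻ r in Set.Iic t, normV (vProc ν x ω r) ^ 2 ∂timeMeasure < ⊤ := by
    have h1 : posEnergy ν (vProc ν x ω) t ≠ ⊤ := by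
      intro htop
      rw [energyAt, energy_eq_of_integrable ν hT, htop, EReal.coe_ennreal_top,
        EReal.top_sub_coe] at hfin
      exact lt_irrefl _ hfin
    rw [posEnergy] at h1
    have h2 := (ENNReal.add_lt_top.1 (lt_top_iff_ne_top.2 h1)).2
    by_contra hc
    rw [not_lt_top_iff.1 hc, ENNReal.mul_top (by simpa using hν)] at h2
    exact lt_irrefl _ h2
  have hV0 := (h.2 t).2
  obtain ⟨C, g, -, hg⟩ := exists_represents_vProc h t
  obtain ⟨y, hy⟩ := exists_heat hν x
  have hi : IntegrableOn (energyDefect ν x ω) (Set.Iic t) timeMeasure :=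
    (((integrableOn_normV_sq hV0).sub' (integrableOn_normV_sq hV)).const_mul ν).sub'
      (hT0.2.sub' hT.2)
  have hgx : ∀ r ≤ t, Represents (vProc ν x ω r) (g r - y r : H) := fun r hr => by
    rw [Submodule.coe_sub]
    exact (hg r hr).1.vProc_sub (represents_heat (hy r))
  have key := inner_add_integral_eq hν h hst hg hy hi
  have hex : ∀ r ≤ t, energyAt ν x r ω = ((2⁻¹ * ‖g r - y r‖ ^ 2
      + ν * ∫ r in Set.Iic r, (normV (vProc ν x ω r) ^ 2).toReal ∂timeMeasure
      - ∫ r in Set.Iic r, trilinear (zProc ν x ω r) (vProc ν x ω r) ∂timeMeasure : ℝ) : EReal) :=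
    fun r hr => energy_eq_coe hν.le (hT.mono hr) (hgx r hr) hm
      ((lintegral_mono_set (Set.Iic_subset_Iic.2 hr)).trans_lt hV)
  have he0 : ∀ r ≤ t, energyAt ν 0 r ω = ((2⁻¹ * ‖g r‖ ^ 2
      + ν * ∫ r in Set.Iic r, (normV (vProc ν 0 ω r) ^ 2).toReal ∂timeMeasure
      - ∫ r in Set.Iic r, trilinear (zProc ν 0 ω r) (vProc ν 0 ω r) ∂timeMeasure : ℝ) : EReal) :=
    fun r hr => energy_eq_coe hν.le (hT0.mono hr) (hg r hr).1 hm0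
      ((lintegral_mono_set (Set.Iic_subset_Iic.2 hr)).trans_lt hV0)
  have hdef : ∀ r ≤ t, ∫ r in Set.Iic r, energyDefect ν x ω r ∂timeMeasure
      = ν * (∫ r in Set.Iic r, (normV (vProc ν 0 ω r) ^ 2).toReal ∂timeMeasure
          - ∫ r in Set.Iic r, (normV (vProc ν x ω r) ^ 2).toReal ∂timeMeasure)
        - (∫ r in Set.Iic r, trilinear (zProc ν 0 ω r) (vProc ν 0 ω r) ∂timeMeasure
          - ∫ r in Set.Iic r, trilinear (zProc ν x ω r) (vProc ν x ω r) ∂timeMeasure) := by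
    intro r hr
    have hsub := Set.Iic_subset_Iic.2 hr
    have i1 := (integrableOn_normV_sq hV0).mono_set hsub
    have i2 := (integrableOn_normV_sq hV).mono_set hsub
    have i3 := hT0.2.mono_set hsub
    have i4 := hT.2.mono_set hsub
    unfold energyDefect
    rw [integral_sub ((i1.sub' i2).const_mul ν) (i3.sub' i4), integral_const_mul,
      integral_sub i1 i2, integral_sub i3 i4]
  have hsq : ∀ r, ‖g r - y r‖ ^ 2 = ‖g r‖ ^ 2 - 2 * ⟪g r, y r⟫ + ‖y r‖ ^ 2 :=
    fun r => norm_sub_sq_real _ _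
  rw [hex t le_rfl, hex s hst, EReal.coe_le_coe_iff, hsq, hsq] at hle
  rw [he0 t le_rfl, he0 s hst, EReal.coe_le_coe_iff]
  rw [hdef t le_rfl, hdef s hst] at key
  linarith

end Regular

/-! ### The variants of the energy property -/

section Equivalence

variable {ν : ℝ} {P : Measure PathSpace}

lemma ae_of_measure_energySetBetween [IsProbabilityMeasure P] {x : H} {s t : ℝ≥0} (hst : s ≤ t)
    (h : P (energySetBetween ν x s t) = 1) :
    ∀ᵐ ω ∂P, energyAt ν x t ω ≤ energyAt ν x s ω :=
  (mem_ae_iff_prob_eq_one (canonicalFiltration.le t _ (measurableSet_energySetBetween ν x hst))).2 h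

lemma energySet_subset_energySetUpTo (ν : ℝ) (x : H) (t : ℝ≥0) :
    energySet ν x ⊆ energySetUpTo ν x t := fun _ hω =>
  ⟨hω.2.1 t, hω.2.2.mono fun _ hs hst => hs t hst⟩

lemma energyAt_zero_time_lt_top (hν : 0 < ν) {ω : PathSpace} (h : ω ∈ regularSet ν) (x : H) :
    energyAt ν x 0 ω < ⊤ := by
  have h0 : timeMeasure.restrict (Set.Iic 0) = 0 := by
    have h1 : Set.Iic (0 : ℝ≥0) = {0} := by ext; simp
    rw [h1, Measure.restrict_eq_zero.2 (timeMeasure_singleton 0)]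
  obtain ⟨C, g, -, hg⟩ := exists_represents_vProc h 0
  obtain ⟨y, hy⟩ := exists_heat hν x
  have hgx : Represents (vProc ν x ω 0) (g 0 - y 0 : H) := by
    rw [Submodule.coe_sub]
    exact (hg 0 le_rfl).1.vProc_sub (represents_heat (hy 0))
  rw [energyAt, energy_eq_coe hν.le ⟨by simp [h0], by simp [IntegrableOn, h0]⟩ hgx
    (measurable_path (measurablePaths_id.vProc ν x).normV_sq ω) (by simp [h0])]
  exact EReal.coe_lt_top _

lemma EnergyProperty.energyPropertyA (h : EnergyProperty ν P) : EnergyPropertyA ν P := by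
  obtain ⟨T, hT0, hT, hE⟩ := h
  refine ⟨0, fun t _ => ⟨T ∩ Set.Ioc 0 t, Set.inter_subset_right,
    measure_mono_null Set.inter_subset_left hT, fun s hst hs => hE s (fun hsT => hs ⟨hsT, ?_, hst⟩)
      t hst⟩⟩
  exact pos_iff_ne_zero.2 fun h0 => hT0 (h0 ▸ hsT)

lemma EnergyProperty.energyPropertyC [IsProbabilityMeasure P] (h : EnergyProperty ν P)
    (hreg : ∀ᵐ ω ∂P, ω ∈ regularSet ν) : EnergyPropertyC ν P := by
  obtain ⟨T, hT0, hT, hE⟩ := h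
  refine ⟨0, (mem_ae_iff_prob_eq_one (measurableSet_energySet ν 0)).1 ?_⟩
  set D : Set ℝ≥0 := Set.range (TopologicalSpace.denseSeq ℝ≥0) with hD
  have hDd : Dense D := TopologicalSpace.denseRange_denseSeq ℝ≥0
  have hDc : D.Countable := Set.countable_range _
  have hEs : ∀ s ∉ T, ∀ᵐ ω ∂P, ∀ q ∈ D, s ≤ q → energyAt ν 0 q ω ≤ energyAt ν 0 s ω := by
    intro s hs
    refine (ae_ball_iff hDc).2 fun q _ => ?_
    by_cases hq : s ≤ q
    · filter_upwards [ae_of_measure_energySetBetween hq (hE s hs q hq)] with ω hω _ using hω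
    · exact Filter.Eventually.of_forall fun ω h => absurd h hq
  have hms : MeasurableSet {p : ℝ≥0 × PathSpace |
      ∀ q ∈ D, p.1 ≤ q → energyAt ν 0 q p.2 ≤ energyAt ν 0 p.1 p.2} := by
    simp only [Set.ofPred_forall]
    exact MeasurableSet.biInter hDc fun q _ => measurableSet_energyAt_le_of_le ν 0 q
  have hae : ∀ᵐ s ∂timeMeasure, ∀ᵐ ω ∂P, ∀ q ∈ D, s ≤ q →
      energyAt ν 0 q ω ≤ energyAt ν 0 s ω :=
    (measure_eq_zero_iff_ae_notMem.1 hT).mono hEs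
  have hae' := (Measure.ae_ae_comm hms).1 hae
  filter_upwards [hreg, hEs 0 hT0, hae'] with ω hω h0 hs
  have hL := inL2H_of_mem_regularSet hω
  exact ⟨hω, fun t => energyAt_le_of_dense hL zero_le hDd h0,
    hs.mono fun s hs t hst => energyAt_le_of_dense hL hst hDd hs⟩

lemma EnergyPropertyC.energyPropertyB [IsProbabilityMeasure P] (h : EnergyPropertyC ν P) :
    EnergyPropertyB ν P := by
  obtain ⟨x, hx⟩ := h
  exact ⟨x, fun t _ => le_antisymm prob_le_one
    (hx.symm.le.trans (measure_mono (energySet_subset_energySetUpTo ν x t)))⟩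

lemma EnergyPropertyB.energyPropertyA [IsProbabilityMeasure P] (h : EnergyPropertyB ν P) :
    EnergyPropertyA ν P := by
  obtain ⟨x, hx⟩ := h
  refine ⟨x, fun t ht => ?_⟩
  have h1 : ∀ᵐ ω ∂P, ω ∈ energySetUpTo ν x t :=
    (mem_ae_iff_prob_eq_one (canonicalFiltration.le t _ (measurableSet_energySetUpTo ν x t))).2
      (hx t ht)
  have h2 : ∀ᵐ s ∂timeMeasure, ∀ᵐ ω ∂P, s ≤ t → energyAt ν x t ω ≤ energyAt ν x s ω :=
    (Measure.ae_ae_comm (measurableSet_energyAt_le_of_le ν x t)).2 (h1.mono fun ω hω => hω.2)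
  set T : Set ℝ≥0 := {s | ¬∀ᵐ ω ∂P, s ≤ t → energyAt ν x t ω ≤ energyAt ν x s ω} with hT
  refine ⟨T ∩ Set.Ioc 0 t, Set.inter_subset_right,
    measure_mono_null Set.inter_subset_left h2, fun s hst hs => ?_⟩
  refine (mem_ae_iff_prob_eq_one
    (canonicalFiltration.le t _ (measurableSet_energySetBetween ν x hst))).1 ?_
  rcases eq_zero_or_pos s with rfl | hs0
  · filter_upwards [h1] with ω hω using hω.1
  · have h3 : s ∉ T := fun h => hs ⟨h, hs0, hst⟩
    rw [hT, Set.mem_ofPred_eq, not_not] at h3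
    filter_upwards [h3] with ω hω using hω hst

/-- The exceptional set is the union of those for a dense sequence of final times; the lower
semicontinuity of the energy gives the inequality at the other final times. -/
lemma EnergyPropertyA.energyProperty [IsProbabilityMeasure P] (hν : 0 < ν)
    (h : EnergyPropertyA ν P) (hreg : ∀ᵐ ω ∂P, ω ∈ regularSet ν) : EnergyProperty ν P := by
  obtain ⟨x, hx⟩ := h
  choose! T hTsub hT hE using hx
  set D : Set ℝ≥0 := Set.range (TopologicalSpace.denseSeq ℝ≥0) with hD
  have hDd : Dense D := TopologicalSpace.denseRange_denseSeq ℝ≥0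
  have hDc : D.Countable := Set.countable_range _
  set S : Set ℝ≥0 := ⋃ q ∈ D ∩ Set.Ioi 0, T q with hS
  have hS0 : (0 : ℝ≥0) ∉ S := by
    simp only [hS, Set.mem_iUnion, not_exists]
    exact fun q hq h0 => lt_irrefl _ (hTsub q hq.2 h0).1
  have hSE : ∀ s ∉ S, ∀ᵐ ω ∂P, ∀ q ∈ D, s ≤ q → energyAt ν x q ω ≤ energyAt ν x s ω := by
    intro s hs
    refine (ae_ball_iff hDc).2 fun q hqD => ?_
    by_cases hq : s ≤ q
    · rcases eq_zero_or_pos q with rfl | hq0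
      · obtain rfl : s = 0 := le_antisymm hq zero_le
        exact Filter.Eventually.of_forall fun ω _ => le_rfl
      · have hsT : s ∉ T q := fun h => hs
          (Set.mem_biUnion (show q ∈ D ∩ Set.Ioi 0 from ⟨hqD, hq0⟩) h)
        filter_upwards [ae_of_measure_energySetBetween hq (hE q hq0 s hq hsT)] with ω hω _ using hω
    · exact Filter.Eventually.of_forall fun ω h => absurd h hq
  refine ⟨S, hS0, (measure_biUnion_null_iff (hDc.mono Set.inter_subset_left)).2
    fun q hq => hT q hq.2, fun s hs t hst => ?_⟩
  refine (mem_ae_iff_prob_eq_one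
    (canonicalFiltration.le t _ (measurableSet_energySetBetween ν 0 hst))).1 ?_
  filter_upwards [hreg, hSE s hs, hSE 0 hS0] with ω hω h1 h2
  have hL := inL2H_of_mem_regularSet hω
  have hfin : energyAt ν x t ω < ⊤ :=
    (energyAt_le_of_dense hL zero_le hDd h2).trans_lt (energyAt_zero_time_lt_top hν hω x)
  exact energyAt_zero_le hν hω hst hfin (energyAt_le_of_dense hL hst hDd h1)

end Equivalence

end NavierStokes

end

theorem proposition3p2 (ν : ℝ) (hν : 0 < ν) :
    (∀ x : NavierStokes.H,
      MeasureTheory.IsStronglyProgressive NavierStokes.canonicalFiltration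
        (NavierStokes.energyAt ν x) ∧
      (∀ s t : ℝ≥0, s ≤ t →
        MeasurableSet[NavierStokes.canonicalFiltration t]
          (NavierStokes.energySetBetween ν x s t)) ∧
      (∀ t : ℝ≥0, 0 < t →
        MeasurableSet[NavierStokes.canonicalFiltration t]
          (NavierStokes.energySetUpTo ν x t)) ∧
      MeasurableSet (NavierStokes.energySet ν x)) ∧
    (∀ Q : NavierStokes.H →L[ℝ] NavierStokes.H, Q.IsPositive → NavierStokes.HasFiniteTrace Q →
      ∀ (μ₀ : MeasureTheory.Measure NavierStokes.H) [MeasureTheory.IsProbabilityMeasure μ₀]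
        (P : MeasureTheory.Measure NavierStokes.PathSpace)
        [MeasureTheory.IsProbabilityMeasure P],
        NavierStokes.IsWeakMartingaleSolution ν Q μ₀ P →
        NavierStokes.HasEnergyClassPaths ν P →
        (NavierStokes.EnergyProperty ν P ↔ NavierStokes.EnergyPropertyA ν P) ∧
        (NavierStokes.EnergyProperty ν P ↔ NavierStokes.EnergyPropertyB ν P) ∧
        (NavierStokes.EnergyProperty ν P ↔ NavierStokes.EnergyPropertyC ν P)) := by
  refine ⟨fun x => ⟨NavierStokes.isStronglyProgressive_energyAt ν x,
    fun s t h => NavierStokes.measurableSet_energySetBetween ν x h,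
    fun t _ => NavierStokes.measurableSet_energySetUpTo ν x t,
    NavierStokes.measurableSet_energySet ν x⟩, ?_⟩
  intro Q hQ htr μ₀ _ P _ h hv
  have hreg := NavierStokes.ae_mem_regularSet hν hQ htr h hv
  exact ⟨⟨fun h => h.energyPropertyA, fun h => h.energyProperty hν hreg⟩,
    ⟨fun h => (h.energyPropertyC hreg).energyPropertyB,
      fun h => h.energyPropertyA.energyProperty hν hreg⟩,
    ⟨fun h => h.energyPropertyC hreg,
      fun h => h.energyPropertyB.energyPropertyA.energyProperty hν hreg⟩⟩
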